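/- **Setting.** Let $m\ge 1$, let $M\subset\mathbb R^m$ be compact with $\overline{\operatorname{int}M}=M$, let $\nu$ be Lebesgue measure on $\mathbb R^m$, $\nu(M)=1$, $d$ the Euclidean distance, $\gamma_k$ the volume of the unit ball of $\mathbb R^k$, $0<\alpha\le 1$, and let $T:M\to M$ be Borel measurable. For a set $A$ put $B_\varepsilon(A)=\{x\in\mathbb R^m: d(x,A)\le\varepsilon\}$, $B_\varepsilon(x)=B_\varepsilon(\{x\})$. **Assumption 1 (piecewise smoothness).** There are finitely many disjoint open sets $U_1,\dots,U_K\subset\mathbb R^m$ with $M=\bigcup_i\overline{U_i}$ and an $\varepsilon_1>0$ such that each $T_i=T|_{U_i}$ is injective and extends to a $C^{1+\alpha}$ map, again denoted $T_i$, from an open set $\tilde U_i\supset\overline{U_i}$ to $\mathbb R^m$ with $T_i\tilde U_i\supset B_{\varepsilon_1}(T U_i)$. **Assumption 2 (fixed point).** There is $p\in U_1$ with $Tp=p$, and $T^{-1}p\cap\partial U_j=\emptyset$ for all $j$. For a map $F$ with domain $W$ and $x\in W$ let $s(x,F)$ be the least $s\in[0,\infty]$ such that $d(x,y)\le s\,d(Fx,Fy)$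 for all $y\in W$ with $d(x,y)\le\min\{\varepsilon_1,0.1\,d(x,p)\}$; put $s(x)=s(x,T_i)$ for $x\in U_i$. Below, $T_1^{-n}$ is the inverse of the $n$-th iterate of $T_1:U_1\to M$ (whose domain is $\{z: z,Tz,\dots,T^{n-1}z\in U_1\}$), and $T_1^{-n}A$ is the preimage of $A$ in this domain. Conditions on $T_1^{-n}$ are required at the points where it is defined. **Assumption 3 (expanding rates).** There is a connected open set $R\ni p$ whose boundary is a smooth hypersurface, with $\overline R\subset TR$, $\overline{TR}\subset U_1$, and for each $j$ either $\overline R\subset TU_j$ or $\overline R\cap TU_j=\emptyset$. Put $R_0=TR\setminus R$. (a) $0<s(x)\le1$ for all $x\in\bigcup_iU_i\setminus\{p\}$; if $s(x)=1$ then $x\in R$ and $d(Tx,p)>d(x,p)$. (b) There are $\eta_0\in(0,1)$, $\varepsilon_2>0$ with $s^\alpha+\lambda\le\eta_0$, where $s=\sup\{s(x):x\in\bigcup_iU_i\setminus R\}$, $$\lambda=\max\Bigl\{2\sup_{0<\varepsilon_0\le\varepsilon_2}\ \sup_{0<\varepsilon\le\varepsilon_0}\frac{G_U(\varepsilon,\varepsilon_0)}{\varepsilon^\alpha}\varepsilon_0^\alpha,\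 \frac{3s\gamma_{m-1}}{(1-s)\gamma_m}\Bigr\},\qquad G_U(\varepsilon,\varepsilon_0)=\sup_{x\in M}\sum_{j=1}^K\frac{\nu\bigl(T_j^{-1}B_\varepsilon(\partial TU_j)\cap B_{(1-s)\varepsilon_0}(x)\bigr)}{\nu\bigl(B_{(1-s)\varepsilon_0}(x)\bigr)},$$ and $T_j^{-1}B_\varepsilon(\partial TU_j)$ is the preimage in $\tilde U_j$. (c) There are $N\ge1$, $\varepsilon_3>0$ such that for all $x\in B_{\varepsilon_3}(R_0)$ $$s(T_1^{-N}x,T_1^N)\le\frac s{5m}\Bigl(\frac{\lambda(1-s)^m}{2C_\xi I^2}\Bigr)^{1/\alpha},$$ with $I$, $C_\xi$ from 4(c). **Assumption 4 (distortion).** (a) There is $c>0$ with $|\det DT_j^{-1}(x)-\det DT_j^{-1}(y)|\le c\,|\det DT_j^{-1}(x)|\,d(x,y)^\alpha$ for all $j$ and all $x,y\in TU_j$ with $d(x,y)\le\varepsilon_1$. (b) For every $b>0$ there are $J,\varepsilon_4>0$ such that for every $\varepsilon\in(0,\varepsilon_4]$ there is $N\in\{1,2,\dots,\infty\}$ with $$\frac{|\det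 DT_1^{-n}(y)|}{|\det DT_1^{-n}(x)|}\le1+J\varepsilon^\alpha\quad(x\in B_{\varepsilon_4}(R_0),\ y\in B_\varepsilon(x),\ 0<n\le N),\qquad \sum_{N\le n<\infty}\ \sup_{y\in B_\varepsilon(x)}|\det DT_1^{-n}(y)|\le b\,\varepsilon^{m+\alpha}\quad(x\in B_{\varepsilon_4}(R_0)).$$ (c) There are $I>1$, $C_\xi>0$, $\varepsilon_5>0$ such that for all $0<\varepsilon_0\le\varepsilon_5$ and $n>0$ there is a countable measurable partition $\xi$ of $B_{\varepsilon_0}(R_0)$ such that for every $A\in\xi$: $\operatorname{diam}(A\cap B_{\varepsilon_0}(\partial R_0))\le5m\varepsilon_0$; if $\nu\bigl(T_1^{-n}(B_{\varepsilon_0}(\partial R_0)\cap A)\bigr)\ne0$, then $\nu(B_\varepsilon(\partial R_0)\cap A)\le C_\xi(\varepsilon/\varepsilon_0)^\alpha\,\nu(B_{\varepsilon_0}(\partial R_0)\cap A)$ for all $0<\varepsilon\le\varepsilon_0$; and $|\det DT_1^{-n}(y)|\le I\,|\det DT_1^{-n}(x)|$ for all $x,y\in A$. **Theorem A.** Under Assumptions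 1–4, $T$ admits a nonzero invariant measure $\mu$, absolutely continuous with respect to $\nu|_M$ and $\sigma$-finite (possibly finite), which is the sum of finitely many mutually singular ergodic invariant measures $\mu_1,\dots,\mu_k$, each finite or $\sigma$-finite, whose densities are (essentially) bounded on every compact subset of $M\setminus\{p\}$; and $\mu(M)<\infty$ if $\sum_{n\ge1}\nu(T_1^{-n}R)<\infty$. Suppose moreover that $|\det DT|$ is bounded on $\bigcup_jU_j$, that $T(\partial U_j)$ is a null set for every $j$, and that for every ball $B_\varepsilon(x)\subset M$ there is $\tilde N>0$ with $T^{\tilde N}B_\varepsilon(x)\supset M$. Then the density of $\mu$ is bounded below by a positive constant almost everywhere on $M$, and $\mu(M)=\infty$ if $\sum_{n\ge1}\nu(T_1^{-n}R)=\infty$. -/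

import Mathlib

open Set Filter Topology MeasureTheory
open scoped ENNReal

/-- Euclidean space of dimension `m`. -/
abbrev Euc (m : ℕ) : Type := EuclideanSpace ℝ (Fin m)

/-- The raw data: a map `T` of a subset `M` of Euclidean space, finitely many pieces `U j`
(the piece `U 0` is the one that contains the fixed point `p`), a neighbourhood `V j` of each piece
with a map `ext j` on it which extends the `j`-th branch of `T`, the region `R` around `p`,
the Hölder exponent `α` and the length `ε₁`.  The laws they obey are stated below. -/
structure PiecewiseMap (m : ℕ) where
  /-- the phase space -/
  M : Set (Euc m)
  /-- the map (only its values on `M` matter) -/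
  T : Euc m → Euc m
  /-- number of pieces minus one -/
  K : ℕ
  /-- the pieces -/
  U : Fin (K + 1) → Set (Euc m)
  /-- neighbourhoods of the pieces -/
  V : Fin (K + 1) → Set (Euc m)
  /-- extensions of the branches to these neighbourhoods -/
  ext : Fin (K + 1) → Euc m → Euc m
  /-- the indifferent fixed point -/
  p : Euc m
  /-- the region around the fixed point -/
  R : Set (Euc m)
  /-- the Hölder exponent -/
  α : ℝ
  /-- the room for the extensions -/
  ε₁ : ℝ

/-- `f` is of class `C^{1+α}` on the open set `V`: it is `C^1` there with an `α`-Hölder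
derivative. -/
def IsC1Holder {m : ℕ} (α : ℝ) (f : Euc m → Euc m) (V : Set (Euc m)) : Prop :=
  ContDiffOn ℝ 1 f V ∧
    ∃ C : ℝ, ∀ x ∈ V, ∀ y ∈ V, ‖fderiv ℝ f x - fderiv ℝ f y‖ ≤ C * dist x y ^ α

/-- The boundary of `R` is a smooth (here: `C^1`) hypersurface: locally the zero set of a function
with nonvanishing gradient. -/
def HasSmoothBoundary {m : ℕ} (R : Set (Euc m)) : Prop :=
  ∀ x ∈ frontier R, ∃ W ∈ 𝓝 x, ∃ ρ : Euc m → ℝ,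
    ContDiffAt ℝ 1 ρ x ∧ fderiv ℝ ρ x ≠ 0 ∧ frontier R ∩ W = {y | ρ y = 0} ∩ W

/-- Volume of the unit ball of `ℝ^m`. -/
noncomputable def unitBallVol (m : ℕ) : ℝ≥0∞ := volume (Metric.closedBall (0 : Euc m) 1)

namespace PiecewiseMap

variable {m : ℕ} (D : PiecewiseMap m)

/-- The standing conventions: `M` is compact, the closure of its interior, of volume one, and `T`
is a (Borel measurable) self-map of `M`. -/
structure Standing : Prop where
  dim_pos : 0 < m
  compact : IsCompact D.M
  closure_interior : closure (interior D.M) = D.M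
  volume_eq_one : volume D.M = 1
  mapsTo : MapsTo D.T D.M D.M
  measurable : Measurable D.T
  α_pos : 0 < D.α
  α_le_one : D.α ≤ 1
  ε₁_pos : 0 < D.ε₁

/-- Piecewise smoothness. -/
structure PiecewiseSmooth : Prop where
  isOpen_U : ∀ j, IsOpen (D.U j)
  disjoint_U : Pairwise fun i j => Disjoint (D.U i) (D.U j)
  cover : D.M = ⋃ j, closure (D.U j)
  /-- the inverses of the branches make sense -/
  injOn : ∀ j, InjOn D.T (D.U j)
  isOpen_V : ∀ j, IsOpen (D.V j)
  closure_subset : ∀ j, closure (D.U j) ⊆ D.V j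
  ext_eq : ∀ j, EqOn (D.ext j) D.T (D.U j)
  smooth : ∀ j, IsC1Holder D.α (D.ext j) (D.V j)
  room : ∀ j, Metric.cthickening D.ε₁ (D.T '' D.U j) ⊆ D.ext j '' D.V j

/-- The fixed point. -/
structure FixedPoint : Prop where
  mem : D.p ∈ D.U 0
  fixed : D.T D.p = D.p
  preimage : ∀ j, ∀ x ∈ frontier (D.U j), D.T x ≠ D.p

/-- The domain of the `n`-th iterate of the branch `T₁ = T|_{U 0}`. -/
def dom (n : ℕ) : Set (Euc m) := {z | ∀ k < n, D.T^[k] z ∈ D.U 0}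

/-- The range of the `n`-th iterate of the branch `T₁`, that is, the domain of `T₁^{-n}`. -/
def ran (n : ℕ) : Set (Euc m) := D.T^[n] '' D.dom n

/-- The set `T₁^{-n} A`. -/
def pre (n : ℕ) (A : Set (Euc m)) : Set (Euc m) := {z ∈ D.dom n | D.T^[n] z ∈ A}

/-- `|det D T_j^{-1} (x)|` without the absolute value, for `x ∈ T (U j)`. -/
noncomputable def detInv (j : Fin (D.K + 1)) (x : Euc m) : ℝ :=
  (fderiv ℝ (Function.invFunOn D.T (D.U j)) x).det

/-- `|det D T₁^{-n} (x)|`, for `x ∈ D.ran n`. -/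
noncomputable def jac (n : ℕ) (x : Euc m) : ℝ :=
  |(fderiv ℝ (Function.invFunOn D.T^[n] (D.dom n)) x).det|

/-- The local rate `s(x, F)` of a map `F` with domain `W`: the least `c` such that
`d(x,y) ≤ c d(F x, F y)` for all `y ∈ W` with `d(x,y) ≤ min {ε₁, |x - p| / 10}`
(it is `∞` if there is no such `c`). -/
noncomputable def rate (F : Euc m → Euc m) (W : Set (Euc m)) (x : Euc m) : ℝ≥0∞ :=
  sInf {c | ∀ y ∈ W, dist x y ≤ min D.ε₁ (0.1 * dist x D.p) →
    edist x y ≤ c * edist (F x) (F y)}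

/-- `s`, the largest rate `s(x)` outside `R`. -/
noncomputable def sOut : ℝ≥0∞ := ⨆ j, ⨆ x ∈ D.U j \ D.R, D.rate D.T (D.U j) x

/-- `G_U(x, ε, ε₀)`: the proportion, in the ball of radius `(1 - s) ε₀` about `x`, of the points
which the (extended) branches map `ε`-close to the boundaries of the images of the pieces. -/
noncomputable def GUx (x : Euc m) (ε ε₀ : ℝ) : ℝ≥0∞ :=
  ∑ j, volume ((D.V j ∩ D.ext j ⁻¹' Metric.cthickening ε (frontier (D.T '' D.U j))) ∩
      Metric.closedBall x ((1 - D.sOut.toReal) * ε₀)) /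
    volume (Metric.closedBall x ((1 - D.sOut.toReal) * ε₀))

/-- `G_U(ε, ε₀)`. -/
noncomputable def GU (ε ε₀ : ℝ) : ℝ≥0∞ := ⨆ x ∈ D.M, D.GUx x ε ε₀

/-- The quantity `λ` which compares discontinuities and expansion. -/
noncomputable def lam (ε₂ : ℝ) : ℝ≥0∞ :=
  max (2 * ⨆ ε₀ ∈ Ioc 0 ε₂, ⨆ ε ∈ Ioc 0 ε₀,
        D.GU ε ε₀ / ENNReal.ofReal (ε ^ D.α) * ENNReal.ofReal (ε₀ ^ D.α))
    (3 * D.sOut * unitBallVol (m - 1) / ((1 - D.sOut) * unitBallVol m))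

/-- `R₀ = TR \ R`. -/
def R₀ : Set (Euc m) := D.T '' D.R \ D.R

/-- Expanding rates.  The constants `I` and `Cξ` are those of the distortion condition. -/
structure ExpandingRates (I Cξ : ℝ) : Prop where
  isOpen_R : IsOpen D.R
  isConnected_R : IsConnected D.R
  smooth_R : HasSmoothBoundary D.R
  mem_R : D.p ∈ D.R
  closure_R : closure D.R ⊆ D.T '' D.R
  closure_TR : closure (D.T '' D.R) ⊆ D.U 0
  full_or_disjoint : ∀ j, closure D.R ⊆ D.T '' D.U j ∨ Disjoint (closure D.R) (D.T '' D.U j)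
  /-- (a) -/
  rate_pos : ∀ j, ∀ x ∈ D.U j, x ≠ D.p → 0 < D.rate D.T (D.U j) x
  rate_le_one : ∀ j, ∀ x ∈ D.U j, x ≠ D.p → D.rate D.T (D.U j) x ≤ 1
  rate_eq_one : ∀ j, ∀ x ∈ D.U j, x ≠ D.p → D.rate D.T (D.U j) x = 1 →
    x ∈ D.R ∧ dist x D.p < dist (D.T x) D.p
  /-- (b) and (c), which share `λ` -/
  rates : ∃ ε₂ : ℝ, 0 < ε₂ ∧
    (∃ η₀ : ℝ, 0 < η₀ ∧ η₀ < 1 ∧ D.sOut ^ D.α + D.lam ε₂ ≤ ENNReal.ofReal η₀) ∧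
    ∃ N : ℕ, 0 < N ∧ ∃ ε₃ : ℝ, 0 < ε₃ ∧
      ∀ z ∈ D.dom N, D.T^[N] z ∈ Metric.cthickening ε₃ D.R₀ →
        D.rate D.T^[N] (D.dom N) z ≤
          D.sOut / (5 * m) *
            (D.lam ε₂ * (1 - D.sOut) ^ m / ENNReal.ofReal (2 * Cξ * I ^ 2)) ^ (1 / D.α)

/-- Distortion.  Points at which the inverse branches `T₁^{-n}` are not defined are left out;
for small `ε₄`, `ε₅` there are none near `R₀`. -/
structure Distortion (I Cξ : ℝ) : Prop where
  /-- (a) -/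
  holder : ∃ c : ℝ, 0 < c ∧ ∀ j, ∀ x ∈ D.T '' D.U j, ∀ y ∈ D.T '' D.U j, dist x y ≤ D.ε₁ →
    |D.detInv j x - D.detInv j y| ≤ c * |D.detInv j x| * dist x y ^ D.α
  /-- (b) -/
  iterates : ∀ b : ℝ, 0 < b → ∃ J : ℝ, 0 < J ∧ ∃ ε₄ : ℝ, 0 < ε₄ ∧ ∀ ε ∈ Ioc 0 ε₄,
    ∃ N : ℕ∞, 0 < N ∧
      (∀ n : ℕ, 0 < n → (n : ℕ∞) ≤ N → ∀ x ∈ Metric.cthickening ε₄ D.R₀ ∩ D.ran n,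
        ∀ y ∈ Metric.closedBall x ε ∩ D.ran n, D.jac n y ≤ (1 + J * ε ^ D.α) * D.jac n x) ∧
      ∀ x ∈ Metric.cthickening ε₄ D.R₀,
        ∑' n : {n : ℕ // N ≤ (n : ℕ∞)},
          (⨆ y ∈ Metric.closedBall x ε ∩ D.ran n, ENNReal.ofReal (D.jac n y)) ≤
          ENNReal.ofReal (b * ε ^ ((m : ℝ) + D.α))
  /-- (c) -/
  one_lt_I : 1 < I
  Cξ_pos : 0 < Cξ
  partition : ∃ ε₅ : ℝ, 0 < ε₅ ∧ ∀ ε₀ ∈ Ioc 0 ε₅, ∀ n : ℕ, 0 < n →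
    ∃ ξ : Set (Set (Euc m)), ξ.Countable ∧ (∀ A ∈ ξ, MeasurableSet A) ∧
      ξ.PairwiseDisjoint id ∧ ⋃₀ ξ = Metric.cthickening ε₀ D.R₀ ∧
      ∀ A ∈ ξ,
        Metric.diam (A ∩ Metric.cthickening ε₀ (frontier D.R₀)) ≤ 5 * m * ε₀ ∧
        (volume (D.pre n (Metric.cthickening ε₀ (frontier D.R₀) ∩ A)) ≠ 0 →
          ∀ ε ∈ Ioc 0 ε₀,
            volume (Metric.cthickening ε (frontier D.R₀) ∩ A) /
                volume (Metric.cthickening ε₀ (frontier D.R₀) ∩ A) ≤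
              ENNReal.ofReal (Cξ * (ε / ε₀) ^ D.α)) ∧
        ∀ x ∈ A ∩ D.ran n, ∀ y ∈ A ∩ D.ran n, D.jac n y ≤ I * D.jac n x

/-- `|det DT|` is bounded, `T` maps the boundaries of the pieces to null sets, and every ball in `M`
covers `M` under some iterate of `T`. -/
structure Covering : Prop where
  det_bounded : ∃ B : ℝ, ∀ j, ∀ x ∈ D.U j, |(fderiv ℝ D.T x).det| ≤ B
  boundary_null : ∀ j, volume (D.T '' frontier (D.U j)) = 0
  covers : ∀ x : Euc m, ∀ ε : ℝ, 0 < ε → Metric.closedBall x ε ⊆ D.M →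
    ∃ N : ℕ, 0 < N ∧ D.M ⊆ D.T^[N] '' Metric.closedBall x ε

end PiecewiseMap

/-! The map is replaced by an induced system that expands uniformly. One step of it applies `T` and
then follows the branch at `p` for a random time: at each point `x` of the orbit the motion goes on
with probability `cutoff δ x`, a Lipschitz function that is 1 on `R` and 0 off a small neighbourhood
of `R`. Stopping at random, and not at the boundary of `R`, creates no new discontinuity: at scale
`r` the weights vary by `O(r)`. This variation is paid for only at visits to a set (`gate`) which an
orbit meets at most three times, so its total cost is `O(r)` in mean. Inverse iterates near `R` do
not expand distances, and their Jacobians are governed by the distortion hypothesis. Hence the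
passage near `p` costs only a factor `1 + C r ^ α` (`exists_induced_estimates`).

The regularity of a density `f` is measured by `∫ dil f r`, the integral of its suprema over balls
of radius `r`. Off `R` inverse branches contract by any `s' > s`, so one step replaces the scale `r`
by `s' r`, apart from a cost at points that branches send near the boundary of an image `T U_j`.
There the extension of the branch supplies a preimage, and one must bound the integral of `dil f (s'
r)` over these cuts. A spreading argument with Cauchy–Schwarz (`lintegral_dil_le_of_kernel`) bounds
it, at scale `r = s' ^ k ρ`, by `η k * ∫ dil f ρ`. The hypotheses `s ^ α + λ < 1` and `3 s γ_{m-1} /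
((1 - s) γ_m) ≤ λ` make the sum of the `η k` less than one (`exists_cut_rates`, resting on the
numerical `numeric_cut`). Unrolling over the scales gives a renewal inequality
(`le_of_triangular_recursion`). Therefore the iterates of the indicator of a compact set `K` are
uniformly bounded, and some iterate is at most `Q * (volume K + e)` for any `e > 0`. The dual
estimate, for infima over balls (`ero`), shows that iterates keep a fixed amount of mass in a form
bounded below on balls. This is `exists_regular`.

A limit of Cesàro averages gives a bounded invariant density of the induced system that is bounded
below on some ball (`exists_fixed_density`). The bound by `Q * volume K` forces every invariant set
of positive measure to have volume at least `1 / Q` (`one_le_of_push_eq`), so there are finitely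
many ergodic components (`exists_finite_ergodic_partition`). The tower construction `lift` turns the
invariant measure of the induced system into one of `T`. Its density is bounded away from `p`,
because every orbit other than `p` leaves the neighbourhood of `R` (`eq_p_of_forall_mem`), and its
total mass is governed by the volumes of `T₁^{-n} R`. Under the covering condition the lower bound
on a ball spreads to `M`, and a second full branch over `R` feeds mass into the sets `T₁^{-n} R`,
which makes the measure infinite when their volumes have infinite sum. -/

/-! ### Suprema over balls. -/

/-- The supremum of `f` over the open ball of radius `r`. -/
noncomputable def dil {m : ℕ} (f : Euc m → ℝ≥0∞) (r : ℝ) (x : Euc m) : ℝ≥0∞ :=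
  ⨆ y ∈ Metric.ball x r, f y

theorem le_dil {m : ℕ} (f : Euc m → ℝ≥0∞) {r : ℝ} {x y : Euc m} (h : dist y x < r) :
    f y ≤ dil f r x :=
  le_iSup₂ (f := fun z (_ : z ∈ Metric.ball x r) => f z) y h

theorem lt_dil_iff {m : ℕ} (f : Euc m → ℝ≥0∞) {r : ℝ} {x : Euc m} {t : ℝ≥0∞} :
    t < dil f r x ↔ ∃ y, dist y x < r ∧ t < f y := by
  simp only [dil, lt_iSup_iff, Metric.mem_ball, exists_prop]

/-- Open balls give semicontinuity, hence measurability, for an arbitrary `f`. -/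
theorem lowerSemicontinuous_dil {m : ℕ} (f : Euc m → ℝ≥0∞) (r : ℝ) :
    LowerSemicontinuous (dil f r) := by
  intro x t ht
  obtain ⟨y, hy, hty⟩ := (lt_dil_iff f).1 ht
  have : ∀ᶠ x' in 𝓝 x, dist y x' < r :=
    (continuous_const.dist continuous_id).continuousAt.eventually_lt continuousAt_const hy
  filter_upwards [this] with x' hx'
  exact (lt_dil_iff f).2 ⟨y, hx', hty⟩

theorem measurable_dil {m : ℕ} (f : Euc m → ℝ≥0∞) (r : ℝ) : Measurable (dil f r) :=
  (lowerSemicontinuous_dil f r).measurable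

/-! ### Integrals of dilations against a measure with controlled mass on balls. -/

/-- The integral of a radially decreasing function, centred at `x`, over a ball about `0` decreases
with `‖x‖`. -/
theorem setLIntegral_ball_radial_anti {m : ℕ} {φ : ℝ → ℝ≥0∞} (hφ : AntitoneOn φ (Ici 0)) (R : ℝ)
    {x x' : Euc m} (hx : ‖x'‖ ≤ ‖x‖) :
    ∫⁻ z in Metric.ball 0 R, φ ‖z - x‖ ≤ ∫⁻ z in Metric.ball 0 R, φ ‖z - x'‖ := by
  rcases eq_or_ne x x' with rfl | hne
  · exact le_rfl
  set a : Euc m := x - x' with ha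
  have ha0 : a ≠ 0 := sub_ne_zero.2 hne
  have hapos : 0 < ‖a‖ ^ 2 := by positivity
  set c : Euc m := (2⁻¹ : ℝ) • (x + x') with hc
  -- `σ` is the reflection in the hyperplane bisecting the segment from `x'` to `x`; it exchanges
  -- the two centres.
  set ρ := (ℝ ∙ a)ᗮ.reflection with hρ
  have hρa : ρ a = -a := Submodule.reflection_orthogonalComplement_singleton_eq_neg a
  set σ : Euc m → Euc m := fun z => ρ (z - c) + c with hσ
  have hσσ : ∀ z, σ (σ z) = z := fun z => by
    simp [hσ, hρ]
  have hσmp : MeasurePreserving σ volume volume := by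
    have h1 := measurePreserving_add_right (volume : Measure (Euc m)) (-c)
    have h2 := measurePreserving_add_right (volume : Measure (Euc m)) c
    have := h2.comp (ρ.measurePreserving.comp h1)
    convert this using 1
    ext z
    simp [hσ, sub_eq_add_neg]
  have hσc : Continuous σ := by fun_prop
  have hemb : MeasurableEmbedding σ :=
    (MeasurableEquiv.mk ⟨σ, σ, hσσ, hσσ⟩ hσc.measurable hσc.measurable).measurableEmbedding
  have hxc : x - c = (2⁻¹ : ℝ) • a := by rw [hc, ha]; module
  have hxc' : x' - c = -((2⁻¹ : ℝ) • a) := by rw [hc, ha]; module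
  have hs1 : ∀ z, ‖σ z - x‖ = ‖z - x'‖ := fun z => by
    have : σ z - x = ρ (z - x') := by
      have e : z - x' = (z - c) - (x' - c) := by abel
      rw [e, map_sub, hxc', map_neg, map_smul, hρa]
      have : σ z - x = ρ (z - c) - (x - c) := by simp only [hσ]; abel
      rw [this, hxc]; simp
    rw [this, LinearIsometryEquiv.norm_map]
  have hs2 : ∀ z, ‖σ z - x'‖ = ‖z - x‖ := fun z => by
    have := hs1 (σ z); rw [hσσ] at this; exact this.symm
  have hformula : ∀ z, σ z = z - (2 * (inner ℝ a (z - c) / ‖a‖ ^ 2)) • a := fun z => by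
    have : ρ (z - c) = (z - c) - (2 * (inner ℝ a (z - c) / ‖a‖ ^ 2)) • a := by
      rw [hρ, Submodule.reflection_orthogonal_apply, Submodule.reflection_singleton_apply]
      simp only [RCLike.ofReal_real_eq_id, id_eq, two_smul]
      module
    simp only [hσ, this]; abel
  -- The origin lies on the side of `x'`, so reflecting a point from the side of `x` does not
  -- increase its norm.
  have hca : 0 ≤ inner ℝ c a := by
    have : inner ℝ c a = (‖x‖ ^ 2 - ‖x'‖ ^ 2) / 2 := by
      rw [hc, ha, inner_smul_left, inner_add_left, inner_sub_right, inner_sub_right,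
        real_inner_self_eq_norm_sq, real_inner_self_eq_norm_sq, real_inner_comm x' x]
      simp; ring
    rw [this]
    have := pow_le_pow_left₀ (norm_nonneg x') hx 2
    linarith
  set H : Set (Euc m) := {z | ‖z - x'‖ ≤ ‖z - x‖} with hH
  have hHm : MeasurableSet H :=
    measurableSet_le (by fun_prop) (by fun_prop)
  have hnorm : ∀ z, z ∉ H → ‖σ z‖ ≤ ‖z‖ := fun z hz => by
    have hz' : ‖z - x‖ < ‖z - x'‖ := not_le.1 hz
    set t := inner ℝ a (z - c) / ‖a‖ ^ 2 with ht
    have e1 : z - x = (z - c) - (2⁻¹ : ℝ) • a := by rw [← hxc]; abel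
    have e2 : z - x' = (z - c) + (2⁻¹ : ℝ) • a := by
      have : (2⁻¹ : ℝ) • a = - (x' - c) := by rw [hxc', neg_neg]
      rw [this]; abel
    have h3 := pow_lt_pow_left₀ hz' (norm_nonneg _) (two_ne_zero)
    rw [e1, e2, norm_sub_sq_real, norm_add_sq_real, inner_smul_right] at h3
    have hpos : 0 < inner ℝ (z - c) a := by linarith
    have htpos : 0 < t := by
      rw [ht, real_inner_comm]; positivity
    have : ‖σ z‖ ^ 2 = ‖z‖ ^ 2 - 4 * t * inner ℝ c a := by
      rw [hformula, norm_sub_sq_real, inner_smul_right, norm_smul, mul_pow, Real.norm_eq_abs,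
        sq_abs]
      have h5 : inner ℝ z a = t * ‖a‖ ^ 2 + inner ℝ c a := by
        have : inner ℝ z a = inner ℝ (z - c) a + inner ℝ c a := by
          rw [← inner_add_left]; simp
        rw [this, ht, real_inner_comm a (z - c)]
        field_simp
      rw [h5]; ring
    have h6 : ‖σ z‖ ^ 2 ≤ ‖z‖ ^ 2 := by rw [this]; nlinarith
    exact (pow_le_pow_iff_left₀ (norm_nonneg _) (norm_nonneg _) two_ne_zero).1 h6
  set B : Set (Euc m) := Metric.ball 0 R with hB
  have hBm : MeasurableSet B := measurableSet_ball
  set D := B \ H with hD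
  have hDm : MeasurableSet D := hBm.diff hHm
  -- `D` is the part of the ball nearer to `x`, and its mirror image `S` stays in the ball. The two
  -- integrals exchange their values on `D` and `S`; every remaining point is at least as near to
  -- `x'` as to `x`.
  set S := σ ⁻¹' D with hS
  have hSm : MeasurableSet S := hσc.measurable hDm
  have hSsub : S ⊆ B ∩ H := fun z hz => by
    have hz1 : σ z ∈ B := hz.1
    have hz2 : σ z ∉ H := hz.2
    constructor
    · have := hnorm _ hz2
      rw [hσσ] at this
      rw [hB, mem_ball_zero_iff] at hz1 ⊢
      exact this.trans_lt hz1
    · have : ‖σ z - x‖ < ‖σ z - x'‖ := not_le.1 hz2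
      rw [hs1, hs2] at this
      exact this.le
  have hSx : ∀ u v : Euc m, (∀ z, ‖σ z - v‖ = ‖z - u‖) →
      ∫⁻ z in S, φ ‖z - u‖ = ∫⁻ z in D, φ ‖z - v‖ := fun u v huv => by
    rw [hS, ← hσmp.setLIntegral_comp_preimage_emb hemb (fun z => φ ‖z - v‖) D]
    simp only [huv]
  have hsplit : ∀ u : Euc m, ∫⁻ z in B, φ ‖z - u‖ =
      (∫⁻ z in (B ∩ H) \ S, φ ‖z - u‖) + (∫⁻ z in S, φ ‖z - u‖) + ∫⁻ z in D, φ ‖z - u‖ := fun u => by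
    have h1 := lintegral_inter_add_sdiff (μ := volume) (fun z => φ ‖z - u‖) B hHm
    have h2 := lintegral_inter_add_sdiff (μ := volume) (fun z => φ ‖z - u‖) (B ∩ H) hSm
    rw [inter_eq_self_of_subset_right hSsub] at h2
    rw [← h1, ← h2, add_comm (∫⁻ z in S, φ ‖z - u‖)]
  rw [hsplit x, hsplit x', hSx x x' hs2, hSx x' x hs1, add_assoc, add_assoc]
  refine add_le_add ?_ (le_of_eq (add_comm _ _))
  refine setLIntegral_mono' ((hBm.inter hHm).diff hSm) fun z hz => ?_
  exact hφ (norm_nonneg _) (norm_nonneg _) hz.1.2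

/-- If the balls about `v` have bounded mass, then a radially decreasing function has a bounded
integral. -/
theorem lintegral_radial_le {m : ℕ} (hm : 0 < m) {k : Euc m → ℝ} (hk0 : ∀ x, 0 ≤ k x)
    (hk : ∀ x x', ‖x'‖ ≤ ‖x‖ → k x ≤ k x') (hkm : Measurable k) {b : ℝ}
    (hkb : ∀ x, b ≤ ‖x‖ → k x = 0) (τ : Measure (Euc m)) (v : Euc m) {a₁ a₂ : ℝ≥0∞} {ω : ℝ}
    {xω : Euc m} (hω : ω ≤ ‖xω‖)
    (hτ : ∀ ρ, 0 ≤ ρ → ρ ≤ b → τ (Metric.closedBall v ρ) ≤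
      a₁ * volume (Metric.closedBall v ρ) + if ρ < ω then a₂ else 0) :
    ∫⁻ u, ENNReal.ofReal (k (u - v)) ∂τ ≤
      a₁ * (∫⁻ u, ENNReal.ofReal (k u)) + a₂ * ENNReal.ofReal (k 0 - k xω) := by
  have : Nonempty (Fin m) := ⟨⟨0, hm⟩⟩
  have : Nontrivial (Euc m) := inferInstance
  have hkm' : Measurable fun u => k (u - v) := hkm.comp (measurable_id.sub_const v)
  rw [lintegral_eq_lintegral_meas_lt τ (Eventually.of_forall fun u => hk0 _) hkm'.aemeasurable]
  have hshift : ∫⁻ u, ENNReal.ofReal (k u) = ∫⁻ u, ENNReal.ofReal (k (u - v)) :=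
    (lintegral_sub_right_eq_self (fun u => ENNReal.ofReal (k u)) v).symm
  rw [hshift, lintegral_eq_lintegral_meas_lt volume (Eventually.of_forall fun u => hk0 _)
    hkm'.aemeasurable]
  -- The excess `a₂` is charged only at levels `t` in `[k xω, k 0)`, an interval of this length.
  have hvol : ENNReal.ofReal (k 0 - k xω) =
      ∫⁻ t in Ioi (0 : ℝ), (Ico (k xω) (k 0)).indicator 1 t := by
    rw [lintegral_indicator_one₀ measurableSet_Ico.nullMeasurableSet,
      Measure.restrict_apply measurableSet_Ico]
    rw [← Real.volume_Ico]
    apply measure_congr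
    have : (Ico (k xω) (k 0) ∩ Ioi 0 : Set ℝ) =ᵐ[volume] (Ico (k xω) (k 0) ∩ Ici 0 : Set ℝ) :=
      (ae_eq_refl _).inter Ioi_ae_eq_Ici
    have e : (Ico (k xω) (k 0) ∩ Ici 0 : Set ℝ) = Ico (k xω) (k 0) :=
      inter_eq_self_of_subset_left fun t ht => (hk0 _).trans ht.1
    rw [e] at this
    exact this.symm
  have hmono : Measurable fun t : ℝ => volume {u | t < k (u - v)} :=
    Antitone.measurable fun t t' htt' => measure_mono fun u hu => lt_of_le_of_lt htt' hu
  rw [hvol, ← lintegral_const_mul _ hmono,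
    ← lintegral_const_mul _ (measurable_one.indicator measurableSet_Ico),
    ← lintegral_add_left (hmono.const_mul a₁)]
  refine setLIntegral_mono' measurableSet_Ioi fun t ht => ?_
  have ht : 0 < t := ht
  rcases lt_or_ge t (k 0) with h0 | h0
  swap
  · have : {u | t < k (u - v)} = ∅ := by
      ext u
      simp only [mem_ofPred_eq, mem_empty_iff_false, iff_false, not_lt]
      exact (hk _ 0 (by simp)).trans h0
    simp [this]
  -- The superlevel set at `t` lies between the open and the closed ball about `v` of radius `sSup
  -- N`, which have equal volume.
  set N : Set ℝ := {ρ | ∃ x : Euc m, ‖x‖ = ρ ∧ t < k x} with hN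
  have hN0 : (0 : ℝ) ∈ N := ⟨0, norm_zero, h0⟩
  have hNb : ∀ ρ ∈ N, ρ ≤ b := by
    rintro ρ ⟨x, rfl, hx⟩
    by_contra! h
    rw [hkb x h.le] at hx
    linarith
  have hNbdd : BddAbove N := ⟨b, hNb⟩
  set c := sSup N with hc
  have hc0 : 0 ≤ c := le_csSup hNbdd hN0
  have hsub : {u | t < k (u - v)} ⊆ Metric.closedBall v c := fun u hu => by
    rw [mem_closedBall_iff_norm]
    exact le_csSup hNbdd ⟨u - v, rfl, hu⟩
  have hsup : Metric.ball v c ⊆ {u | t < k (u - v)} := fun u hu => by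
    rw [mem_ball_iff_norm] at hu
    obtain ⟨ρ, ⟨x, rfl, hx⟩, hlt⟩ := exists_lt_of_lt_csSup ⟨0, hN0⟩ hu
    exact hx.trans_le (hk _ _ hlt.le)
  have hv : volume (Metric.closedBall v c) ≤ volume {u | t < k (u - v)} := by
    refine le_trans ?_ (measure_mono hsup)
    rw [Measure.addHaar_closedBall_eq_addHaar_ball]
  refine (measure_mono hsub).trans ((hτ c hc0 (csSup_le ⟨0, hN0⟩ hNb)).trans ?_)
  refine add_le_add (mul_le_mul_right hv a₁) ?_
  split_ifs with hcω
  · have : t ∈ Ico (k xω) (k 0) := by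
      refine ⟨?_, h0⟩
      by_contra! hcon
      have := le_csSup hNbdd (show ‖xω‖ ∈ N from ⟨xω, rfl, hcon⟩)
      linarith
    simp [this]
  · exact zero_le

/-- A comparison of the integral of a dilation with respect to a measure `τ` with the Lebesgue
integral of a larger dilation. -/
theorem lintegral_dil_le_of_kernel {m : ℕ} {φ : ℝ → ℝ≥0∞} (hφ : Measurable φ) {Cφ : ℝ≥0∞}
    (hCφ : Cφ ≠ ∞) (hφC : ∀ t, φ t ≤ Cφ) {f : Euc m → ℝ≥0∞} {N : Set (Euc m)}
    (hf : ∀ x, x ∉ N → f x = 0) (τ : Measure (Euc m)) [IsFiniteMeasure τ] {R d : ℝ}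
    {κ B : ℝ≥0∞} (hB0 : B ≠ 0)
    (hB : ∀ v ∈ N, ∫⁻ u, (∫⁻ z in Metric.ball v R, φ ‖z - u‖) ∂τ ≤ B)
    (hκ : ∀ u v : Euc m, dist v u < d → κ ≤ ∫⁻ z in Metric.ball v R, φ ‖z - u‖ ^ (1 / 2 : ℝ)) :
    κ ^ 2 * ∫⁻ u, dil f d u ∂τ ≤ B * ∫⁻ z, dil f R z := by
  set vR := volume (Metric.ball (0 : Euc m) R) with hvR
  have hvRt : vR ≠ ∞ := measure_ball_lt_top.ne
  have hjm : Measurable fun q : Euc m × Euc m => φ ‖q.1 - q.2‖ := hφ.comp (by fun_prop)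
  -- The summand `ε` makes `Λ` positive, so that it can be divided by; it is removed by a limit at
  -- the end.
  have key : ∀ ε : ℝ≥0∞, ε ≠ 0 → ε ≠ ∞ →
      κ ^ 2 * ∫⁻ u, dil f d u ∂τ ≤ (B + ε * vR) * ∫⁻ z, dil f R z := by
    intro ε hε hεt
    set Λ : Euc m → ℝ≥0∞ := fun z => (∫⁻ u, φ ‖z - u‖ ∂τ) + ε with hΛ
    have hΛm : Measurable Λ := (hjm.lintegral_prod_right').add_const ε
    have hΛ0 : ∀ z, Λ z ≠ 0 := fun z => by simp [hΛ, hε]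
    have hΛt : ∀ z, Λ z ≠ ∞ := fun z => by
      have : ∫⁻ u, φ ‖z - u‖ ∂τ ≤ Cφ * τ univ := by
        calc _ ≤ ∫⁻ u, Cφ ∂τ := lintegral_mono fun u => hφC _
          _ = _ := by simp
      exact ENNReal.add_ne_top.2
        ⟨ne_top_of_le_ne_top (ENNReal.mul_ne_top hCφ (measure_ne_top τ _)) this, hεt⟩
    -- The value `f v` is spread over the ball about `v` with density proportional to `φ ‖z - u‖ / Λ
    -- z`. For fixed `z` the integral of this quotient in `u` against `τ` is at most one, by the
    -- definition of `Λ`.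
    have hpt : ∀ u, κ ^ 2 * dil f d u ≤
        (B + ε * vR) * ∫⁻ z, dil f R z * ((Λ z)⁻¹ * φ ‖z - u‖) := by
      intro u
      simp only [dil, ENNReal.mul_iSup]
      refine iSup₂_le fun v hv => ?_
      by_cases hvN : v ∈ N
      swap
      · simp [hf v hvN]
      have hΛball : ∫⁻ z in Metric.ball v R, Λ z ≤ B + ε * vR := by
        rw [hΛ, lintegral_add_right _ measurable_const, setLIntegral_const]
        refine add_le_add ?_ (le_of_eq ?_)
        · rw [lintegral_lintegral_swap (f := fun z u => φ ‖z - u‖) hjm.aemeasurable]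
          exact hB v hvN
        · rw [hvR, Measure.addHaar_ball_center]
      -- Cauchy–Schwarz for the square roots of `φ / Λ` and of `Λ`, whose product is the square root
      -- of `φ`.
      have hcs : κ ^ 2 ≤ (∫⁻ z in Metric.ball v R, (Λ z)⁻¹ * φ ‖z - u‖) *
          ∫⁻ z in Metric.ball v R, Λ z := by
        have hφu : Measurable fun z => φ ‖z - u‖ := hφ.comp (by fun_prop)
        have h1 := ENNReal.lintegral_mul_le_Lp_mul_Lq (volume.restrict (Metric.ball v R))
          Real.HolderConjugate.two_two
          (f := fun z => ((Λ z)⁻¹ * φ ‖z - u‖) ^ (1 / 2 : ℝ)) (g := fun z => Λ z ^ (1 / 2 : ℝ))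
          ((hΛm.inv.mul hφu).pow_const _).aemeasurable (hΛm.pow_const _).aemeasurable
        have h2 : κ ≤ ∫⁻ z in Metric.ball v R,
            ((fun z => ((Λ z)⁻¹ * φ ‖z - u‖) ^ (1 / 2 : ℝ)) * fun z => Λ z ^ (1 / 2 : ℝ)) z := by
          refine (hκ u v hv).trans (le_of_eq (lintegral_congr fun z => ?_))
          simp only [Pi.mul_apply]
          rw [← ENNReal.mul_rpow_of_nonneg _ _ (by norm_num), mul_comm (Λ z)⁻¹, mul_assoc,
            ENNReal.inv_mul_cancel (hΛ0 z) (hΛt z), mul_one]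
        have h3 := h2.trans h1
        simp only [← ENNReal.rpow_mul] at h3
        norm_num at h3
        calc κ ^ 2 ≤ _ := pow_le_pow_left' h3 2
          _ = _ := by
            rw [mul_pow, ← ENNReal.rpow_natCast, ← ENNReal.rpow_natCast, ← ENNReal.rpow_mul,
              ← ENNReal.rpow_mul]
            norm_num
      have hlow : f v * ∫⁻ z in Metric.ball v R, (Λ z)⁻¹ * φ ‖z - u‖ ≤
          ∫⁻ z, dil f R z * ((Λ z)⁻¹ * φ ‖z - u‖) := by
        have hm' : Measurable fun z => (Λ z)⁻¹ * φ ‖z - u‖ :=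
          hΛm.inv.mul (hφ.comp (by fun_prop))
        rw [← lintegral_const_mul _ hm']
        refine le_trans (setLIntegral_mono' measurableSet_ball fun z hz => ?_)
          (setLIntegral_le_lintegral (Metric.ball v R) _)
        exact mul_le_mul_left (le_dil f (by rwa [dist_comm, ← Metric.mem_ball])) _
      calc κ ^ 2 * f v ≤ ((∫⁻ z in Metric.ball v R, (Λ z)⁻¹ * φ ‖z - u‖) *
          ∫⁻ z in Metric.ball v R, Λ z) * f v := mul_le_mul_left hcs _
        _ = (∫⁻ z in Metric.ball v R, Λ z) *
            (f v * ∫⁻ z in Metric.ball v R, (Λ z)⁻¹ * φ ‖z - u‖) := by ring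
        _ ≤ _ := mul_le_mul' hΛball hlow
    have hj2 : Measurable fun q : Euc m × Euc m =>
        dil f R q.2 * ((Λ q.2)⁻¹ * φ ‖q.2 - q.1‖) :=
      ((measurable_dil f R).comp measurable_snd).mul
        ((hΛm.inv.comp measurable_snd).mul (hφ.comp (by fun_prop)))
    calc κ ^ 2 * ∫⁻ u, dil f d u ∂τ = ∫⁻ u, κ ^ 2 * dil f d u ∂τ :=
          (lintegral_const_mul _ (measurable_dil f d)).symm
      _ ≤ ∫⁻ u, (B + ε * vR) * (∫⁻ z, dil f R z * ((Λ z)⁻¹ * φ ‖z - u‖)) ∂τ :=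
          lintegral_mono hpt
      _ = (B + ε * vR) * ∫⁻ u, (∫⁻ z, dil f R z * ((Λ z)⁻¹ * φ ‖z - u‖)) ∂τ :=
          lintegral_const_mul _ hj2.lintegral_prod_right'
      _ = (B + ε * vR) * ∫⁻ z, (∫⁻ u, dil f R z * ((Λ z)⁻¹ * φ ‖z - u‖) ∂τ) := by
          rw [lintegral_lintegral_swap hj2.aemeasurable]
      _ ≤ (B + ε * vR) * ∫⁻ z, dil f R z := by
          refine mul_le_mul_right (lintegral_mono fun z => ?_) _
          have hmz : Measurable fun u => φ ‖z - u‖ := hφ.comp (by fun_prop)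
          rw [lintegral_const_mul _ (hmz.const_mul _), lintegral_const_mul _ hmz]
          calc dil f R z * ((Λ z)⁻¹ * ∫⁻ u, φ ‖z - u‖ ∂τ) ≤ dil f R z * ((Λ z)⁻¹ * Λ z) := by
                gcongr; exact le_self_add
            _ = dil f R z := by rw [ENNReal.inv_mul_cancel (hΛ0 z) (hΛt z), mul_one]
  by_cases hY : ∫⁻ z, dil f R z = ∞
  · rw [hY, ENNReal.mul_top hB0]; exact le_top
  have hlim : Tendsto (fun ε : ℝ≥0∞ => (B + ε * vR) * ∫⁻ z, dil f R z) (𝓝[>] 0)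
      (𝓝 ((B + 0 * vR) * ∫⁻ z, dil f R z)) := by
    refine Tendsto.mono_left ?_ nhdsWithin_le_nhds
    refine ENNReal.Tendsto.mul_const ?_ (Or.inr hY)
    exact tendsto_const_nhds.add (ENNReal.Tendsto.mul_const tendsto_id (Or.inr hvRt))
  rw [zero_mul, add_zero] at hlim
  refine ge_of_tendsto hlim ?_
  have : ∀ᶠ ε : ℝ≥0∞ in 𝓝[>] 0, ε < 1 :=
    nhdsWithin_le_nhds (Iio_mem_nhds one_pos)
  filter_upwards [this, self_mem_nhdsWithin] with ε h1 h2
  exact key ε (ne_of_gt h2) (h1.trans ENNReal.one_lt_top).ne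

theorem setLIntegral_ball_shift {m : ℕ} (φ : ℝ → ℝ≥0∞) (R : ℝ) (u v : Euc m) :
    ∫⁻ z in Metric.ball v R, φ ‖z - u‖ = ∫⁻ z in Metric.ball 0 R, φ ‖z - (u - v)‖ := by
  have h := (measurePreserving_add_right (volume : Measure (Euc m)) v).setLIntegral_comp_preimage_emb
    (measurableEmbedding_addRight v) (fun z => φ ‖z - u‖) (Metric.ball v R)
  rw [← h]
  have e : (fun x => x + v) ⁻¹' Metric.ball v R = Metric.ball (0 : Euc m) R := by
    ext z; simp
  rw [e]
  refine lintegral_congr fun z => ?_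
  congr 2; abel

/-- The kernel `K x = ∫ φ ‖z - x‖` over the ball of radius `R` is itself radially decreasing and
vanishes beyond `R + R'`. Hence the layer-cake bound turns control of `τ` on balls into the constant
`B`. The weaker control on balls of radius less than `ω` costs only the deficit `K 0 - K xω`. -/
theorem lintegral_dil_le_of_radial {m : ℕ} (hm : 0 < m) {φ : ℝ → ℝ≥0∞} (hφ : Measurable φ)
    (hanti : AntitoneOn φ (Ici 0)) {R R' : ℝ} (hφR : ∀ t, R' ≤ t → φ t = 0) {Cφ : ℝ≥0∞}
    (hCφ : Cφ ≠ ∞) (hφC : ∀ t, φ t ≤ Cφ) {f : Euc m → ℝ≥0∞} {N : Set (Euc m)}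
    (hf : ∀ x, x ∉ N → f x = 0) (τ : Measure (Euc m)) [IsFiniteMeasure τ] {d : ℝ}
    {κ a₁ a₂ B : ℝ≥0∞} {ω : ℝ} {xω : Euc m} (hω : ω ≤ ‖xω‖)
    (hτ : ∀ v ∈ N, ∀ ρ, 0 ≤ ρ → ρ ≤ R + R' → τ (Metric.closedBall v ρ) ≤
      a₁ * volume (Metric.closedBall v ρ) + if ρ < ω then a₂ else 0)
    (hκ : ∀ w : Euc m, ‖w‖ < d → κ ≤ ∫⁻ z in Metric.ball 0 R, φ ‖z - w‖ ^ (1 / 2 : ℝ))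
    (hB0 : B ≠ 0)
    (hB : a₁ * (volume (Metric.ball (0 : Euc m) R) * ∫⁻ x : Euc m, φ ‖x‖) +
      a₂ * ((∫⁻ z in Metric.ball (0 : Euc m) R, φ ‖z‖) -
        ∫⁻ z in Metric.ball 0 R, φ ‖z - xω‖) ≤ B) :
    κ ^ 2 * ∫⁻ u, dil f d u ∂τ ≤ B * ∫⁻ z, dil f R z := by
  have hjm : Measurable fun q : Euc m × Euc m => φ ‖q.1 - q.2‖ := hφ.comp (by fun_prop)
  set K : Euc m → ℝ≥0∞ := fun x => ∫⁻ z in Metric.ball 0 R, φ ‖z - x‖ with hK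
  have hKm : Measurable K := hjm.lintegral_prod_left'
  have hKt : ∀ x, K x ≠ ∞ := fun x => by
    refine ne_top_of_le_ne_top (ENNReal.mul_ne_top hCφ
      (measure_ball_lt_top (x := (0 : Euc m)) (r := R)).ne) (b := Cφ * volume (Metric.ball 0 R)) ?_
    calc K x ≤ ∫⁻ z in Metric.ball (0 : Euc m) R, Cφ := lintegral_mono fun z => hφC _
      _ = _ := setLIntegral_const _ _
  have hKanti : ∀ x x' : Euc m, ‖x'‖ ≤ ‖x‖ → K x ≤ K x' := fun x x' h =>
    setLIntegral_ball_radial_anti hanti R h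
  have hKb : ∀ x, R + R' ≤ ‖x‖ → K x = 0 := fun x hx => by
    refine (setLIntegral_congr_fun measurableSet_ball fun z hz => ?_).trans (lintegral_zero)
    refine hφR _ ?_
    have h1 : ‖z‖ < R := mem_ball_zero_iff.1 hz
    have h2 : ‖x‖ ≤ ‖z - x‖ + ‖z‖ := by
      have := norm_sub_le z (z - x); simpa [add_comm] using this
    linarith
  have hKint : ∫⁻ x, K x = volume (Metric.ball (0 : Euc m) R) * ∫⁻ x : Euc m, φ ‖x‖ := by
    rw [hK, lintegral_lintegral_swap (f := fun x z => φ ‖z - x‖)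
      (hjm.comp measurable_swap).aemeasurable]
    have : ∀ z : Euc m, ∫⁻ x : Euc m, φ ‖z - x‖ = ∫⁻ x : Euc m, φ ‖x‖ := fun z =>
      lintegral_sub_left_eq_self (fun x : Euc m => φ ‖x‖) z
    simp only [this, setLIntegral_const]
    rw [mul_comm]
  refine lintegral_dil_le_of_kernel hφ hCφ hφC hf τ hB0 (fun v hv => ?_) (fun u v huv => ?_)
  · have h1 := lintegral_radial_le hm (k := fun x => (K x).toReal) (b := R + R')
      (fun x => ENNReal.toReal_nonneg)
      (fun x x' h => ENNReal.toReal_mono (hKt _) (hKanti x x' h)) hKm.ennreal_toReal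
      (fun x hx => by simp [hKb x hx]) τ v hω (hτ v hv)
    simp only [ENNReal.ofReal_toReal (hKt _)] at h1
    rw [hKint, ENNReal.ofReal_sub _ ENNReal.toReal_nonneg, ENNReal.ofReal_toReal (hKt _),
      ENNReal.ofReal_toReal (hKt _)] at h1
    refine le_trans (le_of_eq (lintegral_congr fun u => ?_)) (h1.trans (le_trans (le_of_eq ?_) hB))
    · exact setLIntegral_ball_shift φ R u v
    · simp [hK]
  · rw [setLIntegral_ball_shift (fun t => φ t ^ (1 / 2 : ℝ))]
    exact hκ _ (by rwa [← dist_eq_norm, dist_comm])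

/-! ### The overlap of two balls and the indicator kernel. -/

/-- Volume of the part of a ball which is not covered by a translate in the direction of the first
coordinate axis. -/
theorem volume_ball_diff_translate_le {n : ℕ} {R t : ℝ} (ht : 0 ≤ t) {e : Euc (n + 1)}
    (he : e = EuclideanSpace.single 0 t) :
    volume (Metric.ball (0 : Euc (n + 1)) R \ Metric.ball e R) ≤
      ENNReal.ofReal t * volume (Metric.ball (0 : Euc n) R) := by
  -- The first coordinate is split off, in order to slice by lines parallel to the first axis.
  set Ψ : Euc (n + 1) → ℝ × (Fin n → ℝ) := fun z => (z 0, fun i => z i.succ) with hΨ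
  have hΨmp : MeasurePreserving Ψ volume volume := by
    have h1 := EuclideanSpace.volume_preserving_symm_measurableEquiv_toLp (Fin (n + 1))
    have h2 := volume_preserving_piFinSuccAbove (fun _ : Fin (n + 1) => ℝ) 0
    exact h2.comp h1
  have hnorm : ∀ z : Euc (n + 1), ‖z‖ ^ 2 = z 0 ^ 2 + ∑ i : Fin n, z i.succ ^ 2 := fun z => by
    rw [EuclideanSpace.norm_sq_eq, Fin.sum_univ_succ]; simp
  have hnormn : ∀ b : Euc n, ‖b‖ ^ 2 = ∑ i : Fin n, b i ^ 2 := fun b => by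
    rw [EuclideanSpace.norm_sq_eq]; simp
  rcases le_or_gt R 0 with hR | hR
  · simp [Metric.ball_eq_empty.2 hR]
  set S : Set (ℝ × (Fin n → ℝ)) :=
    {q | q.1 ^ 2 + ∑ i, q.2 i ^ 2 < R ^ 2 ∧ R ^ 2 ≤ (q.1 - t) ^ 2 + ∑ i, q.2 i ^ 2} with hS
  have hSm : MeasurableSet S := by
    have e1 : S = {q | q.1 ^ 2 + ∑ i, q.2 i ^ 2 < R ^ 2} ∩
        {q | R ^ 2 ≤ (q.1 - t) ^ 2 + ∑ i, q.2 i ^ 2} := rfl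
    rw [e1]
    refine (measurableSet_lt ?_ measurable_const).inter (measurableSet_le measurable_const ?_) <;>
    · refine Continuous.measurable ?_
      fun_prop
  have hpre : Metric.ball (0 : Euc (n + 1)) R \ Metric.ball e R = Ψ ⁻¹' S := by
    ext z
    have h1 : ‖z‖ < R ↔ ‖z‖ ^ 2 < R ^ 2 := (pow_lt_pow_iff_left₀ (norm_nonneg _) hR.le two_ne_zero).symm
    have h2 : R ≤ ‖z - e‖ ↔ R ^ 2 ≤ ‖z - e‖ ^ 2 :=
      (pow_le_pow_iff_left₀ hR.le (norm_nonneg _) two_ne_zero).symm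
    rw [Set.mem_sdiff, mem_ball_zero_iff, mem_ball_iff_norm, not_lt, h1, h2]
    rw [hnorm z, hnorm (z - e)]
    simp [he, hS, hΨ, Fin.succ_ne_zero]
  rw [hpre, hΨmp.measure_preimage hSm.nullMeasurableSet, Measure.volume_eq_prod,
    Measure.prod_apply_symm hSm]
  have hslice : ∀ b : Fin n → ℝ, volume ((fun a => (a, b)) ⁻¹' S) ≤
      ({b : Fin n → ℝ | ∑ i, b i ^ 2 < R ^ 2}).indicator (fun _ => ENNReal.ofReal t) b := by
    intro b
    by_cases hb : ∑ i, b i ^ 2 < R ^ 2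
    · rw [indicator_of_mem (by exact hb)]
      -- Over `b` the ball is the chord `(-c, c)`; what the translate leaves uncovered lies in `[-c,
      -- t - c]`, of length `t`.
      set c := √(R ^ 2 - ∑ i, b i ^ 2) with hc
      have hc2 : c ^ 2 = R ^ 2 - ∑ i, b i ^ 2 := Real.sq_sqrt (by linarith)
      have hc0 : 0 ≤ c := Real.sqrt_nonneg _
      have : (fun a => (a, b)) ⁻¹' S ⊆ Icc (-c) (t - c) := by
        rintro a ⟨h1, h2⟩
        have h1 : a ^ 2 + ∑ i, b i ^ 2 < R ^ 2 := h1
        have h2 : R ^ 2 ≤ (a - t) ^ 2 + ∑ i, b i ^ 2 := h2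
        have h3 : a ^ 2 < c ^ 2 := by linarith
        have h4 : c ^ 2 ≤ (a - t) ^ 2 := by linarith
        have h5 := abs_lt_of_sq_lt_sq h3 hc0
        have h6 := abs_lt.1 h5
        refine ⟨h6.1.le, ?_⟩
        by_contra! hcon
        nlinarith
      refine (measure_mono this).trans (le_of_eq ?_)
      rw [Real.volume_Icc]; congr 1; ring
    · rw [indicator_of_notMem (by exact hb)]
      have : (fun a => (a, b)) ⁻¹' S = ∅ := by
        ext a
        simp only [mem_preimage, hS, mem_ofPred_eq, mem_empty_iff_false, iff_false, not_and]
        intro h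
        nlinarith [sq_nonneg a]
      simp [this]
  have hbm : MeasurableSet {b : Fin n → ℝ | ∑ i, b i ^ 2 < R ^ 2} := by
    refine measurableSet_lt ?_ measurable_const
    refine Continuous.measurable ?_
    fun_prop
  refine (lintegral_mono hslice).trans ?_
  rw [lintegral_indicator hbm, setLIntegral_const]
  refine mul_le_mul_right (le_of_eq ?_) _
  rw [← (EuclideanSpace.volume_preserving_symm_measurableEquiv_toLp (Fin n)).measure_preimage
    hbm.nullMeasurableSet]
  congr 1
  ext z
  have h1 : ‖z‖ < R ↔ ‖z‖ ^ 2 < R ^ 2 := (pow_lt_pow_iff_left₀ (norm_nonneg _) hR.le two_ne_zero).symm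
  rw [mem_ball_zero_iff, h1, hnormn]
  rfl

/-- Volume of the unit ball as a real number. -/
noncomputable def gam (m : ℕ) : ℝ := (unitBallVol m).toReal

theorem unitBallVol_ne_top (m : ℕ) : unitBallVol m ≠ ∞ := measure_closedBall_lt_top.ne

theorem gam_pos (m : ℕ) : 0 < gam m :=
  ENNReal.toReal_pos (Metric.measure_closedBall_pos _ _ one_pos).ne' (unitBallVol_ne_top m)

theorem ofReal_gam (m : ℕ) : ENNReal.ofReal (gam m) = unitBallVol m :=
  ENNReal.ofReal_toReal (unitBallVol_ne_top m)

theorem volume_closedBall_eq {m : ℕ} (x : Euc m) {R : ℝ} (hR : 0 ≤ R) :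
    volume (Metric.closedBall x R) = ENNReal.ofReal (gam m * R ^ m) := by
  rw [Measure.addHaar_closedBall' _ _ hR, finrank_euclideanSpace_fin, mul_comm,
    ENNReal.ofReal_mul (gam_pos m).le, ofReal_gam]
  rfl

theorem volume_ball_eq {m : ℕ} (x : Euc m) {R : ℝ} (hR : 0 < R) :
    volume (Metric.ball x R) = ENNReal.ofReal (gam m * R ^ m) := by
  rw [Measure.addHaar_ball_of_pos _ _ hR, ← Measure.addHaar_unitClosedBall_eq_addHaar_unitBall,
    finrank_euclideanSpace_fin, mul_comm, ENNReal.ofReal_mul (gam_pos m).le, ofReal_gam]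
  rfl

theorem setLIntegral_ball_indicator {m : ℕ} (R : ℝ) (w : Euc m) :
    ∫⁻ z in Metric.ball (0 : Euc m) R, (Iio R).indicator (1 : ℝ → ℝ≥0∞) ‖z - w‖ =
      volume (Metric.ball 0 R ∩ Metric.ball w R) := by
  have : ∀ z : Euc m, (Iio R).indicator (1 : ℝ → ℝ≥0∞) ‖z - w‖ =
      (Metric.ball w R).indicator 1 z := fun z => by
    simp only [indicator, mem_Iio, mem_ball_iff_norm, Pi.one_apply]
  simp only [this]
  rw [lintegral_indicator_one measurableSet_ball, Measure.restrict_apply measurableSet_ball,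
    inter_comm]

theorem antitoneOn_indicator_Iio (R : ℝ) :
    AntitoneOn ((Iio R).indicator (1 : ℝ → ℝ≥0∞)) (Ici 0) := by
  intro a _ b _ hab
  by_cases hb : b < R
  · simp [indicator, hb, hab.trans_lt hb]
  · simp [indicator, hb]

/-- The overlap depends only on the norm of the translation, by radial monotonicity, so `w` may be
turned to the first axis and the slicing bound applied. -/
theorem volume_ball_inter_ball_ge {n : ℕ} {R : ℝ} (hR : 0 < R) (w : Euc (n + 1)) :
    ENNReal.ofReal ((1 - ‖w‖ * (gam n / gam (n + 1)) / R) * (gam (n + 1) * R ^ (n + 1))) ≤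
      volume (Metric.ball (0 : Euc (n + 1)) R ∩ Metric.ball w R) := by
  set e : Euc (n + 1) := EuclideanSpace.single 0 ‖w‖ with he
  have hne : ‖w‖ ≤ ‖e‖ := by simp [he]
  have h1 := setLIntegral_ball_radial_anti (antitoneOn_indicator_Iio R) R
    (x := e) (x' := w) hne
  rw [setLIntegral_ball_indicator, setLIntegral_ball_indicator] at h1
  refine le_trans ?_ h1
  have h2 := volume_ball_diff_translate_le (R := R) (norm_nonneg w) he
  have h3 := measure_inter_add_sdiff (μ := volume) (Metric.ball (0 : Euc (n + 1)) R)
    (measurableSet_ball (x := e) (ε := R))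
  rw [volume_ball_eq _ hR] at h3 h2
  have h4 : ENNReal.ofReal (gam (n + 1) * R ^ (n + 1)) ≤
      volume (Metric.ball 0 R ∩ Metric.ball e R) + ENNReal.ofReal (‖w‖ * (gam n * R ^ n)) := by
    rw [← h3, ENNReal.ofReal_mul (norm_nonneg w)]
    exact add_le_add le_rfl h2
  have h5 : (1 - ‖w‖ * (gam n / gam (n + 1)) / R) * (gam (n + 1) * R ^ (n + 1)) =
      gam (n + 1) * R ^ (n + 1) - ‖w‖ * (gam n * R ^ n) := by
    have := (gam_pos (n + 1)).ne'
    field_simp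
    ring
  rw [h5, ENNReal.ofReal_sub _ (by have := gam_pos n; positivity)]
  exact tsub_le_iff_right.2 h4

/-- The ratio `γ_{m-1} / γ_m`. -/
noncomputable def gratio (m : ℕ) : ℝ := gam (m - 1) / gam m

theorem gratio_pos (m : ℕ) : 0 < gratio m := div_pos (gam_pos _) (gam_pos _)

/-- The spreading argument with the indicator of `[0, R)` as profile: `κ` becomes the volume of the
overlap of two balls with centres at distance less than `d`, and `θ` bounds the fraction of a ball
lost under a translation of length `ω`. -/
theorem lintegral_dil_le_overlap {m : ℕ} (hm : 0 < m) {f : Euc m → ℝ≥0∞} {N : Set (Euc m)}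
    (hf : ∀ x, x ∉ N → f x = 0) (τ : Measure (Euc m)) [IsFiniteMeasure τ] {R d ω θ : ℝ}
    (hR : 0 < R) {a₁ a₂ : ℝ≥0∞} (ha₁ : a₁ + a₂ * ENNReal.ofReal θ ≠ 0) (hω : 0 ≤ ω)
    (hθ : min 1 (gratio m * ω / R) ≤ θ) (hd1 : d * gratio m / R ≤ 1)
    (hτ : ∀ v ∈ N, ∀ ρ, 0 ≤ ρ → ρ ≤ R + R → τ (Metric.closedBall v ρ) ≤
      a₁ * volume (Metric.closedBall v ρ) +
        if ρ < ω then a₂ * ENNReal.ofReal (gam m * R ^ m) else 0) :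
    ENNReal.ofReal ((1 - d * gratio m / R) ^ 2) * ∫⁻ u, dil f d u ∂τ ≤
      (a₁ + a₂ * ENNReal.ofReal θ) * ∫⁻ z, dil f R z := by
  obtain ⟨n, rfl⟩ : ∃ n, m = n + 1 := ⟨m - 1, by omega⟩
  set V : ℝ≥0∞ := ENNReal.ofReal (gam (n + 1) * R ^ (n + 1)) with hV
  have hγ := gam_pos (n + 1)
  have hg := gratio_pos (n + 1)
  have hV0 : V ≠ 0 := by simp only [hV, ne_eq, ENNReal.ofReal_eq_zero, not_le]; positivity
  have hVt : V ≠ ∞ := ENNReal.ofReal_ne_top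
  have hgdef : gratio (n + 1) = gam n / gam (n + 1) := rfl
  set κ := ENNReal.ofReal (1 - d * gratio (n + 1) / R) * V with hκ
  have hθ0 : 0 ≤ θ := le_trans (le_min zero_le_one (by positivity)) hθ
  set xω : Euc (n + 1) := EuclideanSpace.single 0 ω with hxω
  have hxωn : ‖xω‖ = ω := by simp [hxω, abs_of_nonneg hω]
  have hball0 : volume (Metric.ball (0 : Euc (n + 1)) R) = V := volume_ball_eq 0 hR
  have key := lintegral_dil_le_of_radial hm (φ := (Iio R).indicator (1 : ℝ → ℝ≥0∞))
    (measurable_one.indicator measurableSet_Iio) (antitoneOn_indicator_Iio R)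
    (R := R) (R' := R) (fun t ht => indicator_of_notMem (by simpa using ht) _)
    ENNReal.one_ne_top (fun t => indicator_le_self' (by simp) t) hf τ (d := d) (κ := κ)
    (a₁ := a₁) (a₂ := a₂ * V) (B := (a₁ + a₂ * ENNReal.ofReal θ) * V ^ 2) (ω := ω) (xω := xω)
    hxωn.ge hτ ?_ ?_ ?_
  · have : κ ^ 2 = ENNReal.ofReal ((1 - d * gratio (n + 1) / R) ^ 2) * V ^ 2 := by
      rw [hκ, mul_pow, ENNReal.ofReal_pow (by linarith)]
    rw [this] at key
    have hV2 : V ^ 2 ≠ 0 := pow_ne_zero _ hV0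
    have hV2t : V ^ 2 ≠ ∞ := ENNReal.pow_ne_top hVt
    refine (ENNReal.mul_le_mul_iff_right hV2 hV2t).1 ?_
    calc _ = _ := by ring
      _ ≤ _ := key
      _ = _ := by ring
  · intro w hw
    have e : ∀ t, (Iio R).indicator (1 : ℝ → ℝ≥0∞) t ^ (1 / 2 : ℝ) = (Iio R).indicator 1 t :=
      fun t => by
        by_cases h : t ∈ Iio R <;> simp [h]
    simp only [e]
    rw [setLIntegral_ball_indicator]
    refine le_trans ?_ (volume_ball_inter_ball_ge hR w)
    rw [hκ, hV, ← ENNReal.ofReal_mul (by linarith)]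
    refine ENNReal.ofReal_le_ofReal ?_
    rw [← hgdef]
    gcongr
  · exact mul_ne_zero ha₁ (pow_ne_zero _ hV0)
  · have h1 : ∫⁻ x : Euc (n + 1), (Iio R).indicator (1 : ℝ → ℝ≥0∞) ‖x‖ = V := by
      have : ∀ x : Euc (n + 1), (Iio R).indicator (1 : ℝ → ℝ≥0∞) ‖x‖ =
          (Metric.ball 0 R).indicator 1 x := fun x => by
        simp only [indicator, mem_Iio, mem_ball_zero_iff, Pi.one_apply]
      simp only [this]
      rw [lintegral_indicator_one measurableSet_ball, hball0]
    have h2 : ∫⁻ z in Metric.ball (0 : Euc (n + 1)) R, (Iio R).indicator (1 : ℝ → ℝ≥0∞) ‖z‖ = V := by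
      have := setLIntegral_ball_indicator R (0 : Euc (n + 1))
      simp only [sub_zero, inter_self] at this
      rw [this, hball0]
    have h3 : V - ∫⁻ z in Metric.ball (0 : Euc (n + 1)) R,
        (Iio R).indicator (1 : ℝ → ℝ≥0∞) ‖z - xω‖ ≤ ENNReal.ofReal θ * V := by
      rw [setLIntegral_ball_indicator]
      rcases le_total 1 (gratio (n + 1) * ω / R) with h | h
      · rw [min_eq_left h] at hθ
        refine tsub_le_self.trans ?_
        calc V = 1 * V := (one_mul V).symm
          _ ≤ _ := by gcongr; exact ENNReal.one_le_ofReal.2 hθ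
      · rw [min_eq_right h] at hθ
        rw [tsub_le_iff_left]
        have := volume_ball_inter_ball_ge hR xω
        rw [hxωn, ← hgdef] at this
        refine le_trans ?_ (add_le_add this le_rfl)
        rw [hV, ← ENNReal.ofReal_mul hθ0, ← ENNReal.ofReal_add _ (by positivity)]
        · refine ENNReal.ofReal_le_ofReal ?_
          rw [← add_mul]
          have : 1 ≤ 1 - ω * gratio (n + 1) / R + θ := by rw [mul_comm ω]; linarith
          calc _ = 1 * (gam (n + 1) * R ^ (n + 1)) := (one_mul _).symm
            _ ≤ _ := by gcongr
        · have : 0 ≤ 1 - ω * gratio (n + 1) / R := by rw [mul_comm ω]; linarith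
          positivity
    rw [h1, h2, hball0]
    calc a₁ * (V * V) + a₂ * V * (V - _) ≤ a₁ * (V * V) + a₂ * V * (ENNReal.ofReal θ * V) := by
          gcongr
      _ = _ := by ring

/-! ### The parabolic kernel. -/

theorem integral_radial_Ioi {m : ℕ} (hm : 0 < m) (f : ℝ → ℝ) :
    ∫ x : Euc m, f ‖x‖ = m * gam m * ∫ y in Ioi (0 : ℝ), y ^ (m - 1) * f y := by
  have : Nonempty (Fin m) := ⟨⟨0, hm⟩⟩
  have h := integral_fun_norm_addHaar (volume : Measure (Euc m)) f
  rw [h, finrank_euclideanSpace_fin]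
  have e : (volume : Measure (Euc m)).real (Metric.ball 0 1) = gam m := by
    rw [Measure.real, ← Measure.addHaar_unitClosedBall_eq_addHaar_unitBall]; rfl
  rw [e]
  simp [mul_assoc]

theorem integral_radial_Iio {m : ℕ} (hm : 0 < m) {L : ℝ} (hL : 0 ≤ L) (f : ℝ → ℝ) :
    ∫ x : Euc m, (Iio L).indicator f ‖x‖ = m * gam m * ∫ y in (0 : ℝ)..L, y ^ (m - 1) * f y := by
  rw [integral_radial_Ioi hm]
  congr 1
  have : ∀ y : ℝ, y ^ (m - 1) * (Iio L).indicator f y =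
      (Iio L).indicator (fun y => y ^ (m - 1) * f y) y := fun y => by
    by_cases h : y ∈ Iio L <;> simp [h]
  simp only [this]
  rw [setIntegral_indicator measurableSet_Iio, Ioi_inter_Iio,
    intervalIntegral.integral_of_le hL, integral_Ioc_eq_integral_Ioo]

/-- The profile `max 0 (β - t² / R²)`. -/
noncomputable def parab (β R t : ℝ) : ℝ := max 0 (β - t ^ 2 / R ^ 2)

theorem parab_antitoneOn (β R : ℝ) : AntitoneOn (parab β R) (Ici 0) := by
  intro a ha b _ hab
  have ha : 0 ≤ a := ha
  unfold parab
  gcongr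

theorem integral_parab_sq {m : ℕ} (hm : 0 < m) {β R : ℝ} (hβ : 0 < β) (hR : 0 < R) :
    ∫ x : Euc m, parab β R ‖x‖ ^ 2 =
      gam m * R ^ m * (√β ^ m * β ^ 2 * (8 / ((m + 2) * (m + 4)))) := by
  set L := √β * R with hL
  have hL0 : 0 ≤ L := by positivity
  have hL2 : L ^ 2 = β * R ^ 2 := by rw [hL, mul_pow, Real.sq_sqrt hβ.le]
  have e : ∀ x : Euc m, parab β R ‖x‖ ^ 2 =
      (Iio L).indicator (fun t => (β - t ^ 2 / R ^ 2) ^ 2) ‖x‖ := fun x => by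
    by_cases h : ‖x‖ < L
    · rw [indicator_of_mem (by exact h), parab, max_eq_right]
      have : ‖x‖ ^ 2 ≤ L ^ 2 := by gcongr
      rw [sub_nonneg, div_le_iff₀ (by positivity)]; linarith
    · rw [indicator_of_notMem (by exact h), parab, max_eq_left]
      · simp
      have : L ^ 2 ≤ ‖x‖ ^ 2 := by gcongr; exact not_lt.1 h
      rw [sub_nonpos, le_div_iff₀ (by positivity)]; linarith
  simp only [e]
  rw [integral_radial_Iio hm hL0]
  have e2 : ∀ y : ℝ, y ^ (m - 1) * (β - y ^ 2 / R ^ 2) ^ 2 =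
      β ^ 2 * y ^ (m - 1) - (2 * β / R ^ 2) * y ^ (m + 1) + (1 / R ^ 4) * y ^ (m + 3) := fun y => by
    obtain ⟨n, rfl⟩ : ∃ n, m = n + 1 := ⟨m - 1, by omega⟩
    simp only [Nat.add_sub_cancel]
    field_simp
    ring
  simp only [e2]
  rw [intervalIntegral.integral_add, intervalIntegral.integral_sub,
    intervalIntegral.integral_const_mul, intervalIntegral.integral_const_mul,
    intervalIntegral.integral_const_mul, integral_pow, integral_pow, integral_pow]
  · obtain ⟨n, rfl⟩ : ∃ n, m = n + 1 := ⟨m - 1, by omega⟩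
    have h2 : L ^ (n + 1 + 1 + 1) = L ^ (n + 1) * (β * R ^ 2) := by rw [← hL2]; ring
    have h4 : L ^ (n + 1 + 3 + 1) = L ^ (n + 1) * (β * R ^ 2) ^ 2 := by rw [← hL2]; ring
    have h0 : L ^ (n + 1) = √β ^ (n + 1) * R ^ (n + 1) := by rw [hL, mul_pow]
    simp only [Nat.add_sub_cancel]
    rw [h2, h4, h0]
    push_cast
    have : (n : ℝ) + 1 ≠ 0 := by positivity
    have : (n : ℝ) + 1 + 1 + 1 ≠ 0 := by positivity
    have : (n : ℝ) + 1 + 3 + 1 ≠ 0 := by positivity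
    have : (n : ℝ) + 1 + 2 ≠ 0 := by positivity
    have : (n : ℝ) + 1 + 4 ≠ 0 := by positivity
    field_simp
    ring
  all_goals apply Continuous.intervalIntegrable; fun_prop

theorem integral_norm_sq_ball {m : ℕ} (hm : 0 < m) {R : ℝ} (hR : 0 < R) :
    ∫ x : Euc m in Metric.ball 0 R, ‖x‖ ^ 2 = gam m * R ^ m * (R ^ 2 * (m / (m + 2))) := by
  have e : ∀ x : Euc m, (Metric.ball (0 : Euc m) R).indicator (fun x => ‖x‖ ^ 2) x =
      (Iio R).indicator (fun t => t ^ 2) ‖x‖ := fun x => by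
    by_cases h : ‖x‖ < R <;> simp [indicator, h]
  rw [← integral_indicator measurableSet_ball]
  simp only [e]
  rw [integral_radial_Iio hm hR.le]
  obtain ⟨n, rfl⟩ : ∃ n, m = n + 1 := ⟨m - 1, by omega⟩
  simp only [Nat.add_sub_cancel, ← pow_add]
  rw [integral_pow]
  push_cast
  have : (n : ℝ) + 1 + 2 ≠ 0 := by positivity
  have : (n : ℝ) + 2 + 1 ≠ 0 := by positivity
  field_simp
  ring

/-- The integral does not change when `w` is replaced by `-w`. In the sum of the two integrands the
cross terms cancel by the parallelogram law, and truncation at zero can only increase the integrand.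
-/
theorem setLIntegral_parab_ge {m : ℕ} (hm : 0 < m) {β R δ : ℝ} (hR : 0 < R) (w : Euc m)
    (hw : ‖w‖ ≤ δ * R) :
    ENNReal.ofReal (gam m * R ^ m * (β - (m / (m + 2) + δ ^ 2))) ≤
      ∫⁻ z in Metric.ball (0 : Euc m) R, ENNReal.ofReal (parab β R ‖z - w‖) := by
  have hanti : AntitoneOn (fun t => ENNReal.ofReal (parab β R t)) (Ici 0) := fun a ha b hb hab =>
    ENNReal.ofReal_le_ofReal (parab_antitoneOn β R ha hb hab)
  have hsym : ∫⁻ z in Metric.ball (0 : Euc m) R, ENNReal.ofReal (parab β R ‖z - w‖) =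
      ∫⁻ z in Metric.ball (0 : Euc m) R, ENNReal.ofReal (parab β R ‖z - -w‖) :=
    le_antisymm (setLIntegral_ball_radial_anti hanti R (by simp))
      (setLIntegral_ball_radial_anti hanti R (by simp))
  set I := ∫⁻ z in Metric.ball (0 : Euc m) R, ENNReal.ofReal (parab β R ‖z - w‖) with hI
  have hpc : Continuous (parab β R) := by unfold parab; fun_prop
  have h2 : I + I = ∫⁻ z in Metric.ball (0 : Euc m) R,
      (ENNReal.ofReal (parab β R ‖z - w‖) + ENNReal.ofReal (parab β R ‖z - -w‖)) := by
    rw [lintegral_add_left, ← hsym]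
    exact (hpc.measurable.comp (by fun_prop)).ennreal_ofReal
  set Q : ℝ := gam m * R ^ m * (β - (m / (m + 2) + δ ^ 2)) with hQ
  have hint : IntegrableOn (fun z : Euc m => ‖z‖ ^ 2) (Metric.ball 0 R) :=
    (ContinuousOn.integrableOn_compact (isCompact_closedBall 0 R) (by fun_prop)).mono_set
      Metric.ball_subset_closedBall
  have hcint : ∀ c : ℝ, IntegrableOn (fun _ : Euc m => c) (Metric.ball 0 R) := fun c =>
    integrableOn_const measure_ball_lt_top.ne
  have hreal : (∫ z in Metric.ball (0 : Euc m) R, (2 * (β - δ ^ 2) - (2 / R ^ 2) * ‖z‖ ^ 2)) =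
      2 * Q := by
    rw [integral_sub (hcint _) (hint.const_mul _), setIntegral_const, integral_const_mul,
      integral_norm_sq_ball hm hR, Measure.real, volume_ball_eq _ hR, ENNReal.toReal_ofReal
      (by have := gam_pos m; positivity), smul_eq_mul, hQ]
    field_simp
    ring
  have h3 : ENNReal.ofReal (2 * Q) ≤ I + I := by
    rw [h2, ← hreal]
    have hi : Integrable (fun z : Euc m => 2 * (β - δ ^ 2) - 2 / R ^ 2 * ‖z‖ ^ 2)
        (volume.restrict (Metric.ball 0 R)) := (hcint (2 * (β - δ ^ 2))).sub (hint.const_mul (2 / R ^ 2))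
    rw [integral_eq_lintegral_pos_part_sub_lintegral_neg_part hi]
    refine (ENNReal.ofReal_le_ofReal (sub_le_self _ ENNReal.toReal_nonneg)).trans
      (ENNReal.ofReal_toReal_le.trans ?_)
    refine lintegral_mono fun z => ?_
    rw [← ENNReal.ofReal_add (show 0 ≤ parab β R ‖z - w‖ from le_max_left _ _)
      (show 0 ≤ parab β R ‖z - -w‖ from le_max_left _ _)]
    refine ENNReal.ofReal_le_ofReal ?_
    have h4 : β - ‖z - w‖ ^ 2 / R ^ 2 ≤ parab β R ‖z - w‖ := le_max_right _ _
    have h5 : β - ‖z - -w‖ ^ 2 / R ^ 2 ≤ parab β R ‖z - -w‖ := le_max_right _ _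
    have h6 : ‖z - w‖ ^ 2 + ‖z - -w‖ ^ 2 = 2 * (‖z‖ ^ 2 + ‖w‖ ^ 2) := by
      have := parallelogram_law_with_norm ℝ z w
      rw [sub_neg_eq_add]; linarith
    have h7 : ‖w‖ ^ 2 ≤ (δ * R) ^ 2 := by gcongr
    have h8 : ‖w‖ ^ 2 / R ^ 2 ≤ δ ^ 2 := by
      rw [div_le_iff₀ (by positivity)]; linarith
    have h9 : ‖z - w‖ ^ 2 / R ^ 2 + ‖z - -w‖ ^ 2 / R ^ 2 =
        2 / R ^ 2 * ‖z‖ ^ 2 + 2 * (‖w‖ ^ 2 / R ^ 2) := by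
      rw [← add_div, h6]; ring
    linarith
  rw [← two_mul, ENNReal.ofReal_mul zero_le_two, ENNReal.ofReal_ofNat] at h3
  exact (ENNReal.mul_le_mul_iff_right two_ne_zero ENNReal.ofNat_ne_top).1 h3

/-- The constant of the comparison lemma with the parabolic profile. -/
noncomputable def parabConst (m : ℕ) (δ : ℝ) : ℝ :=
  √((m + 4) / m * (m / (m + 2) + δ ^ 2)) ^ m * ((m + 4) / (m + 2)) / 2

/-- The profile is the square of `parab`, so that its square root, which determines `κ`, is `parab`
itself and needs only a second moment. This kernel serves in high dimension, where the loss in the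
overlap of two balls is too large. -/
theorem lintegral_dil_le_parab {m : ℕ} (hm : 0 < m) {f : Euc m → ℝ≥0∞} {N : Set (Euc m)}
    (hf : ∀ x, x ∉ N → f x = 0) (τ : Measure (Euc m)) [IsFiniteMeasure τ] {R δ : ℝ}
    (hR : 0 < R) {a₁ a₂ : ℝ≥0∞} (ha₁ : a₁ ≠ 0)
    (hτ : ∀ v ∈ N, ∀ ρ, 0 ≤ ρ →
      ρ ≤ R + √((m + 4) / m * (m / (m + 2) + δ ^ 2)) * R → τ (Metric.closedBall v ρ) ≤
      a₁ * volume (Metric.closedBall v ρ) + a₂ * ENNReal.ofReal (gam m * R ^ m)) :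
    ∫⁻ u, dil f (δ * R) u ∂τ ≤
      (a₁ + a₂) * ENNReal.ofReal (parabConst m δ) * ∫⁻ z, dil f R z := by
  have hm' : (0 : ℝ) < m := by exact_mod_cast hm
  set h : ℝ := m / (m + 2) + δ ^ 2 with hh
  -- This value minimises `β ^ (m / 2 + 2) / (β - h) ^ 2`, to which the resulting constant is
  -- proportional.
  set β : ℝ := (m + 4) / m * h with hβ
  have hhpos : 0 < h := by positivity
  have hβpos : 0 < β := by positivity
  have hγ := gam_pos m
  set V : ℝ≥0∞ := ENNReal.ofReal (gam m * R ^ m) with hV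
  have hV0 : V ≠ 0 := by simp only [hV, ne_eq, ENNReal.ofReal_eq_zero, not_le]; positivity
  have hVt : V ≠ ∞ := ENNReal.ofReal_ne_top
  have hpc : Continuous (parab β R) := by unfold parab; fun_prop
  have hp0 : ∀ t, 0 ≤ parab β R t := fun t => le_max_left _ _
  set φ : ℝ → ℝ≥0∞ := fun t => ENNReal.ofReal (parab β R t ^ 2) with hφ
  set Ψ := ∫⁻ x : Euc m, φ ‖x‖ with hΨ
  set ψ : ℝ := √β ^ m * β ^ 2 * (8 / ((m + 2) * (m + 4))) with hψ
  have hψ0 : 0 < ψ := by positivity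
  have hΨval : Ψ = V * ENNReal.ofReal ψ := by
    have hi := integral_parab_sq hm hβpos hR
    have hint : Integrable fun x : Euc m => parab β R ‖x‖ ^ 2 := by
      by_contra hni
      rw [integral_undef hni] at hi
      have : 0 < gam m * R ^ m * ψ := by positivity
      linarith
    rw [hΨ, hφ, ← ofReal_integral_eq_lintegral_ofReal hint
      (Eventually.of_forall fun x => sq_nonneg _), hi, ENNReal.ofReal_mul (by positivity)]
  set κ := V * ENNReal.ofReal (β - h) with hκ
  have hβh : β - h = 4 * h / m := by rw [hβ]; field_simp; ring
  have hβh0 : 0 < β - h := by rw [hβh]; positivity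
  set b : ℝ := R + √β * R with hb
  have hb0 : 0 < b := by positivity
  have key := lintegral_dil_le_of_radial hm (φ := φ) (hpc.pow 2).measurable.ennreal_ofReal
    (fun a ha b hb hab => ENNReal.ofReal_le_ofReal
      (pow_le_pow_left₀ (hp0 _) (parab_antitoneOn β R ha hb hab) 2))
    (R := R) (R' := √β * R) (Cφ := ENNReal.ofReal (β ^ 2)) ?_ ENNReal.ofReal_ne_top
    (fun t => ENNReal.ofReal_le_ofReal (pow_le_pow_left₀ (hp0 _) ?_ 2)) hf τ (d := δ * R) (κ := κ)
    -- With `ω` beyond every radius in use, the constant part of the mass bound is always present.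
    (a₁ := a₁) (a₂ := a₂ * V) (B := (a₁ + a₂) * V * Ψ) (ω := b + 1)
    (xω := EuclideanSpace.single ⟨0, hm⟩ (b + 1)) ?_ ?_ ?_ ?_ ?_
  · rw [hκ, hΨval] at key
    have hV2 : V ^ 2 ≠ 0 := pow_ne_zero _ hV0
    have hV2t : V ^ 2 ≠ ∞ := ENNReal.pow_ne_top hVt
    have hc : parabConst m δ * (β - h) ^ 2 = ψ := by
      rw [parabConst, ← hh, ← hβ, hψ, hβh]
      have : β ^ 2 = ((m + 4) / m) ^ 2 * h ^ 2 := by rw [hβ]; ring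
      rw [this]
      field_simp
      ring
    rw [← hc, ENNReal.ofReal_mul (by unfold parabConst; positivity), ENNReal.ofReal_pow hβh0.le] at key
    have h1 : ENNReal.ofReal (β - h) ^ 2 ≠ 0 := pow_ne_zero _ (by simpa using hβh0)
    have h1t : ENNReal.ofReal (β - h) ^ 2 ≠ ∞ := ENNReal.pow_ne_top ENNReal.ofReal_ne_top
    refine (ENNReal.mul_le_mul_iff_right (mul_ne_zero hV2 h1) (ENNReal.mul_ne_top hV2t h1t)).1 ?_
    calc _ = _ := by ring
      _ ≤ _ := key
      _ = _ := by ring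
  · intro t ht
    have : parab β R t = 0 := by
      rw [parab, max_eq_left]
      have h1 : (√β * R) ^ 2 ≤ t ^ 2 := by gcongr
      rw [mul_pow, Real.sq_sqrt hβpos.le] at h1
      rw [sub_nonpos, le_div_iff₀ (by positivity)]; linarith
    simp [hφ, this]
  · refine max_le hβpos.le (sub_le_self _ (by positivity))
  · simp [abs_of_pos (show (0 : ℝ) < b + 1 by linarith)]
  · intro v hv ρ hρ hρb
    rw [if_pos (by linarith)]
    exact hτ v hv ρ hρ hρb
  · intro w hw
    have e : ∀ t, φ t ^ (1 / 2 : ℝ) = ENNReal.ofReal (parab β R t) := fun t => by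
      rw [hφ, ENNReal.ofReal_rpow_of_nonneg (sq_nonneg _) (by norm_num), ← Real.sqrt_eq_rpow,
        Real.sqrt_sq (hp0 t)]
    simp only [e]
    refine le_trans (le_of_eq ?_) (setLIntegral_parab_ge hm hR w hw.le)
    rw [hκ, hV, ← ENNReal.ofReal_mul (by positivity)]
  · refine mul_ne_zero (mul_ne_zero (by simp [ha₁]) hV0) ?_
    rw [hΨval]
    exact mul_ne_zero hV0 (by simpa using hψ0)
  · rw [volume_ball_eq _ hR]
    calc _ ≤ a₁ * (V * Ψ) + a₂ * V * Ψ := by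
          gcongr
          exact tsub_le_self.trans (setLIntegral_le_lintegral _ _)
      _ = _ := by ring

/-! ### The ratio of the volumes of unit balls in consecutive dimensions. -/

theorem gam_zero : gam 0 = 1 := by
  have h := EuclideanSpace.volume_preserving_symm_measurableEquiv_toLp (Fin 0)
  have h1 : volume (univ : Set (Euc 0)) = 1 := by
    have := h.measure_preimage (MeasurableSet.univ (α := Fin 0 → ℝ)).nullMeasurableSet
    rw [preimage_univ] at this
    rw [this, volume_pi, Measure.pi_of_empty]
    simp
  have h2 : Metric.closedBall (0 : Euc 0) 1 = univ := by
    ext x; simp [Subsingleton.elim x 0]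
  rw [gam, unitBallVol, h2, h1, ENNReal.toReal_one]

theorem gam_eq (m : ℕ) : gam m = √Real.pi ^ m / Real.Gamma (m / 2 + 1) := by
  rcases Nat.eq_zero_or_pos m with rfl | hm
  · simp [gam_zero]
  have : Nonempty (Fin m) := ⟨⟨0, hm⟩⟩
  rw [gam, unitBallVol, EuclideanSpace.volume_closedBall]
  have : 0 < Real.Gamma ((m : ℝ) / 2 + 1) := Real.Gamma_pos_of_pos (by positivity)
  rw [ENNReal.ofReal_one, one_pow, one_mul, Fintype.card_fin, ENNReal.toReal_ofReal (by positivity)]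

/-- Logarithmic convexity of the Gamma function at the midpoint of `x` and `x + 1`. -/
theorem Gamma_add_half_sq_le {x : ℝ} (hx : 0 < x) :
    Real.Gamma (x + 1 / 2) ^ 2 ≤ x * Real.Gamma x ^ 2 := by
  have h := Real.Gamma_mul_add_mul_le_rpow_Gamma_mul_rpow_Gamma hx (add_pos hx one_pos)
    (a := 1 / 2) (b := 1 / 2) (by norm_num) (by norm_num) (by norm_num)
  have h1 := Real.Gamma_pos_of_pos hx
  have h2 := Real.Gamma_pos_of_pos (show 0 < x + 1 / 2 by linarith)
  have e : 1 / 2 * x + 1 / 2 * (x + 1) = x + 1 / 2 := by ring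
  rw [e, Real.Gamma_add_one hx.ne', ← Real.mul_rpow h1.le (by positivity), ← Real.sqrt_eq_rpow] at h
  have h3 := pow_le_pow_left₀ h2.le h 2
  rw [Real.sq_sqrt (by positivity)] at h3
  linarith

theorem gratio_eq {m : ℕ} (hm : 0 < m) :
    gratio m = Real.Gamma ((m + 1) / 2 + 1 / 2) / (√Real.pi * Real.Gamma ((m + 1) / 2)) := by
  obtain ⟨n, rfl⟩ : ∃ n, m = n + 1 := ⟨m - 1, by omega⟩
  rw [gratio, gam_eq, gam_eq]
  simp only [Nat.add_sub_cancel]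
  push_cast
  have h1 : (n : ℝ) / 2 + 1 = (n + 1 + 1) / 2 := by ring
  have h2 : ((n : ℝ) + 1) / 2 + 1 = (n + 1 + 1) / 2 + 1 / 2 := by ring
  rw [h1, h2, pow_succ]
  have h3 : 0 < Real.Gamma (((n : ℝ) + 1 + 1) / 2) := Real.Gamma_pos_of_pos (by positivity)
  have h4 : 0 < Real.Gamma (((n : ℝ) + 1 + 1) / 2 + 1 / 2) := Real.Gamma_pos_of_pos (by positivity)
  have h5 : 0 < √Real.pi := by positivity
  field_simp

/-- With `le_gratio_sq` this encloses `2 π gratio ^ 2` between `m` and `m + 1`, which is all the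
numerical part needs about the ratio. -/
theorem gratio_sq_le {m : ℕ} (hm : 0 < m) : 2 * Real.pi * gratio m ^ 2 ≤ m + 1 := by
  have hx : (0 : ℝ) < (m + 1) / 2 := by positivity
  have h := Gamma_add_half_sq_le hx
  have h1 := Real.Gamma_pos_of_pos hx
  rw [gratio_eq hm, div_pow, mul_pow, Real.sq_sqrt Real.pi_pos.le]
  have hpi := Real.pi_pos
  rw [mul_div_assoc', div_le_iff₀ (by positivity)]
  nlinarith

theorem le_gratio_sq {m : ℕ} (hm : 0 < m) : m ≤ 2 * Real.pi * gratio m ^ 2 := by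
  have hm' : (0 : ℝ) < m := by exact_mod_cast hm
  have hx : (0 : ℝ) < m / 2 := by positivity
  have h := Gamma_add_half_sq_le hx
  have e : (m : ℝ) / 2 + 1 / 2 = (m + 1) / 2 := by ring
  rw [e] at h
  have h1 := Real.Gamma_pos_of_pos hx
  have h2 : 0 < Real.Gamma (((m : ℝ) + 1) / 2) := Real.Gamma_pos_of_pos (by positivity)
  have e2 : ((m : ℝ) + 1) / 2 + 1 / 2 = m / 2 + 1 := by ring
  rw [gratio_eq hm, div_pow, mul_pow, Real.sq_sqrt Real.pi_pos.le, e2, Real.Gamma_add_one hx.ne']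
  have hpi := Real.pi_pos
  rw [mul_div_assoc', le_div_iff₀ (by positivity)]
  have : (m : ℝ) * (Real.pi * Real.Gamma ((m + 1) / 2) ^ 2) ≤
      m * (Real.pi * (m / 2 * Real.Gamma (m / 2) ^ 2)) := by gcongr
  refine this.trans (le_of_eq ?_)
  ring

/-- `(1 - s) ^ m ≤ exp (-m s) ≤ exp (-z)`, and the Taylor polynomial bounds `exp z` from below. -/
theorem one_sub_pow_le {m : ℕ} {s z : ℝ} (hs1 : s ≤ 1) (hz0 : 0 ≤ z) (hz : z ≤ m * s) :
    (1 - s) ^ m * (1 + z + z ^ 2 / 2 + z ^ 3 / 6 + z ^ 4 / 24) ≤ 1 := by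
  have h1 : (1 - s) ^ m ≤ Real.exp (-z) := by
    calc (1 - s) ^ m ≤ Real.exp (-s) ^ m := by
          gcongr
          exact Real.one_sub_le_exp_neg s
      _ = Real.exp (-(m * s)) := by rw [← Real.exp_nat_mul]; ring_nf
      _ ≤ _ := Real.exp_le_exp.2 (by linarith)
  have h2 : 1 + z + z ^ 2 / 2 + z ^ 3 / 6 + z ^ 4 / 24 ≤ Real.exp z := by
    have := Real.sum_le_exp_of_nonneg hz0 5
    simp [Finset.sum_range_succ, Nat.factorial] at this
    linarith
  calc _ ≤ Real.exp (-z) * Real.exp z := by gcongr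
    _ = 1 := by rw [← Real.exp_add]; simp

/-! ### The numerical inequality between the constants. -/

/-- The constants of the comparison lemmas at the largest scale and at the smaller scales. -/
noncomputable def cutConst₀ (m : ℕ) (s δ : ℝ) : ℝ :=
  (1 + (1 - s) ^ m * min 1 (gratio m * (1 - s))) / (1 - δ * gratio m) ^ 2

/-- The alternative at the largest scale, from the parabolic kernel. -/
noncomputable def cutConst₀' (m : ℕ) (s δ : ℝ) : ℝ :=
  (1 + (1 - s) ^ m) * parabConst m δ

noncomputable def cutConst₁ (m : ℕ) (s δ : ℝ) : ℝ :=
  (1 + ((1 - s) * δ) ^ m) / (1 - δ ^ 2 * gratio m) ^ 2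


theorem mul_rate_le {s g : ℝ} (hs : 0 ≤ s) (hs1 : s ≤ 1)
    (hy : 3 * (s * g) ≤ (1 - s) ^ 2) : s * (s * g) ≤ 4 / 81 := by
  -- The maximum is at `s = 1 / 3`: `4 / 27 - s (1 - s) ^ 2 = (4 / 3 - s) (s - 1 / 3) ^ 2`.
  have : s * (1 - s) ^ 2 ≤ 4 / 27 := by nlinarith [mul_nonneg (show 0 ≤ 4 / 3 - s by linarith) (sq_nonneg (s - 1 / 3))]
  nlinarith

theorem cutConst₁_le {m : ℕ} {s e F c : ℝ} (hs : 0 ≤ s) (hs1 : s ≤ 1)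
    (he : ((1 - s) * s) ^ m ≤ e) (hF : s * (s * gratio m) ≤ F) (hF1 : F < 1)
    (hc : 1 + e ≤ c * (1 - F) ^ 2) : cutConst₁ m s s ≤ c := by
  have hg := gratio_pos m
  have h0 : 0 ≤ ((1 - s) * s) ^ m := pow_nonneg (mul_nonneg (by linarith) hs) _
  have hF0 : 0 ≤ s * (s * gratio m) := by positivity
  have h1 : 0 < 1 - s ^ 2 * gratio m := by nlinarith
  have hc0 : 0 ≤ c := by
    by_contra! h
    nlinarith [sq_nonneg (1 - F)]
  rw [cutConst₁, div_le_iff₀ (by positivity)]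
  have h2 : (1 - F) ^ 2 ≤ (1 - s ^ 2 * gratio m) ^ 2 := by
    have : 0 ≤ 1 - F := by linarith
    gcongr
    nlinarith
  nlinarith

theorem numeric_finish {m : ℕ} {s c X : ℝ} (hs : 0 ≤ s) (hc : cutConst₁ m s s ≤ c)
    (hg1 : s * gratio m < 1) (h : (1 - s) * (1 + X) ≤ (2 - c * s) * (1 - gratio m * s) ^ 2) :
    (1 - s) * ((1 + X) / (1 - s * gratio m) ^ 2) + s * cutConst₁ m s s ≤ 2 := by
  have h1 : (0 : ℝ) < (1 - s * gratio m) ^ 2 := by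
    have : 0 < 1 - s * gratio m := by linarith
    positivity
  have h2 : (1 - s) * ((1 + X) / (1 - s * gratio m) ^ 2) ≤ 2 - c * s := by
    rw [mul_div_assoc', div_le_iff₀ h1, mul_comm s]; exact h
  have h3 : s * cutConst₁ m s s ≤ s * c := by gcongr
  linarith

/-- The decimals 6.2832 here and 6.283 in `gratio_le` lie on either side of `2 π`. -/
theorem gratio_ge {m : ℕ} {L : ℝ} (hm : 0 < m) (hL : 6.2832 * L ^ 2 ≤ m) : L ≤ gratio m := by
  have h1 := le_gratio_sq hm
  have hg := gratio_pos m
  have hpi := Real.pi_lt_d4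
  by_contra! h
  have : gratio m ^ 2 < L ^ 2 := by gcongr
  nlinarith [sq_nonneg (gratio m)]

theorem gratio_le {m : ℕ} {G : ℝ} (hm : 0 < m) (hG0 : 0 ≤ G) (hG : m + 1 ≤ 6.283 * G ^ 2) :
    gratio m ≤ G := by
  have h1 := gratio_sq_le hm
  have hpi := Real.pi_gt_d4
  by_contra! h
  have : G ^ 2 < gratio m ^ 2 := by gcongr
  nlinarith [sq_nonneg G]

/-- As `s` grows, `3 s g` increases and `(1 - s) ^ 2` decreases, so a failure of the inequality at
`S`, already with the lower bound `L` of `g`, excludes `s > S`. -/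
theorem rate_le_of {g s S L : ℝ} (hL : L ≤ g) (hs1 : s ≤ 1) (hy : 3 * (s * g) ≤ (1 - s) ^ 2)
    (hL0 : 0 ≤ L) (hS : (1 - S) ^ 2 < 3 * (S * L)) (hS0 : 0 ≤ S) : s ≤ S := by
  by_contra! h
  have h1 : (1 - s) ^ 2 ≤ (1 - S) ^ 2 := by
    have : 0 ≤ 1 - s := by linarith
    gcongr
  have h2 : S * L ≤ s * g := mul_le_mul h.le hL hL0 (hS0.trans h.le)
  linarith

/-- Reduces one dimension to a polynomial inequality on `[0, S]`: `L` and `G` enclose `gratio m`,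
`S` bounds `s`, and `c` bounds the constant of the smaller scales. The minimum in `cutConst₀` is
estimated by its second entry. -/
theorem numeric_refined {m : ℕ} (hm : 0 < m) {s S L G c : ℝ} (hs : 0 ≤ s) (hs1 : s ≤ 1)
    (hy : 3 * (s * gratio m) ≤ (1 - s) ^ 2) (hL0 : 0 ≤ L) (hL : 6.2832 * L ^ 2 ≤ m) (hG0 : 0 ≤ G)
    (hG : m + 1 ≤ 6.283 * G ^ 2) (hS0 : 0 ≤ S) (hS : (1 - S) ^ 2 < 3 * (S * L)) (hGS : G * S ≤ 1)
    (hc : cutConst₁ m s s ≤ c) (hcS : c * S ≤ 2) (hc0 : 0 ≤ c)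
    (h : s ≤ S → (1 - s) * (1 + (1 - s) ^ (m + 1) * G) ≤ (2 - c * s) * (1 - G * s) ^ 2) :
    (1 - s) * cutConst₀ m s s + s * cutConst₁ m s s ≤ 2 := by
  have hgL := gratio_ge hm hL
  have hgG := gratio_le hm hG0 hG
  have hg := gratio_pos m
  have hsS := rate_le_of hgL hs1 hy hL0 hS hS0
  have h1s : 0 ≤ 1 - s := by linarith
  have hGs : G * s ≤ 1 := (mul_le_mul_of_nonneg_left hsS hG0).trans hGS
  have hcs : 0 ≤ 2 - c * s := by
    have := mul_le_mul_of_nonneg_left hsS hc0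
    linarith
  have hy1 : s * gratio m < 1 := by nlinarith
  refine numeric_finish hs hc hy1 ?_
  have h2 : (1 - s) ^ m * min 1 (gratio m * (1 - s)) ≤ (1 - s) ^ (m + 1) * G := by
    calc _ ≤ (1 - s) ^ m * (gratio m * (1 - s)) := by
          gcongr
          exact min_le_right _ _
      _ ≤ (1 - s) ^ m * (G * (1 - s)) := by gcongr
      _ = _ := by ring
  have h3 : (1 - G * s) ^ 2 ≤ (1 - gratio m * s) ^ 2 := by
    have : 0 ≤ 1 - G * s := by linarith
    gcongr
  calc _ ≤ (1 - s) * (1 + (1 - s) ^ (m + 1) * G) := by gcongr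
    _ ≤ _ := h hsS
    _ ≤ _ := by gcongr

/-- The same reduction with the minimum in `cutConst₀` estimated by 1. -/
theorem numeric_plain {m : ℕ} (hm : 0 < m) {s S L G c : ℝ} (hs : 0 ≤ s) (hs1 : s ≤ 1)
    (hy : 3 * (s * gratio m) ≤ (1 - s) ^ 2) (hL0 : 0 ≤ L) (hL : 6.2832 * L ^ 2 ≤ m) (hG0 : 0 ≤ G)
    (hG : m + 1 ≤ 6.283 * G ^ 2) (hS0 : 0 ≤ S) (hS : (1 - S) ^ 2 < 3 * (S * L)) (hGS : G * S ≤ 1)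
    (hc : s ≤ S → cutConst₁ m s s ≤ c) (hcS : c * S ≤ 2) (hc0 : 0 ≤ c)
    (h : s ≤ S → (1 - s) * (1 + (1 - s) ^ m) ≤ (2 - c * s) * (1 - G * s) ^ 2) :
    (1 - s) * cutConst₀ m s s + s * cutConst₁ m s s ≤ 2 := by
  have hgL := gratio_ge hm hL
  have hgG := gratio_le hm hG0 hG
  have hg := gratio_pos m
  have hsS := rate_le_of hgL hs1 hy hL0 hS hS0
  have h1s : 0 ≤ 1 - s := by linarith
  have hGs : G * s ≤ 1 := (mul_le_mul_of_nonneg_left hsS hG0).trans hGS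
  have hcs : 0 ≤ 2 - c * s := by
    have := mul_le_mul_of_nonneg_left hsS hc0
    linarith
  have hy1 : s * gratio m < 1 := by nlinarith
  refine numeric_finish hs (hc hsS) hy1 ?_
  have h2 : (1 - s) ^ m * min 1 (gratio m * (1 - s)) ≤ (1 - s) ^ m :=
    mul_le_of_le_one_right (by positivity) (min_le_left _ _)
  have h3 : (1 - G * s) ^ 2 ≤ (1 - gratio m * s) ^ 2 := by
    have : 0 ≤ 1 - G * s := by linarith
    gcongr
  calc _ ≤ (1 - s) * (1 + (1 - s) ^ m) := by gcongr
    _ ≤ _ := h hsS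
    _ ≤ _ := by gcongr

/-- From `2 π gratio ^ 2 ≤ m + 1` one gets `(m s) ^ 2 ≥ 6.283 a ^ 2 m ^ 2 / (m + 1)`, and `m ^ 2 /
(m + 1)` increases with `m`. -/
theorem numeric_interval {m m₀ : ℕ} (hm : 0 < m) (hm0 : m₀ ≤ m) {s a z : ℝ} (hs : 0 ≤ s) (ha : 0 ≤ a)
    (hay : a ≤ s * gratio m) (hz : z ^ 2 * (m₀ + 1) ≤ a ^ 2 * 6.283 * m₀ ^ 2) : z ≤ m * s := by
  have h1 := gratio_sq_le hm
  have hg := gratio_pos m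
  have hpi := Real.pi_gt_d4
  have hm0' : (m₀ : ℝ) ≤ m := by exact_mod_cast hm0
  have hms : 0 ≤ m * s := by positivity
  refine le_of_sq_le_sq ?_ hms
  have h2 : a ^ 2 ≤ (s * gratio m) ^ 2 := by gcongr
  have h3 : a ^ 2 * 6.283 ≤ s ^ 2 * (m + 1) := by
    calc a ^ 2 * 6.283 ≤ (s * gratio m) ^ 2 * (2 * Real.pi) := by gcongr; linarith
      _ = s ^ 2 * (2 * Real.pi * gratio m ^ 2) := by ring
      _ ≤ _ := by gcongr
  have h4 : (m₀ : ℝ) ^ 2 * (m + 1) ≤ m ^ 2 * (m₀ + 1) := by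
    have : 0 ≤ (m : ℝ) - m₀ := by linarith
    have : 0 ≤ ((m : ℝ) - m₀) * (m * m₀ + m + m₀) := by positivity
    nlinarith
  have h5 : z ^ 2 * (m₀ + 1) * (m + 1) ≤ (m * s) ^ 2 * (m₀ + 1) * (m + 1) := by
    calc z ^ 2 * (m₀ + 1) * (m + 1) ≤ a ^ 2 * 6.283 * m₀ ^ 2 * (m + 1) := by gcongr
      _ = a ^ 2 * 6.283 * (m₀ ^ 2 * (m + 1)) := by ring
      _ ≤ s ^ 2 * (m + 1) * (m ^ 2 * (m₀ + 1)) := by gcongr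
      _ = _ := by ring
  exact le_of_mul_le_mul_right (le_of_mul_le_mul_right h5 (by positivity)) (by positivity)

/-- If `s * gratio m` is at least `a`, then `1 - s ≥ √(3 a) ≥ r`. So `s` is small and `gratio m` is
at least `a / (1 - r)`, which forces a large dimension. -/
theorem dim_ge_of {m m₀ : ℕ} (hm : 0 < m) {s a r : ℝ} (hs1 : s ≤ 1) (ha : 0 ≤ a)
    (hy : 3 * (s * gratio m) ≤ (1 - s) ^ 2) (hay : a ≤ s * gratio m) (hr : r ^ 2 ≤ 3 * a)
    (hm0 : m₀ * (1 - r) ^ 2 < 6.283 * a ^ 2) (hr1 : r < 1) : m₀ ≤ m := by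
  have hg := gratio_pos m
  have h1 := gratio_sq_le hm
  have hpi := Real.pi_gt_d4
  have hsr : s ≤ 1 - r := by
    have : r ≤ 1 - s := le_of_sq_le_sq (by linarith) (by linarith)
    linarith
  have h2 : a ^ 2 ≤ (1 - r) ^ 2 * gratio m ^ 2 := by
    rw [← mul_pow]
    have : a ≤ (1 - r) * gratio m := hay.trans (by gcongr)
    gcongr
  have h3 : (m₀ : ℝ) * (1 - r) ^ 2 < (m + 1) * (1 - r) ^ 2 := by
    calc _ < 6.283 * a ^ 2 := hm0
      _ ≤ 6.283 * ((1 - r) ^ 2 * gratio m ^ 2) := by gcongr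
      _ ≤ 2 * Real.pi * ((1 - r) ^ 2 * gratio m ^ 2) := by gcongr; linarith
      _ = (2 * Real.pi * gratio m ^ 2) * (1 - r) ^ 2 := by ring
      _ ≤ _ := by gcongr
  have h4 : (m₀ : ℝ) < m + 1 := lt_of_mul_lt_mul_right h3 (by positivity)
  have : m₀ < m + 1 := by exact_mod_cast h4
  omega

theorem cutConst₁_le_small {m k : ℕ} {s c : ℝ} (hs : 0 ≤ s) (hs1 : s ≤ 1)
    (hy : 3 * (s * gratio m) ≤ (1 - s) ^ 2) (hk : k ≤ m)
    (hc : 1 + (1 / 4 : ℝ) ^ k ≤ c * (77 / 81) ^ 2) : cutConst₁ m s s ≤ c := by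
  refine cutConst₁_le hs hs1 ?_ (mul_rate_le hs hs1 hy) (by norm_num) (e := (1 / 4) ^ k) ?_
  · have h0 : 0 ≤ (1 - s) * s := mul_nonneg (by linarith) hs
    have h1 : (1 - s) * s ≤ 1 / 4 := by nlinarith [sq_nonneg (s - 1 / 2)]
    calc ((1 - s) * s) ^ m ≤ ((1 - s) * s) ^ k :=
          pow_le_pow_of_le_one h0 (by linarith) hk
      _ ≤ _ := by gcongr
  · norm_num at hc ⊢; linarith

theorem cutConst₁_le_of_six {m : ℕ} {s : ℝ} (hs : 0 ≤ s) (hs1 : s ≤ 43 / 200)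
    (hy : 3 * (s * gratio m) ≤ (1 - s) ^ 2) (hm : 6 ≤ m) : cutConst₁ m s s ≤ 11 / 10 := by
  refine cutConst₁_le hs (by linarith) (e := (1 / 4) ^ 6) (F := 89 / 2000) ?_ ?_ (by norm_num)
    (by norm_num)
  · have h0 : 0 ≤ (1 - s) * s := mul_nonneg (by linarith) hs
    have h1 : (1 - s) * s ≤ 1 / 4 := by nlinarith [sq_nonneg (s - 1 / 2)]
    calc ((1 - s) * s) ^ m ≤ ((1 - s) * s) ^ 6 := pow_le_pow_of_le_one h0 (by linarith) hm
      _ ≤ _ := by gcongr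
  · have h1 : s * (1 - s) ^ 2 ≤ 43 / 200 * (1 - 43 / 200) ^ 2 := by
      nlinarith [mul_nonneg hs (sub_nonneg.2 hs1), mul_nonneg hs (mul_nonneg hs (sub_nonneg.2 hs1))]
    nlinarith

/-- For `s * gratio m ≤ b` it suffices that `(1 - s) ^ m ≤ 2 (1 - b) ^ 2 - 1`, which the exponential
bound gives once `m s ≥ z`. This needs `b` below `1 - 1 / √2`. -/
theorem numeric_pow_interval {m : ℕ} {s b z : ℝ} (hs : 0 ≤ s) (hs1 : s ≤ 1)
    (hb : s * gratio m ≤ b) (hb1 : b < 1) (hz0 : 0 ≤ z) (hz : z ≤ m * s) (hc : cutConst₁ m s s ≤ 2)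
    (h : 1 ≤ (2 * (1 - b) ^ 2 - 1) * (1 + z + z ^ 2 / 2 + z ^ 3 / 6 + z ^ 4 / 24)) :
    (1 - s) * cutConst₀ m s s + s * cutConst₁ m s s ≤ 2 := by
  have h1 := one_sub_pow_le hs1 hz0 hz
  have hP : 0 < 1 + z + z ^ 2 / 2 + z ^ 3 / 6 + z ^ 4 / 24 := by positivity
  have h2 : (1 - s) ^ m ≤ 2 * (1 - b) ^ 2 - 1 :=
    le_of_mul_le_mul_right (h1.trans h) hP
  have h1s : 0 ≤ 1 - s := by linarith
  refine numeric_finish hs hc (by linarith) ?_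
  have h3 : (1 - s) ^ m * min 1 (gratio m * (1 - s)) ≤ (1 - s) ^ m :=
    mul_le_of_le_one_right (by positivity) (min_le_left _ _)
  have h4 : (1 - b) ^ 2 ≤ (1 - gratio m * s) ^ 2 := by
    have : 0 ≤ 1 - b := by linarith
    gcongr
    linarith
  calc _ ≤ (1 - s) * (1 + (1 - s) ^ m) := by gcongr
    _ ≤ (1 - s) * (2 * (1 - b) ^ 2) := by gcongr; linarith
    _ ≤ (1 - s) * (2 * (1 - gratio m * s) ^ 2) := by gcongr
    _ = _ := by ring

theorem exp_parab_le : Real.exp (1 + Real.pi / 9) / 2 ≤ 1.9272 := by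
  have hpi := Real.pi_lt_d4
  have h1 : Real.exp 1 ≤ 2.7182818286 := Real.exp_one_lt_d9.le
  have h2 : Real.exp (Real.pi / 9) ≤ 1.4179 := by
    have hle : Real.pi / 9 ≤ 0.34907 := by linarith
    refine (Real.exp_le_exp.2 hle).trans ?_
    have := Real.exp_bound' (x := 0.34907) (by norm_num) (by norm_num) (n := 5) (by norm_num)
    refine this.trans ?_
    norm_num [Finset.sum_range_succ, Nat.factorial]
  rw [Real.exp_add]
  have h3 : 0 < Real.exp (Real.pi / 9) := Real.exp_pos _
  nlinarith

/-- Writing the factors as exponentials bounds twice the constant by `exp (1 + s ^ 2 (m + 2) / 2)`.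
Since `m ≤ 2 π gratio ^ 2` and `s * gratio m ≤ (1 - s) ^ 2 / 3`, the exponent is at most `1 + π /
9`. -/
theorem parabConst_le {m : ℕ} (hm : 0 < m) {s : ℝ} (hs : 0 ≤ s) (hs1 : s ≤ 1 / 5)
    (hy : 3 * (s * gratio m) ≤ (1 - s) ^ 2) : parabConst m s ≤ 1.9272 := by
  have hm' : (0 : ℝ) < m := by exact_mod_cast hm
  have hpi := Real.pi_gt_d4
  have hpi' := Real.pi_lt_d4
  refine le_trans ?_ exp_parab_le
  rw [parabConst]
  refine div_le_div_of_nonneg_right ?_ zero_le_two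
  set β : ℝ := (m + 4) / m * (m / (m + 2) + s ^ 2) with hβ
  have hβ1 : β ≤ Real.exp (2 / (m + 2) + s ^ 2 * (m + 2) / m) := by
    have e : β = (1 + 2 / (m + 2)) * (1 + s ^ 2 * (m + 2) / m) := by
      rw [hβ]; field_simp; ring
    rw [e, Real.exp_add]
    have h1 := Real.add_one_le_exp (2 / ((m : ℝ) + 2))
    have h2 := Real.add_one_le_exp (s ^ 2 * ((m : ℝ) + 2) / m)
    have h3 : 0 ≤ 2 / ((m : ℝ) + 2) := by positivity
    have h4 : 0 ≤ s ^ 2 * ((m : ℝ) + 2) / m := by positivity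
    exact mul_le_mul (by linarith) (by linarith) (by linarith) (by linarith)
  have h5 : √β ^ m ≤ Real.exp (m / (m + 2) + s ^ 2 * (m + 2) / 2) := by
    have : √β ≤ Real.exp ((2 / (m + 2) + s ^ 2 * (m + 2) / m) / 2) := by
      rw [Real.sqrt_le_left (Real.exp_pos _).le, ← Real.exp_nat_mul]
      refine hβ1.trans (le_of_eq ?_)
      congr 1; push_cast; ring
    calc √β ^ m ≤ Real.exp ((2 / (m + 2) + s ^ 2 * (m + 2) / m) / 2) ^ m := by gcongr
      _ = _ := by
        rw [← Real.exp_nat_mul]; congr 1; field_simp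
  have h6 : ((m : ℝ) + 4) / (m + 2) ≤ Real.exp (2 / (m + 2)) := by
    have := Real.add_one_le_exp (2 / ((m : ℝ) + 2))
    refine le_trans (le_of_eq ?_) this
    field_simp; ring
  calc √β ^ m * ((m + 4) / (m + 2))
      ≤ Real.exp (m / (m + 2) + s ^ 2 * (m + 2) / 2) * Real.exp (2 / (m + 2)) := by gcongr
    _ = Real.exp (1 + s ^ 2 * (m + 2) / 2) := by
        rw [← Real.exp_add]; congr 1; field_simp; ring
    _ ≤ _ := by
        refine Real.exp_le_exp.2 ?_
        have h7 := le_gratio_sq hm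
        have h8 : s ^ 2 * m ≤ 2 * Real.pi * (s * gratio m) ^ 2 := by
          calc s ^ 2 * m ≤ s ^ 2 * (2 * Real.pi * gratio m ^ 2) := by gcongr
            _ = _ := by ring
        have hg := gratio_pos m
        have h9 : (s * gratio m) ^ 2 ≤ ((1 - s) ^ 2 / 3) ^ 2 := by
          have : s * gratio m ≤ (1 - s) ^ 2 / 3 := by linarith
          gcongr
        have h10 : Real.pi * (s * gratio m) ^ 2 ≤ Real.pi * ((1 - s) ^ 2 / 3) ^ 2 := by gcongr
        have h11 : Real.pi * (1 - (1 - s) ^ 4) / 9 ≥ s ^ 2 := by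
          have : 1 - (1 - s) ^ 4 ≥ 3 * s ^ 2 := by
            have : (1 - s) ^ 4 ≤ (1 - s) ^ 2 := pow_le_pow_of_le_one (by linarith) (by linarith) (by norm_num)
            nlinarith
          nlinarith [sq_nonneg s]
        nlinarith

/-- With `y = s * gratio m`, which is at most `1 / 3`, the overlap constant at the largest scale is
at least `1 / (1 - y) ^ 2`. This can be as large as `9 / 4` when `y` is near `1 / 3`, so a second
kernel is needed. That range of `y` occurs only in high dimension, where the parabolic constant
stays below 2. -/
theorem numeric_cut {m : ℕ} (hm : 0 < m) {s : ℝ} (hs : 0 ≤ s) (hs1 : s ≤ 1)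
    (hy : 3 * (s * gratio m) ≤ (1 - s) ^ 2) :
    cutConst₁ m s s ≤ 2 ∧ ((1 - s) * cutConst₀ m s s + s * cutConst₁ m s s ≤ 2 ∨
      (1 - s) * cutConst₀' m s s + s * cutConst₁ m s s ≤ 2) := by
  have hc2 : cutConst₁ m s s ≤ 2 := cutConst₁_le_small hs hs1 hy hm (by norm_num)
  refine ⟨hc2, ?_⟩
  have hg := gratio_pos m
  -- Products of this kind are the Bernstein basis on `[0, S]`; each polynomial inequality below is
  -- a nonnegative combination of them.
  have hS : ∀ S : ℝ, s ≤ S → ∀ i j : ℕ, 0 ≤ s ^ i * (S - s) ^ j := fun S hS i j => by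
    have : 0 ≤ S - s := by linarith
    positivity
  rcases lt_or_ge m 12 with h12 | h12
  · left
    have h6 : 6 ≤ m → ∀ S : ℝ, S ≤ 43 / 200 → s ≤ S → cutConst₁ m s s ≤ 11 / 10 := fun h S h1 h2 =>
      cutConst₁_le_of_six hs (h2.trans h1) hy h
    interval_cases m
    · refine numeric_refined hm hs hs1 hy (S := 0.352) (L := 0.398) (G := 0.5642) (c := 1.4)
        (by norm_num) (by norm_num) (by norm_num) (by norm_num) (by norm_num) (by norm_num)
        (by norm_num) (cutConst₁_le_small hs hs1 hy le_rfl (by norm_num)) (by norm_num)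
        (by norm_num) fun hsS => ?_
      have h := hS _ hsS
      linarith [h 0 3, h 1 2, h 2 1, h 3 0]
    · refine numeric_refined hm hs hs1 hy (S := 0.295) (L := 0.564) (G := 0.691) (c := 1.2)
        (by norm_num) (by norm_num) (by norm_num) (by norm_num) (by norm_num) (by norm_num)
        (by norm_num) (cutConst₁_le_small hs hs1 hy le_rfl (by norm_num)) (by norm_num)
        (by norm_num) fun hsS => ?_
      have h := hS _ hsS
      linarith [h 0 4, h 1 3, h 2 2, h 3 1, h 4 0]
    · refine numeric_refined hm hs hs1 hy (S := 0.263) (L := 0.690) (G := 0.798) (c := 1.2)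
        (by norm_num) (by norm_num) (by norm_num) (by norm_num) (by norm_num) (by norm_num)
        (by norm_num) (cutConst₁_le_small hs hs1 hy (k := 2) (by norm_num) (by norm_num)) (by norm_num)
        (by norm_num) fun hsS => ?_
      have h := hS _ hsS
      linarith [h 0 5, h 1 4, h 2 3, h 3 2, h 4 1, h 5 0]
    · refine numeric_refined hm hs hs1 hy (S := 0.241) (L := 0.797) (G := 0.8921) (c := 1.2)
        (by norm_num) (by norm_num) (by norm_num) (by norm_num) (by norm_num) (by norm_num)
        (by norm_num) (cutConst₁_le_small hs hs1 hy (k := 2) (by norm_num) (by norm_num)) (by norm_num)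
        (by norm_num) fun hsS => ?_
      have h := hS _ hsS
      linarith [h 0 6, h 1 5, h 2 4, h 3 3, h 4 2, h 5 1, h 6 0]
    · refine numeric_refined hm hs hs1 hy (S := 0.225) (L := 0.892) (G := 0.9773) (c := 1.2)
        (by norm_num) (by norm_num) (by norm_num) (by norm_num) (by norm_num) (by norm_num)
        (by norm_num) (cutConst₁_le_small hs hs1 hy (k := 2) (by norm_num) (by norm_num)) (by norm_num)
        (by norm_num) fun hsS => ?_
      have h := hS _ hsS
      linarith [h 0 7, h 1 6, h 2 5, h 3 4, h 4 3, h 5 2, h 6 1, h 7 0]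
    · refine numeric_plain hm hs hs1 hy (S := 0.213) (L := 0.977) (G := 1.0556) (c := 11 / 10)
        (by norm_num) (by norm_num) (by norm_num) (by norm_num) (by norm_num) (by norm_num)
        (by norm_num) (h6 le_rfl _ (by norm_num)) (by norm_num)
        (by norm_num) fun hsS => ?_
      have h := hS _ hsS
      linarith [h 1 6, h 2 5, h 3 4, h 4 3, h 5 2, h 6 1, h 7 0]
    · refine numeric_plain hm hs hs1 hy (S := 0.203) (L := 1.055) (G := 1.1284) (c := 11 / 10)
        (by norm_num) (by norm_num) (by norm_num) (by norm_num) (by norm_num) (by norm_num)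
        (by norm_num) (h6 (by norm_num) _ (by norm_num)) (by norm_num)
        (by norm_num) fun hsS => ?_
      have h := hS _ hsS
      linarith [h 1 7, h 2 6, h 3 5, h 4 4, h 5 3, h 6 2, h 7 1, h 8 0]
    · refine numeric_plain hm hs hs1 hy (S := 0.194) (L := 1.128) (G := 1.197) (c := 11 / 10)
        (by norm_num) (by norm_num) (by norm_num) (by norm_num) (by norm_num) (by norm_num)
        (by norm_num) (h6 (by norm_num) _ (by norm_num)) (by norm_num)
        (by norm_num) fun hsS => ?_
      have h := hS _ hsS
      linarith [h 1 8, h 2 7, h 3 6, h 4 5, h 5 4, h 6 3, h 7 2, h 8 1, h 9 0]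
    · refine numeric_plain hm hs hs1 hy (S := 0.186) (L := 1.196) (G := 1.2617) (c := 11 / 10)
        (by norm_num) (by norm_num) (by norm_num) (by norm_num) (by norm_num) (by norm_num)
        (by norm_num) (h6 (by norm_num) _ (by norm_num)) (by norm_num)
        (by norm_num) fun hsS => ?_
      have h := hS _ hsS
      linarith [h 1 9, h 2 8, h 3 7, h 4 6, h 5 5, h 6 4, h 7 3, h 8 2, h 9 1, h 10 0]
    · refine numeric_plain hm hs hs1 hy (S := 0.18) (L := 1.261) (G := 1.3233) (c := 11 / 10)
        (by norm_num) (by norm_num) (by norm_num) (by norm_num) (by norm_num) (by norm_num)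
        (by norm_num) (h6 (by norm_num) _ (by norm_num)) (by norm_num)
        (by norm_num) fun hsS => ?_
      have h := hS _ hsS
      linarith [h 1 10, h 2 9, h 3 8, h 4 7, h 5 6, h 6 5, h 7 4, h 8 3, h 9 2, h 10 1, h 11 0]
    · refine numeric_plain hm hs hs1 hy (S := 0.174) (L := 1.323) (G := 1.3821) (c := 11 / 10)
        (by norm_num) (by norm_num) (by norm_num) (by norm_num) (by norm_num) (by norm_num)
        (by norm_num) (h6 (by norm_num) _ (by norm_num)) (by norm_num)
        (by norm_num) fun hsS => ?_
      have h := hS _ hsS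
      linarith [h 1 11, h 2 10, h 3 9, h 4 8, h 5 7, h 6 6, h 7 5, h 8 4, h 9 3, h 10 2, h 11 1,
        h 12 0]
  · have hy0 : 0 ≤ s * gratio m := by positivity
    rcases le_or_gt (s * gratio m) (1 / 5) with c1 | c1
    · left
      -- 8.34 is just below `√(6.283 * 12 ^ 2 / 13)`.
      have hz := numeric_interval hm h12 hs hy0 le_rfl (z := 8.34 * (s * gratio m))
        (by norm_num; nlinarith [sq_nonneg (s * gratio m)])
      refine numeric_pow_interval hs hs1 le_rfl (by linarith) (by positivity) hz hc2 ?_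
      have h := fun i j : ℕ => show 0 ≤ (s * gratio m) ^ i * (1 / 5 - s * gratio m) ^ j by
        have : 0 ≤ 1 / 5 - s * gratio m := by linarith
        positivity
      generalize s * gratio m = y at *
      linarith [h 1 5, h 2 4, h 3 3, h 4 2, h 5 1, h 6 0]
    rcases le_or_gt (s * gratio m) 0.22 with c2 | c2
    · left
      exact numeric_pow_interval hs hs1 c2 (by norm_num) (by norm_num)
        (numeric_interval hm h12 hs (by norm_num) c1.le (z := 1.66) (by norm_num)) hc2 (by norm_num)
    rcases le_or_gt (s * gratio m) 0.235 with c3 | c3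
    · left
      exact numeric_pow_interval hs hs1 c3 (by norm_num) (by norm_num)
        (numeric_interval hm h12 hs (by norm_num) c2.le (z := 1.83) (by norm_num)) hc2 (by norm_num)
    have h12' : 13 ≤ m := dim_ge_of hm hs1 (by norm_num) hy c3.le (r := 0.8396) (by norm_num)
      (by norm_num) (by norm_num)
    rcases le_or_gt (s * gratio m) 0.245 with c4 | c4
    · left
      exact numeric_pow_interval hs hs1 c4 (by norm_num) (by norm_num)
        (numeric_interval hm h12' hs (by norm_num) c3.le (z := 2.046) (by norm_num)) hc2 (by norm_num)
    have h18 : 18 ≤ m := dim_ge_of hm hs1 (by norm_num) hy c4.le (r := 0.8573) (by norm_num)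
      (by norm_num) (by norm_num)
    rcases le_or_gt (s * gratio m) 0.255 with c5 | c5
    · left
      exact numeric_pow_interval hs hs1 c5 (by norm_num) (by norm_num)
        (numeric_interval hm h18 hs (by norm_num) c4.le (z := 2.53) (by norm_num)) hc2 (by norm_num)
    have h24 : 24 ≤ m := dim_ge_of hm hs1 (by norm_num) hy c5.le (r := 0.8746) (by norm_num)
      (by norm_num) (by norm_num)
    rcases le_or_gt (s * gratio m) 0.265 with c6 | c6
    · left
      exact numeric_pow_interval hs hs1 c6 (by norm_num) (by norm_num)
        (numeric_interval hm h24 hs (by norm_num) c5.le (z := 3.06) (by norm_num)) hc2 (by norm_num)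
    have h36 : 36 ≤ m := dim_ge_of hm hs1 (by norm_num) hy c6.le (r := 0.8916) (by norm_num)
      (by norm_num) (by norm_num)
    rcases le_or_gt (s * gratio m) 0.275 with c7 | c7
    · left
      exact numeric_pow_interval hs hs1 c7 (by norm_num) (by norm_num)
        (numeric_interval hm h36 hs (by norm_num) c6.le (z := 3.93) (by norm_num)) hc2 (by norm_num)
    have h55 : 55 ≤ m := dim_ge_of hm hs1 (by norm_num) hy c7.le (r := 0.9082) (by norm_num)
      (by norm_num) (by norm_num)
    rcases le_or_gt (s * gratio m) 0.28 with c8 | c8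
    · left
      exact numeric_pow_interval hs hs1 c8 (by norm_num) (by norm_num)
        (numeric_interval hm h55 hs (by norm_num) c7.le (z := 5.06) (by norm_num)) hc2 (by norm_num)
    -- Here `s * gratio m > 0.28`: the dimension is at least 69, `(1 - s) ^ m` is negligible, and
    -- the parabolic kernel takes over.
    right
    have h69 : 69 ≤ m := dim_ge_of hm hs1 (by norm_num) hy c8.le (r := 0.9165) (by norm_num)
      (by norm_num) (by norm_num)
    have hs5 : s ≤ 1 / 5 := by
      have : (0.9 : ℝ) ≤ 1 - s := le_of_sq_le_sq (by norm_num; linarith) (by linarith)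
      linarith
    have hE := one_sub_pow_le hs1 (by norm_num)
      (numeric_interval hm h69 hs (by norm_num) c8.le (z := 5.78) (by norm_num))
    have hE' : (1 - s) ^ m ≤ 0.02 := by
      norm_num at hE ⊢
      linarith
    have hC := parabConst_le hm hs hs5 hy
    have h11 := cutConst₁_le_of_six hs (by linarith) hy (by omega)
    have hC0 : 0 ≤ parabConst m s := by unfold parabConst; positivity
    have h1 : cutConst₀' m s s ≤ 1.97 := by
      rw [cutConst₀']
      nlinarith
    have h1s : 0 ≤ 1 - s := by linarith
    nlinarith

/-! ### The cost of the cuts at each scale. -/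

/-- Young's inequality `R ^ α ρ ^ (m - α) ≤ (α / m) R ^ m + (1 - α / m) ρ ^ m`. It brings the given
mass bound into the form of a multiple of the volume plus a constant, as the comparison lemmas
require. -/
theorem volume_le_young {m : ℕ} (hm : 0 < m) {α lam q t R ρ : ℝ} (hα : 0 < α) (hα1 : α ≤ 1)
    (hlam : 0 ≤ lam) (ht : 0 ≤ t) (hR : 0 < R) (hρ : 0 < ρ) (hq : q = t * R / ρ) :
    lam / 2 * q ^ α * (gam m * ρ ^ m) ≤
      lam / 2 * t ^ α * (gam m * (α / m * R ^ m + (1 - α / m) * ρ ^ m)) := by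
  have hm' : (1 : ℝ) ≤ m := by exact_mod_cast hm
  have hγ := gam_pos m
  have ha : 0 ≤ α / m := by positivity
  have ha1 : α / m ≤ 1 := by rw [div_le_one (by positivity)]; linarith
  have hy := Real.geom_mean_le_arith_mean2_weighted ha (sub_nonneg.2 ha1)
    (show 0 ≤ R ^ m by positivity) (show 0 ≤ ρ ^ m by positivity) (by ring)
  have e1 : (R ^ m) ^ (α / m) = R ^ α := by
    rw [← Real.rpow_natCast, ← Real.rpow_mul hR.le]; congr 1; field_simp
  have e2 : (ρ ^ m) ^ (1 - α / m) = ρ ^ m / ρ ^ α := by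
    rw [← Real.rpow_natCast, ← Real.rpow_mul hρ.le, ← Real.rpow_sub hρ]; congr 1; field_simp
  rw [e1, e2] at hy
  have e3 : q ^ α = t ^ α * R ^ α / ρ ^ α := by
    rw [hq, Real.div_rpow (by positivity) hρ.le, Real.mul_rpow ht hR.le]
  have h0 : 0 ≤ lam / 2 * t ^ α * gam m := by
    have := Real.rpow_nonneg ht α
    positivity
  calc _ = lam / 2 * t ^ α * gam m * (R ^ α * (ρ ^ m / ρ ^ α)) := by rw [e3]; ring
    _ ≤ lam / 2 * t ^ α * gam m * (α / m * R ^ m + (1 - α / m) * ρ ^ m) := by gcongr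
    _ = _ := by ring

/-- Bound on the mass of small balls at the largest scale. -/
theorem cut_mass_top {m : ℕ} {M : Set (Euc m)} {τ : Measure (Euc m)} {s lam α R : ℝ} (hs1 : s < 1) (hlam : 0 < lam) (hα : 0 < α)
    (hR : 0 < R) {b : ℝ} (hbR : R ≤ b)
    (hτ : ∀ v ∈ M, ∀ ρ, (1 - s) * R ≤ ρ → ρ ≤ b → τ (Metric.closedBall v ρ) ≤
      ENNReal.ofReal (lam / 2 * ((1 - s) * R / ρ) ^ α * (gam m * ρ ^ m))) (hs : 0 ≤ s)
    (v : Euc m) (hv : v ∈ M) (ρ : ℝ) (hρ : 0 ≤ ρ) (hρ2 : ρ ≤ b) :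
    τ (Metric.closedBall v ρ) ≤ ENNReal.ofReal (lam / 2) * volume (Metric.closedBall v ρ) +
      if ρ < (1 - s) * R then ENNReal.ofReal (lam / 2 * (1 - s) ^ m) *
        ENNReal.ofReal (gam m * R ^ m) else 0 := by
  have hγ := gam_pos m
  have hq0 : 0 < 1 - s := by linarith
  rw [volume_closedBall_eq _ hρ, ← ENNReal.ofReal_mul (by positivity),
    ← ENNReal.ofReal_mul (by positivity)]
  split_ifs with h
  · refine le_add_left ?_
    have h1 : (1 - s) * R ≤ b := by nlinarith
    refine (measure_mono (Metric.closedBall_subset_closedBall h.le)).trans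
      ((hτ v hv _ le_rfl h1).trans (ENNReal.ofReal_le_ofReal ?_))
    rw [div_self (by positivity), Real.one_rpow, mul_pow]
    exact le_of_eq (by ring)
  · rw [add_zero]
    have h := not_lt.1 h
    have hρ0 : 0 < ρ := lt_of_lt_of_le (by positivity) h
    refine (hτ v hv ρ h hρ2).trans (ENNReal.ofReal_le_ofReal ?_)
    have : ((1 - s) * R / ρ) ^ α ≤ 1 := by
      refine Real.rpow_le_one (by positivity) ?_ hα.le
      rwa [div_le_one hρ0]
    calc _ ≤ lam / 2 * 1 * (gam m * ρ ^ m) := by gcongr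
      _ = _ := by ring

section
variable {m : ℕ} {M : Set (Euc m)} {τ : Measure (Euc m)} [IsFiniteMeasure τ]
  {s s' lam α R r : ℝ} {f : Euc m → ℝ≥0∞}

/-- Cost of a cut of thickness `r = s' ^ k * R`, `k ≥ 1`. -/
theorem cut_estimate_succ (hm : 0 < m) (hs1 : s < 1) (hs : 0 ≤ s) (hs' : 0 < s') (hs'1 : s' < 1)
    (hg : s' * gratio m < 1)
    (hlam : 0 < lam) (hα : 0 < α) (hα1 : α ≤ 1) (hR : 0 < R) {k : ℕ} (hk : 1 ≤ k)
    (hr : r = s' ^ k * R) (hf : ∀ x, x ∉ M → f x = 0)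
    (hτ : ∀ v ∈ M, ∀ ρ, (1 - s) * r ≤ ρ → ρ ≤ 2 * R → τ (Metric.closedBall v ρ) ≤
      ENNReal.ofReal (lam / 2 * ((1 - s) * r / ρ) ^ α * (gam m * ρ ^ m))) :
    ∫⁻ u, dil f (s' ^ (k + 1) * R) u ∂τ ≤
      ENNReal.ofReal (lam / 2 * cutConst₁ m s s' * (s' ^ α) ^ k) * ∫⁻ z, dil f R z := by
  have hm' : (1 : ℝ) ≤ m := by exact_mod_cast hm
  have hγ := gam_pos m
  have hgr := gratio_pos m
  -- `t * R` is the smallest radius at which the mass of the cut is controlled.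
  set t := (1 - s) * s' ^ k with ht
  have hq0 : 0 < 1 - s := by linarith
  have ht0 : 0 < t := by positivity
  have htR : (1 - s) * r = t * R := by rw [hr, ht]; ring
  have ht1 : t ≤ 1 := by
    have : s' ^ k ≤ 1 := pow_le_one₀ hs'.le hs'1.le
    rw [ht]; nlinarith
  set a := α / m with ha
  have ha0 : 0 ≤ a := by positivity
  have ha1 : a ≤ 1 := by rw [ha, div_le_one (by positivity)]; linarith
  set P := lam / 2 * t ^ α with hP
  have hP0 : 0 < P := by have := Real.rpow_pos_of_pos ht0 α; positivity
  have h1a : 0 ≤ 1 - a := by linarith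
  -- The volume part and the constant part from Young's inequality. The term with `t ^ m` in `A2`
  -- pays for the balls of radius less than `t * R`, which are enlarged to that radius.
  set A1 := P * (1 - a) with hA1
  set A2 := P * (a + (1 - a) * t ^ m) with hA2
  have hA1n : 0 ≤ A1 := by positivity
  have hA2n : 0 ≤ A2 := by positivity
  have hsum : A1 + A2 = P * (1 + (1 - a) * t ^ m) := by rw [hA1, hA2]; ring
  have hsum0 : 0 < A1 + A2 := by rw [hsum]; positivity
  have hs2 : s' ^ (k + 1) ≤ s' ^ 2 := pow_le_pow_of_le_one hs'.le hs'1.le (by omega)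
  have hs'2 : s' ^ 2 * gratio m < 1 := by nlinarith [mul_pos hs' hgr]
  have key := lintegral_dil_le_overlap hm hf τ (R := R) (d := s' ^ (k + 1) * R)
    -- Beyond every radius in use, so the constant part is always present.
    (ω := 2 * R + 1) (θ := 1)
    hR (a₁ := ENNReal.ofReal A1) (a₂ := ENNReal.ofReal A2) ?_ (by positivity) (min_le_left _ _)
    ?_ ?_
  · have e1 : s' ^ (k + 1) * R * gratio m / R = s' ^ (k + 1) * gratio m := by field_simp
    rw [e1, ENNReal.ofReal_one, mul_one, ← ENNReal.ofReal_add hA1n hA2n] at key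
    set D := (1 - s' ^ 2 * gratio m) ^ 2 with hD
    have hD0 : 0 < D := by
      have : 0 < 1 - s' ^ 2 * gratio m := by linarith
      positivity
    have hDle : D ≤ (1 - s' ^ (k + 1) * gratio m) ^ 2 := by
      have : 0 ≤ 1 - s' ^ 2 * gratio m := by linarith
      rw [hD]
      gcongr
    have h3 : A1 + A2 ≤ D * (lam / 2 * cutConst₁ m s s' * (s' ^ α) ^ k) := by
      have e2 : D * (lam / 2 * cutConst₁ m s s' * (s' ^ α) ^ k) =
          lam / 2 * (s' ^ α) ^ k * (1 + ((1 - s) * s') ^ m) := by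
        rw [cutConst₁, ← hD]; field_simp
      rw [e2, hsum]
      have h4 : P ≤ lam / 2 * (s' ^ α) ^ k := by
        rw [hP]
        gcongr
        rw [ht, Real.mul_rpow hq0.le (by positivity), ← Real.rpow_natCast, ← Real.rpow_mul hs'.le,
          mul_comm (k : ℝ), Real.rpow_mul hs'.le, Real.rpow_natCast]
        exact mul_le_of_le_one_left (by positivity) (Real.rpow_le_one hq0.le (by linarith) hα.le)
      have h5 : (1 - a) * t ^ m ≤ ((1 - s) * s') ^ m := by
        have h6 : t ≤ (1 - s) * s' := by
          rw [ht]
          have := pow_le_pow_of_le_one hs'.le hs'1.le hk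
          rw [pow_one] at this
          gcongr
        calc (1 - a) * t ^ m ≤ 1 * t ^ m := by gcongr; linarith
          _ ≤ _ := by rw [one_mul]; gcongr
      have : 0 ≤ (s' ^ α) ^ k := by positivity
      gcongr
    have hD' : ENNReal.ofReal D ≠ 0 := (ENNReal.ofReal_pos.2 hD0).ne'
    refine (ENNReal.mul_le_mul_iff_right hD' ENNReal.ofReal_ne_top).1 ?_
    calc _ ≤ _ := mul_le_mul_left (ENNReal.ofReal_le_ofReal hDle) _
      _ ≤ _ := key
      _ ≤ _ := by
        rw [← mul_assoc, ← ENNReal.ofReal_mul hD0.le]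
        exact mul_le_mul_left (ENNReal.ofReal_le_ofReal h3) _
  · rw [ENNReal.ofReal_one, mul_one, ← ENNReal.ofReal_add hA1n hA2n]
    simpa using hsum0
  · have e1 : s' ^ (k + 1) * R * gratio m / R = s' ^ (k + 1) * gratio m := by field_simp
    rw [e1]
    calc s' ^ (k + 1) * gratio m ≤ s' ^ 2 * gratio m := by gcongr
      _ ≤ 1 := hs'2.le
  · intro v hv ρ hρ hρ2
    rw [if_pos (by linarith), volume_closedBall_eq _ hρ, ← ENNReal.ofReal_mul hA1n,
      ← ENNReal.ofReal_mul hA2n, ← ENNReal.ofReal_add (by positivity) (by positivity)]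
    have hρ1 : 0 < t * R := by positivity
    rcases le_or_gt ((1 - s) * r) ρ with h | h
    · rw [htR] at h
      have hρ0 : 0 < ρ := hρ1.trans_le h
      refine (hτ v hv ρ (by rw [htR]; exact h) (by linarith)).trans (ENNReal.ofReal_le_ofReal ?_)
      refine (volume_le_young hm hα hα1 hlam.le ht0.le hR hρ0 (by rw [htR])).trans ?_
      rw [← ha, ← hP]
      have : 0 ≤ P * (gam m * ((1 - a) * t ^ m * R ^ m)) := by positivity
      rw [hA1, hA2]
      linarith
    · rw [htR] at h
      have htR2 : t * R ≤ 2 * R := by nlinarith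
      refine (measure_mono (Metric.closedBall_subset_closedBall h.le)).trans
        ((hτ v hv (t * R) htR.le htR2).trans (ENNReal.ofReal_le_ofReal ?_))
      refine (volume_le_young hm hα hα1 hlam.le ht0.le hR hρ1 (by rw [htR])).trans ?_
      rw [← ha, ← hP, mul_pow]
      have : 0 ≤ A1 * (gam m * ρ ^ m) := by positivity
      rw [hA2]
      linarith

/-- At the largest scale the thickness of the cut is `R` itself. Balls of radius at least `(1 - s)
R` then have mass at most `lam / 2` times their volume, and only smaller balls need the excess;
hence `ω = (1 - s) R`, which gives the minimum in `cutConst₀`. -/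
theorem cut_estimate_zero (hm : 0 < m) (hs1 : s < 1) (hs : 0 ≤ s)
    (hg : s' * gratio m < 1)
    (hlam : 0 < lam) (hα : 0 < α) (hR : 0 < R) (hf : ∀ x, x ∉ M → f x = 0)
    (hτ : ∀ v ∈ M, ∀ ρ, (1 - s) * R ≤ ρ → ρ ≤ 2 * R → τ (Metric.closedBall v ρ) ≤
      ENNReal.ofReal (lam / 2 * ((1 - s) * R / ρ) ^ α * (gam m * ρ ^ m))) :
    ∫⁻ u, dil f (s' * R) u ∂τ ≤
      ENNReal.ofReal (lam / 2 * cutConst₀ m s s') * ∫⁻ z, dil f R z := by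
  have hq0 : 0 < 1 - s := by linarith
  have hgr := gratio_pos m
  set θ := min 1 (gratio m * (1 - s)) with hθ
  have hθ0 : 0 ≤ θ := le_min zero_le_one (by positivity)
  have key := lintegral_dil_le_overlap hm hf τ (R := R) (d := s' * R) (ω := (1 - s) * R) (θ := θ)
    hR (a₁ := ENNReal.ofReal (lam / 2)) (a₂ := ENNReal.ofReal (lam / 2 * (1 - s) ^ m)) ?_
    (by positivity) (le_of_eq (by rw [hθ, mul_div_assoc, mul_div_assoc, div_self hR.ne', mul_one]))
    ?_ (fun v hv ρ hρ hρ2 => cut_mass_top hs1 hlam hα hR (by linarith) hτ hs v hv ρ hρ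
      (by linarith))
  · have e1 : s' * R * gratio m / R = s' * gratio m := by field_simp
    rw [e1, ← ENNReal.ofReal_mul (by positivity), ← ENNReal.ofReal_add (by positivity)
      (by positivity)] at key
    have h1 : 1 - s' * gratio m ≠ 0 := by linarith
    have hD0 : 0 < (1 - s' * gratio m) ^ 2 := by positivity
    have hD' : ENNReal.ofReal ((1 - s' * gratio m) ^ 2) ≠ 0 := (ENNReal.ofReal_pos.2 hD0).ne'
    refine (ENNReal.mul_le_mul_iff_right hD' ENNReal.ofReal_ne_top).1 (key.trans (le_of_eq ?_))
    rw [← mul_assoc, ← ENNReal.ofReal_mul hD0.le]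
    congr 2
    rw [cutConst₀, ← hθ]
    field_simp
  · have : 0 < ENNReal.ofReal (lam / 2) := by simpa using hlam
    exact (lt_of_lt_of_le this le_self_add).ne'
  · have e1 : s' * R * gratio m / R = s' * gratio m := by field_simp
    rw [e1]; exact hg.le

theorem cut_estimate_zero' (hm : 0 < m) (hs1 : s < 1) (hs : 0 ≤ s)
    (hlam : 0 < lam) (hα : 0 < α) (hR : 0 < R) (hf : ∀ x, x ∉ M → f x = 0)
    (hτ : ∀ v ∈ M, ∀ ρ, (1 - s) * R ≤ ρ →
      ρ ≤ R + √((m + 4) / m * (m / (m + 2) + s' ^ 2)) * R → τ (Metric.closedBall v ρ) ≤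
      ENNReal.ofReal (lam / 2 * ((1 - s) * R / ρ) ^ α * (gam m * ρ ^ m))) :
    ∫⁻ u, dil f (s' * R) u ∂τ ≤
      ENNReal.ofReal (lam / 2 * cutConst₀' m s s') * ∫⁻ z, dil f R z := by
  have hq0 : 0 < 1 - s := by linarith
  have key := lintegral_dil_le_parab hm hf τ (R := R) (δ := s')
    hR (a₁ := ENNReal.ofReal (lam / 2)) (a₂ := ENNReal.ofReal (lam / 2 * (1 - s) ^ m))
    (by simpa using hlam) (fun v hv ρ hρ hρ2 => ?_)
  · rw [← ENNReal.ofReal_add (by positivity) (by positivity),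
      ← ENNReal.ofReal_mul (by positivity)] at key
    refine key.trans (le_of_eq ?_)
    congr 2
    rw [cutConst₀']
    ring
  · refine (cut_mass_top hs1 hlam hα hR (le_add_of_nonneg_right (by positivity)) hτ hs v hv ρ hρ
      hρ2).trans (add_le_add le_rfl ?_)
    split_ifs
    · exact le_rfl
    · exact zero_le
end

/-- The inequality holds strictly at `s`, because `lam < 1 - s ^ α`, and by continuity it persists
at some `s' > s`. This margin is what the variation of the derivative over small balls will consume.
-/
theorem exists_rate_of_cut {m : ℕ} {s lam α : ℝ} {c : ℝ → ℝ} (hs : 0 < s) (hs1 : s < 1)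
    (hlam : 0 < lam) (hα : 0 < α) (hα1 : α ≤ 1) (hsg : s * gratio m < 1)
    (hsum : s ^ α + lam < 1) (hc : ContinuousAt c s) 
    (h1 : cutConst₁ m s s ≤ 2) (h2 : (1 - s) * c s + s * cutConst₁ m s s ≤ 2) (h3 : 0 < c s) :
    ∃ s', s < s' ∧ s' < 1 ∧ s' * gratio m < 1 ∧
      lam / 2 * (c s' + cutConst₁ m s s' * (s' ^ α / (1 - s' ^ α))) < 1 := by
  have hgr := gratio_pos m
  have hp : s ≤ s ^ α := by
    simpa using Real.rpow_le_rpow_of_exponent_ge hs hs1.le hα1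
  have hp1 : s ^ α < 1 := Real.rpow_lt_one hs.le hs1 hα
  have hs2 : 0 < 1 - s ^ 2 * gratio m := by nlinarith [mul_pos hs hgr]
  have hcc : ContinuousAt (fun x => lam / 2 * (c x + cutConst₁ m s x * (x ^ α / (1 - x ^ α)))) s := by
    have hr : ContinuousAt (fun x : ℝ => x ^ α) s :=
      Real.continuousAt_rpow_const _ _ (Or.inl hs.ne')
    have h1 : ContinuousAt (fun x => cutConst₁ m s x) s := by
      unfold cutConst₁
      refine ContinuousAt.div (by fun_prop) (by fun_prop) (by positivity)
    exact continuousAt_const.mul (hc.add (h1.mul (hr.div (continuousAt_const.sub hr) (by linarith))))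
  have hlt : lam / 2 * (c s + cutConst₁ m s s * (s ^ α / (1 - s ^ α))) < 1 := by
    have hpos : 0 < 1 - s ^ α := by linarith
    -- Since `s ≤ s ^ α`, the weight moves from `c s` towards `cutConst₁`. If `c s` is the larger,
    -- the sum only decreases from its value at weight `s`; otherwise it is at most `cutConst₁ ≤ 2`.
    have h5 : (1 - s ^ α) * c s + s ^ α * cutConst₁ m s s ≤ 2 := by
      rcases le_total (c s) (cutConst₁ m s s) with h | h
      · nlinarith
      · nlinarith
    have hc1 : 0 < cutConst₁ m s s := by
      unfold cutConst₁
      have : 0 < 1 - s := by linarith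
      positivity
    have hX : 0 < (1 - s ^ α) * c s + s ^ α * cutConst₁ m s s := by positivity
    have e : lam / 2 * (c s + cutConst₁ m s s * (s ^ α / (1 - s ^ α))) =
      lam * ((1 - s ^ α) * c s + s ^ α * cutConst₁ m s s) / (2 * (1 - s ^ α)) := by
      field_simp
    rw [e, div_lt_one (by positivity)]
    calc _ < (1 - s ^ α) * ((1 - s ^ α) * c s + s ^ α * cutConst₁ m s s) := by
          gcongr; linarith
      _ ≤ (1 - s ^ α) * 2 := by gcongr
      _ = _ := by ring
  have ev1 := hcc.eventually (gt_mem_nhds hlt)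
  have ev2 : ∀ᶠ x in 𝓝 s, x < 1 := gt_mem_nhds hs1
  have ev3 : ∀ᶠ x in 𝓝 s, x * gratio m < 1 :=
    (continuousAt_id.mul continuousAt_const).eventually (gt_mem_nhds hsg)
  have ev : ∀ᶠ x in 𝓝[>] s, s < x ∧ x < 1 ∧ x * gratio m < 1 ∧
      lam / 2 * (c x + cutConst₁ m s x * (x ^ α / (1 - x ^ α))) < 1 := by
    filter_upwards [nhdsWithin_le_nhds ev1, nhdsWithin_le_nhds ev2, nhdsWithin_le_nhds ev3,
      self_mem_nhdsWithin] with x a b c d using ⟨d, b, c, a⟩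
  exact ev.exists

/-- The total cost of all cuts is less than one. -/
theorem exists_cut_rates {m : ℕ} (hm : 0 < m) {s lam α : ℝ} (hs : 0 < s) (hs1 : s < 1)
    (hlam : 0 < lam) (hα : 0 < α) (hα1 : α ≤ 1)
    (hy : 3 * (s * gratio m) ≤ lam * (1 - s)) (hsum : s ^ α + lam < 1) :
    ∃ (s' L : ℝ) (η : ℕ → ℝ), s < s' ∧ s' < 1 ∧ 0 < L ∧ (∀ k, 0 ≤ η k) ∧ Summable η ∧
      ∑' k, η k < 1 ∧
      ∀ (M : Set (Euc m)) (τ : ℝ → Measure (Euc m)) (f : Euc m → ℝ≥0∞) (R ε₂ : ℝ),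
        (∀ r, IsFiniteMeasure (τ r)) → 0 < R → L * R ≤ ε₂ → (∀ x, x ∉ M → f x = 0) →
        (∀ r > 0, ∀ v ∈ M, ∀ ρ, (1 - s) * r ≤ ρ → ρ ≤ (1 - s) * ε₂ →
          τ r (Metric.closedBall v ρ) ≤
            ENNReal.ofReal (lam / 2 * ((1 - s) * r / ρ) ^ α * (gam m * ρ ^ m))) →
        ∀ k, ∫⁻ u, dil f (s' ^ (k + 1) * R) u ∂τ (s' ^ k * R) ≤
          ENNReal.ofReal (η k) * ∫⁻ z, dil f R z := by
  have hgr := gratio_pos m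
  have hm' : (1 : ℝ) ≤ m := by exact_mod_cast hm
  have hp : s ≤ s ^ α := by
    simpa using Real.rpow_le_rpow_of_exponent_ge hs hs1.le hα1
  have hlam1 : lam ≤ 1 - s := by linarith
  have hsg : s * gratio m < 1 := by nlinarith
  obtain ⟨n1, n2⟩ := numeric_cut hm hs.le hs1.le (by nlinarith)
  have hq : 0 < 1 - s := by linarith
  obtain ⟨c, hc, hc0, hcs, h2, hce⟩ : ∃ c : ℝ → ℝ, ContinuousAt c s ∧ (∀ x, 0 ≤ c x) ∧ 0 < c s ∧
      (1 - s) * c s + s * cutConst₁ m s s ≤ 2 ∧ (c = cutConst₀ m s ∨ c = cutConst₀' m s) := by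
    rcases n2 with n2 | n2
    · refine ⟨cutConst₀ m s, ?_, fun x => ?_, ?_, n2, Or.inl rfl⟩
      · unfold cutConst₀
        refine ContinuousAt.div (by fun_prop) (by fun_prop) ?_
        have : 1 - s * gratio m ≠ 0 := by linarith
        positivity
      · unfold cutConst₀; positivity
      · unfold cutConst₀
        have : 0 < 1 - s * gratio m := by linarith
        positivity
    · refine ⟨cutConst₀' m s, ?_, fun x => ?_, ?_, n2, Or.inr rfl⟩
      · unfold cutConst₀' parabConst
        fun_prop
      · unfold cutConst₀' parabConst; positivity
      · unfold cutConst₀' parabConst; positivity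
  obtain ⟨s', ha, hb, hd, he⟩ :=
    exists_rate_of_cut (m := m) hs hs1 hlam hα hα1 hsg hsum hc n1 h2 hcs
  have hs'0 : 0 < s' := hs.trans ha
  have hp' : s' ^ α < 1 := Real.rpow_lt_one hs'0.le hb hα
  have hp0 : 0 < s' ^ α := Real.rpow_pos_of_pos hs'0 α
  have hc1 : 0 ≤ cutConst₁ m s s' := by unfold cutConst₁; positivity
  -- The scale `k = 0` has its own constant; from `k = 1` on the costs form a geometric series with
  -- ratio `s' ^ α`.
  set η : ℕ → ℝ := fun k => if k = 0 then lam / 2 * c s' else lam / 2 * cutConst₁ m s s' * (s' ^ α) ^ k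
    with hη
  have hS : HasSum (fun k => η (k + 1)) (lam / 2 * cutConst₁ m s s' * (s' ^ α / (1 - s' ^ α))) := by
    have := (hasSum_geometric_of_lt_one hp0.le hp').mul_left (lam / 2 * cutConst₁ m s s' * s' ^ α)
    have e1 : (fun k => η (k + 1)) = fun k => lam / 2 * cutConst₁ m s s' * s' ^ α * (s' ^ α) ^ k := by
      ext k; simp [hη, pow_succ]; ring
    rw [e1, div_eq_mul_inv (s' ^ α), ← mul_assoc (lam / 2 * _)]
    exact this
  have hS' := (hasSum_nat_add_iff 1).1 hS
  -- `L` keeps the radii `2 R` and `R + √β R` that the two kernels use below `(1 - s) ε₂`.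
  refine ⟨s', (2 + √((m + 4) / m * (m / (m + 2) + s' ^ 2))) / (1 - s), η, ha, hb, by positivity,
    fun k => ?_, hS'.summable, ?_, ?_⟩
  · have := hc0 s'
    simp only [hη]; split_ifs <;> positivity
  · rw [hS'.tsum_eq]
    simp only [Finset.range_one, Finset.sum_singleton, hη, if_true]
    linarith
  · intro M τ f R ε₂ hfin hR hL hf hτ k
    have hL' : (2 + √((m + 4) / m * (m / (m + 2) + s' ^ 2))) * R ≤ (1 - s) * ε₂ := by
      rw [div_mul_eq_mul_div, div_le_iff₀ hq] at hL; linarith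
    have hroot : 0 ≤ √((m + 4) / m * (m / (m + 2) + s' ^ 2)) * R := by positivity
    rcases Nat.eq_zero_or_pos k with rfl | hk
    · have hη0 : η 0 = lam / 2 * c s' := by simp [hη]
      simp only [zero_add, pow_one, pow_zero, one_mul]
      have := hfin R
      rw [hη0]
      rcases hce with rfl | rfl
      · exact cut_estimate_zero hm hs1 hs.le hd hlam hα hR hf
          fun v hv ρ h1 h2 => hτ R hR v hv ρ h1 (by linarith)
      · exact cut_estimate_zero' hm hs1 hs.le hlam hα hR hf
          fun v hv ρ h1 h2 => hτ R hR v hv ρ h1 (by linarith)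
    · have hηk : η k = lam / 2 * cutConst₁ m s s' * (s' ^ α) ^ k := by simp [hη, hk.ne']
      have := hfin (s' ^ k * R)
      rw [hηk]
      exact cut_estimate_succ hm hs1 hs.le hs'0 hb hd hlam hα hα1 hR hk rfl hf
        fun v hv ρ h1 h2 => hτ _ (by positivity) v hv ρ h1 (by linarith)

/-! ### Change of variables and quantitative inversion. -/

section
variable {E : Type*} [NormedAddCommGroup E] [NormedSpace ℝ E] [FiniteDimensional ℝ E]
  [MeasurableSpace E] [BorelSpace E]

/-- Comparison of integrals through a map which need not be injective. -/
theorem lintegral_le_of_forall_exists_preimage (μ : Measure E) [μ.IsAddHaarMeasure]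
    {F : E → E} {W : Set E} (hW : MeasurableSet W)
    (hF : ∀ u ∈ W, ∃ A : E ≃L[ℝ] E, HasStrictFDerivAt F (A : E →L[ℝ] E) u)
    {G Φ : E → ℝ≥0∞} (hΦ : Measurable Φ)
    (h : ∀ x, ∀ t < G x, ∃ u ∈ W, F u = x ∧ t * ENNReal.ofReal |(fderiv ℝ F u).det| ≤ Φ u) :
    ∫⁻ x, G x ∂μ ≤ ∫⁻ u in W, Φ u ∂μ := by
  -- `F` is only locally injective. By Lindelöf, `W` is cut into countably many disjoint pieces on
  -- which it is injective.
  have hnb : ∀ u ∈ W, ∃ O, IsOpen O ∧ u ∈ O ∧ InjOn F O := by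
    intro u hu
    obtain ⟨A, hA⟩ := hF u hu
    have hu' := hA.mem_toOpenPartialHomeomorph_source
    exact ⟨_, (hA.toOpenPartialHomeomorph F).open_source, hu',
      (hA.toOpenPartialHomeomorph F).injOn⟩
  choose! O hO huO hinj using hnb
  obtain ⟨S, hSW, hSc, hScov⟩ := TopologicalSpace.countable_cover_nhdsWithin
    (f := O) (s := W) (fun u hu => mem_nhdsWithin_of_mem_nhds ((hO u hu).mem_nhds (huO u hu)))
  have hdet : ∀ u ∈ W, (fderiv ℝ F u).det ≠ 0 := by
    intro u hu
    obtain ⟨A, hA⟩ := hF u hu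
    rw [hA.hasFDerivAt.fderiv]
    exact A.toLinearEquiv.isUnit_det'.ne_zero
  set Ψ : E → ℝ≥0∞ := fun u => Φ u / ENNReal.ofReal |(fderiv ℝ F u).det| with hΨ
  have hm1 : Measurable fun u => ENNReal.ofReal |(fderiv ℝ F u).det| := by
    have : Measurable fun u => (fderiv ℝ F u).det :=
      ContinuousLinearMap.continuous_det.measurable.comp (measurable_fderiv ℝ F)
    exact ENNReal.measurable_ofReal.comp (measurable_norm.comp this)
  have hΨm : Measurable Ψ := hΦ.div hm1
  rcases S.eq_empty_or_nonempty with rfl | hSne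
  · have hWe : W = ∅ := by simpa using hScov
    have : ∀ x, G x = 0 := by
      intro x
      by_contra hx
      obtain ⟨u, hu, -⟩ := h x 0 (pos_iff_ne_zero.2 hx)
      simp [hWe] at hu
    simp [this]
  obtain ⟨e, rfl⟩ := hSc.exists_eq_range hSne
  set A : ℕ → Set E := fun n => W ∩ disjointed (fun k => O (e k)) n with hA
  have heW : ∀ n, e n ∈ W := fun n => hSW (mem_range_self n)
  have hOm : ∀ n, MeasurableSet (O (e n)) := fun n => (hO _ (heW n)).measurableSet
  have hAm : ∀ n, MeasurableSet (A n) := fun n => hW.inter (MeasurableSet.disjointed hOm n)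
  have hAd : Pairwise (Function.onFun Disjoint A) := fun i j hij =>
    (disjoint_disjointed (fun k => O (e k)) hij).mono inter_subset_right inter_subset_right
  have hAU : ⋃ n, A n = W := by
    rw [hA, ← inter_iUnion, iUnion_disjointed, inter_eq_left]
    simpa using hScov
  have hAi : ∀ n, InjOn F (A n) := fun n =>
    (hinj _ (heW n)).mono (inter_subset_right.trans (disjointed_subset _ n))
  have hAf : ∀ n, ∀ x ∈ A n, HasFDerivWithinAt F (fderiv ℝ F x) (A n) x := by
    intro n x hx
    obtain ⟨B, hB⟩ := hF x hx.1
    exact hB.hasFDerivAt.differentiableAt.hasFDerivAt.hasFDerivWithinAt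
  have hemb : ∀ n, MeasurableEmbedding ((A n).domRestrict F) := fun n =>
    measurableEmbedding_of_fderivWithin (hAm n) (hAf n) (hAi n)
  -- `H n` carries `Ψ` forward from the `n`-th piece. A single good preimage of `x` already puts its
  -- value below the sum of the `H n`, so counting all preimages is harmless.
  set H : ℕ → E → ℝ≥0∞ := fun n =>
    Function.extend ((A n).domRestrict F) (fun u => Ψ u) 0 with hH
  have hHm : ∀ n, Measurable (H n) := fun n =>
    (hemb n).measurable_extend (hΨm.comp measurable_subtype_coe) measurable_zero
  have hHv : ∀ n, ∀ u ∈ A n, H n (F u) = Ψ u := fun n u hu =>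
    (hemb n).injective.extend_apply (fun u : A n => Ψ u) 0 ⟨u, hu⟩
  have hH0 : ∀ n, ∀ x, x ∉ F '' A n → H n x = 0 := by
    intro n x hx
    rw [hH]
    exact Function.extend_apply' _ _ _ fun ⟨u, hu⟩ => hx ⟨u, u.2, hu⟩
  have hG : ∀ x, G x ≤ ∑' n, H n x := by
    intro x
    refine le_of_forall_lt fun t ht => ?_
    obtain ⟨t', htt', ht'⟩ := exists_between ht
    obtain ⟨u, hu, rfl, hle⟩ := h x t' ht'
    rw [← hAU] at hu
    obtain ⟨n, hn⟩ := mem_iUnion.1 hu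
    have h1 : t' ≤ H n (F u) := by
      rw [hHv n u hn]
      refine ENNReal.le_div_iff_mul_le (Or.inl ?_) (Or.inl ENNReal.ofReal_ne_top) |>.2 hle
      have := hdet u hn.1
      simpa using this
    exact htt'.trans_le (h1.trans (ENNReal.le_tsum n))
  calc ∫⁻ x, G x ∂μ ≤ ∫⁻ x, ∑' n, H n x ∂μ := lintegral_mono hG
    _ = ∑' n, ∫⁻ x, H n x ∂μ := lintegral_tsum fun n => (hHm n).aemeasurable
    _ = ∑' n, ∫⁻ u in A n, Φ u ∂μ := by
      refine tsum_congr fun n => ?_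
      rw [← setLIntegral_eq_of_support_subset
        (s := F '' A n) (fun x hx => by by_contra h'; exact hx (hH0 n x h')),
        lintegral_image_eq_lintegral_abs_det_fderiv_mul μ (hAm n) (hAf n) (hAi n)]
      refine setLIntegral_congr_fun (hAm n) fun u hu => ?_
      rw [hHv n u hu, hΨ]
      refine ENNReal.mul_div_cancel ?_ ENNReal.ofReal_ne_top
      have := hdet u hu.1
      simpa using this
    _ = ∫⁻ u in W, Φ u ∂μ := by
      rw [← hAU, lintegral_iUnion hAm hAd]

/-- The image of the unit ball lies in the ball of radius `‖A‖`; compare volumes. -/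
theorem abs_det_le_norm_pow (A : E →L[ℝ] E) : |A.det| ≤ ‖A‖ ^ Module.finrank ℝ E := by
  let μ : Measure E := Measure.addHaar
  have h1 := Measure.addHaar_image_continuousLinearMap μ A (Metric.closedBall 0 1)
  have h2 : A '' Metric.closedBall 0 1 ⊆ Metric.closedBall 0 ‖A‖ := by
    rintro _ ⟨x, hx, rfl⟩
    simp only [Metric.mem_closedBall, dist_zero_right] at hx ⊢
    calc _ ≤ ‖A‖ * ‖x‖ := A.le_opNorm x
      _ ≤ ‖A‖ * 1 := by gcongr
      _ = _ := mul_one _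
  have h3 : μ (Metric.closedBall (0 : E) 1) ≠ 0 :=
    (Metric.measure_closedBall_pos μ _ one_pos).ne'
  have h4 : μ (Metric.closedBall (0 : E) 1) ≠ ∞ := measure_closedBall_lt_top.ne
  have h5 := measure_mono (μ := μ) h2
  rw [h1, Measure.addHaar_closedBall' μ _ (norm_nonneg A),
    ENNReal.mul_le_mul_iff_left h3 h4] at h5
  exact (ENNReal.ofReal_le_ofReal_iff (by positivity)).1 h5

omit [MeasurableSpace E] [BorelSpace E] in
/-- Openness of the image and differentiability of the inverse. -/
theorem isOpen_image_of_strict {F : E → E} {U : Set E} (hU : IsOpen U)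
    (hF : ∀ u ∈ U, ∃ A : E ≃L[ℝ] E, HasStrictFDerivAt F (A : E →L[ℝ] E) u) :
    IsOpen (F '' U) := by
  rw [isOpen_iff_mem_nhds]
  rintro _ ⟨u, hu, rfl⟩
  obtain ⟨A, hA⟩ := hF u hu
  rw [← hA.map_nhds_eq_of_equiv]
  exact image_mem_map (hU.mem_nhds hu)

omit [MeasurableSpace E] [BorelSpace E] in
theorem hasFDerivAt_invFunOn {F : E → E} {U : Set E} (hU : IsOpen U) (hinj : InjOn F U)
    (hF : ∀ u ∈ U, ∃ A : E ≃L[ℝ] E, HasStrictFDerivAt F (A : E →L[ℝ] E) u) {u : E} (hu : u ∈ U)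
    {A : E ≃L[ℝ] E} (hA : HasFDerivAt F (A : E →L[ℝ] E) u) :
    HasFDerivAt (Function.invFunOn F U) (A.symm : E →L[ℝ] E) (F u) := by
  have hval : ∀ v ∈ U, Function.invFunOn F U (F v) = v := fun v hv =>
    hinj.leftInvOn_invFunOn hv
  have hopen := isOpen_image_of_strict hU hF
  have hc : ContinuousAt (Function.invFunOn F U) (F u) := by
    rw [ContinuousAt, hval u hu]
    intro O hO
    have h1 : F '' (U ∩ interior O) ∈ 𝓝 (F u) :=
      (isOpen_image_of_strict (hU.inter isOpen_interior) fun v hv => hF v hv.1).mem_nhds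
        ⟨u, ⟨hu, mem_interior_iff_mem_nhds.2 hO⟩, rfl⟩
    refine mem_map.2 (mem_of_superset h1 ?_)
    rintro _ ⟨v, hv, rfl⟩
    rw [mem_preimage]
    rw [hval v hv.1]
    exact interior_subset hv.2
  refine HasFDerivAt.of_local_left_inverse hc (by rwa [hval u hu]) ?_
  filter_upwards [hopen.mem_nhds ⟨u, hu, rfl⟩]
  rintro _ ⟨v, hv, rfl⟩
  rw [hval v hv]
end

section
variable {E : Type*} [NormedAddCommGroup E] [NormedSpace ℝ E] [FiniteDimensional ℝ E]

theorem exists_equiv_of_norm_le {L : E →L[ℝ] E} {c : ℝ} (h : ∀ ξ, ‖ξ‖ ≤ c * ‖L ξ‖) :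
    ∃ A : E ≃L[ℝ] E, (A : E →L[ℝ] E) = L ∧ ∀ η, ‖A.symm η‖ ≤ c * ‖η‖ := by
  have hinj : Function.Injective (L : E →ₗ[ℝ] E) := by
    rw [injective_iff_map_eq_zero]
    intro ξ hξ
    have h0 : L ξ = 0 := hξ
    have := h ξ
    rw [h0, norm_zero, mul_zero] at this
    exact norm_le_zero_iff.1 this
  let A := (LinearEquiv.ofInjectiveEndo (L : E →ₗ[ℝ] E) hinj).toContinuousLinearEquiv
  have hA : ∀ ξ, A ξ = L ξ := fun ξ => rfl
  refine ⟨A, by ext ξ; exact hA ξ, fun η => ?_⟩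
  have := h (A.symm η)
  rwa [← hA, A.apply_symm_apply] at this

omit [FiniteDimensional ℝ E] in
-- A local expansion rate of the map passes to the derivative through difference quotients.
theorem norm_le_fderiv_of_eventually {F : E → E} {L : E →L[ℝ] E} {x : E} {c : ℝ}
    (hL : HasFDerivAt F L x) (h : ∀ᶠ y in 𝓝 x, ‖x - y‖ ≤ c * ‖F x - F y‖) (ξ : E) :
    ‖ξ‖ ≤ c * ‖L ξ‖ := by
  have h1 := (hL.lim_real ξ).norm.const_mul c
  refine ge_of_tendsto h1 ?_
  have h2 : Tendsto (fun t : ℝ => x + t⁻¹ • ξ) atTop (𝓝 x) := by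
    have : Tendsto (fun t : ℝ => x + t⁻¹ • ξ) atTop (𝓝 (x + (0 : ℝ) • ξ)) :=
      tendsto_const_nhds.add (tendsto_inv_atTop_zero.smul_const ξ)
    simpa using this
  filter_upwards [h2.eventually h, eventually_gt_atTop 0] with t ht ht0
  rw [norm_smul, Real.norm_of_nonneg ht0.le, norm_sub_rev (F _)]
  have e : ‖x - (x + t⁻¹ • ξ)‖ = t⁻¹ * ‖ξ‖ := by
    rw [sub_add_cancel_left, norm_neg, norm_smul, Real.norm_of_nonneg (by positivity)]
  rw [e] at ht
  calc ‖ξ‖ = t * (t⁻¹ * ‖ξ‖) := by field_simp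
    _ ≤ t * (c * ‖F x - F (x + t⁻¹ • ξ)‖) := by gcongr
    _ = _ := by ring

theorem one_add_pow_le {δ : ℝ} (h0 : 0 ≤ δ) (h1 : δ ≤ 1) (n : ℕ) :
    (1 + δ) ^ n ≤ 1 + 3 ^ n * δ := by
  induction n with
  | zero => simp [h0]
  | succ k ih =>
    have h3 : (1 : ℝ) ≤ 3 ^ k := one_le_pow₀ (by norm_num)
    calc (1 + δ) ^ (k + 1) = (1 + δ) ^ k * (1 + δ) := pow_succ _ _
      _ ≤ (1 + 3 ^ k * δ) * (1 + δ) := by gcongr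
      _ ≤ 1 + 3 ^ (k + 1) * δ := by
        rw [pow_succ]
        nlinarith [mul_nonneg h0 (sub_nonneg.2 h3), mul_nonneg (mul_nonneg h0 (sub_nonneg.2 h1)) (zero_le_one.trans h3)]

/-- `B = A (1 + A⁻¹ (B - A))`, where the inverse of `A` has norm at most one, so the last factor has
norm at most `1 + δ`. -/
theorem abs_det_le_of_close {A B : E →L[ℝ] E} {δ : ℝ} (hA : ∀ ξ, ‖ξ‖ ≤ ‖A ξ‖)
    (h : ‖B - A‖ ≤ δ) (hδ : δ ≤ 1) :
    |B.det| ≤ (1 + 3 ^ Module.finrank ℝ E * δ) * |A.det| := by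
  have hδ0 : 0 ≤ δ := (norm_nonneg _).trans h
  obtain ⟨e, he, hs⟩ := exists_equiv_of_norm_le (L := A) (c := 1) (by simpa using hA)
  set X : E →L[ℝ] E := (e.symm : E →L[ℝ] E).comp (B - A) with hX
  have hXn : ‖X‖ ≤ δ := by
    refine ContinuousLinearMap.opNorm_le_bound _ hδ0 fun ξ => ?_
    calc ‖X ξ‖ = ‖e.symm ((B - A) ξ)‖ := rfl
      _ ≤ 1 * ‖(B - A) ξ‖ := hs _
      _ ≤ ‖B - A‖ * ‖ξ‖ := by rw [one_mul]; exact (B - A).le_opNorm ξ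
      _ ≤ δ * ‖ξ‖ := by gcongr
  have hB : B = A.comp (ContinuousLinearMap.id ℝ E + X) := by
    ext ξ
    have : A (e.symm ((B - A) ξ)) = (B - A) ξ := by
      rw [← he]; exact e.apply_symm_apply _
    simp only [ContinuousLinearMap.comp_apply, add_apply, map_add]
    rw [show X ξ = e.symm ((B - A) ξ) from rfl, this]
    simp
  have hdet : B.det = A.det * (ContinuousLinearMap.id ℝ E + X).det := by
    conv_lhs => rw [hB]
    simp only [ContinuousLinearMap.det]
    rw [← LinearMap.det_comp]
    rfl
  let _ : MeasurableSpace E := borel E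
  have : BorelSpace E := ⟨rfl⟩
  have h1 := abs_det_le_norm_pow (ContinuousLinearMap.id ℝ E + X)
  have h2 : ‖ContinuousLinearMap.id ℝ E + X‖ ≤ 1 + δ :=
    (norm_add_le _ _).trans (add_le_add ContinuousLinearMap.norm_id_le hXn)
  rw [hdet, abs_mul, mul_comm]
  gcongr
  calc _ ≤ _ := h1
    _ ≤ (1 + δ) ^ Module.finrank ℝ E := by gcongr
    _ ≤ _ := one_add_pow_le hδ0 hδ _

/-- Quantitative local surjectivity. -/
theorem exists_preimage_of_close {F : E → E} {F' : E → E →L[ℝ] E} {v x : E} {c s s' : ℝ}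
    (hs : 0 < s) (hs' : 0 < s') (h : ∀ ξ, ‖ξ‖ ≤ s * ‖F' v ξ‖)
    (hF : ∀ u ∈ Metric.closedBall v (s' * dist x (F v)), HasFDerivAt F (F' u) u)
    (hc : ∀ u ∈ Metric.closedBall v (s' * dist x (F v)), ‖F' u - F' v‖ ≤ c) (hc0 : 0 ≤ c)
    (hcs : c ≤ s⁻¹ - s'⁻¹) :
    ∃ u ∈ Metric.closedBall v (s' * dist x (F v)), F u = x := by
  obtain ⟨A, hA, hAs⟩ := exists_equiv_of_norm_le h
  have hap : ApproximatesLinearOn F (F' v) (Metric.closedBall v (s' * dist x (F v)))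
      ⟨c, hc0⟩ := by
    intro a ha b hb
    exact Convex.norm_image_sub_le_of_norm_hasFDerivWithin_le' (𝕜 := ℝ)
      (fun u hu => (hF u hu).hasFDerivWithinAt) (fun u hu => hc u hu)
      (convex_closedBall _ _) hb ha
  let N : (F' v).NonlinearRightInverse :=
    { toFun := A.symm
      nnnorm := ⟨s, hs.le⟩
      bound' := fun y => hAs y
      right_inv' := fun y => by rw [← hA]; exact A.apply_symm_apply y }
  have := hap.surjOn_closedBall_of_nonlinearRightInverse N (ε := s' * dist x (F v)) (b := v)
    (by positivity) Subset.rfl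
  have hx : x ∈ Metric.closedBall (F v) (((N.nnnorm : ℝ)⁻¹ - (⟨c, hc0⟩ : NNReal)) *
      (s' * dist x (F v))) := by
    rw [Metric.mem_closedBall]
    change dist x (F v) ≤ (s⁻¹ - c) * (s' * dist x (F v))
    have h1 : 1 ≤ (s⁻¹ - c) * s' := by
      calc 1 = s'⁻¹ * s' := by field_simp
        _ ≤ _ := by gcongr; linarith
    calc dist x (F v) = 1 * dist x (F v) := (one_mul _).symm
      _ ≤ ((s⁻¹ - c) * s') * dist x (F v) := by gcongr
      _ = _ := by ring
  obtain ⟨u, hu, hux⟩ := this hx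
  exact ⟨u, hu, hux⟩

omit [FiniteDimensional ℝ E] in
theorem norm_le_of_close {A B : E →L[ℝ] E} {s s' c : ℝ} (hs : 0 < s) (hs' : 0 < s')
    (h : ∀ ξ, ‖ξ‖ ≤ s * ‖A ξ‖) (hc : ‖B - A‖ ≤ c) (hcs : c ≤ s⁻¹ - s'⁻¹) (ξ : E) :
    ‖ξ‖ ≤ s' * ‖B ξ‖ := by
  have h1 : ‖A ξ‖ ≤ ‖B ξ‖ + c * ‖ξ‖ := by
    have : A ξ = B ξ - (B - A) ξ := by simp
    rw [this]
    refine (norm_sub_le _ _).trans ?_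
    gcongr
    exact ((B - A).le_opNorm ξ).trans (by gcongr)
  have h2 : s⁻¹ * ‖ξ‖ ≤ ‖A ξ‖ := by
    rw [inv_mul_le_iff₀ hs]; exact h ξ
  have h3 : s'⁻¹ * ‖ξ‖ ≤ ‖B ξ‖ := by
    have : c * ‖ξ‖ ≤ (s⁻¹ - s'⁻¹) * ‖ξ‖ := by gcongr
    nlinarith
  rwa [inv_mul_le_iff₀ hs'] at h3

/-- Mean value inequality for the inverse of an expanding map. -/
theorem dist_invFunOn_le {F : E → E} {U : Set E} (hU : IsOpen U) (hinj : InjOn F U)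
    (hF : ∀ u ∈ U, HasStrictFDerivAt F (fderiv ℝ F u) u) {c₀ : ℝ}
    (hexp₀ : ∀ u ∈ U, ∀ ξ, ‖ξ‖ ≤ c₀ * ‖fderiv ℝ F u ξ‖) {c : ℝ} (hc : 0 ≤ c) {x y : E}
    (hseg : segment ℝ x y ⊆ F '' U)
    (hexp : ∀ z ∈ segment ℝ x y, ∀ ξ, ‖ξ‖ ≤ c * ‖fderiv ℝ F (Function.invFunOn F U z) ξ‖) :
    dist (Function.invFunOn F U x) (Function.invFunOn F U y) ≤ c * dist x y := by
  have hF' : ∀ u ∈ U, ∃ A : E ≃L[ℝ] E, HasStrictFDerivAt F (A : E →L[ℝ] E) u := by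
    intro u hu
    obtain ⟨A, hA, -⟩ := exists_equiv_of_norm_le (hexp₀ u hu)
    exact ⟨A, by rw [hA]; exact hF u hu⟩
  have hd : ∀ z ∈ segment ℝ x y, ∃ g' : E →L[ℝ] E,
      HasFDerivAt (Function.invFunOn F U) g' z ∧ ‖g'‖ ≤ c := by
    intro z hz
    obtain ⟨u, hu, rfl⟩ := hseg hz
    have hue : Function.invFunOn F U (F u) = u := hinj.leftInvOn_invFunOn hu
    have he := hexp _ hz
    rw [hue] at he
    obtain ⟨A, hA, hAs⟩ := exists_equiv_of_norm_le he
    refine ⟨A.symm, hasFDerivAt_invFunOn hU hinj hF' hu (by rw [hA]; exact (hF u hu).hasFDerivAt),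
      ContinuousLinearMap.opNorm_le_bound _ hc hAs⟩
  choose! g' hg' hgn using hd
  have := (convex_segment x y).norm_image_sub_le_of_norm_hasFDerivWithin_le (𝕜 := ℝ)
    (fun z hz => (hg' z hz).hasFDerivWithinAt) hgn (right_mem_segment ℝ x y)
    (left_mem_segment ℝ x y)
  rwa [← dist_eq_norm, ← dist_eq_norm] at this

omit [FiniteDimensional ℝ E] in
-- A segment leaving `W` would meet the frontier of `W` at a point within `r` of both ends.
theorem segment_subset_of_frontier {W : Set E} (hW : IsOpen W) {x y : E} {r : ℝ}
    (hx : x ∈ W) (hxy : dist x y < r)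
    (h : x ∉ Metric.cthickening r (frontier W) ∨ y ∉ Metric.cthickening r (frontier W)) :
    segment ℝ x y ⊆ W := by
  refine (convex_segment x y).isPreconnected.subset_of_closure_inter_subset hW
    ⟨x, left_mem_segment ℝ x y, hx⟩ ?_
  rintro z ⟨hzc, hz⟩
  by_contra hzW
  have hzf : z ∈ frontier W := by rw [hW.frontier_eq]; exact ⟨hzc, hzW⟩
  have h1 : dist x z ≤ r := by
    have : z ∈ Metric.closedBall x (dist x y) :=
      (convex_closedBall x _).segment_subset (by simp) (by simp [dist_comm]) hz
    rw [Metric.mem_closedBall, dist_comm] at this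
    linarith
  have h2 : dist y z ≤ r := by
    have : z ∈ Metric.closedBall y (dist x y) :=
      (convex_closedBall y _).segment_subset (by simp) (by simp) hz
    rw [Metric.mem_closedBall, dist_comm] at this
    linarith
  rcases h with h | h
  · exact h (Metric.mem_cthickening_of_dist_le x z r _ hzf h1)
  · exact h (Metric.mem_cthickening_of_dist_le y z r _ hzf h2)
end

/-! ### Expansion of the branches and the constants in real form. -/

namespace PiecewiseMap
variable {m : ℕ} {D : PiecewiseMap m} {I Cξ : ℝ}

/-- All the assumptions together. -/
structure System (D : PiecewiseMap m) (I Cξ : ℝ) : Prop where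
  std : D.Standing
  smooth : D.PiecewiseSmooth
  fixed : D.FixedPoint
  rates : D.ExpandingRates I Cξ
  distortion : D.Distortion I Cξ

/-- `s`, as a real number. -/
noncomputable def sr (D : PiecewiseMap m) : ℝ := D.sOut.toReal

/-- The points which the extended branch maps `r`-close to the boundary of the image. -/
def cut (D : PiecewiseMap m) (j : Fin (D.K + 1)) (r : ℝ) : Set (Euc m) :=
  D.V j ∩ D.ext j ⁻¹' Metric.cthickening r (frontier (D.T '' D.U j))

namespace System
variable (H : D.System I Cξ)
include H

theorem U_subset_M (j : Fin (D.K + 1)) : D.U j ⊆ D.M := by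
  rw [H.smooth.cover]
  exact subset_closure.trans (subset_iUnion (fun j => closure (D.U j)) j)

theorem closure_U_subset_M (j : Fin (D.K + 1)) : closure (D.U j) ⊆ D.M := by
  rw [H.smooth.cover]
  exact subset_iUnion (fun j => closure (D.U j)) j

theorem U_subset_V (j : Fin (D.K + 1)) : D.U j ⊆ D.V j :=
  subset_closure.trans (H.smooth.closure_subset j)

theorem R_subset_TR : D.R ⊆ D.T '' D.R := subset_closure.trans H.rates.closure_R

theorem TR_subset_U : D.T '' D.R ⊆ D.U 0 := subset_closure.trans H.rates.closure_TR

theorem R_subset_U : D.R ⊆ D.U 0 := H.R_subset_TR.trans H.TR_subset_U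

theorem measurableSet_M : MeasurableSet D.M := H.std.compact.isClosed.measurableSet

theorem measurableSet_R : MeasurableSet D.R := H.rates.isOpen_R.measurableSet

theorem measurableSet_U (j : Fin (D.K + 1)) : MeasurableSet (D.U j) :=
  (H.smooth.isOpen_U j).measurableSet

theorem contDiffAt {j : Fin (D.K + 1)} {x : Euc m} (hx : x ∈ D.V j) :
    ContDiffAt ℝ 1 (D.ext j) x :=
  (H.smooth.smooth j).1.contDiffAt ((H.smooth.isOpen_V j).mem_nhds hx)

theorem strict {j : Fin (D.K + 1)} {x : Euc m} (hx : x ∈ D.V j) :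
    HasStrictFDerivAt (D.ext j) (fderiv ℝ (D.ext j) x) x :=
  (H.contDiffAt hx).hasStrictFDerivAt one_ne_zero

theorem T_eventuallyEq {j : Fin (D.K + 1)} {x : Euc m} (hx : x ∈ D.U j) :
    D.ext j =ᶠ[𝓝 x] D.T :=
  (H.smooth.ext_eq j).eventuallyEq_of_mem ((H.smooth.isOpen_U j).mem_nhds hx)

theorem fderiv_T {j : Fin (D.K + 1)} {x : Euc m} (hx : x ∈ D.U j) :
    fderiv ℝ D.T x = fderiv ℝ (D.ext j) x := (H.T_eventuallyEq hx).fderiv_eq.symm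

theorem strict_T {j : Fin (D.K + 1)} {x : Euc m} (hx : x ∈ D.U j) :
    HasStrictFDerivAt D.T (fderiv ℝ D.T x) x := by
  rw [H.fderiv_T hx]
  exact (H.strict (H.U_subset_V j hx)).congr_of_eventuallyEq (H.T_eventuallyEq hx)

/-- The infimum defining `rate` is attained. -/
theorem dist_le_rate {j : Fin (D.K + 1)} {x y : Euc m} (hx : x ∈ D.U j) (hp : x ≠ D.p)
    (hy : y ∈ D.U j) (hxy : dist x y ≤ min D.ε₁ (0.1 * dist x D.p)) :
    dist x y ≤ (D.rate D.T (D.U j) x).toReal * dist (D.T x) (D.T y) := by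
  have h1 := H.rates.rate_le_one j x hx hp
  have hne : D.rate D.T (D.U j) x ≠ ∞ := (h1.trans_lt ENNReal.one_lt_top).ne
  have key : edist x y ≤ D.rate D.T (D.U j) x * edist (D.T x) (D.T y) := by
    by_contra! hlt
    rcases eq_or_ne (edist (D.T x) (D.T y)) 0 with h0 | h0
    · have hnon : D.rate D.T (D.U j) x < ∞ := hne.lt_top
      rw [rate, sInf_lt_iff] at hnon
      obtain ⟨c, hc, -⟩ := hnon
      have := hc y hy hxy
      rw [h0, mul_zero] at this hlt
      exact absurd this (not_le.2 hlt)
    · have h2 : D.rate D.T (D.U j) x < edist x y / edist (D.T x) (D.T y) :=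
        (ENNReal.lt_div_iff_mul_lt (Or.inl h0) (Or.inl (edist_ne_top _ _))).2 hlt
      rw [rate, sInf_lt_iff] at h2
      obtain ⟨c, hc, hc2⟩ := h2
      have := hc y hy hxy
      have h3 := (ENNReal.lt_div_iff_mul_lt (Or.inl h0) (Or.inl (edist_ne_top _ _))).1 hc2
      exact absurd this (not_le.2 h3)
  rw [edist_dist, edist_dist] at key
  have := ENNReal.toReal_mono (ENNReal.mul_ne_top hne ENNReal.ofReal_ne_top) key
  rwa [ENNReal.toReal_mul, ENNReal.toReal_ofReal dist_nonneg,
    ENNReal.toReal_ofReal dist_nonneg] at this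

theorem norm_le_rate {j : Fin (D.K + 1)} {x : Euc m} (hx : x ∈ D.U j) (hp : x ≠ D.p)
    (ξ : Euc m) : ‖ξ‖ ≤ (D.rate D.T (D.U j) x).toReal * ‖fderiv ℝ D.T x ξ‖ := by
  refine norm_le_fderiv_of_eventually (H.strict_T hx).hasFDerivAt ?_ ξ
  have hδ : 0 < min D.ε₁ (0.1 * dist x D.p) := by
    have := dist_pos.2 hp
    have := H.std.ε₁_pos
    positivity
  filter_upwards [(H.smooth.isOpen_U j).mem_nhds hx, Metric.closedBall_mem_nhds x hδ] with y hy hy'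
  rw [← dist_eq_norm, ← dist_eq_norm]
  refine H.dist_le_rate hx hp hy ?_
  rwa [dist_comm, ← Metric.mem_closedBall]

theorem nontrivial_E : Nontrivial (Euc m) := by
  have : Nonempty (Fin m) := ⟨⟨0, H.std.dim_pos⟩⟩
  infer_instance

/-- Away from `p` this follows from the rate being at most one. At `p`, where the radius in `rate`
degenerates to zero, it follows by continuity of the derivative. -/
theorem norm_le {j : Fin (D.K + 1)} {x : Euc m} (hx : x ∈ D.U j) (ξ : Euc m) :
    ‖ξ‖ ≤ ‖fderiv ℝ D.T x ξ‖ := by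
  have h1 : ∀ y ∈ D.U j, y ≠ D.p → ‖ξ‖ ≤ ‖fderiv ℝ D.T y ξ‖ := by
    intro y hy hp
    refine (H.norm_le_rate hy hp ξ).trans ?_
    refine mul_le_of_le_one_left (norm_nonneg _) ?_
    exact ENNReal.toReal_mono ENNReal.one_ne_top (H.rates.rate_le_one j y hy hp)
  by_cases hp : x = D.p
  · have := H.nontrivial_E
    have hc : ContinuousAt (fun y => ‖fderiv ℝ D.T y ξ‖) x := by
      have h2 : ContinuousAt (fderiv ℝ (D.ext j)) x :=
        (H.contDiffAt (H.U_subset_V j hx)).continuousAt_fderiv one_ne_zero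
      have h3 : ContinuousAt (fderiv ℝ D.T) x := h2.congr (H.T_eventuallyEq hx).fderiv
      exact (h3.clm_apply continuousAt_const).norm
    have : (𝓝[≠] x).NeBot := inferInstance
    have hc' := hc.tendsto.mono_left (nhdsWithin_le_nhds (s := {x}ᶜ))
    refine ge_of_tendsto hc' ?_
    filter_upwards [self_mem_nhdsWithin,
      nhdsWithin_le_nhds ((H.smooth.isOpen_U j).mem_nhds hx)] with y hy hyU
    exact h1 y hyU (hp ▸ hy)
  · exact h1 x hx hp

theorem exists_equiv {j : Fin (D.K + 1)} {x : Euc m} (hx : x ∈ D.U j) :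
    ∃ A : Euc m ≃L[ℝ] Euc m, HasStrictFDerivAt D.T (A : Euc m →L[ℝ] Euc m) x := by
  obtain ⟨A, hA, -⟩ := exists_equiv_of_norm_le (c := 1) (by simpa using H.norm_le hx)
  exact ⟨A, by rw [hA]; exact H.strict_T hx⟩

theorem isOpen_image {j : Fin (D.K + 1)} {U : Set (Euc m)} (hU : IsOpen U) (h : U ⊆ D.U j) :
    IsOpen (D.T '' U) :=
  isOpen_image_of_strict hU fun _ hu => H.exists_equiv (h hu)

theorem isOpen_TU (j : Fin (D.K + 1)) : IsOpen (D.T '' D.U j) :=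
  H.isOpen_image (H.smooth.isOpen_U j) Subset.rfl

theorem detInv_eq {j : Fin (D.K + 1)} {x : Euc m} (hx : x ∈ D.U j) :
    D.detInv j (D.T x) = (fderiv ℝ D.T x).det⁻¹ := by
  obtain ⟨A, hA⟩ := H.exists_equiv hx
  have := hasFDerivAt_invFunOn (H.smooth.isOpen_U j) (H.smooth.injOn j)
    (fun u hu => H.exists_equiv hu) hx hA.hasFDerivAt
  rw [detInv, this.fderiv, hA.hasFDerivAt.fderiv, ContinuousLinearMap.det, ContinuousLinearMap.det]
  have h1 := LinearEquiv.det_symm_mul_det A.toLinearEquiv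
  exact eq_inv_of_mul_eq_one_left h1

theorem invFunOn_eq {j : Fin (D.K + 1)} {x : Euc m} (hx : x ∈ D.U j) :
    Function.invFunOn D.T (D.U j) (D.T x) = x :=
  (H.smooth.injOn j).leftInvOn_invFunOn hx

theorem det_ne_zero {j : Fin (D.K + 1)} {x : Euc m} (hx : x ∈ D.U j) :
    (fderiv ℝ D.T x).det ≠ 0 := by
  obtain ⟨A, hA⟩ := H.exists_equiv hx
  rw [hA.hasFDerivAt.fderiv]
  exact A.toLinearEquiv.isUnit_det'.ne_zero

/-- Otherwise `U 0` would lie in `R`, and `R` would be open and closed in a connected noncompact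
space. The point found here makes `s` positive. -/
theorem exists_lt_sOut : ∃ x ∈ D.U 0 \ D.R, x ≠ D.p := by
  by_contra! h
  have h1 : D.U 0 ⊆ D.R := by
    intro x hx
    by_contra hR
    exact hR ((h x ⟨hx, hR⟩) ▸ H.rates.mem_R)
  have h2 : closure D.R ⊆ D.R := H.rates.closure_R.trans (H.TR_subset_U.trans h1)
  have h3 : IsClopen D.R := ⟨closure_subset_iff_isClosed.1 h2, H.rates.isOpen_R⟩
  rcases isClopen_iff.1 h3 with h4 | h4
  · exact absurd H.rates.mem_R (by rw [h4]; simp)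
  · have := H.nontrivial_E
    have h5 : D.M = univ :=
      eq_univ_of_univ_subset (h4 ▸ (H.R_subset_U.trans (H.U_subset_M 0)))
    have := H.std.compact
    rw [h5] at this
    exact noncompact_univ (Euc m) this

/-- Everything the analysis uses of the rate hypothesis: `s ^ α + λ < 1`, the comparison of `λ` with
the ratio of unit balls, and the bound on the volume of the cuts inside balls. -/
theorem exists_lam : 0 < D.sr ∧ D.sr < 1 ∧ D.sOut = ENNReal.ofReal D.sr ∧
    ∃ ε₂ lam : ℝ, 0 < ε₂ ∧ 0 < lam ∧ D.sr ^ D.α + lam < 1 ∧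
      3 * (D.sr * gratio m) ≤ lam * (1 - D.sr) ∧
      ∀ r > 0, ∀ v ∈ D.M, ∀ ρ, (1 - D.sr) * r ≤ ρ → ρ ≤ (1 - D.sr) * ε₂ →
        ∑ j, volume (D.cut j r ∩ Metric.closedBall v ρ) ≤
          ENNReal.ofReal (lam / 2 * ((1 - D.sr) * r / ρ) ^ D.α * (gam m * ρ ^ m)) := by
  obtain ⟨ε₂, hε₂, ⟨η₀, h0, h1, hη⟩, -⟩ := H.rates.rates
  have hη1 : D.sOut ^ D.α + D.lam ε₂ < 1 :=
    hη.trans_lt (by rw [← ENNReal.ofReal_one]; exact (ENNReal.ofReal_lt_ofReal_iff one_pos).2 h1)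
  have hα := H.std.α_pos
  have hs1 : D.sOut < 1 := by
    by_contra! h
    have := ENNReal.rpow_le_rpow h hα.le
    rw [ENNReal.one_rpow] at this
    exact absurd (this.trans le_self_add) (not_le.2 hη1)
  have hst : D.sOut ≠ ∞ := (hs1.trans ENNReal.one_lt_top).ne
  obtain ⟨x, hx, hxp⟩ := H.exists_lt_sOut
  have hs0 : 0 < D.sOut := by
    refine (H.rates.rate_pos 0 x hx.1 hxp).trans_le ?_
    exact le_iSup₂_of_le 0 x (le_iSup_of_le hx le_rfl)
  have hsr0 : 0 < D.sr := ENNReal.toReal_pos hs0.ne' hst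
  have hsr1 : D.sr < 1 := by
    have := (ENNReal.toReal_lt_toReal hst ENNReal.one_ne_top).2 hs1
    rwa [ENNReal.toReal_one] at this
  have hse : D.sOut = ENNReal.ofReal D.sr := (ENNReal.ofReal_toReal hst).symm
  have hlt : D.lam ε₂ ≠ ∞ := (lt_of_le_of_lt le_add_self hη1).ne_top
  have hle : D.lam ε₂ = ENNReal.ofReal (D.lam ε₂).toReal := (ENNReal.ofReal_toReal hlt).symm
  set l := (D.lam ε₂).toReal with hl
  have hgm := gam_pos m
  have hgm1 := gam_pos (m - 1)
  have hq : 0 < 1 - D.sr := by linarith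
  have h3 : 3 * (D.sr * gratio m) ≤ l * (1 - D.sr) := by
    have h4 : 3 * D.sOut * unitBallVol (m - 1) / ((1 - D.sOut) * unitBallVol m) ≤ D.lam ε₂ :=
      le_max_right _ _
    rw [hle, hse, ← ofReal_gam, ← ofReal_gam, ← ENNReal.ofReal_one,
      ← ENNReal.ofReal_sub _ hsr0.le, show (3 : ℝ≥0∞) = ENNReal.ofReal 3 by simp,
      ← ENNReal.ofReal_mul (by norm_num), ← ENNReal.ofReal_mul (by positivity),
      ← ENNReal.ofReal_mul (by positivity), ← ENNReal.ofReal_div_of_pos (by positivity),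
      ENNReal.ofReal_le_ofReal_iff ENNReal.toReal_nonneg, div_le_iff₀ (by positivity)] at h4
    rw [gratio, ← mul_div_assoc, ← mul_div_assoc, div_le_iff₀ hgm]
    linarith
  have hl0 : 0 < l := by
    by_contra! h
    have := gratio_pos m
    have : 0 < 3 * (D.sr * gratio m) := by positivity
    nlinarith
  refine ⟨hsr0, hsr1, hse, ε₂, l, hε₂, hl0, ?_, h3, ?_⟩
  · rw [hse, hle, ENNReal.ofReal_rpow_of_pos hsr0, ← ENNReal.ofReal_add (by positivity) hl0.le,
      ← ENNReal.ofReal_one] at hη1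
    exact (ENNReal.ofReal_lt_ofReal_iff one_pos).1 hη1
  · intro r hr v hv ρ h5 h6
    have hρ : 0 < ρ := lt_of_lt_of_le (by positivity) h5
    -- A radius `ρ ≥ (1 - s) r` is read as `(1 - s) ε₀` with `ε₀ ≥ r`, to which the definition of
    -- `λ` applies.
    set ε₀ := ρ / (1 - D.sr) with hε₀
    have hρe : ρ = (1 - D.sr) * ε₀ := by rw [hε₀]; field_simp
    have hε₀0 : 0 < ε₀ := by positivity
    have hre : r ≤ ε₀ := by rw [hε₀, le_div_iff₀ hq]; linarith
    have hε₀2 : ε₀ ≤ ε₂ := by rw [hε₀, div_le_iff₀ hq]; linarith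
    have h7 : 2 * (D.GUx v r ε₀ / ENNReal.ofReal (r ^ D.α) * ENNReal.ofReal (ε₀ ^ D.α)) ≤
        D.lam ε₂ := by
      refine le_trans ?_ (le_max_left _ _)
      gcongr
      refine le_iSup₂_of_le ε₀ ⟨hε₀0, hε₀2⟩ (le_iSup₂_of_le r ⟨hr, hre⟩ ?_)
      gcongr
      exact le_iSup₂_of_le v hv le_rfl
    have hrα : 0 < r ^ D.α := Real.rpow_pos_of_pos hr _
    have hεα : 0 < ε₀ ^ D.α := Real.rpow_pos_of_pos hε₀0 _
    have h8 : D.GUx v r ε₀ = (∑ j, volume (D.cut j r ∩ Metric.closedBall v ρ)) /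
        ENNReal.ofReal (gam m * ρ ^ m) := by
      rw [GUx, ENNReal.div_eq_inv_mul, Finset.mul_sum]
      refine Finset.sum_congr rfl fun j _ => ?_
      rw [ENNReal.div_eq_inv_mul]
      have : D.sOut.toReal = D.sr := rfl
      rw [this, ← hρe, volume_closedBall_eq v hρ.le]
      rfl
    set X := ∑ j, volume (D.cut j r ∩ Metric.closedBall v ρ) with hX
    have hXt : X ≠ ∞ := by
      refine (ENNReal.sum_lt_top.2 fun j _ => ?_).ne
      exact (measure_mono inter_subset_right).trans_lt measure_closedBall_lt_top
    rw [h8, hle, ← ENNReal.ofReal_toReal hXt, ← ENNReal.ofReal_div_of_pos (by positivity),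
      ← ENNReal.ofReal_div_of_pos hrα, ← ENNReal.ofReal_mul (by positivity),
      show (2 : ℝ≥0∞) = ENNReal.ofReal 2 by simp, ← ENNReal.ofReal_mul (by norm_num),
      ENNReal.ofReal_le_ofReal_iff hl0.le] at h7
    rw [← ENNReal.ofReal_toReal hXt]
    refine ENNReal.ofReal_le_ofReal ?_
    have e : ((1 - D.sr) * r / ρ) ^ D.α = r ^ D.α / ε₀ ^ D.α := by
      rw [← Real.div_rpow hr.le hε₀0.le]; congr 1; rw [hρe]; field_simp
    rw [e]
    have h9 : 0 < gam m * ρ ^ m := by positivity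
    have h10 : X.toReal = (2 * (X.toReal / (gam m * ρ ^ m) / r ^ D.α * ε₀ ^ D.α)) / 2 *
        (r ^ D.α / ε₀ ^ D.α) * (gam m * ρ ^ m) := by field_simp
    rw [h10]
    gcongr

theorem norm_le_sr {j : Fin (D.K + 1)} {x : Euc m} (hx : x ∈ D.U j) (hR : x ∉ D.R)
    (ξ : Euc m) : ‖ξ‖ ≤ D.sr * ‖fderiv ℝ D.T x ξ‖ := by
  have hp : x ≠ D.p := fun h => hR (h ▸ H.rates.mem_R)
  refine (H.norm_le_rate hx hp ξ).trans ?_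
  obtain ⟨-, -, hse, -⟩ := H.exists_lam
  gcongr
  refine ENNReal.toReal_mono (by rw [hse]; exact ENNReal.ofReal_ne_top) ?_
  exact le_iSup₂_of_le j x (le_iSup_of_le ⟨hx, hR⟩ le_rfl)

end System
end PiecewiseMap

/-! ### Inverse branches near the complement of `R`, and the cuts. -/

namespace PiecewiseMap
variable {m : ℕ} {D : PiecewiseMap m} {I Cξ : ℝ}

namespace System
variable (H : D.System I Cξ)
include H

/-- The closures of the finitely many pieces are compact in the domains of the extensions, so one
radius serves all their points. -/
theorem exists_holder : ∃ ρ₀ C : ℝ, 0 < ρ₀ ∧ 0 ≤ C ∧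
    (∀ j, ∀ v ∈ D.U j, Metric.closedBall v ρ₀ ⊆ D.V j) ∧
    ∀ j, ∀ v ∈ D.U j, ∀ u, dist u v ≤ ρ₀ →
      ‖fderiv ℝ (D.ext j) u - fderiv ℝ (D.ext j) v‖ ≤ C * dist u v ^ D.α := by
  have h1 : ∀ j, ∃ ρ > 0, Metric.cthickening ρ (closure (D.U j)) ⊆ D.V j := fun j =>
    (H.std.compact.of_isClosed_subset isClosed_closure
      (H.closure_U_subset_M j)).exists_cthickening_subset_open (H.smooth.isOpen_V j)
      (H.smooth.closure_subset j)
  choose ρ hρ hρV using h1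
  choose C hC using fun j => (H.smooth.smooth j).2
  have hball : ∀ j, ∀ v ∈ D.U j,
      Metric.closedBall v (Finset.univ.inf' Finset.univ_nonempty ρ) ⊆ D.V j := by
    intro j v hv u hu
    refine hρV j (Metric.mem_cthickening_of_dist_le u v _ _ (subset_closure hv) ?_)
    exact (Metric.mem_closedBall.1 hu).trans (Finset.inf'_le _ (Finset.mem_univ j))
  refine ⟨Finset.univ.inf' Finset.univ_nonempty ρ, ∑ j, |C j|, ?_, by positivity, hball, ?_⟩
  · rw [Finset.lt_inf'_iff]
    exact fun j _ => hρ j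
  · intro j v hv u hu
    refine (hC j u (hball j v hv hu) v (H.U_subset_V j hv)).trans ?_
    gcongr
    exact (le_abs_self _).trans
      (Finset.single_le_sum (f := fun j => |C j|) (fun i _ => abs_nonneg _) (Finset.mem_univ j))

/-- Inverse branches contract near the complement of `R`. -/
theorem exists_local {s' : ℝ} (hs : D.sr < s') (hs1 : s' < 1) : ∃ r₀ C : ℝ, 0 < r₀ ∧ r₀ ≤ 1 ∧ 0 ≤ C ∧
    (∀ j, ∀ v ∈ D.U j, v ∉ D.R → ∀ x, dist x (D.T v) ≤ r₀ →
      ∃ u ∈ D.V j, D.ext j u = x ∧ dist u v ≤ s' * dist x (D.T v)) ∧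
    (∀ j, ∀ v ∈ D.U j, v ∉ D.R → ∀ r ≤ r₀, ∀ x, dist x (D.T v) < r →
      (x ∉ Metric.cthickening r (frontier (D.T '' D.U j)) ∨
        D.T v ∉ Metric.cthickening r (frontier (D.T '' D.U j))) →
      ∃ u ∈ D.U j, D.T u = x ∧ dist u v ≤ s' * dist x (D.T v)) ∧
    (∀ j, ∀ v ∈ D.U j, ∀ r ≤ r₀, ∀ u, dist u v ≤ r → u ∈ D.V j ∧
      |(fderiv ℝ (D.ext j) u).det| ≤ (1 + C * r ^ D.α) * |(fderiv ℝ (D.ext j) v).det| ∧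
      (fderiv ℝ (D.ext j) u).det ≠ 0) := by
  obtain ⟨hs0, -, -, -⟩ := H.exists_lam
  obtain ⟨ρ₀, C, hρ₀, hC, hball, hhol⟩ := H.exists_holder
  have hα := H.std.α_pos
  have hs'0 : 0 < s' := hs0.trans hs
  have hgap : 0 < D.sr⁻¹ - s'⁻¹ := sub_pos.2 (inv_strictAnti₀ hs0 hs)
  -- Below this radius the oscillation of the derivative stays within the gap between the rates `s`
  -- and `s'`.
  obtain ⟨r₁, hr₁, hr₁C⟩ : ∃ r₁ > 0, C * r₁ ^ D.α ≤ min (D.sr⁻¹ - s'⁻¹) (1 / 2) := by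
    have h1 : Tendsto (fun r : ℝ => C * r ^ D.α) (𝓝[>] 0) (𝓝 0) := by
      have h2 : ContinuousAt (fun r : ℝ => C * r ^ D.α) 0 :=
        continuousAt_const.mul (Real.continuousAt_rpow_const _ _ (Or.inr hα.le))
      have h3 := h2.tendsto
      rw [Real.zero_rpow hα.ne', mul_zero] at h3
      exact h3.mono_left nhdsWithin_le_nhds
    have h2 : ∀ᶠ r in 𝓝[>] (0 : ℝ), C * r ^ D.α < min (D.sr⁻¹ - s'⁻¹) (1 / 2) :=
      h1.eventually (gt_mem_nhds (by positivity))
    obtain ⟨r, hr, hr0⟩ := (h2.and self_mem_nhdsWithin).exists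
    exact ⟨r, hr0, hr.le⟩
  set r₀ := min (min ρ₀ r₁) 1 with hr₀
  have hr₀0 : 0 < r₀ := by positivity
  have hr₀ρ : r₀ ≤ ρ₀ := (min_le_left _ _).trans (min_le_left _ _)
  have hr₀r : r₀ ≤ r₁ := (min_le_left _ _).trans (min_le_right _ _)
  have hclose : ∀ j, ∀ v ∈ D.U j, ∀ u, ∀ r ≤ r₀, dist u v ≤ r →
      ‖fderiv ℝ (D.ext j) u - fderiv ℝ (D.ext j) v‖ ≤ C * r ^ D.α ∧
        C * r ^ D.α ≤ min (D.sr⁻¹ - s'⁻¹) (1 / 2) := by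
    intro j v hv u r hr hu
    have hr0 : 0 ≤ r := dist_nonneg.trans hu
    constructor
    · refine (hhol j v hv u (hu.trans (hr.trans hr₀ρ))).trans ?_
      gcongr
    · refine le_trans ?_ hr₁C
      gcongr
      exact hr.trans hr₀r
  have hnle : ∀ j, ∀ v ∈ D.U j, ∀ ξ, ‖ξ‖ ≤ ‖fderiv ℝ (D.ext j) v ξ‖ := by
    intro j v hv
    rw [← H.fderiv_T hv]
    exact H.norm_le hv
  have hnles : ∀ j, ∀ v ∈ D.U j, v ∉ D.R → ∀ ξ, ‖ξ‖ ≤ D.sr * ‖fderiv ℝ (D.ext j) v ξ‖ := by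
    intro j v hv
    rw [← H.fderiv_T hv]
    exact H.norm_le_sr hv
  refine ⟨r₀, 3 ^ m * C, hr₀0, min_le_right _ _, by positivity, ?_, ?_, ?_⟩
  · intro j v hv hR x hx
    have hTv : D.T v = D.ext j v := (H.smooth.ext_eq j hv).symm
    rw [hTv] at hx ⊢
    have hle : s' * dist x (D.ext j v) ≤ r₀ := by nlinarith [dist_nonneg (x := x) (y := D.ext j v)]
    obtain ⟨u, hu, hux⟩ := exists_preimage_of_close (F := D.ext j) (F' := fderiv ℝ (D.ext j))
      (v := v) (x := x) (c := C * r₀ ^ D.α) hs0 hs'0 (hnles j v hv hR)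
      (fun u hu => (H.strict (hball j v hv ((Metric.closedBall_subset_closedBall
        (hle.trans hr₀ρ)) hu))).hasFDerivAt)
      (fun u hu => (hclose j v hv u r₀ le_rfl ((Metric.mem_closedBall.1 hu).trans hle)).1)
      (by positivity) ((hclose j v hv v r₀ le_rfl (by rw [dist_self]; exact hr₀0.le)).2.trans
        (min_le_left _ _))
    exact ⟨u, hball j v hv (Metric.closedBall_subset_closedBall (hle.trans hr₀ρ) hu), hux, hu⟩
  · intro j v hv hR r hr x hx hcut
    have hxv : dist (D.T v) x < r := by rwa [dist_comm]
    have hseg : segment ℝ (D.T v) x ⊆ D.T '' D.U j :=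
      segment_subset_of_frontier (H.isOpen_TU j) ⟨v, hv, rfl⟩ hxv hcut.symm
    have hgv := H.invFunOn_eq hv
    obtain ⟨u, hu, rfl⟩ := hseg (right_mem_segment ℝ _ _)
    refine ⟨u, hu, rfl, ?_⟩
    -- The inverse branch is 1-Lipschitz along the segment, so its values stay in the ball where the
    -- derivative varies little; only then can the rate `s'` be used.
    have hdist : ∀ z ∈ segment ℝ (D.T v) (D.T u),
        dist (Function.invFunOn D.T (D.U j) z) v ≤ r₀ := by
      intro z hz
      have hsub : segment ℝ z (D.T v) ⊆ segment ℝ (D.T v) (D.T u) :=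
        (convex_segment _ _).segment_subset hz (left_mem_segment ℝ _ _)
      have h1 := dist_invFunOn_le (H.smooth.isOpen_U j) (H.smooth.injOn j)
        (fun u hu => H.strict_T hu) (c₀ := 1) (fun u hu => by simpa using H.norm_le hu)
        zero_le_one (hsub.trans hseg) (fun w hw ξ => by
          obtain ⟨a, ha, rfl⟩ := hseg (hsub hw)
          rw [H.invFunOn_eq ha]
          simpa using H.norm_le ha ξ)
      rw [hgv, one_mul] at h1
      have h2 : dist z (D.T v) ≤ dist (D.T u) (D.T v) := by
        have : z ∈ Metric.closedBall (D.T v) (dist (D.T u) (D.T v)) :=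
          (convex_closedBall _ _).segment_subset (by simp) (by simp) hz
        exact this
      linarith
    have h1 := dist_invFunOn_le (H.smooth.isOpen_U j) (H.smooth.injOn j)
        (fun u hu => H.strict_T hu) (c₀ := 1) (fun u hu => by simpa using H.norm_le hu)
        hs'0.le hseg (fun z hz ξ => by
          obtain ⟨a, ha, rfl⟩ := hseg hz
          have h2 := hdist _ hz
          rw [H.invFunOn_eq ha] at h2 ⊢
          obtain ⟨h3, h4⟩ := hclose j v hv a r₀ le_rfl h2
          rw [H.fderiv_T ha]
          exact norm_le_of_close hs0 hs'0 (hnles j v hv hR) h3 (h4.trans (min_le_left _ _)) ξ)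
    rw [hgv, H.invFunOn_eq hu] at h1
    rwa [dist_comm u, dist_comm (D.T u)]
  · intro j v hv r hr u hu
    obtain ⟨h1, h2⟩ := hclose j v hv u r hr hu
    refine ⟨hball j v hv (Metric.closedBall_subset_closedBall (hr.trans hr₀ρ) hu), ?_, ?_⟩
    · have := abs_det_le_of_close (hnle j v hv) h1
        (h2.trans ((min_le_right _ _).trans (by norm_num)))
      rw [finrank_euclideanSpace_fin] at this
      rw [mul_assoc]
      exact this
    · have h3 : ∀ ξ, ‖ξ‖ ≤ 2 * ‖fderiv ℝ (D.ext j) u ξ‖ :=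
        norm_le_of_close one_pos two_pos (by simpa using hnle j v hv) h1
          (h2.trans ((min_le_right _ _).trans (by norm_num)))
      obtain ⟨A, hA, -⟩ := exists_equiv_of_norm_le h3
      rw [← hA]
      exact A.toLinearEquiv.isUnit_det'.ne_zero

theorem measurableSet_cut (j : Fin (D.K + 1)) (r : ℝ) : MeasurableSet (D.cut j r) := by
  have h1 : IsOpen (D.V j ∩ D.ext j ⁻¹' (Metric.cthickening r (frontier (D.T '' D.U j)))ᶜ) :=
    (H.smooth.smooth j).1.continuousOn.isOpen_inter_preimage (H.smooth.isOpen_V j)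
      Metric.isClosed_cthickening.isOpen_compl
  have h2 : D.cut j r = D.V j \
      (D.V j ∩ D.ext j ⁻¹' (Metric.cthickening r (frontier (D.T '' D.U j)))ᶜ) := by
    ext x; simp only [cut, mem_inter_iff, mem_preimage, Set.mem_sdiff, mem_compl_iff]; tauto
  rw [h2]
  exact (H.smooth.isOpen_V j).measurableSet.diff h1.measurableSet

theorem hasFDerivAt_inv {j : Fin (D.K + 1)} {v : Euc m} (hv : v ∈ D.U j) :
    ∃ A : Euc m ≃L[ℝ] Euc m, HasFDerivAt D.T (A : Euc m →L[ℝ] Euc m) v ∧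
      HasFDerivAt (Function.invFunOn D.T (D.U j)) (A.symm : Euc m →L[ℝ] Euc m) (D.T v) := by
  obtain ⟨A, hA⟩ := H.exists_equiv hv
  exact ⟨A, hA.hasFDerivAt, hasFDerivAt_invFunOn (H.smooth.isOpen_U j) (H.smooth.injOn j)
      (fun u hu => H.exists_equiv hu) hv hA.hasFDerivAt⟩

/-- The inverse branch is continuous at the points of `T '' U j`. A boundary point sent there by the
extension would, as a limit of points of `U j`, coincide with the interior preimage. -/
theorem ext_notMem_image {j : Fin (D.K + 1)} {x : Euc m} (hx : x ∈ closure (D.U j))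
    (hxU : x ∉ D.U j) : D.ext j x ∉ D.T '' D.U j := by
  rintro ⟨v, hv, hvx⟩
  have hc : ContinuousAt (D.ext j) x := (H.contDiffAt (H.smooth.closure_subset j hx)).continuousAt
  obtain ⟨A, -, hA⟩ := H.hasFDerivAt_inv hv
  have hg := hA.continuousAt
  have : (𝓝[D.U j] x).NeBot := mem_closure_iff_nhdsWithin_neBot.1 hx
  have h0 : Tendsto (D.ext j) (𝓝[D.U j] x) (𝓝 (D.T v)) := by
    rw [hvx]; exact hc.tendsto.mono_left nhdsWithin_le_nhds
  have h1 := hg.tendsto.comp h0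
  rw [H.invFunOn_eq hv] at h1
  have h2 : Tendsto (Function.invFunOn D.T (D.U j) ∘ D.ext j) (𝓝[D.U j] x) (𝓝 x) := by
    refine (tendsto_nhdsWithin_of_tendsto_nhds tendsto_id).congr' ?_
    filter_upwards [self_mem_nhdsWithin] with u hu
    rw [Function.comp_apply, H.smooth.ext_eq j hu, H.invFunOn_eq hu, id]
  have h3 : v = x := tendsto_nhds_unique h1 h2
  exact hxU (h3 ▸ hv)

/-- The boundary of a piece lies in its cut at every scale. So the pieces without their cuts,
together with the cuts, cover `M`, and the boundaries turn out to be null. -/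
theorem frontier_subset_cut (j : Fin (D.K + 1)) (r : ℝ) :
    frontier (D.U j) ⊆ D.cut j r := by
  intro x hx
  rw [(H.smooth.isOpen_U j).frontier_eq] at hx
  have hxV := H.smooth.closure_subset j hx.1
  have hc : ContinuousAt (D.ext j) x := (H.contDiffAt hxV).continuousAt
  have hcl : D.ext j x ∈ closure (D.ext j '' D.U j) := mem_closure_image hc hx.1
  rw [(H.smooth.ext_eq j).image_eq] at hcl
  have hmem : D.ext j x ∈ frontier (D.T '' D.U j) := by
    rw [(H.isOpen_TU j).frontier_eq]
    exact ⟨hcl, H.ext_notMem_image hx.1 hx.2⟩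
  have h3 : D.ext j x ∈ Metric.cthickening r (frontier (D.T '' D.U j)) :=
    Metric.self_subset_cthickening _ hmem
  exact ⟨hxV, h3⟩

end System
end PiecewiseMap

/-! ### The transfer operator on suprema and infima over balls. -/

/-- Infimum over balls. -/
noncomputable def ero {m : ℕ} (f : Euc m → ℝ≥0∞) (r : ℝ) (x : Euc m) : ℝ≥0∞ :=
  ⨅ y ∈ Metric.ball x r, f y

theorem ero_le {m : ℕ} (f : Euc m → ℝ≥0∞) {r : ℝ} {x y : Euc m} (h : dist y x < r) :
    ero f r x ≤ f y :=
  iInf₂_le (f := fun z (_ : z ∈ Metric.ball x r) => f z) y h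

theorem ero_le_self {m : ℕ} (f : Euc m → ℝ≥0∞) {r : ℝ} (hr : 0 < r) (x : Euc m) :
    ero f r x ≤ f x := ero_le f (by simpa using hr)

theorem measurable_ero {m : ℕ} (f : Euc m → ℝ≥0∞) (r : ℝ) : Measurable (ero f r) := by
  refine UpperSemicontinuous.measurable fun x t ht => ?_
  obtain ⟨y, hy, hyt⟩ : ∃ y, dist y x < r ∧ f y < t := by
    simpa only [ero, iInf_lt_iff, Metric.mem_ball, exists_prop] using ht
  have : ∀ᶠ z in 𝓝 x, dist y z < r := by
    have hc : Continuous fun z : Euc m => dist y z := by fun_prop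
    exact hc.continuousAt.eventually (gt_mem_nhds hy)
  filter_upwards [this] with z hz
  exact (ero_le f hz).trans_lt hyt

theorem sum_lintegral_le {α ι : Type*} [MeasurableSpace α] (μ : Measure α) (s : Finset ι)
    (f : ι → α → ℝ≥0∞) : ∑ i ∈ s, ∫⁻ x, f i x ∂μ ≤ ∫⁻ x, ∑ i ∈ s, f i x ∂μ := by
  classical
  induction s using Finset.induction_on with
  | empty => simp
  | insert i s hi ih =>
    simp only [Finset.sum_insert hi]
    exact (add_le_add le_rfl ih).trans (le_lintegral_add _ _)

namespace PiecewiseMap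
variable {m : ℕ} {D : PiecewiseMap m} {I Cξ : ℝ}

/-- The contribution of one branch to the transfer operator. -/
noncomputable def branch (D : PiecewiseMap m) (j : Fin (D.K + 1)) (f : Euc m → ℝ≥0∞) :
    Euc m → ℝ≥0∞ :=
  (D.T '' D.U j).indicator fun x =>
    ENNReal.ofReal |D.detInv j x| * f (Function.invFunOn D.T (D.U j) x)

/-- The transfer operator of `T`. -/
noncomputable def transfer (D : PiecewiseMap m) (f : Euc m → ℝ≥0∞) (x : Euc m) : ℝ≥0∞ :=
  ∑ j, D.branch j f x

/-- Volume near the cuts. -/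
noncomputable def cutMeasure (D : PiecewiseMap m) (r : ℝ) : Measure (Euc m) :=
  ∑ j, volume.restrict (D.cut j r ∩ Metric.thickening 1 D.M)

theorem cutMeasure_le (r : ℝ) (A : Set (Euc m)) (hA : MeasurableSet A) :
    D.cutMeasure r A ≤ ∑ j, volume (D.cut j r ∩ A) := by
  rw [cutMeasure, Measure.coe_finsetSum, Finset.sum_apply]
  refine Finset.sum_le_sum fun j _ => ?_
  rw [Measure.restrict_apply hA, inter_comm A, inter_assoc]
  exact measure_mono (inter_subset_inter_right _ inter_subset_right)

namespace System
variable (H : D.System I Cξ)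
include H

theorem branch_apply {j : Fin (D.K + 1)} {v : Euc m} (hv : v ∈ D.U j) (f : Euc m → ℝ≥0∞) :
    D.branch j f (D.T v) = ENNReal.ofReal |(fderiv ℝ D.T v).det|⁻¹ * f v := by
  rw [branch, indicator_of_mem (mem_image_of_mem _ hv), H.detInv_eq hv, H.invFunOn_eq hv, abs_inv]

theorem isFiniteMeasure_cutMeasure (r : ℝ) : IsFiniteMeasure (D.cutMeasure r) := by
  refine ⟨?_⟩
  rw [cutMeasure, Measure.coe_finsetSum, Finset.sum_apply]
  refine ENNReal.sum_lt_top.2 fun j _ => ?_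
  rw [Measure.restrict_apply_univ]
  refine (measure_mono inter_subset_right).trans_lt ?_
  exact (H.std.compact.isBounded.thickening).measure_lt_top

/-- One step of the dynamics, from above. -/
theorem exists_transfer_dil_le {s' : ℝ} (hs : D.sr < s') (hs1 : s' < 1) :
    ∃ r₀ C : ℝ, 0 < r₀ ∧ 0 ≤ C ∧ ∀ f : Euc m → ℝ≥0∞, (∀ x, x ∈ D.R → f x = 0) →
      ∀ r ∈ Ioc 0 r₀, ∫⁻ x, dil (D.transfer f) r x ≤ ENNReal.ofReal (1 + C * r ^ D.α) *
        ((∫⁻ x, dil f (s' * r) x) + ∫⁻ x, dil f (s' * r) x ∂D.cutMeasure r) := by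
  obtain ⟨hs0, -, -, -⟩ := H.exists_lam
  have hs'0 := hs0.trans hs
  obtain ⟨r₀, C, hr₀, hr₀1, hC, hsurj, hseg, hdet⟩ := H.exists_local hs hs1
  refine ⟨r₀, C, hr₀, hC, fun f hf r hr => ?_⟩
  have hc0 : 0 ≤ 1 + C * r ^ D.α := by have := Real.rpow_nonneg hr.1.le D.α; positivity
  set Φ : Euc m → ℝ≥0∞ := fun u => ENNReal.ofReal (1 + C * r ^ D.α) * dil f (s' * r) u with hΦ
  have hΦm : Measurable Φ := (measurable_dil _ _).const_mul _
  -- The admissible preimages under the extended branch: points of the piece itself, or points of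
  -- its cut.
  set W : Fin (D.K + 1) → Set (Euc m) := fun j => (D.U j ∪ D.cut j r) ∩
    (D.V j ∩ {u | (fderiv ℝ (D.ext j) u).det ≠ 0} ∩ Metric.thickening 1 D.M) with hW
  have hWm : ∀ j, MeasurableSet (W j) := fun j => by
    have h1 : Measurable fun u => (fderiv ℝ (D.ext j) u).det :=
      ContinuousLinearMap.continuous_det.measurable.comp (measurable_fderiv ℝ _)
    exact ((H.measurableSet_U j).union (H.measurableSet_cut j r)).inter
      (((H.smooth.isOpen_V j).measurableSet.inter
        (h1 (measurableSet_singleton 0).compl)).inter Metric.isOpen_thickening.measurableSet)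
  have hbranch : ∀ j, ∫⁻ x, dil (D.branch j f) r x ≤ ∫⁻ u in W j, Φ u := by
    intro j
    refine lintegral_le_of_forall_exists_preimage volume (F := D.ext j) (hWm j) ?_ hΦm ?_
    · rintro u ⟨-, ⟨huV, hu⟩, -⟩
      have hst := H.strict huV
      refine ⟨((fderiv ℝ (D.ext j) u).toContinuousLinearEquivOfDetNeZero hu), ?_⟩
      simpa using hst
    · intro x t ht
      obtain ⟨y, hyx, hty⟩ := (lt_dil_iff _).1 ht
      have hyU : y ∈ D.T '' D.U j := by
        by_contra h
        rw [branch, indicator_of_notMem h] at hty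
        exact absurd hty not_lt_zero
      obtain ⟨v, hv, rfl⟩ := hyU
      rw [H.branch_apply hv] at hty
      have hvR : v ∉ D.R := by
        intro h
        rw [hf v h, mul_zero] at hty
        exact absurd hty not_lt_zero
      rw [dist_comm] at hyx
      -- If `x` is near the frontier of the image, its preimage under the extension lies in the cut.
      -- Otherwise the segment from `T v` to `x` stays in the image, and the preimage lies in the
      -- piece.
      obtain ⟨u, huW, hux, huv⟩ : ∃ u, u ∈ D.U j ∪ D.cut j r ∧ D.ext j u = x ∧
          dist u v ≤ s' * dist x (D.T v) := by
        by_cases hcut : x ∈ Metric.cthickening r (frontier (D.T '' D.U j))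
        · obtain ⟨u, hu, h1, h2⟩ := hsurj j v hv hvR x (hyx.le.trans hr.2)
          exact ⟨u, Or.inr ⟨hu, by rw [mem_preimage, h1]; exact hcut⟩, h1, h2⟩
        · obtain ⟨u, hu, h1, h2⟩ := hseg j v hv hvR r hr.2 x hyx (Or.inl hcut)
          exact ⟨u, Or.inl hu, by rw [H.smooth.ext_eq j hu, h1], h2⟩
      have huv' : dist u v < s' * r := huv.trans_lt (by gcongr)
      have huvr : dist u v < r := huv'.trans_le (by nlinarith [hr.1])
      obtain ⟨huV, hd1, hd2⟩ := hdet j v hv r hr.2 u huvr.le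
      refine ⟨u, ⟨huW, ⟨huV, hd2⟩, ?_⟩, hux, ?_⟩
      · exact Metric.mem_thickening_iff.2 ⟨v, H.U_subset_M j hv, by linarith [hr.2]⟩
      · have hdv := H.det_ne_zero hv
        rw [← H.fderiv_T hv] at hd1
        calc t * ENNReal.ofReal |(fderiv ℝ (D.ext j) u).det|
            ≤ (ENNReal.ofReal |(fderiv ℝ D.T v).det|⁻¹ * f v) * ENNReal.ofReal
              ((1 + C * r ^ D.α) * |(fderiv ℝ D.T v).det|) := by gcongr
          _ = (ENNReal.ofReal |(fderiv ℝ D.T v).det|⁻¹ * ENNReal.ofReal |(fderiv ℝ D.T v).det|) *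
              (ENNReal.ofReal (1 + C * r ^ D.α) * f v) := by
            rw [ENNReal.ofReal_mul hc0]; ring
          _ = ENNReal.ofReal (1 + C * r ^ D.α) * f v := by
            rw [← ENNReal.ofReal_mul (by positivity), inv_mul_cancel₀ (abs_ne_zero.2 hdv),
              ENNReal.ofReal_one, one_mul]
          _ ≤ _ := by
            exact mul_le_mul_right (le_dil f (by rwa [dist_comm])) _
  calc ∫⁻ x, dil (D.transfer f) r x ≤ ∫⁻ x, ∑ j, dil (D.branch j f) r x := by
        refine lintegral_mono fun x => iSup₂_le fun y hy => ?_
        exact Finset.sum_le_sum fun j _ => le_dil _ hy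
    _ = ∑ j, ∫⁻ x, dil (D.branch j f) r x := lintegral_finsetSum _ fun j _ => measurable_dil _ _
    _ ≤ ∑ j, ((∫⁻ u in D.U j, Φ u) + ∫⁻ u in D.cut j r ∩ Metric.thickening 1 D.M, Φ u) := by
        refine Finset.sum_le_sum fun j _ => (hbranch j).trans ?_
        refine (lintegral_mono_set (t := D.U j ∪ (D.cut j r ∩ Metric.thickening 1 D.M)) ?_).trans
          (lintegral_union_le _ _ _)
        rintro u ⟨h1 | h1, h2⟩
        · exact Or.inl h1
        · exact Or.inr ⟨h1, h2.2⟩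
    _ = (∑ j, ∫⁻ u in D.U j, Φ u) + ∫⁻ u, Φ u ∂D.cutMeasure r := by
        rw [Finset.sum_add_distrib, cutMeasure, lintegral_finsetSum_measure]
    _ ≤ (∫⁻ u, Φ u) + ∫⁻ u, Φ u ∂D.cutMeasure r := by
        gcongr
        rw [← lintegral_finsetSum_measure]
        refine lintegral_mono' ?_ le_rfl
        have h1 := Measure.restrict_iUnion H.smooth.disjoint_U H.measurableSet_U (μ := volume)
        rw [Measure.sum_fintype] at h1
        rw [← h1]
        exact Measure.restrict_le_self
    _ = _ := by
        rw [hΦ, lintegral_const_mul _ (measurable_dil _ _),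
          lintegral_const_mul _ (measurable_dil _ _), mul_add]

/-- One step of the dynamics, from below. -/
theorem exists_ero_le_transfer {s' : ℝ} (hs : D.sr < s') (hs1 : s' < 1) :
    ∃ r₀ C : ℝ, 0 < r₀ ∧ 0 ≤ C ∧ ∀ f : Euc m → ℝ≥0∞, (∀ x, x ∈ D.R → f x = 0) →
      (∀ x, x ∉ D.M → f x = 0) → ∀ S, (∀ x, f x ≤ S) →
      ∀ r ∈ Ioc 0 r₀, ∫⁻ x, ero f (s' * r) x ≤
        ENNReal.ofReal (1 + C * r ^ D.α) * (∫⁻ x, ero (D.transfer f) r x) +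
          S * ∑ j, volume (D.cut j r ∩ D.M) := by
  obtain ⟨hs0, -, -, -⟩ := H.exists_lam
  have hs'0 := hs0.trans hs
  obtain ⟨r₀, C, hr₀, hr₀1, hC, hsurj, hseg, hdet⟩ := H.exists_local hs hs1
  refine ⟨r₀, C, hr₀, hC, fun f hf hfM S hS r hr => ?_⟩
  have hcp : 0 < 1 + C * r ^ D.α := by have := Real.rpow_nonneg hr.1.le D.α; positivity
  have hc0 := hcp.le
  have hsr : 0 < s' * r := mul_pos hs'0 hr.1
  set φ := ero f (s' * r) with hφ
  have hφf : ∀ x, φ x ≤ f x := ero_le_self f hsr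
  -- Only points off the cut are transported: around the image of such a point, every point within
  -- `r` has a preimage in the piece at distance less than `s' * r`.
  set G : Fin (D.K + 1) → Euc m → ℝ≥0∞ := fun j => (D.T '' (D.U j \ D.cut j r)).indicator fun x =>
    ENNReal.ofReal |D.detInv j x| * φ (Function.invFunOn D.T (D.U j) x) with hG
  have hGint : ∀ j, ∫⁻ x, G j x = ∫⁻ u in D.U j \ D.cut j r, φ u := by
    intro j
    have hms : MeasurableSet (D.U j \ D.cut j r) :=
      (H.measurableSet_U j).diff (H.measurableSet_cut j r)
    have hd : ∀ u ∈ D.U j \ D.cut j r,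
        HasFDerivWithinAt D.T (fderiv ℝ D.T u) (D.U j \ D.cut j r) u :=
      fun u hu => (H.strict_T hu.1).hasFDerivAt.hasFDerivWithinAt
    have hi : InjOn D.T (D.U j \ D.cut j r) := (H.smooth.injOn j).mono sdiff_subset
    rw [hG, lintegral_indicator (measurable_image_of_fderivWithin hms hd hi),
      lintegral_image_eq_lintegral_abs_det_fderiv_mul volume hms hd hi]
    refine setLIntegral_congr_fun hms fun u hu => ?_
    have hdu := H.det_ne_zero hu.1
    rw [H.detInv_eq hu.1, H.invFunOn_eq hu.1, ← mul_assoc, ← ENNReal.ofReal_mul (abs_nonneg _),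
      abs_inv, mul_inv_cancel₀ (abs_ne_zero.2 hdu), ENNReal.ofReal_one, one_mul]
  have hpt : ∀ x, ∑ j, G j x ≤ ENNReal.ofReal (1 + C * r ^ D.α) * ero (D.transfer f) r x := by
    intro x
    rw [ero, ENNReal.mul_iInf_of_ne (ENNReal.ofReal_pos.2 hcp).ne' ENNReal.ofReal_ne_top]
    refine le_iInf fun y => ?_
    rw [ENNReal.mul_iInf_of_ne (ENNReal.ofReal_pos.2 hcp).ne' ENNReal.ofReal_ne_top]
    refine le_iInf fun hy => ?_
    rw [transfer, Finset.mul_sum]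
    refine Finset.sum_le_sum fun j _ => ?_
    by_cases hx : x ∈ D.T '' (D.U j \ D.cut j r)
    · obtain ⟨v, hv, rfl⟩ := hx
      rw [hG]
      simp only
      rw [indicator_of_mem (mem_image_of_mem _ hv), H.detInv_eq hv.1, H.invFunOn_eq hv.1]
      by_cases hvR : v ∈ D.R
      · have : φ v = 0 := le_antisymm ((hφf v).trans (hf v hvR).le) zero_le
        rw [this, mul_zero]; exact zero_le
      · obtain ⟨u, hu, rfl, huv⟩ := hseg j v hv.1 hvR r hr.2 y hy (Or.inr fun h =>
          hv.2 ⟨H.U_subset_V j hv.1, by rw [mem_preimage, H.smooth.ext_eq j hv.1]; exact h⟩)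
        have huv' : dist u v < s' * r := huv.trans_lt (by gcongr; exact hy)
        have huvr : dist u v ≤ r := by
          exact huv'.le.trans (by nlinarith [hr.1])
        rw [H.branch_apply hu]
        obtain ⟨-, hd1, -⟩ := hdet j v hv.1 r hr.2 u huvr
        rw [← H.fderiv_T hv.1, ← H.fderiv_T hu] at hd1
        have hdu := abs_pos.2 (H.det_ne_zero hu)
        have hdv := abs_pos.2 (H.det_ne_zero hv.1)
        rw [← mul_assoc, ← ENNReal.ofReal_mul hc0, abs_inv]
        gcongr
        · rw [← div_eq_mul_inv, inv_eq_one_div, div_le_div_iff₀ hdv hdu]; linarith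
        · exact ero_le f huv'
    · rw [hG]
      simp only
      rw [indicator_of_notMem hx]
      exact zero_le
  have hcover : D.M ⊆ ⋃ j, ((D.U j \ D.cut j r) ∪ (D.cut j r ∩ D.M)) := by
    intro x hx
    have hx' := hx
    rw [H.smooth.cover] at hx
    obtain ⟨j, hj⟩ := mem_iUnion.1 hx
    refine mem_iUnion.2 ⟨j, ?_⟩
    by_cases hc : x ∈ D.cut j r
    · exact Or.inr ⟨hc, hx'⟩
    · refine Or.inl ⟨?_, hc⟩
      by_contra hU
      refine hc (H.frontier_subset_cut j r ?_)
      rw [(H.smooth.isOpen_U j).frontier_eq]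
      exact ⟨hj, hU⟩
  calc ∫⁻ x, φ x = ∫⁻ x in D.M, φ x := by
        refine (setLIntegral_eq_of_support_subset fun x hx => ?_).symm
        by_contra h
        exact hx (le_antisymm ((hφf x).trans (hfM x h).le) zero_le)
    _ ≤ ∑ j, ((∫⁻ x in D.U j \ D.cut j r, φ x) + ∫⁻ x in D.cut j r ∩ D.M, φ x) := by
        refine (lintegral_mono_set hcover).trans ((lintegral_iUnion_le _ _).trans ?_)
        rw [tsum_fintype]
        exact Finset.sum_le_sum fun j _ => lintegral_union_le _ _ _
    _ ≤ (∑ j, ∫⁻ x, G j x) + S * ∑ j, volume (D.cut j r ∩ D.M) := by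
        rw [Finset.sum_add_distrib, Finset.mul_sum]
        refine add_le_add (Finset.sum_le_sum fun j _ => (hGint j).ge)
          (Finset.sum_le_sum fun j _ => ?_)
        calc ∫⁻ x in D.cut j r ∩ D.M, φ x ≤ ∫⁻ x in D.cut j r ∩ D.M, S :=
              lintegral_mono fun x => (hφf x).trans (hS x)
          _ = _ := by rw [setLIntegral_const]
    _ ≤ _ := by
        gcongr
        refine (sum_lintegral_le _ _ _).trans ((lintegral_mono hpt).trans (le_of_eq ?_))
        rw [lintegral_const_mul _ (measurable_ero _ _)]

/-- The cuts have small volume. -/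
theorem exists_volume_cut_le : ∃ r₀ C : ℝ, 0 < r₀ ∧ 0 ≤ C ∧ ∀ r ∈ Ioc 0 r₀,
    ∑ j, volume (D.cut j r ∩ D.M) ≤ ENNReal.ofReal (C * r ^ D.α) := by
  obtain ⟨hs0, hs1, -, ε₂, lam, hε₂, hlam, -, -, hτ⟩ := H.exists_lam
  have hq : 0 < 1 - D.sr := by linarith
  -- The largest radius at which the volume of the cuts is controlled; `M` is covered by finitely
  -- many such balls.
  set ρ := (1 - D.sr) * ε₂ with hρ
  have hρ0 : 0 < ρ := by positivity
  obtain ⟨t, htM, htf, htc⟩ := H.std.compact.finite_cover_balls hρ0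
  have hγ := gam_pos m
  have hα := H.std.α_pos
  refine ⟨ε₂, htf.toFinset.card * (lam / 2 * (1 / ε₂) ^ D.α * (gam m * ρ ^ m)), hε₂,
    by positivity, fun r hr => ?_⟩
  have h1 : ∀ v ∈ t, ∑ j, volume (D.cut j r ∩ Metric.closedBall v ρ) ≤
      ENNReal.ofReal ((lam / 2 * (1 / ε₂) ^ D.α * (gam m * ρ ^ m)) * r ^ D.α) := by
    intro v hv
    refine (hτ r hr.1 v (htM hv) ρ (by rw [hρ]; gcongr; exact hr.2) le_rfl).trans
      (ENNReal.ofReal_le_ofReal (le_of_eq ?_))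
    have : (1 - D.sr) * r / ρ = (1 / ε₂) * r := by rw [hρ]; field_simp
    rw [this, Real.mul_rpow (by positivity) hr.1.le]
    ring
  calc ∑ j, volume (D.cut j r ∩ D.M)
      ≤ ∑ j, ∑ v ∈ htf.toFinset, volume (D.cut j r ∩ Metric.closedBall v ρ) := by
        refine Finset.sum_le_sum fun j _ => ?_
        refine (measure_mono (t := ⋃ v ∈ htf.toFinset, D.cut j r ∩ Metric.closedBall v ρ)
          ?_).trans (measure_biUnion_finset_le _ _)
        rintro x ⟨hx, hxM⟩
        obtain ⟨v, hv, hxv⟩ := mem_iUnion₂.1 (htc hxM)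
        exact mem_iUnion₂.2 ⟨v, htf.mem_toFinset.2 hv, hx, Metric.ball_subset_closedBall hxv⟩
    _ = ∑ v ∈ htf.toFinset, ∑ j, volume (D.cut j r ∩ Metric.closedBall v ρ) := Finset.sum_comm
    _ ≤ ∑ v ∈ htf.toFinset,
        ENNReal.ofReal ((lam / 2 * (1 / ε₂) ^ D.α * (gam m * ρ ^ m)) * r ^ D.α) :=
        Finset.sum_le_sum fun v hv => h1 v (htf.mem_toFinset.1 hv)
    _ = _ := by
      rw [Finset.sum_const, nsmul_eq_mul, mul_assoc (htf.toFinset.card : ℝ), ENNReal.ofReal_mul (Nat.cast_nonneg _),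
        ENNReal.ofReal_natCast]

end System
end PiecewiseMap

/-! ### Orbits that stay near `R`. -/

namespace PiecewiseMap
variable {m : ℕ} {D : PiecewiseMap m} {I Cξ : ℝ}

/-- The inverse of the branch at the fixed point. -/
noncomputable def inv₀ (D : PiecewiseMap m) : Euc m → Euc m := Function.invFunOn D.T (D.U 0)

/-- Functions on `R` with gradient at most one, vanishing at `p`. -/
def gradLeOne (D : PiecewiseMap m) : Set (Euc m → ℝ) :=
  {f | f D.p = 0 ∧ ∀ x ∈ D.R, DifferentiableAt ℝ f x ∧ ‖fderiv ℝ f x‖ ≤ 1}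

/-- The inner distance to `p` in `R`. -/
noncomputable def innerDist (D : PiecewiseMap m) (x : Euc m) : ℝ := ⨆ f : D.gradLeOne, f.1 x

namespace System
variable (H : D.System I Cξ)
include H

theorem inv₀_T {x : Euc m} (hx : x ∈ D.U 0) : D.inv₀ (D.T x) = x := H.invFunOn_eq hx

theorem T_p : D.T D.p = D.p := H.fixed.fixed

theorem inv₀_p : D.inv₀ D.p = D.p := by
  conv_lhs => rw [← H.T_p]
  exact H.inv₀_T H.fixed.mem

theorem inv₀_mem {x : Euc m} (hx : x ∈ D.T '' D.R) : D.inv₀ x ∈ D.R := by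
  obtain ⟨u, hu, rfl⟩ := hx
  rwa [H.inv₀_T (H.R_subset_U hu)]

theorem T_inv₀ {x : Euc m} (hx : x ∈ D.T '' D.U 0) : D.T (D.inv₀ x) = x := by
  obtain ⟨u, hu, rfl⟩ := hx
  rw [H.inv₀_T hu]

theorem TR_subset_TU : D.T '' D.R ⊆ D.T '' D.U 0 := image_mono H.R_subset_U

theorem isOpen_TR : IsOpen (D.T '' D.R) := H.isOpen_image H.rates.isOpen_R H.R_subset_U

theorem hasFDerivAt_inv₀ {v : Euc m} (hv : v ∈ D.U 0) {c : ℝ} (hc : 0 ≤ c)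
    (h : ∀ ξ, ‖ξ‖ ≤ c * ‖fderiv ℝ D.T v ξ‖) :
    ∃ A : Euc m →L[ℝ] Euc m, HasFDerivAt D.inv₀ A (D.T v) ∧ ‖A‖ ≤ c := by
  obtain ⟨A, hA, hAs⟩ := exists_equiv_of_norm_le h
  refine ⟨A.symm, hasFDerivAt_invFunOn (H.smooth.isOpen_U 0) (H.smooth.injOn 0)
      (fun u hu => H.exists_equiv hu) hv (by rw [hA]; exact (H.strict_T hv).hasFDerivAt),
    ContinuousLinearMap.opNorm_le_bound _ hc hAs⟩

theorem norm_le_one_mul {j : Fin (D.K + 1)} {v : Euc m} (hv : v ∈ D.U j) (ξ : Euc m) :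
    ‖ξ‖ ≤ 1 * ‖fderiv ℝ D.T v ξ‖ := by rw [one_mul]; exact H.norm_le hv ξ

theorem continuousAt_inv₀ {x : Euc m} (hx : x ∈ D.T '' D.U 0) : ContinuousAt D.inv₀ x := by
  obtain ⟨v, hv, rfl⟩ := hx
  obtain ⟨A, hA, -⟩ := H.hasFDerivAt_inv₀ hv zero_le_one (H.norm_le_one_mul hv)
  exact hA.continuousAt

/-- The inverse branch maps `R` into `R` and its derivative has norm at most one, so the class of
test functions is preserved. It follows that the inner distance does not decrease under `T`. The
Euclidean distance to `p` need not be monotone, since the expansion is only local. -/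
theorem comp_inv₀_mem {f : Euc m → ℝ} (hf : f ∈ D.gradLeOne) : f ∘ D.inv₀ ∈ D.gradLeOne := by
  refine ⟨by rw [Function.comp_apply, H.inv₀_p, hf.1], fun x hx => ?_⟩
  obtain ⟨u, hu, rfl⟩ := H.R_subset_TR hx
  have huU := H.R_subset_U hu
  obtain ⟨A, hA, hAn⟩ := H.hasFDerivAt_inv₀ huU zero_le_one (H.norm_le_one_mul huU)
  obtain ⟨h1, h2⟩ := hf.2 u hu
  have h3 : HasFDerivAt f (fderiv ℝ f u) (D.inv₀ (D.T u)) := by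
    rw [H.inv₀_T huU]; exact h1.hasFDerivAt
  have h4 := h3.comp (D.T u) hA
  refine ⟨h4.differentiableAt, ?_⟩
  rw [h4.fderiv]
  calc _ ≤ ‖fderiv ℝ f u‖ * ‖A‖ := ContinuousLinearMap.opNorm_comp_le _ _
    _ ≤ 1 * 1 := by gcongr
    _ = 1 := one_mul 1

omit H in
theorem _root_.PiecewiseMap.gradLeOne_le {f : Euc m → ℝ} (hf : f ∈ D.gradLeOne) {c x y : Euc m}
    {ε : ℝ} (hB : Metric.ball c ε ⊆ D.R) (hx : x ∈ Metric.ball c ε) (hy : y ∈ Metric.ball c ε) :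
    f y ≤ f x + dist y x := by
  have := (convex_ball c ε).norm_image_sub_le_of_norm_hasFDerivWithin_le (𝕜 := ℝ) (f := f)
    (fun z hz => (hf.2 z (hB hz)).1.hasFDerivAt.hasFDerivWithinAt)
    (fun z hz => (hf.2 z (hB hz)).2) hx hy
  rw [one_mul, ← dist_eq_norm, ← dist_eq_norm, Real.dist_eq] at this
  linarith [le_abs_self (f y - f x)]

/-- Boundedness propagates over small balls in both directions, so it holds on an open and
relatively closed subset of the connected set `R`, which contains `p`. -/
theorem bddAbove_gradLeOne {x : Euc m} (hx : x ∈ D.R) :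
    BddAbove (range fun f : D.gradLeOne => f.1 x) := by
  set u := {x ∈ D.R | BddAbove (range fun f : D.gradLeOne => f.1 x)} with hu
  have hstep : ∀ c ε, Metric.ball c ε ⊆ D.R → ∀ a ∈ Metric.ball c ε, a ∈ u →
      ∀ b ∈ Metric.ball c ε, b ∈ u := by
    rintro c ε hB a ha ⟨-, C, hC⟩ b hb
    refine ⟨hB hb, C + dist b a, ?_⟩
    rintro _ ⟨f, rfl⟩
    have h1 : f.1 a ≤ C := hC ⟨f, rfl⟩
    have h2 := gradLeOne_le f.2 hB ha hb
    simp only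
    linarith
  have huo : IsOpen u := by
    rw [Metric.isOpen_iff]
    intro a ha
    obtain ⟨ε, hε, hB⟩ := Metric.isOpen_iff.1 H.rates.isOpen_R a ha.1
    exact ⟨ε, hε, fun b hb => hstep a ε hB a (Metric.mem_ball_self hε) ha b hb⟩
  have hpu : D.p ∈ u := by
    refine ⟨H.rates.mem_R, 0, ?_⟩
    rintro _ ⟨f, rfl⟩
    exact f.2.1.le
  have := H.rates.isConnected_R.isPreconnected.subset_of_closure_inter_subset huo
    ⟨D.p, H.rates.mem_R, hpu⟩ (by
      rintro b ⟨hbc, hbR⟩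
      obtain ⟨ε, hε, hB⟩ := Metric.isOpen_iff.1 H.rates.isOpen_R b hbR
      obtain ⟨a, ha, hab⟩ := Metric.mem_closure_iff.1 hbc ε hε
      exact hstep b ε hB a (by rwa [Metric.mem_ball, dist_comm]) ha b (Metric.mem_ball_self hε))
  exact (this hx).2

theorem le_innerDist {f : Euc m → ℝ} (hf : f ∈ D.gradLeOne) {x : Euc m} (hx : x ∈ D.R) :
    f x ≤ D.innerDist x :=
  le_ciSup (f := fun f : D.gradLeOne => f.1 x) (H.bddAbove_gradLeOne hx) ⟨f, hf⟩

omit H in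
theorem _root_.PiecewiseMap.zero_mem_gradLeOne : (0 : Euc m → ℝ) ∈ D.gradLeOne := by
  refine ⟨rfl, fun x _ => ⟨differentiableAt_const 0, ?_⟩⟩
  have : fderiv ℝ (0 : Euc m → ℝ) x = 0 := by simp
  rw [this]; simp

omit H in
theorem _root_.PiecewiseMap.innerDist_le {x : Euc m} {C : ℝ}
    (h : ∀ f ∈ D.gradLeOne, f x ≤ C) : D.innerDist x ≤ C := by
  have : Nonempty D.gradLeOne := ⟨⟨0, zero_mem_gradLeOne⟩⟩
  exact ciSup_le fun f => h f.1 f.2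

theorem continuousOn_innerDist : ContinuousOn D.innerDist D.R := by
  intro x hx
  obtain ⟨ε, hε, hB⟩ := Metric.isOpen_iff.1 H.rates.isOpen_R x hx
  have hxB := Metric.mem_ball_self (x := x) hε
  refine ContinuousAt.continuousWithinAt ?_
  rw [Metric.continuousAt_iff]
  intro e he
  refine ⟨min ε e, lt_min hε he, fun y hy => ?_⟩
  have hyB : y ∈ Metric.ball x ε := hy.trans_le (min_le_left _ _)
  have hye : dist y x < e := hy.trans_le (min_le_right _ _)
  have h1 : D.innerDist y ≤ D.innerDist x + dist y x := innerDist_le fun f hf =>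
    (gradLeOne_le hf hB hxB hyB).trans (by linarith [H.le_innerDist hf hx])
  have h2 : D.innerDist x ≤ D.innerDist y + dist x y := innerDist_le fun f hf =>
    (gradLeOne_le hf hB hyB hxB).trans (by linarith [H.le_innerDist hf (hB hyB)])
  rw [dist_comm x y] at h2
  rw [Real.dist_eq, abs_lt]
  constructor <;> linarith

theorem innerDist_le_T {x : Euc m} (hx : x ∈ D.R) (hTx : D.T x ∈ D.R) :
    D.innerDist x ≤ D.innerDist (D.T x) := innerDist_le fun f hf => by
  have := H.le_innerDist (H.comp_inv₀_mem hf) hTx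
  rwa [Function.comp_apply, H.inv₀_T (H.R_subset_U hx)] at this

/-- Near `T x` a test function composed with the inverse branch has gradient at most `s₂ < 1`. This
leaves room to add a small bump at `T x` without leaving the class. -/
theorem innerDist_lt_T {x : Euc m} (hx : x ∈ D.R) (hTx : D.T x ∈ D.R) (hxp : x ≠ D.p)
    (hs : D.rate D.T (D.U 0) x < 1) : D.innerDist x < D.innerDist (D.T x) := by
  have hxU := H.R_subset_U hx
  set s₁ := (D.rate D.T (D.U 0) x).toReal with hs₁
  have hs₁0 : 0 < s₁ := ENNReal.toReal_pos (H.rates.rate_pos 0 x hxU hxp).ne' (hs.ne_top)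
  have hs₁1 : s₁ < 1 := by
    have := (ENNReal.toReal_lt_toReal hs.ne_top ENNReal.one_ne_top).2 hs
    rwa [ENNReal.toReal_one] at this
  set s₂ := (s₁ + 1) / 2 with hs₂
  have h12 : s₁ < s₂ := by rw [hs₂]; linarith
  have hs₂1 : s₂ < 1 := by rw [hs₂]; linarith
  have hs₂0 : 0 < s₂ := hs₁0.trans h12
  have hgap : 0 < s₁⁻¹ - s₂⁻¹ := sub_pos.2 (inv_strictAnti₀ hs₁0 h12)
  have hnear : ∀ᶠ u in 𝓝 x, u ∈ D.U 0 ∧ ∀ ξ, ‖ξ‖ ≤ s₂ * ‖fderiv ℝ D.T u ξ‖ := by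
    have hc : ContinuousAt (fderiv ℝ D.T) x :=
      ((H.contDiffAt (H.U_subset_V 0 hxU)).continuousAt_fderiv one_ne_zero).congr
        (H.T_eventuallyEq hxU).fderiv
    filter_upwards [Metric.continuousAt_iff'.1 hc _ hgap, (H.smooth.isOpen_U 0).mem_nhds hxU]
      with u hu huU
    refine ⟨huU, norm_le_of_close hs₁0 hs₂0 (H.norm_le_rate hxU hxp) ?_ le_rfl⟩
    rw [← dist_eq_norm]; exact hu.le
  have hnear2 : ∀ᶠ y in 𝓝 (D.T x), y ∈ D.T '' D.U 0 ∧
      ∀ ξ, ‖ξ‖ ≤ s₂ * ‖fderiv ℝ D.T (D.inv₀ y) ξ‖ := by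
    have hc := (H.continuousAt_inv₀ ⟨x, hxU, rfl⟩).tendsto
    rw [H.inv₀_T hxU] at hc
    filter_upwards [hc.eventually hnear, (H.isOpen_TU 0).mem_nhds ⟨x, hxU, rfl⟩] with y hy hyU
    exact ⟨hyU, hy.2⟩
  have hTp : D.T x ≠ D.p := fun h =>
    hxp (H.smooth.injOn 0 hxU H.fixed.mem (h.trans H.T_p.symm))
  obtain ⟨ε, hε, hεB⟩ := Metric.eventually_nhds_iff_ball.1
    (hnear2.and (eventually_ne_nhds hTp))
  let φ : ContDiffBump (D.T x) := ⟨ε / 4, ε / 2, by positivity, by linarith⟩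
  have hφd : ContDiff ℝ 1 φ := φ.contDiff
  obtain ⟨B, hB⟩ : ∃ B, ∀ y, ‖fderiv ℝ φ y‖ ≤ B := by
    have h1 : HasCompactSupport (fderiv ℝ φ) := φ.hasCompactSupport.fderiv (𝕜 := ℝ)
    obtain ⟨B, hB⟩ := h1.exists_bound_of_continuous (hφd.continuous_fderiv one_ne_zero)
    exact ⟨B, hB⟩
  have hB0 : 0 ≤ B := (norm_nonneg _).trans (hB 0)
  -- The height of the bump is chosen so that its gradient, at most `κ * B`, fits into the room `1 -
  -- s₂`.
  set κ := (1 - s₂) / (B + 1) with hκ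
  have hκ0 : 0 < κ := by have : 0 < 1 - s₂ := by linarith
                         positivity
  have hκB : κ * B ≤ 1 - s₂ := by
    rw [hκ, div_mul_eq_mul_div, div_le_iff₀ (by positivity)]; nlinarith
  have key : ∀ f ∈ D.gradLeOne, f x ≤ D.innerDist (D.T x) - κ := by
    intro f hf
    have hmem : (fun y => (f ∘ D.inv₀) y + κ * φ y) ∈ D.gradLeOne := by
      have hfg := H.comp_inv₀_mem hf
      refine ⟨?_, fun y hy => ?_⟩
      · have : φ D.p = 0 := by
          refine φ.zero_of_le_dist ?_
          by_contra! h
          have h2 : D.p ∈ Metric.ball (D.T x) ε := by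
            rw [Metric.mem_ball]; exact h.trans (by change ε / 2 < ε; linarith)
          exact (hεB _ h2).2 rfl
        simp only [hfg.1, this, mul_zero, add_zero]
      · have hφy : HasFDerivAt (fun y => κ * φ y) (κ • fderiv ℝ φ y) y :=
          (hφd.differentiable one_ne_zero y).hasFDerivAt.const_mul κ
        have h3 := (hfg.2 y hy).1.hasFDerivAt.add hφy
        refine ⟨h3.differentiableAt, ?_⟩
        rw [HasFDerivAt.fderiv (f := fun y => (f ∘ D.inv₀) y + κ * φ y) h3]
        by_cases hyB : y ∈ Metric.ball (D.T x) ε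
        · obtain ⟨⟨⟨u, hu, rfl⟩, hexp⟩, -⟩ := hεB y hyB
          rw [H.inv₀_T hu] at hexp
          obtain ⟨A, hA, hAn⟩ := H.hasFDerivAt_inv₀ hu hs₂0.le hexp
          have huR : u ∈ D.R := by
            have := H.inv₀_mem (H.R_subset_TR hy); rwa [H.inv₀_T hu] at this
          obtain ⟨h1, h2⟩ := hf.2 u huR
          have h5 : HasFDerivAt f (fderiv ℝ f u) (D.inv₀ (D.T u)) := by
            rw [H.inv₀_T hu]; exact h1.hasFDerivAt
          have h4 := h5.comp (D.T u) hA
          rw [h4.fderiv]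
          calc _ ≤ ‖(fderiv ℝ f u).comp A‖ + ‖κ • fderiv ℝ φ (D.T u)‖ := norm_add_le _ _
            _ ≤ ‖fderiv ℝ f u‖ * ‖A‖ + κ * ‖fderiv ℝ φ (D.T u)‖ := by
              gcongr
              · exact ContinuousLinearMap.opNorm_comp_le _ _
              · rw [norm_smul, Real.norm_of_nonneg hκ0.le]
            _ ≤ 1 * s₂ + κ * B := by gcongr; exact hB _
            _ ≤ 1 := by linarith
        · have h0 : fderiv ℝ φ y = 0 := by
            have : (φ : Euc m → ℝ) =ᶠ[𝓝 y] fun _ => 0 := by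
              have h6 : ∀ᶠ z in 𝓝 y, ε / 2 < dist z (D.T x) := by
                have hc : Continuous fun z => dist z (D.T x) := by fun_prop
                refine hc.continuousAt.eventually (lt_mem_nhds ?_)
                rw [Metric.mem_ball, not_lt] at hyB
                linarith
              filter_upwards [h6] with z hz
              exact φ.zero_of_le_dist hz.le
            rw [this.fderiv_eq]; simp
          rw [h0, smul_zero, add_zero]
          exact (hfg.2 y hy).2
    have := H.le_innerDist hmem hTx
    simp only [Function.comp_apply, H.inv₀_T hxU] at this
    have h1 : φ (D.T x) = 1 := φ.one_of_mem_closedBall (by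
      rw [Metric.mem_closedBall, dist_self]; exact φ.rIn_pos.le)
    rw [h1] at this
    linarith
  have := innerDist_le key
  linarith

/-- Tested with the linear function of unit gradient in the direction of `x - p`. -/
theorem innerDist_pos {x : Euc m} (hx : x ∈ D.R) (hxp : x ≠ D.p) : 0 < D.innerDist x := by
  have hn : 0 < ‖x - D.p‖ := norm_pos_iff.2 (sub_ne_zero.2 hxp)
  set v := ‖x - D.p‖⁻¹ • (x - D.p) with hv
  have hvn : ‖v‖ = 1 := by
    rw [hv, norm_smul, norm_inv, norm_norm, inv_mul_cancel₀ hn.ne']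
  have hmem : (fun y => innerSL ℝ v (y - D.p)) ∈ D.gradLeOne := by
    refine ⟨by simp, fun y _ => ?_⟩
    have h1 : HasFDerivAt (fun y => innerSL ℝ v (y - D.p)) (innerSL ℝ v) y := by
      have := (innerSL ℝ v).hasFDerivAt.comp y ((hasFDerivAt_id y).sub_const D.p)
      rwa [ContinuousLinearMap.comp_id] at this
    refine ⟨h1.differentiableAt, ?_⟩
    rw [h1.fderiv, innerSL_apply_norm, hvn]
  have h2 := H.le_innerDist hmem hx
  refine lt_of_lt_of_le ?_ h2
  simp only [hv, innerSL_apply_apply, inner_smul_left, real_inner_self_eq_norm_sq]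
  simp only [conj_trivial]
  positivity

/-- Only the fixed point stays near `R` for ever. -/
theorem eq_p_of_forall_mem {K : Set (Euc m)} (hK : IsCompact K) (hKR : K ⊆ D.T '' D.R)
    {x : Euc m} (hx : ∀ n, D.T^[n] x ∈ K) : x = D.p := by
  have hKU : K ⊆ D.U 0 := hKR.trans H.TR_subset_U
  set A : ℕ → Set (Euc m) := fun n => {z | ∀ k ≤ n, D.T^[k] z ∈ K} with hA
  have hcont : ContinuousOn D.T K := fun z hz =>
    (H.strict_T (hKU hz)).hasFDerivAt.continuousAt.continuousWithinAt
  have hAc : ∀ n, IsClosed (A n) := by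
    intro n
    induction n with
    | zero => simpa [hA] using hK.isClosed
    | succ n ih =>
      have : A (n + 1) = K ∩ D.T ⁻¹' A n := by
        ext z
        simp only [hA, mem_ofPred_eq, mem_inter_iff, mem_preimage]
        constructor
        · exact fun h => ⟨h 0 (Nat.zero_le _), fun k hk => h (k + 1) (by omega)⟩
        · rintro ⟨h1, h2⟩ k hk
          rcases k with _ | k
          · exact h1
          · exact h2 k (by omega)
      rw [this]
      exact hcont.preimage_isClosed_of_isClosed hK.isClosed ih
  -- `Λ` is compact and forward invariant, and it lies in `R` by injectivity of the branch.
  set Λ : Set (Euc m) := {z | ∀ n, D.T^[n] z ∈ K} with hΛ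
  have hΛK : Λ ⊆ K := fun z hz => hz 0
  have hΛc : IsCompact Λ := by
    refine hK.of_isClosed_subset ?_ hΛK
    have : Λ = ⋂ n, A n := by
      ext z
      simp only [hΛ, hA, mem_iInter, mem_ofPred_eq]
      exact ⟨fun h n k _ => h k, fun h n => h n n le_rfl⟩
    rw [this]
    exact isClosed_iInter hAc
  have hΛT : ∀ z ∈ Λ, D.T z ∈ Λ := fun z hz n => hz (n + 1)
  have hΛR : Λ ⊆ D.R := by
    intro z hz
    obtain ⟨u, hu, huz⟩ := hKR (hΛK (hΛT z hz))
    rwa [← H.smooth.injOn 0 (H.R_subset_U hu) (hKU (hΛK hz)) huz]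
  by_contra hxp
  obtain ⟨y, hy, hymax⟩ := hΛc.exists_isMaxOn ⟨x, hx⟩ (H.continuousOn_innerDist.mono hΛR)
  have hpos : 0 < D.innerDist y := (H.innerDist_pos (hΛR hx) hxp).trans_le (hymax hx)
  -- Among the maximisers of the inner distance on `Λ` one takes the farthest from `p`. Its image
  -- increases the inner distance if the rate is below one, and keeps it maximal while increasing
  -- the distance to `p` if the rate is one. Both are impossible.
  set Mx := Λ ∩ {z | D.innerDist z = D.innerDist y} with hMx
  have hMxc : IsCompact Mx := by
    refine hΛc.of_isClosed_subset ?_ inter_subset_left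
    exact (H.continuousOn_innerDist.mono hΛR).preimage_isClosed_of_isClosed hΛc.isClosed
      (isClosed_singleton (x := D.innerDist y))
  obtain ⟨z, hz, hzmax⟩ := hMxc.exists_isMaxOn ⟨y, hy, rfl⟩
    (f := fun z => dist z D.p) (by fun_prop)
  have hzp : z ≠ D.p := by
    rintro rfl
    have h1 : D.innerDist D.p ≤ 0 := innerDist_le fun f hf => hf.1.le
    have h2 : D.innerDist D.p = D.innerDist y := hz.2
    linarith
  have hzU := H.R_subset_U (hΛR hz.1)
  have hTz := hΛT z hz.1
  have hTle : D.innerDist (D.T z) ≤ D.innerDist y := hymax hTz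
  have hle := H.rates.rate_le_one 0 z hzU hzp
  rcases hle.lt_or_eq with h | h
  · have := H.innerDist_lt_T (hΛR hz.1) (hΛR hTz) hzp h
    have h2 : D.innerDist z = D.innerDist y := hz.2
    linarith
  · have h1 := (H.rates.rate_eq_one 0 z hzU hzp h).2
    have h3 : D.T z ∈ Mx := by
      refine ⟨hTz, le_antisymm hTle ?_⟩
      have h2 : D.innerDist z = D.innerDist y := hz.2
      rw [← h2]
      exact H.innerDist_le_T (hΛR hz.1) (hΛR hTz)
    have h4 : dist (D.T z) D.p ≤ dist z D.p := hzmax h3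
    linarith

end System
end PiecewiseMap

/-! ### Inverse iterates of the branch at the fixed point. -/

namespace PiecewiseMap
variable {m : ℕ} {D : PiecewiseMap m} {I Cξ : ℝ}

/-- The inverse of the `n`-th iterate of the branch at the fixed point. -/
noncomputable def invn (D : PiecewiseMap m) (n : ℕ) : Euc m → Euc m :=
  Function.invFunOn D.T^[n] (D.dom n)

/-- The transfer operator of the `n`-th iterate of the branch at the fixed point. -/
noncomputable def pull (D : PiecewiseMap m) (n : ℕ) (g : Euc m → ℝ≥0∞) : Euc m → ℝ≥0∞ :=
  (D.ran n).indicator fun x => ENNReal.ofReal (D.jac n x) * g (D.invn n x)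

theorem mem_dom_succ {n : ℕ} {z : Euc m} :
    z ∈ D.dom (n + 1) ↔ z ∈ D.dom n ∧ D.T^[n] z ∈ D.U 0 := by
  simp only [dom, mem_ofPred_eq]
  constructor
  · exact fun h => ⟨fun k hk => h k (by omega), h n (by omega)⟩
  · rintro ⟨h1, h2⟩ k hk
    rcases Nat.lt_succ_iff_lt_or_eq.1 hk with h | rfl
    · exact h1 k h
    · exact h2

theorem mem_dom_succ' {n : ℕ} {z : Euc m} :
    z ∈ D.dom (n + 1) ↔ z ∈ D.U 0 ∧ D.T z ∈ D.dom n := by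
  simp only [dom, mem_ofPred_eq]
  constructor
  · exact fun h => ⟨h 0 (by omega), fun k hk => h (k + 1) (by omega)⟩
  · rintro ⟨h1, h2⟩ k hk
    rcases k with _ | k
    · exact h1
    · exact h2 k (by omega)

theorem dom_zero : D.dom 0 = univ := by ext z; simp [dom]

theorem ran_zero : D.ran 0 = univ := by simp [ran, dom_zero]

namespace System
variable (H : D.System I Cξ)
include H

theorem injOn_dom (n : ℕ) : InjOn D.T^[n] (D.dom n) := by
  induction n with
  | zero => exact Function.injective_id.injOn
  | succ n ih =>
    intro x hx y hy hxy
    rw [mem_dom_succ] at hx hy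
    rw [Function.iterate_succ_apply', Function.iterate_succ_apply'] at hxy
    exact ih hx.1 hy.1 (H.smooth.injOn 0 hx.2 hy.2 hxy)

theorem strict_iterate {n : ℕ} {z : Euc m} (hz : z ∈ D.dom n) :
    ∃ A : Euc m ≃L[ℝ] Euc m, HasStrictFDerivAt D.T^[n] (A : Euc m →L[ℝ] Euc m) z := by
  induction n with
  | zero => exact ⟨ContinuousLinearEquiv.refl ℝ _, hasStrictFDerivAt_id z⟩
  | succ n ih =>
    rw [mem_dom_succ] at hz
    obtain ⟨A, hA⟩ := ih hz.1
    obtain ⟨B, hB⟩ := H.exists_equiv hz.2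
    refine ⟨A.trans B, ?_⟩
    rw [Function.iterate_succ']
    exact hB.comp z hA

theorem isOpen_dom (n : ℕ) : IsOpen (D.dom n) := by
  induction n with
  | zero => rw [dom_zero]; exact isOpen_univ
  | succ n ih =>
    have : D.dom (n + 1) = D.dom n ∩ D.T^[n] ⁻¹' D.U 0 := by
      ext z; rw [mem_dom_succ]; rfl
    rw [this]
    have hc : ContinuousOn D.T^[n] (D.dom n) := fun z hz => by
      obtain ⟨A, hA⟩ := H.strict_iterate hz
      exact hA.hasFDerivAt.continuousAt.continuousWithinAt
    exact hc.isOpen_inter_preimage ih (H.smooth.isOpen_U 0)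

theorem isOpen_ran (n : ℕ) : IsOpen (D.ran n) :=
  isOpen_image_of_strict (H.isOpen_dom n) fun _ hu => H.strict_iterate hu

theorem invn_iterate {n : ℕ} {z : Euc m} (hz : z ∈ D.dom n) : D.invn n (D.T^[n] z) = z :=
  (H.injOn_dom n).leftInvOn_invFunOn hz

theorem jac_iterate {n : ℕ} {z : Euc m} (hz : z ∈ D.dom n) :
    D.jac n (D.T^[n] z) = |(fderiv ℝ D.T^[n] z).det|⁻¹ ∧ (fderiv ℝ D.T^[n] z).det ≠ 0 := by
  obtain ⟨A, hA⟩ := H.strict_iterate hz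
  have := hasFDerivAt_invFunOn (H.isOpen_dom n) (H.injOn_dom n)
    (fun u hu => H.strict_iterate hu) hz hA.hasFDerivAt
  constructor
  · rw [jac, this.fderiv, hA.hasFDerivAt.fderiv, ContinuousLinearMap.det, ContinuousLinearMap.det]
    have h1 := LinearEquiv.det_symm_mul_det A.toLinearEquiv
    rw [← abs_inv]
    congr 1
    exact eq_inv_of_mul_eq_one_left h1
  · rw [hA.hasFDerivAt.fderiv]
    exact A.toLinearEquiv.isUnit_det'.ne_zero

theorem continuousOn_invn (n : ℕ) : ContinuousOn (D.invn n) (D.ran n) := by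
  rintro _ ⟨z, hz, rfl⟩
  obtain ⟨A, hA⟩ := H.strict_iterate hz
  exact (hasFDerivAt_invFunOn (H.isOpen_dom n) (H.injOn_dom n)
    (fun u hu => H.strict_iterate hu) hz hA.hasFDerivAt).continuousAt.continuousWithinAt

theorem pull_iterate {n : ℕ} {z : Euc m} (hz : z ∈ D.dom n) (g : Euc m → ℝ≥0∞) :
    D.pull n g (D.T^[n] z) = ENNReal.ofReal |(fderiv ℝ D.T^[n] z).det|⁻¹ * g z := by
  rw [pull, indicator_of_mem (show D.T^[n] z ∈ D.ran n from mem_image_of_mem _ hz),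
    H.invn_iterate hz, (H.jac_iterate hz).1]

omit H in
theorem _root_.PiecewiseMap.pull_eq_zero {n : ℕ} {x : Euc m} (hx : x ∉ D.ran n)
    (g : Euc m → ℝ≥0∞) : D.pull n g x = 0 := indicator_of_notMem hx _

theorem setLIntegral_pull (n : ℕ) (g : Euc m → ℝ≥0∞) {A : Set (Euc m)} (hA : MeasurableSet A) :
    ∫⁻ x in D.T^[n] '' (D.dom n ∩ A), D.pull n g x = ∫⁻ z in D.dom n ∩ A, g z := by
  have hm := (H.isOpen_dom n).measurableSet.inter hA
  have hd : ∀ z ∈ D.dom n ∩ A,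
      HasFDerivWithinAt D.T^[n] (fderiv ℝ D.T^[n] z) (D.dom n ∩ A) z := by
    rintro z ⟨hz, -⟩
    obtain ⟨A, hA⟩ := H.strict_iterate hz
    exact hA.hasFDerivAt.differentiableAt.hasFDerivAt.hasFDerivWithinAt
  rw [lintegral_image_eq_lintegral_abs_det_fderiv_mul volume hm hd
    ((H.injOn_dom n).mono inter_subset_left)]
  refine setLIntegral_congr_fun hm fun z hz => ?_
  rw [H.pull_iterate hz.1, ← mul_assoc, ← ENNReal.ofReal_mul (abs_nonneg _),
    mul_inv_cancel₀ (abs_ne_zero.2 (H.jac_iterate hz.1).2), ENNReal.ofReal_one, one_mul]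

theorem lintegral_pull (n : ℕ) (g : Euc m → ℝ≥0∞) :
    ∫⁻ x, D.pull n g x = ∫⁻ z in D.dom n, g z := by
  have := H.setLIntegral_pull n g MeasurableSet.univ
  rw [inter_univ] at this
  rw [← this]
  refine (setLIntegral_eq_of_support_subset fun x hx => ?_).symm
  by_contra h
  exact hx (pull_eq_zero h g)

theorem measurable_pull (n : ℕ) {g : Euc m → ℝ≥0∞} (hg : Measurable g) :
    Measurable (D.pull n g) := by
  classical
  have hran := (H.isOpen_ran n).measurableSet
  have h1 : Measurable ((D.ran n).piecewise (D.invn n) (fun _ => 0)) :=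
    (H.continuousOn_invn n).measurable_piecewise continuousOn_const hran
  have hj : Measurable fun x => ENNReal.ofReal (D.jac n x) := by
    have : Measurable fun x => (fderiv ℝ (Function.invFunOn D.T^[n] (D.dom n)) x).det :=
      ContinuousLinearMap.continuous_det.measurable.comp (measurable_fderiv ℝ _)
    exact ENNReal.measurable_ofReal.comp (measurable_norm.comp this)
  have : D.pull n g = (D.ran n).indicator fun x => ENNReal.ofReal (D.jac n x) *
      g ((D.ran n).piecewise (D.invn n) (fun _ => 0) x) := by
    refine indicator_congr fun x hx => ?_
    rw [piecewise_eq_of_mem _ _ _ hx]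
  rw [this]
  exact (hj.mul (hg.comp h1)).indicator hran

omit H in
theorem _root_.PiecewiseMap.pull_zero_apply (g : Euc m → ℝ≥0∞) (x : Euc m) :
    D.pull 0 g x = g x := by
  have h0 : Function.invFunOn D.T^[0] (D.dom 0) = id := by
    ext1 y
    have : (id y : Euc m) ∈ D.T^[0] '' D.dom 0 := ⟨y, by rw [dom_zero]; trivial, rfl⟩
    exact Function.invFunOn_eq this
  rw [pull, ran_zero, indicator_univ, invn, jac, h0]
  simp [fderiv_id, ContinuousLinearMap.det]

/-- The density of the image of an absolutely continuous measure under an iterate of the branch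
at the fixed point. -/
theorem map_iterate_withDensity (n : ℕ) {g : Euc m → ℝ≥0∞}
    (hsupp : ∀ x, x ∉ D.dom n → g x = 0) :
    (volume.withDensity g).map D.T^[n] = volume.withDensity (D.pull n g) := by
  ext A hA
  have hTn : Measurable D.T^[n] := H.std.measurable.iterate n
  rw [Measure.map_apply hTn hA, withDensity_apply _ (hTn hA), withDensity_apply _ hA]
  have h1 : ∫⁻ x in A, D.pull n g x = ∫⁻ x in D.T^[n] '' (D.dom n ∩ D.T^[n] ⁻¹' A), D.pull n g x := by
    have h2 : D.T^[n] '' (D.dom n ∩ D.T^[n] ⁻¹' A) = A ∩ D.ran n := by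
      rw [image_inter_preimage, inter_comm]; rfl
    rw [h2, ← lintegral_indicator hA, ← lintegral_indicator (hA.inter (H.isOpen_ran n).measurableSet)]
    refine lintegral_congr fun x => ?_
    by_cases hx : x ∈ D.ran n
    · by_cases hxA : x ∈ A
      · rw [indicator_of_mem hxA, indicator_of_mem (show x ∈ A ∩ D.ran n from ⟨hxA, hx⟩)]
      · rw [indicator_of_notMem hxA, indicator_of_notMem fun h => hxA h.1]
    · have h0 := pull_eq_zero hx g
      by_cases hxA : x ∈ A
      · rw [indicator_of_mem hxA, indicator_of_notMem fun h => hx h.2, h0]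
      · rw [indicator_of_notMem hxA, indicator_of_notMem fun h => hxA h.1]
  rw [h1, H.setLIntegral_pull n g (hTn hA),
    ← lintegral_indicator (hTn hA),
    ← lintegral_indicator ((H.isOpen_dom n).measurableSet.inter (hTn hA))]
  refine lintegral_congr fun x => ?_
  by_cases hx : x ∈ D.dom n
  · by_cases hxA : x ∈ D.T^[n] ⁻¹' A
    · rw [indicator_of_mem hxA, indicator_of_mem (show x ∈ D.dom n ∩ D.T^[n] ⁻¹' A from ⟨hx, hxA⟩)]
    · rw [indicator_of_notMem hxA, indicator_of_notMem fun h => hxA h.2]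
  · have h0 := hsupp x hx
    by_cases hxA : x ∈ D.T^[n] ⁻¹' A
    · rw [indicator_of_mem hxA, indicator_of_notMem fun h => hx h.1, h0]
    · rw [indicator_of_notMem hxA, indicator_of_notMem fun h => hxA h.2]

end System
end PiecewiseMap

/-! ### The collar around `R` and the stopping weights. -/

namespace PiecewiseMap
variable {m : ℕ} {D : PiecewiseMap m} {I Cξ : ℝ}

/-- A Lipschitz function which is one on `R` and vanishes at distance `δ` of `R`. -/
noncomputable def cutoff (D : PiecewiseMap m) (δ : ℝ) (x : Euc m) : ℝ≥0∞ :=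
  1 - ENNReal.ofReal (Metric.infDist x D.R / δ)

theorem cutoff_le_one (δ : ℝ) (x : Euc m) : D.cutoff δ x ≤ 1 := tsub_le_self

theorem continuous_cutoff (δ : ℝ) : Continuous (D.cutoff δ) := by
  unfold cutoff
  exact (ENNReal.continuous_sub_left ENNReal.one_ne_top).comp
    (ENNReal.continuous_ofReal.comp ((Metric.continuous_infDist_pt _).div_const _))

theorem cutoff_of_mem {δ : ℝ} {x : Euc m} (hx : x ∈ D.R) : D.cutoff δ x = 1 := by
  rw [cutoff, Metric.infDist_zero_of_mem hx]; simp

theorem cutoff_le_add {δ : ℝ} (hδ : 0 < δ) (x y : Euc m) :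
    D.cutoff δ x ≤ D.cutoff δ y + ENNReal.ofReal (dist x y / δ) := by
  unfold cutoff
  rw [tsub_le_iff_right]
  have h1 : ENNReal.ofReal (Metric.infDist y D.R / δ) ≤
      ENNReal.ofReal (dist x y / δ) + ENNReal.ofReal (Metric.infDist x D.R / δ) := by
    rw [← ENNReal.ofReal_add (by positivity) (div_nonneg Metric.infDist_nonneg hδ.le), ← add_div]
    refine ENNReal.ofReal_le_ofReal ?_
    gcongr
    have := Metric.infDist_le_infDist_add_dist (s := D.R) (x := y) (y := x)
    rw [dist_comm] at this
    linarith
  rw [add_assoc]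
  exact le_trans le_tsub_add (add_le_add le_rfl h1)

theorem one_sub_cutoff_le_add {δ : ℝ} (hδ : 0 < δ) (x y : Euc m) :
    1 - D.cutoff δ x ≤ 1 - D.cutoff δ y + ENNReal.ofReal (dist x y / δ) := by
  rw [tsub_le_iff_right]
  have h := cutoff_le_add (D := D) hδ y x
  rw [dist_comm] at h
  have h1 : 1 ≤ (1 - D.cutoff δ y) + D.cutoff δ y := le_tsub_add
  calc (1 : ℝ≥0∞) ≤ (1 - D.cutoff δ y) + (D.cutoff δ x + ENNReal.ofReal (dist x y / δ)) :=
        h1.trans (add_le_add le_rfl h)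
    _ = _ := by ring

theorem cutoff_eq_zero {δ : ℝ} (hδ : 0 < δ) (hR : D.R.Nonempty) {x : Euc m}
    (hx : x ∉ Metric.thickening δ D.R) : D.cutoff δ x = 0 := by
  rw [cutoff, tsub_eq_zero_iff_le]
  rw [Metric.mem_thickening_iff_infDist_lt hR, not_lt] at hx
  rw [ENNReal.one_le_ofReal, le_div_iff₀ hδ]
  linarith

/-- The set `B_δ(R)`, slightly larger than `R`. -/
def nbhdR (D : PiecewiseMap m) (δ : ℝ) : Set (Euc m) := Metric.cthickening δ D.R

/-- A thin collar around `R`. -/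
structure Collar (D : PiecewiseMap m) (ε δ r₀ : ℝ) : Prop where
  δ_pos : 0 < δ
  r₀_pos : 0 < r₀
  r₀_le_one : r₀ ≤ 1
  subset : D.nbhdR (2 * δ) ⊆ D.T '' D.R
  ball_TR : ∀ x ∈ D.nbhdR δ, Metric.ball x r₀ ⊆ D.T '' D.R
  ball_T : ∀ a ∈ D.T '' D.nbhdR δ, Metric.ball a r₀ ⊆ D.T '' D.nbhdR (2 * δ)
  near : D.T '' D.nbhdR δ \ D.R ⊆ Metric.thickening (ε / 2) D.R₀
  r₀_le : r₀ ≤ ε / 2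
  sep : ∀ a ∉ D.R, ∀ b ∈ Metric.ball a r₀, b ∉ D.inv₀ '' D.R

/-- The weight with which the point `z` is stopped at time `n`. -/
noncomputable def stopWeight (D : PiecewiseMap m) (δ : ℝ) (n : ℕ) (z : Euc m) : ℝ≥0∞ :=
  (∏ i ∈ Finset.range n, D.cutoff δ (D.T^[i] z)) * (1 - D.cutoff δ (D.T^[n] z))

/-- The stopping weight, read off at the end point. -/
noncomputable def endWeight (D : PiecewiseMap m) (δ : ℝ) (y : Euc m) : ℝ≥0∞ :=
  (D.T '' D.U 0).indicator (fun y => D.cutoff δ (D.inv₀ y)) y * (1 - D.cutoff δ y)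

/-- A set which orbits near `R` visit at most three times. -/
def gate (D : PiecewiseMap m) (ε δ : ℝ) : Set (Euc m) :=
  (D.T '' D.nbhdR (2 * δ) ∩ Metric.cthickening ε D.R₀) \ D.inv₀ '' D.R

theorem endWeight_le_one (δ : ℝ) (y : Euc m) : D.endWeight δ y ≤ 1 := by
  unfold endWeight
  refine mul_le_one' ?_ tsub_le_self
  by_cases h : y ∈ D.T '' D.U 0
  · rw [indicator_of_mem h]; exact cutoff_le_one _ _
  · rw [indicator_of_notMem h]; exact zero_le

theorem nbhdR_mono {δ δ' : ℝ} (h : δ ≤ δ') : D.nbhdR δ ⊆ D.nbhdR δ' := Metric.cthickening_mono h _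

theorem Collar.nbhdR_subset {ε δ r₀ : ℝ} (hC : D.Collar ε δ r₀) : D.nbhdR δ ⊆ D.T '' D.R :=
  (nbhdR_mono (by linarith [hC.δ_pos])).trans hC.subset

theorem Collar.T_nbhdR_subset {ε δ r₀ : ℝ} (hC : D.Collar ε δ r₀) :
    D.T '' D.nbhdR (2 * δ) ⊆ D.T '' (D.T '' D.R) := image_mono hC.subset

namespace System
variable (H : D.System I Cξ)
include H

theorem isCompact_nbhdR (δ : ℝ) : IsCompact (D.nbhdR δ) :=
  Metric.isCompact_of_isClosed_isBounded Metric.isClosed_cthickening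
    (H.std.compact.isBounded.subset (H.R_subset_U.trans (H.U_subset_M 0))).cthickening

theorem isCompact_closure_R : IsCompact (closure D.R) :=
  (H.std.compact.isBounded.subset (H.R_subset_U.trans (H.U_subset_M 0))).isCompact_closure

theorem continuousOn_T : ContinuousOn D.T (D.U 0) := fun _ hz =>
  (H.strict_T hz).hasFDerivAt.continuousAt.continuousWithinAt

theorem continuousOn_inv₀ : ContinuousOn D.inv₀ (D.T '' D.U 0) := fun _ hz =>
  (H.continuousAt_inv₀ hz).continuousWithinAt

/-- `T` maps the closure of `R` into the closure of `T R`, which is the union of the closures of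
`R₀` and `R`; boundary points of `R` lie in `R₀`, because the closure of `R` is contained in `T R`.
-/
theorem R₀_near_closure {ε : ℝ} (hε : 0 < ε) :
    D.T '' closure D.R ⊆ Metric.thickening ε D.R₀ ∪ D.R := by
  rintro x ⟨z, hz, rfl⟩
  have hzU : z ∈ D.U 0 := H.TR_subset_U (H.rates.closure_R hz)
  have h1 : D.T z ∈ closure (D.T '' D.R) :=
    mem_closure_image (H.strict_T hzU).hasFDerivAt.continuousAt hz
  have h2 : D.T '' D.R ⊆ D.R₀ ∪ D.R := by
    intro y hy
    by_cases h : y ∈ D.R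
    · exact Or.inr h
    · exact Or.inl ⟨hy, h⟩
  have h3 := closure_mono h2 h1
  rw [closure_union] at h3
  rcases h3 with h3 | h3
  · exact Or.inl (Metric.closure_subset_thickening hε _ h3)
  · by_cases h : D.T z ∈ D.R
    · exact Or.inr h
    · exact Or.inl (Metric.self_subset_thickening hε _ ⟨H.rates.closure_R h3, h⟩)

/-- Each requirement expresses that a compact set lies in an open one, and so persists on a small
neighbourhood. -/
theorem exists_collar {ε : ℝ} (hε : 0 < ε) : ∃ δ r₀, D.Collar ε δ r₀ := by
  have hc := H.isCompact_closure_R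
  have ho : IsOpen (D.T '' D.R ∩ (D.U 0 ∩ D.T ⁻¹' (Metric.thickening (ε / 2) D.R₀ ∪ D.R))) :=
    H.isOpen_TR.inter (H.continuousOn_T.isOpen_inter_preimage (H.smooth.isOpen_U 0)
      (Metric.isOpen_thickening.union H.rates.isOpen_R))
  obtain ⟨δ', hδ', hsub⟩ := hc.exists_cthickening_subset_open ho (fun x hx =>
    ⟨H.rates.closure_R hx, H.TR_subset_U (H.rates.closure_R hx),
      H.R₀_near_closure (half_pos hε) ⟨x, hx, rfl⟩⟩)
  rw [Metric.cthickening_closure] at hsub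
  set δ := δ' / 2 with hδ
  have hδ0 : 0 < δ := by positivity
  have h2δ : 2 * δ = δ' := by rw [hδ]; ring
  have hsubTR : D.nbhdR (2 * δ) ⊆ D.T '' D.R := fun x hx => (hsub (h2δ ▸ hx)).1
  have hmono : D.nbhdR δ ⊆ D.nbhdR (2 * δ) := nbhdR_mono (by linarith)
  have hK := H.isCompact_nbhdR δ
  have hKU : D.nbhdR δ ⊆ D.U 0 := (hmono.trans hsubTR).trans H.TR_subset_U
  obtain ⟨r₁, hr₁, hr₁s⟩ := hK.exists_thickening_subset_open H.isOpen_TR (hmono.trans hsubTR)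
  have hthick : IsOpen (D.T '' Metric.thickening (2 * δ) D.R) :=
    H.isOpen_image (j := 0) Metric.isOpen_thickening
      ((Metric.thickening_subset_cthickening _ _).trans (hsubTR.trans H.TR_subset_U))
  obtain ⟨r₂, hr₂, hr₂s⟩ := (hK.image_of_continuousOn (H.continuousOn_T.mono hKU)).exists_thickening_subset_open
    hthick (image_mono (Metric.cthickening_subset_thickening' (by positivity) (by linarith) _))
  have hg : IsCompact (D.inv₀ '' closure D.R) := hc.image_of_continuousOn
    (H.continuousOn_inv₀.mono (H.rates.closure_R.trans H.TR_subset_TU))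
  obtain ⟨r₃, hr₃, hr₃s⟩ := hg.exists_thickening_subset_open H.rates.isOpen_R (by
    rintro _ ⟨x, hx, rfl⟩; exact H.inv₀_mem (H.rates.closure_R hx))
  refine ⟨δ, min (min (min r₁ r₂) (min r₃ 1)) (ε / 2), hδ0, by positivity,
    (min_le_left _ _).trans ((min_le_right _ _).trans (min_le_right _ _)), hsubTR, ?_, ?_, ?_,
    min_le_right _ _, ?_⟩
  · intro x hx y hy
    refine hr₁s (Metric.mem_thickening_iff.2 ⟨x, hx, lt_of_lt_of_le hy ?_⟩)
    exact (min_le_left _ _).trans ((min_le_left _ _).trans (min_le_left _ _))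
  · intro x hx y hy
    refine image_mono (Metric.thickening_subset_cthickening _ _)
      (hr₂s (Metric.mem_thickening_iff.2 ⟨x, hx, lt_of_lt_of_le hy ?_⟩))
    exact (min_le_left _ _).trans ((min_le_left _ _).trans (min_le_right _ _))
  · rintro _ ⟨⟨x, hx, rfl⟩, hxR⟩
    have := (hsub (h2δ ▸ hmono hx)).2.2
    exact this.resolve_right hxR
  · rintro a ha b hb ⟨x, hx, rfl⟩
    refine ha (hr₃s (Metric.mem_thickening_iff.2 ⟨_, ⟨x, subset_closure hx, rfl⟩, ?_⟩))
    rw [dist_comm]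
    refine lt_of_lt_of_le hb ?_
    exact (min_le_left _ _).trans ((min_le_right _ _).trans (min_le_left _ _))

theorem dist_inv₀_le {x y : Euc m} {r : ℝ} (hB : Metric.ball x r ⊆ D.T '' D.R)
    (hy : y ∈ Metric.ball x r) : dist (D.inv₀ x) (D.inv₀ y) ≤ dist x y := by
  have hx : x ∈ Metric.ball x r := Metric.mem_ball_self (Metric.pos_of_mem_ball hy)
  have hseg : segment ℝ x y ⊆ D.T '' D.U 0 :=
    ((convex_ball x r).segment_subset hx hy).trans (hB.trans H.TR_subset_TU)
  have h1 := dist_invFunOn_le (H.smooth.isOpen_U 0) (H.smooth.injOn 0)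
    (fun u hu => H.strict_T hu) (c₀ := 1) (fun u hu => H.norm_le_one_mul hu)
    zero_le_one hseg (fun w hw ξ => by
      obtain ⟨a, ha, rfl⟩ := hseg hw
      rw [H.invFunOn_eq ha]
      exact H.norm_le_one_mul ha ξ)
  rwa [one_mul] at h1

theorem inv₀_iterate_mem {x : Euc m} (hx : x ∈ D.T '' D.R) (n : ℕ) :
    D.inv₀^[n + 1] x ∈ D.R := by
  induction n with
  | zero => exact H.inv₀_mem hx
  | succ n ih =>
    rw [Function.iterate_succ_apply']
    exact H.inv₀_mem (H.R_subset_TR ih)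

theorem dom_inv₀_iterate {y : Euc m} (hy : y ∈ D.T '' (D.T '' D.R)) (n : ℕ) :
    D.inv₀^[n] y ∈ D.dom n ∧ D.T^[n] (D.inv₀^[n] y) = y := by
  induction n with
  | zero => rw [dom_zero]; exact ⟨trivial, rfl⟩
  | succ n ih =>
    have h1 : D.inv₀^[n] y ∈ D.T '' D.U 0 := by
      rcases n with _ | n
      · exact image_mono H.TR_subset_U hy
      · obtain ⟨u, hu, rfl⟩ := hy
        rw [Function.iterate_succ_apply, H.inv₀_T (H.TR_subset_U hu)]
        rcases n with _ | n
        · exact H.TR_subset_TU hu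
        · exact H.TR_subset_TU (H.R_subset_TR (H.inv₀_iterate_mem hu n))
    rw [Function.iterate_succ_apply', mem_dom_succ', Function.iterate_succ_apply, H.T_inv₀ h1]
    refine ⟨⟨?_, ih.1⟩, ih.2⟩
    obtain ⟨u, hu, hux⟩ := h1
    rw [← hux, H.inv₀_T hu]
    exact hu

theorem mem_ran {y : Euc m} (hy : y ∈ D.T '' (D.T '' D.R)) (n : ℕ) : y ∈ D.ran n :=
  ⟨_, (H.dom_inv₀_iterate hy n).1, (H.dom_inv₀_iterate hy n).2⟩

theorem invn_eq {y : Euc m} (hy : y ∈ D.T '' (D.T '' D.R)) (n : ℕ) :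
    D.invn n y = D.inv₀^[n] y := by
  obtain ⟨h1, h2⟩ := H.dom_inv₀_iterate hy n
  conv_lhs => rw [← h2]
  exact H.invn_iterate h1

/-- Backward orbits which start near `R` stay in `R`. -/
theorem iterate_mem_R {n k : ℕ} {z : Euc m} (hz : z ∈ D.dom (n + 1)) (h : D.T^[n] z ∈ D.T '' D.R)
    (hk : k < n) : D.T^[k] z ∈ D.R := by
  induction n with
  | zero => omega
  | succ n ih =>
    have hz' := mem_dom_succ.1 hz
    have h1 : D.T^[n] z ∈ D.R := by
      obtain ⟨u, hu, hux⟩ := h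
      rw [Function.iterate_succ_apply'] at hux
      have h2 := H.smooth.injOn 0 (H.R_subset_U hu) (mem_dom_succ.1 hz'.1).2 hux
      rwa [← h2]
    rcases Nat.lt_succ_iff_lt_or_eq.1 hk with h3 | rfl
    · exact ih hz'.1 (H.R_subset_TR h1) h3
    · exact h1

variable {ε δ r₀ : ℝ} (hC : D.Collar ε δ r₀)
include hC

theorem cutoff_ne_zero {x : Euc m} (hx : D.cutoff δ x ≠ 0) : x ∈ D.nbhdR δ := by
  by_contra h
  exact hx (cutoff_eq_zero hC.δ_pos ⟨_, H.rates.mem_R⟩ fun h' =>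
    h (Metric.thickening_subset_cthickening _ _ h'))

/-- Once the last step before stopping is in the collar, all earlier points lie in `R`, where the
cutoff is 1. So the weight, a product over the whole orbit, depends on the end point alone. -/
theorem stopWeight_eq {n : ℕ} {z : Euc m} (hz : z ∈ D.dom (n + 1)) :
    D.stopWeight δ (n + 1) z = D.endWeight δ (D.T^[n + 1] z) := by
  have hzn := (mem_dom_succ.1 hz).2
  have h1 : (D.T '' D.U 0).indicator (fun y => D.cutoff δ (D.inv₀ y)) (D.T^[n + 1] z) =
      D.cutoff δ (D.T^[n] z) := by
    rw [Function.iterate_succ_apply', indicator_of_mem (mem_image_of_mem _ hzn), H.inv₀_T hzn]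
  rw [stopWeight, endWeight, h1, Finset.prod_range_succ]
  by_cases h0 : D.cutoff δ (D.T^[n] z) = 0
  · rw [h0]; simp
  · have h2 := hC.nbhdR_subset (H.cutoff_ne_zero hC h0)
    rw [Finset.prod_eq_one, one_mul]
    intro k hk
    exact cutoff_of_mem (H.iterate_mem_R hz h2 (Finset.mem_range.1 hk))

theorem endWeight_ne_zero {a : Euc m} (ha : D.endWeight δ a ≠ 0) :
    a ∈ D.T '' D.nbhdR δ ∧ a ∉ D.R := by
  rw [endWeight, mul_ne_zero_iff] at ha
  constructor
  · have h1 : a ∈ D.T '' D.U 0 := by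
      by_contra h; exact ha.1 (indicator_of_notMem h _)
    rw [indicator_of_mem h1] at ha
    exact ⟨_, H.cutoff_ne_zero hC ha.1, H.T_inv₀ h1⟩
  · intro h
    rw [cutoff_of_mem h] at ha
    exact ha.2 (tsub_self _)

theorem mem_gate {a b : Euc m} (ha : D.endWeight δ a ≠ 0) (hab : dist a b < r₀) :
    b ∈ D.gate ε δ := by
  obtain ⟨h1, h2⟩ := H.endWeight_ne_zero hC ha
  have hb : b ∈ Metric.ball a r₀ := by rwa [Metric.mem_ball, dist_comm]
  refine ⟨⟨hC.ball_T a h1 hb, ?_⟩, hC.sep a h2 b hb⟩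
  obtain ⟨c, hc, hac⟩ := Metric.mem_thickening_iff.1 (hC.near ⟨h1, h2⟩)
  refine Metric.mem_cthickening_of_dist_le b c _ _ hc ?_
  have := dist_triangle b a c
  rw [dist_comm b a] at this
  linarith [hC.r₀_le]

/-- A product of two functions bounded by one, each with Lipschitz constant `1 / δ`; the inverse
branch does not increase distances. -/
theorem endWeight_le_add {a b : Euc m} {r : ℝ} (hr : r ≤ r₀) (hab : dist a b < r)
    (ha : D.endWeight δ a ≠ 0) :
    D.endWeight δ a ≤ D.endWeight δ b + ENNReal.ofReal (2 * r / δ) := by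
  obtain ⟨h1, h2⟩ := H.endWeight_ne_zero hC ha
  have hδ := hC.δ_pos
  have hb : b ∈ Metric.ball a r₀ := by rw [Metric.mem_ball, dist_comm]; linarith
  have haU : a ∈ D.T '' D.U 0 :=
    image_mono ((hC.nbhdR_subset).trans H.TR_subset_U) h1
  have hbU : b ∈ D.T '' D.U 0 :=
    image_mono (hC.subset.trans H.TR_subset_U) (hC.ball_T a h1 hb)
  have hr0 : 0 ≤ r := dist_nonneg.trans hab.le
  have hd : dist (D.inv₀ a) (D.inv₀ b) ≤ dist a b := by
    have hseg : segment ℝ a b ⊆ D.T '' D.U 0 :=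
      ((convex_ball a r₀).segment_subset (Metric.mem_ball_self hC.r₀_pos) hb).trans
        ((hC.ball_T a h1).trans (image_mono (hC.subset.trans H.TR_subset_U)))
    have h1 := dist_invFunOn_le (H.smooth.isOpen_U 0) (H.smooth.injOn 0)
      (fun u hu => H.strict_T hu) (c₀ := 1) (fun u hu => H.norm_le_one_mul hu)
      zero_le_one hseg (fun w hw ξ => by
        obtain ⟨a, ha, rfl⟩ := hseg hw
        rw [H.invFunOn_eq ha]
        exact H.norm_le_one_mul ha ξ)
    rwa [one_mul] at h1
  rw [endWeight, endWeight, indicator_of_mem haU, indicator_of_mem hbU]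
  have e1 : D.cutoff δ (D.inv₀ a) ≤ D.cutoff δ (D.inv₀ b) + ENNReal.ofReal (r / δ) :=
    (cutoff_le_add hδ _ _).trans (add_le_add le_rfl (ENNReal.ofReal_le_ofReal
      (by gcongr; linarith)))
  have e2 : 1 - D.cutoff δ a ≤ 1 - D.cutoff δ b + ENNReal.ofReal (r / δ) :=
    (one_sub_cutoff_le_add hδ _ _).trans (add_le_add le_rfl (ENNReal.ofReal_le_ofReal
      (by gcongr)))
  have e3 : ENNReal.ofReal (2 * r / δ) = ENNReal.ofReal (r / δ) + ENNReal.ofReal (r / δ) := by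
    rw [← ENNReal.ofReal_add (by positivity) (by positivity)]; congr 1; ring
  calc _ ≤ (D.cutoff δ (D.inv₀ b) + ENNReal.ofReal (r / δ)) * (1 - D.cutoff δ a) := by gcongr
    _ = D.cutoff δ (D.inv₀ b) * (1 - D.cutoff δ a) +
        ENNReal.ofReal (r / δ) * (1 - D.cutoff δ a) := add_mul _ _ _
    _ ≤ D.cutoff δ (D.inv₀ b) * (1 - D.cutoff δ b + ENNReal.ofReal (r / δ)) +
        ENNReal.ofReal (r / δ) * 1 := by
      gcongr
      exact tsub_le_self
    _ = D.cutoff δ (D.inv₀ b) * (1 - D.cutoff δ b) + D.cutoff δ (D.inv₀ b) *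
        ENNReal.ofReal (r / δ) + ENNReal.ofReal (r / δ) := by ring
    _ ≤ D.cutoff δ (D.inv₀ b) * (1 - D.cutoff δ b) + 1 *
        ENNReal.ofReal (r / δ) + ENNReal.ofReal (r / δ) := by
      gcongr
      exact cutoff_le_one _ _
    _ = _ := by rw [e3, one_mul, add_assoc]

/-- Each inverse step is 1-Lipschitz along segments in the domain of the inverse branch, and the
collar keeps the relevant segment there at every step. -/
theorem dist_invn_le {a b : Euc m} (ha : a ∈ D.T '' D.nbhdR δ) (hab : dist a b < r₀) (n : ℕ) :
    a ∈ D.ran n ∧ b ∈ D.ran n ∧ dist (D.invn n a) (D.invn n b) ≤ dist a b := by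
  have hb : b ∈ Metric.ball a r₀ := by rwa [Metric.mem_ball, dist_comm]
  have ha2 : a ∈ D.T '' (D.T '' D.R) :=
    hC.T_nbhdR_subset (hC.ball_T a ha (Metric.mem_ball_self hC.r₀_pos))
  have hb2 := hC.T_nbhdR_subset (hC.ball_T a ha hb)
  refine ⟨H.mem_ran ha2 n, H.mem_ran hb2 n, ?_⟩
  rw [H.invn_eq ha2, H.invn_eq hb2]
  induction n with
  | zero => exact le_rfl
  | succ n ih =>
    rw [Function.iterate_succ_apply', Function.iterate_succ_apply']
    refine le_trans ?_ ih
    rcases n with _ | n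
    · have hseg : segment ℝ a b ⊆ D.T '' D.U 0 :=
        ((convex_ball a r₀).segment_subset (Metric.mem_ball_self hC.r₀_pos) hb).trans
          ((hC.ball_T a ha).trans (image_mono (hC.subset.trans H.TR_subset_U)))
      have h1 := dist_invFunOn_le (H.smooth.isOpen_U 0) (H.smooth.injOn 0)
        (fun u hu => H.strict_T hu) (c₀ := 1) (fun u hu => H.norm_le_one_mul hu)
        zero_le_one hseg (fun w hw ξ => by
          obtain ⟨a, ha, rfl⟩ := hseg hw
          rw [H.invFunOn_eq ha]
          exact H.norm_le_one_mul ha ξ)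
      rwa [one_mul] at h1
    · have hmem : D.inv₀^[n + 1] a ∈ D.nbhdR δ := by
        obtain ⟨u, hu, rfl⟩ := ha
        have hu' := hC.nbhdR_subset hu
        rw [Function.iterate_succ_apply, H.inv₀_T (H.TR_subset_U hu')]
        rcases n with _ | n
        · exact hu
        · exact Metric.self_subset_cthickening _ (H.inv₀_iterate_mem hu' n)
      refine H.dist_inv₀_le (hC.ball_TR _ hmem) ?_
      rw [Metric.mem_ball, dist_comm]
      exact lt_of_le_of_lt ih hab

/-- A late visit to the gate forces the orbit into `R` up to two steps before it. Then the point at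
time `n` is the preimage of a point of `R` under the branch, and such points are removed from the
gate. -/
theorem not_gate {n k : ℕ} {z : Euc m} (hz : z ∈ D.dom (n + (k + 3)))
    (h1 : D.T^[n] z ∈ D.gate ε δ) : D.T^[n + (k + 3)] z ∉ D.gate ε δ := by
  intro h2
  obtain ⟨u, hu, hux⟩ := h2.1.1
  have hu' := hC.subset hu
  have hz2 : z ∈ D.dom ((n + k + 2) + 1) := hz
  have h3 : D.T^[n + k + 2] z = u := by
    refine H.smooth.injOn 0 (mem_dom_succ.1 hz2).2 (H.TR_subset_U hu') ?_
    rw [hux]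
    exact (Function.iterate_succ_apply' D.T (n + k + 2) z).symm
  have h4 : D.T^[n + 1] z ∈ D.R :=
    H.iterate_mem_R hz2 (by rw [h3]; exact hu') (by omega)
  refine h1.2 ⟨_, h4, ?_⟩
  rw [Function.iterate_succ_apply', H.inv₀_T]
  exact hz n (by omega)

end System
end PiecewiseMap

/-! ### The transfer operator with random stopping. -/

namespace PiecewiseMap
variable {m : ℕ} {D : PiecewiseMap m} {I Cξ : ℝ}

/-- The transfer operator of the map which follows the branch at the fixed point until the
random stopping time. -/
noncomputable def induced (D : PiecewiseMap m) (δ : ℝ) (g : Euc m → ℝ≥0∞) (x : Euc m) : ℝ≥0∞ :=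
  ∑' n, D.pull n (fun z => D.stopWeight δ n z * g z) x

theorem sum_stopWeight (δ : ℝ) (N : ℕ) (z : Euc m) :
    ∑ n ∈ Finset.range N, D.stopWeight δ n z +
      ∏ i ∈ Finset.range N, D.cutoff δ (D.T^[i] z) = 1 := by
  induction N with
  | zero => simp
  | succ N ih =>
    rw [Finset.sum_range_succ, Finset.prod_range_succ, ← ih, stopWeight, add_assoc, ← mul_add,
      tsub_add_cancel_of_le (cutoff_le_one _ _), mul_one]

theorem tsum_stopWeight_le (δ : ℝ) (z : Euc m) : ∑' n, D.stopWeight δ n z ≤ 1 := by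
  rw [ENNReal.tsum_eq_iSup_nat]
  exact iSup_le fun N => (sum_stopWeight δ N z) ▸ le_self_add

theorem tsum_indicator_le_three {S : Set ℕ} (h : ∀ a ∈ S, ∀ b ∈ S, a ≤ b → b ≤ a + 2) :
    ∑' n, S.indicator (fun _ => (1 : ℝ≥0∞)) n ≤ 3 := by
  rcases S.eq_empty_or_nonempty with rfl | hne
  · simp
  · obtain ⟨a, ha, hmin⟩ : ∃ a ∈ S, ∀ b ∈ S, a ≤ b :=
      ⟨sInf S, Nat.sInf_mem hne, fun b hb => Nat.sInf_le hb⟩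
    rw [tsum_eq_sum (s := Finset.Icc a (a + 2))]
    · calc _ ≤ ∑ n ∈ Finset.Icc a (a + 2), (1 : ℝ≥0∞) :=
            Finset.sum_le_sum fun n _ => indicator_le_self' (fun _ _ => zero_le) n
        _ = 3 := by
          simp only [Finset.sum_const, Nat.card_Icc, nsmul_eq_mul, mul_one]
          have : a + 2 + 1 - a = 3 := by omega
          rw [this]; norm_num
    · intro b hb
      refine indicator_of_notMem (fun hbS => hb ?_) _
      have := hmin b hbS
      exact Finset.mem_Icc.2 ⟨this, h a ha b hbS this⟩

namespace System
variable (H : D.System I Cξ)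
include H

theorem measurable_stopWeight (δ : ℝ) (n : ℕ) : Measurable (D.stopWeight δ n) := by
  unfold stopWeight
  have hc : ∀ k, Measurable fun z => D.cutoff δ (D.T^[k] z) := fun k =>
    (continuous_cutoff δ).measurable.comp (H.std.measurable.iterate k)
  exact (Finset.measurable_fun_prod _ fun k _ => hc k).mul ((hc n).const_sub 1)

theorem pull_indicator {n : ℕ} (A : Set (Euc m)) (g : Euc m → ℝ≥0∞) (x : Euc m) :
    D.pull n ((D.T^[n] ⁻¹' A).indicator g) x = A.indicator (D.pull n g) x := by
  by_cases hx : x ∈ D.ran n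
  · obtain ⟨z, hz, rfl⟩ := hx
    rw [H.pull_iterate hz]
    by_cases hA : D.T^[n] z ∈ A
    · rw [indicator_of_mem (show z ∈ D.T^[n] ⁻¹' A from hA), indicator_of_mem hA,
        H.pull_iterate hz]
    · rw [indicator_of_notMem (show z ∉ D.T^[n] ⁻¹' A from hA), indicator_of_notMem hA, mul_zero]
  · rw [pull_eq_zero hx]
    by_cases hA : x ∈ A
    · rw [indicator_of_mem hA, pull_eq_zero hx]
    · rw [indicator_of_notMem hA]

theorem measurable_induced {g : Euc m → ℝ≥0∞} (hg : Measurable g) (δ : ℝ) :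
    Measurable (D.induced δ g) :=
  Measurable.tsum fun n => H.measurable_pull n ((H.measurable_stopWeight δ n).mul hg)

variable {ε δ r₀ : ℝ} (hC : D.Collar ε δ r₀)
include hC

theorem stopWeight_eq_zero {n : ℕ} {z : Euc m} (hz : z ∉ D.dom n) : D.stopWeight δ n z = 0 := by
  rw [stopWeight]
  have : ∃ k < n, D.T^[k] z ∉ D.U 0 := by
    by_contra! h; exact hz h
  obtain ⟨k, hk, hkU⟩ := this
  rw [Finset.prod_eq_zero (Finset.mem_range.2 hk), zero_mul]
  by_contra h
  exact hkU (H.TR_subset_U (hC.nbhdR_subset (H.cutoff_ne_zero hC h)))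

/-- Every orbit except that of `p` reaches a point of zero cutoff, after which the telescoping sum
of the weights is complete. -/
theorem tsum_stopWeight {z : Euc m} (hz : z ≠ D.p) : ∑' n, D.stopWeight δ n z = 1 := by
  refine le_antisymm (tsum_stopWeight_le δ z) ?_
  have : ∃ n, D.T^[n] z ∉ D.nbhdR δ := by
    by_contra! h
    exact hz (H.eq_p_of_forall_mem (H.isCompact_nbhdR δ) hC.nbhdR_subset h)
  obtain ⟨n, hn⟩ := this
  have h0 : D.cutoff δ (D.T^[n] z) = 0 := by
    by_contra h; exact hn (H.cutoff_ne_zero hC h)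
  have h1 := sum_stopWeight (D := D) δ (n + 1) z
  rw [Finset.prod_eq_zero (Finset.mem_range.2 (Nat.lt_succ_self n)) h0, add_zero] at h1
  rw [← h1]
  exact ENNReal.sum_le_tsum _

theorem ae_tsum_stopWeight : ∀ᵐ z : Euc m, ∑' n, D.stopWeight δ n z = 1 := by
  have := H.nontrivial_E
  have h0 : ∀ᵐ z : Euc m, z ≠ D.p := by
    have h1 : volume ({D.p} : Set (Euc m)) = 0 := measure_singleton _
    exact compl_mem_ae_iff.2 h1
  filter_upwards [h0] with z hz using H.tsum_stopWeight hC hz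

theorem lintegral_induced {g : Euc m → ℝ≥0∞} (hg : Measurable g) :
    ∫⁻ x, D.induced δ g x = ∫⁻ x, g x := by
  unfold induced
  have hm : ∀ n, Measurable fun z => D.stopWeight δ n z * g z := fun n =>
    (H.measurable_stopWeight δ n).mul hg
  rw [lintegral_tsum fun n => (H.measurable_pull n (hm n)).aemeasurable]
  have h1 : ∀ n, ∫⁻ x, D.pull n (fun z => D.stopWeight δ n z * g z) x =
      ∫⁻ z, D.stopWeight δ n z * g z := by
    intro n
    rw [H.lintegral_pull]
    refine setLIntegral_eq_of_support_subset fun z hz => ?_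
    by_contra h
    exact hz (by simp only [H.stopWeight_eq_zero hC h, zero_mul])
  rw [tsum_congr h1, ← lintegral_tsum fun n => (hm n).aemeasurable]
  refine lintegral_congr_ae ?_
  filter_upwards [H.ae_tsum_stopWeight hC] with z hz
  rw [ENNReal.tsum_mul_right, hz, one_mul]

theorem pull_stopWeight (n : ℕ) (g : Euc m → ℝ≥0∞) (x : Euc m) :
    D.pull (n + 1) (fun z => D.stopWeight δ (n + 1) z * g z) x =
      D.endWeight δ x * D.pull (n + 1) g x := by
  by_cases hx : x ∈ D.ran (n + 1)
  · obtain ⟨z, hz, rfl⟩ := hx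
    rw [H.pull_iterate hz, H.pull_iterate hz, H.stopWeight_eq hC hz]
    ring
  · rw [pull_eq_zero hx, pull_eq_zero hx, mul_zero]

/-- Apart from time 0 the weights come out of the sum as a function of the end point. -/
theorem induced_eq (g : Euc m → ℝ≥0∞) (x : Euc m) :
    D.induced δ g x = (1 - D.cutoff δ x) * g x + ∑' n, D.endWeight δ x * D.pull (n + 1) g x := by
  rw [induced, tsum_eq_zero_add' ENNReal.summable, pull_zero_apply]
  congr 1
  · simp [stopWeight]
  · exact tsum_congr fun n => H.pull_stopWeight hC n g x

theorem measurableSet_gate : MeasurableSet (D.gate ε δ) := by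
  have h1 : IsCompact (D.T '' D.nbhdR (2 * δ)) := (H.isCompact_nbhdR _).image_of_continuousOn
    (H.continuousOn_T.mono (hC.subset.trans H.TR_subset_U))
  have h2 : D.inv₀ '' D.R = D.R ∩ D.T ⁻¹' D.R := by
    ext z
    constructor
    · rintro ⟨x, hx, rfl⟩
      refine ⟨H.inv₀_mem (H.R_subset_TR hx), ?_⟩
      rw [mem_preimage, H.T_inv₀ (H.TR_subset_TU (H.R_subset_TR hx))]
      exact hx
    · rintro ⟨h1, h2⟩
      exact ⟨_, h2, H.inv₀_T (H.R_subset_U h1)⟩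
  rw [gate, h2]
  exact (h1.isClosed.measurableSet.inter Metric.isClosed_cthickening.measurableSet).diff
    (H.measurableSet_R.inter (H.std.measurable H.measurableSet_R))

/-- The total contribution of the visits to the gate. -/
theorem lintegral_gate_le {g : Euc m → ℝ≥0∞} (hg : Measurable g) :
    ∫⁻ x, ∑' n, (D.gate ε δ).indicator (D.pull (n + 1) g) x ≤ 3 * ∫⁻ x, g x := by
  have hgm := H.measurableSet_gate hC
  have hTm : ∀ n, MeasurableSet (D.T^[n] ⁻¹' D.gate ε δ) := fun n =>
    (H.std.measurable.iterate n) hgm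
  have hm : ∀ n, Measurable ((D.T^[n + 1] ⁻¹' D.gate ε δ).indicator g) := fun n =>
    hg.indicator (hTm _)
  calc _ = ∑' n, ∫⁻ x, D.pull (n + 1) ((D.T^[n + 1] ⁻¹' D.gate ε δ).indicator g) x := by
        rw [← lintegral_tsum fun n => (H.measurable_pull _ (hm n)).aemeasurable]
        refine lintegral_congr fun x => tsum_congr fun n => ?_
        rw [H.pull_indicator]
    _ = ∑' n, ∫⁻ z, (D.dom (n + 1) ∩ D.T^[n + 1] ⁻¹' D.gate ε δ).indicator g z := by
        refine tsum_congr fun n => ?_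
        rw [H.lintegral_pull, ← lintegral_indicator (H.isOpen_dom _).measurableSet,
          indicator_indicator]
    _ = ∫⁻ z, ∑' n, (D.dom (n + 1) ∩ D.T^[n + 1] ⁻¹' D.gate ε δ).indicator g z := by
        rw [lintegral_tsum fun n =>
          (hg.indicator ((H.isOpen_dom _).measurableSet.inter (hTm _))).aemeasurable]
    _ ≤ ∫⁻ z, 3 * g z := by
        refine lintegral_mono fun z => ?_
        -- The times at which the orbit of `z` is in the gate; they lie within three consecutive
        -- integers.
        set S : Set ℕ := {n | z ∈ D.dom (n + 1) ∩ D.T^[n + 1] ⁻¹' D.gate ε δ} with hS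
        have hterm : ∀ n, (D.dom (n + 1) ∩ D.T^[n + 1] ⁻¹' D.gate ε δ).indicator g z =
            S.indicator (fun _ => (1 : ℝ≥0∞)) n * g z := by
          intro n
          by_cases h : n ∈ S
          · rw [indicator_of_mem h, indicator_of_mem (by exact h), one_mul]
          · rw [indicator_of_notMem h, indicator_of_notMem (by exact h), zero_mul]
        simp only [hterm]
        rw [ENNReal.tsum_mul_right]
        refine mul_le_mul_left (tsum_indicator_le_three fun a ha b hb hab => ?_) _
        by_contra! hlt
        obtain ⟨k, rfl⟩ : ∃ k, b = a + (k + 3) := ⟨b - a - 3, by omega⟩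
        have h1 : z ∈ D.dom (a + 1 + (k + 3)) := by
          have := hb.1
          rwa [show a + (k + 3) + 1 = a + 1 + (k + 3) by ring] at this
        refine H.not_gate hC h1 ha.2 ?_
        have h2 : D.T^[a + (k + 3) + 1] z ∈ D.gate ε δ := hb.2
        rwa [show a + (k + 3) + 1 = a + 1 + (k + 3) by ring] at h2
    _ = 3 * ∫⁻ x, g x := lintegral_const_mul _ hg

omit H hC in
/-- Distortion of the inverse iterates at scale `r`. -/
def _root_.PiecewiseMap.DistortionAt (D : PiecewiseMap m) (ε J r : ℝ) (N : ℕ∞) : Prop :=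
  (∀ n : ℕ, 0 < n → (n : ℕ∞) ≤ N → ∀ x ∈ Metric.cthickening ε D.R₀ ∩ D.ran n,
    ∀ y ∈ Metric.closedBall x r ∩ D.ran n, D.jac n y ≤ (1 + J * r ^ D.α) * D.jac n x) ∧
  ∀ x ∈ Metric.cthickening ε D.R₀,
    ∑' n : {n : ℕ // N ≤ (n : ℕ∞)},
      (⨆ y ∈ Metric.closedBall x r ∩ D.ran n, ENNReal.ofReal (D.jac n y)) ≤
      ENNReal.ofReal (1 * r ^ ((m : ℝ) + D.α))

/-- Comparison of one term at two nearby end points: distortion controls the Jacobians, and the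
inverse orbits stay within `r`. The pair `f`, `h` allows both a function with its suprema and infima
with the function. -/
theorem pull_le_pull {J r : ℝ} {N : ℕ∞} (hJ : D.DistortionAt ε J r N) (hJ0 : 0 ≤ J) (hr0 : 0 < r)
    (hr : r ≤ r₀) {a b : Euc m} (ha : D.endWeight δ a ≠ 0) (hab : dist a b < r) {n : ℕ}
    (hn : ((n + 1 : ℕ) : ℕ∞) ≤ N) {f h : Euc m → ℝ≥0∞} (hfh : ∀ z z', dist z z' < r → f z ≤ h z') :
    D.pull (n + 1) f a ≤ ENNReal.ofReal (1 + J * r ^ D.α) * D.pull (n + 1) h b := by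
  obtain ⟨h1, h2, h3⟩ := H.dist_invn_le hC (H.endWeight_ne_zero hC ha).1 (hab.trans_le hr) (n + 1)
  have hb := (H.mem_gate hC ha (hab.trans_le hr)).1.2
  rw [pull, pull, indicator_of_mem h1, indicator_of_mem h2, ← mul_assoc,
    ← ENNReal.ofReal_mul (by have := Real.rpow_nonneg hr0.le D.α; positivity)]
  gcongr
  · exact hJ.1 (n + 1) (Nat.succ_pos n) hn b ⟨hb, h2⟩ a ⟨hab.le, h1⟩
  · exact hfh _ _ (h3.trans_lt hab)

/-- The times beyond the range of controlled distortion contribute at most `r ^ (m + α)`. -/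
theorem tail_le {J r : ℝ} {N : ℕ∞} (hJ : D.DistortionAt ε J r N) (hr0 : 0 < r)
    {a : Euc m} (ha : D.endWeight δ a ≠ 0) :
    ∑' n : ℕ, (if N ≤ ((n + 1 : ℕ) : ℕ∞) then ENNReal.ofReal (D.jac (n + 1) a) else 0) ≤
      ENNReal.ofReal (r ^ ((m : ℝ) + D.α)) := by
  have hag := (H.mem_gate hC ha (by rw [dist_self]; exact hC.r₀_pos)).1.2
  have h1 := hJ.2 a hag
  rw [one_mul] at h1
  refine le_trans ?_ h1
  set F : ℕ → ℝ≥0∞ := fun n =>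
    ⨆ y ∈ Metric.closedBall a r ∩ D.ran n, ENNReal.ofReal (D.jac n y) with hF
  have h2 : ∑' n : {n : ℕ // N ≤ (n : ℕ∞)}, F n =
      ∑' n : ℕ, ({n : ℕ | N ≤ (n : ℕ∞)} : Set ℕ).indicator F n :=
    tsum_subtype ({n : ℕ | N ≤ (n : ℕ∞)} : Set ℕ) F
  calc _ ≤ ∑' n : ℕ, ({n : ℕ | N ≤ (n : ℕ∞)} : Set ℕ).indicator F (n + 1) := by
        refine ENNReal.tsum_le_tsum fun n => ?_
        split_ifs with h
        · rw [indicator_of_mem (by exact h)]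
          have hran := (H.dist_invn_le hC (b := a) (H.endWeight_ne_zero hC ha).1
            (by rw [dist_self]; exact hC.r₀_pos) (n + 1)).1
          exact le_iSup₂ (f := fun y (_ : y ∈ Metric.closedBall a r ∩ D.ran (n + 1)) =>
            ENNReal.ofReal (D.jac (n + 1) y)) a ⟨Metric.mem_closedBall_self hr0.le, hran⟩
        · exact zero_le
    _ ≤ ∑' n : ℕ, ({n : ℕ | N ≤ (n : ℕ∞)} : Set ℕ).indicator F n :=
        ENNReal.tsum_comp_le_tsum_of_injective Nat.succ_injective _
    _ = _ := h2.symm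

/-- Splitting a sum over the inverse iterates into a controlled part and a tail. -/
theorem tsum_pull_le {J r : ℝ} {N : ℕ∞} (hJ : D.DistortionAt ε J r N) (hr0 : 0 < r)
    {a : Euc m} (ha : D.endWeight δ a ≠ 0) {f : Euc m → ℝ≥0∞} {S : ℝ≥0∞} (hS : ∀ x, f x ≤ S)
    {X : ℕ → ℝ≥0∞} (hX : ∀ n : ℕ, ((n + 1 : ℕ) : ℕ∞) ≤ N →
      D.endWeight δ a * D.pull (n + 1) f a ≤ X n) :
    ∑' n, D.endWeight δ a * D.pull (n + 1) f a ≤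
      (∑' n, X n) + ENNReal.ofReal (r ^ ((m : ℝ) + D.α)) * S := by
  calc _ ≤ ∑' n : ℕ, (X n + (if N ≤ ((n + 1 : ℕ) : ℕ∞) then ENNReal.ofReal (D.jac (n + 1) a)
          else 0) * S) := by
        refine ENNReal.tsum_le_tsum fun n => ?_
        rcases le_total ((n + 1 : ℕ) : ℕ∞) N with h | h
        · exact (hX n h).trans le_self_add
        · rw [if_pos h]
          refine le_trans ?_ le_add_self
          calc _ ≤ 1 * D.pull (n + 1) f a := by gcongr; exact endWeight_le_one _ _
            _ ≤ ENNReal.ofReal (D.jac (n + 1) a) * S := by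
              rw [one_mul, pull]
              refine (indicator_le_self _ _ _).trans ?_
              gcongr
              exact hS _
    _ ≤ _ := by
        rw [ENNReal.tsum_add, ENNReal.tsum_mul_right]
        gcongr
        exact H.tail_le hC hJ hr0 ha

/-- Three errors enter: the distortion factor, the variation of the weights, charged on the visits
of `x` to the gate, and the tail, which is present only near `M`. -/
theorem induced_le_of_dist {J r : ℝ} {N : ℕ∞} (hJ : D.DistortionAt ε J r N) (hJ0 : 0 ≤ J)
    (hr0 : 0 < r) (hr : r ≤ r₀) {g : Euc m → ℝ≥0∞} {S : ℝ≥0∞}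
    (hS : ∀ x, g x ≤ S) {x y : Euc m} (hxy : dist y x < r) :
    D.induced δ g y ≤ ENNReal.ofReal (1 + J * r ^ D.α) * (D.induced δ (dil g r) x +
      ENNReal.ofReal (2 * r / δ) * (dil g r x +
        ∑' n, (D.gate ε δ).indicator (D.pull (n + 1) (dil g r)) x)) +
      (Metric.thickening 1 D.M).indicator
        (fun _ => ENNReal.ofReal (r ^ ((m : ℝ) + D.α)) * S) x := by
  have hδ := hC.δ_pos
  set Jr := ENNReal.ofReal (1 + J * r ^ D.α) with hJr
  set κ := ENNReal.ofReal (2 * r / δ) with hκ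
  have hJr1 : 1 ≤ Jr := by
    rw [hJr, ENNReal.one_le_ofReal]
    have := Real.rpow_nonneg hr0.le D.α
    nlinarith [mul_nonneg hJ0 this]
  set G := ∑' n, (D.gate ε δ).indicator (D.pull (n + 1) (dil g r)) x with hG
  have h0 : (1 - D.cutoff δ y) * g y ≤ Jr * ((1 - D.cutoff δ x) * dil g r x + κ * dil g r x) := by
    have e1 : 1 - D.cutoff δ y ≤ 1 - D.cutoff δ x + κ :=
      (one_sub_cutoff_le_add hδ _ _).trans (add_le_add le_rfl (ENNReal.ofReal_le_ofReal
        (by gcongr; linarith)))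
    calc _ ≤ (1 - D.cutoff δ x + κ) * dil g r x := by gcongr; exact le_dil g hxy
      _ = 1 * ((1 - D.cutoff δ x) * dil g r x + κ * dil g r x) := by ring
      _ ≤ _ := by gcongr
  have h1 : ∑' n, D.endWeight δ y * D.pull (n + 1) g y ≤
      Jr * (∑' n, D.endWeight δ x * D.pull (n + 1) (dil g r) x + κ * G) +
      (Metric.thickening 1 D.M).indicator
        (fun _ => ENNReal.ofReal (r ^ ((m : ℝ) + D.α)) * S) x := by
    by_cases hy : D.endWeight δ y = 0
    · simp only [hy, zero_mul, tsum_zero]; exact zero_le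
    · have hxM : x ∈ Metric.thickening 1 D.M := by
        obtain ⟨⟨u, hu, rfl⟩, -⟩ := H.endWeight_ne_zero hC hy
        have hu' := H.U_subset_M 0 (H.TR_subset_U (hC.nbhdR_subset hu))
        refine Metric.mem_thickening_iff.2 ⟨D.T u, H.std.mapsTo hu', ?_⟩
        rw [dist_comm]
        linarith [hC.r₀_le_one]
      rw [indicator_of_mem hxM]
      refine (H.tsum_pull_le hC hJ hr0 hy hS (X := fun n => Jr * (D.endWeight δ x *
        D.pull (n + 1) (dil g r) x + κ * (D.gate ε δ).indicator (D.pull (n + 1) (dil g r)) x))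
        fun n hn => ?_).trans (le_of_eq ?_)
      · have hp := H.pull_le_pull hC hJ hJ0 hr0 hr hy hxy hn (f := g) (h := dil g r)
          (fun z z' h => le_dil g h)
        have he := H.endWeight_le_add hC hr hxy hy
        rw [indicator_of_mem (H.mem_gate hC hy (hxy.trans_le hr))]
        calc _ ≤ (D.endWeight δ x + κ) * (Jr * D.pull (n + 1) (dil g r) x) := by gcongr
          _ = _ := by ring
      · rw [ENNReal.tsum_mul_left, ENNReal.tsum_add, ENNReal.tsum_mul_left (a := κ)]
  rw [H.induced_eq hC, H.induced_eq hC]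
  calc _ ≤ Jr * ((1 - D.cutoff δ x) * dil g r x + κ * dil g r x) + (Jr * (∑' n, D.endWeight δ x *
        D.pull (n + 1) (dil g r) x + κ * G) + (Metric.thickening 1 D.M).indicator
        (fun _ => ENNReal.ofReal (r ^ ((m : ℝ) + D.α)) * S) x) := add_le_add h0 h1
    _ = _ := by ring

/-- The mirror image for infima. The errors are measured at `x`, so that they can be integrated
afterwards. -/
theorem induced_ero_le_of_dist {J r : ℝ} {N : ℕ∞} (hJ : D.DistortionAt ε J r N) (hJ0 : 0 ≤ J)
    (hr0 : 0 < r) (hr : r ≤ r₀) {g : Euc m → ℝ≥0∞} {S : ℝ≥0∞}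
    (hS : ∀ x, g x ≤ S) {x y : Euc m} (hxy : dist y x < r) :
    D.induced δ (ero g r) x ≤ ENNReal.ofReal (1 + J * r ^ D.α) * D.induced δ g y +
      (ENNReal.ofReal (2 * r / δ) * (ero g r x +
        ∑' n, (D.gate ε δ).indicator (D.pull (n + 1) (ero g r)) x) +
      D.M.indicator (fun _ => ENNReal.ofReal (r ^ ((m : ℝ) + D.α)) * S) x) := by
  have hδ := hC.δ_pos
  rw [dist_comm] at hxy
  set Jr := ENNReal.ofReal (1 + J * r ^ D.α) with hJr
  set κ := ENNReal.ofReal (2 * r / δ) with hκ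
  have hJr1 : 1 ≤ Jr := by
    rw [hJr, ENNReal.one_le_ofReal]
    have := Real.rpow_nonneg hr0.le D.α
    nlinarith [mul_nonneg hJ0 this]
  set G := ∑' n, (D.gate ε δ).indicator (D.pull (n + 1) (ero g r)) x with hG
  have h0 : (1 - D.cutoff δ x) * ero g r x ≤ Jr * ((1 - D.cutoff δ y) * g y) + κ * ero g r x := by
    have e1 : 1 - D.cutoff δ x ≤ 1 - D.cutoff δ y + κ :=
      (one_sub_cutoff_le_add hδ _ _).trans (add_le_add le_rfl (ENNReal.ofReal_le_ofReal
        (by gcongr; linarith)))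
    calc _ ≤ (1 - D.cutoff δ y + κ) * ero g r x := by gcongr
      _ = 1 * ((1 - D.cutoff δ y) * ero g r x) + κ * ero g r x := by ring
      _ ≤ _ := by
        gcongr
        exact ero_le g (by rwa [dist_comm])
  have h1 : ∑' n, D.endWeight δ x * D.pull (n + 1) (ero g r) x ≤
      Jr * ∑' n, D.endWeight δ y * D.pull (n + 1) g y + (κ * G +
      D.M.indicator (fun _ => ENNReal.ofReal (r ^ ((m : ℝ) + D.α)) * S) x) := by
    by_cases hx : D.endWeight δ x = 0
    · simp only [hx, zero_mul, tsum_zero]; exact zero_le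
    · have hxM : x ∈ D.M := by
        obtain ⟨⟨u, hu, rfl⟩, -⟩ := H.endWeight_ne_zero hC hx
        exact H.std.mapsTo (H.U_subset_M 0 (H.TR_subset_U (hC.nbhdR_subset hu)))
      rw [indicator_of_mem hxM, ← add_assoc]
      have hSe : ∀ z, ero g r z ≤ S := fun z => (ero_le_self g hr0 z).trans (hS z)
      refine (H.tsum_pull_le hC hJ hr0 hx hSe (X := fun n => Jr * (D.endWeight δ y *
        D.pull (n + 1) g y) + κ * (D.gate ε δ).indicator (D.pull (n + 1) (ero g r)) x)
        fun n hn => ?_).trans (le_of_eq ?_)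
      · have hp := H.pull_le_pull hC hJ hJ0 hr0 hr hx hxy hn (f := ero g r) (h := g)
          (fun z z' h => ero_le g (by rwa [dist_comm]))
        have he := H.endWeight_le_add hC hr hxy hx
        rw [indicator_of_mem (H.mem_gate hC hx (by rw [dist_self]; exact hC.r₀_pos))]
        calc _ ≤ (D.endWeight δ y + κ) * D.pull (n + 1) (ero g r) x := by gcongr
          _ = D.endWeight δ y * D.pull (n + 1) (ero g r) x + κ * D.pull (n + 1) (ero g r) x := by
            ring
          _ ≤ D.endWeight δ y * (Jr * D.pull (n + 1) g y) + κ * D.pull (n + 1) (ero g r) x := by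
            gcongr
          _ = _ := by ring
      · rw [ENNReal.tsum_add, ENNReal.tsum_mul_left, ENNReal.tsum_mul_left (a := κ)]
  rw [H.induced_eq hC, H.induced_eq hC]
  calc _ ≤ Jr * ((1 - D.cutoff δ y) * g y) + κ * ero g r x +
        (Jr * ∑' n, D.endWeight δ y * D.pull (n + 1) g y + (κ * G +
      D.M.indicator (fun _ => ENNReal.ofReal (r ^ ((m : ℝ) + D.α)) * S) x)) := add_le_add h0 h1
    _ = _ := by ring

end System
end PiecewiseMap

/-! ### The passage near the fixed point at scale `r`. -/

/-- On the ball about `y` the dilation is at least `g y`. This is how integral bounds become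
pointwise bounds. -/
theorem iSup_mul_volume_le_lintegral_dil {m : ℕ} (g : Euc m → ℝ≥0∞) {r : ℝ} (hr : 0 < r) :
    (⨆ x, g x) * ENNReal.ofReal (gam m * r ^ m) ≤ ∫⁻ x, dil g r x := by
  rw [ENNReal.iSup_mul]
  refine iSup_le fun y => ?_
  calc g y * ENNReal.ofReal (gam m * r ^ m) = ∫⁻ x in Metric.ball y r, g y := by
        rw [setLIntegral_const, volume_ball_eq y hr]
    _ ≤ ∫⁻ x in Metric.ball y r, dil g r x := by
        refine setLIntegral_mono (measurable_dil g r) fun x hx => le_dil g ?_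
        rwa [dist_comm]
    _ ≤ _ := setLIntegral_le_lintegral _ _

namespace PiecewiseMap
variable {m : ℕ} {D : PiecewiseMap m} {I Cξ : ℝ}

namespace System
variable (H : D.System I Cξ)
include H

theorem rpow_le {r : ℝ} (hr : 0 < r) (hr1 : r ≤ 1) : r ≤ r ^ D.α := by
  simpa using Real.rpow_le_rpow_of_exponent_ge hr hr1 H.std.α_le_one

/-- Integration of the pointwise comparisons: random stopping preserves mass, and the gate terms
integrate to at most three times the mass. -/
theorem exists_induced_estimates : ∃ ε δ r₀, D.Collar ε δ r₀ ∧ ∃ r₁ C : ℝ, 0 < r₁ ∧ 0 ≤ C ∧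
    ∀ g : Euc m → ℝ≥0∞, ∀ r ∈ Ioc 0 r₁,
      ∫⁻ x, dil (D.induced δ g) r x ≤ ENNReal.ofReal (1 + C * r ^ D.α) * ∫⁻ x, dil g r x ∧
      ∀ S : ℝ≥0∞, Measurable g → (∀ x, g x ≤ S) →
        ∫⁻ x, ero g r x ≤ ENNReal.ofReal (1 + C * r ^ D.α) * (∫⁻ x, ero (D.induced δ g) r x) +
          ENNReal.ofReal (C * r ^ D.α) * ((∫⁻ x, g x) + S) := by
  -- The value 1 of the tail constant is arbitrary; it is absorbed into `C`.
  obtain ⟨J, hJ, ε, hε, hdist⟩ := H.distortion.iterates 1 one_pos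
  obtain ⟨δ, r₀, hC⟩ := H.exists_collar hε
  have hδ := hC.δ_pos
  have hγ := gam_pos m
  set V := volume (Metric.thickening 1 D.M) with hV
  have hVt : V ≠ ∞ := (H.std.compact.isBounded.thickening).measure_lt_top.ne
  have hα := H.std.α_pos
  -- The summands pay for distortion, for the weights (`2 / δ` times one plus three visits), for
  -- their product, and for the tails in the two estimates.
  refine ⟨ε, δ, r₀, hC, min r₀ ε, J + 8 / δ + 8 * J / δ + V.toReal / gam m + 1,
    lt_min hC.r₀_pos hε, by positivity, fun g r hr => ?_⟩
  have hr0 := hr.1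
  have hrr := hr.2.trans (min_le_left _ _)
  have hr1 : r ≤ 1 := hrr.trans hC.r₀_le_one
  have hrα := H.rpow_le hr0 hr1
  have hrα1 : r ^ D.α ≤ 1 := Real.rpow_le_one hr0.le hr1 hα.le
  have hrα0 : 0 < r ^ D.α := Real.rpow_pos_of_pos hr0 _
  obtain ⟨N, -, hN1, hN2⟩ := hdist r ⟨hr0, hr.2.trans (min_le_right _ _)⟩
  have hD : D.DistortionAt ε J r N := ⟨hN1, hN2⟩
  set Jr := ENNReal.ofReal (1 + J * r ^ D.α) with hJr
  set κ := ENNReal.ofReal (2 * r / δ) with hκ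
  have hrm : r ^ ((m : ℝ) + D.α) = r ^ m * r ^ D.α := by
    rw [Real.rpow_add hr0, Real.rpow_natCast]
  have h8 : 8 * r / δ ≤ 8 / δ * r ^ D.α := by rw [div_mul_eq_mul_div]; gcongr
  constructor
  · set X := ∫⁻ x, dil g r x with hX
    set S := ⨆ x, g x with hS
    have hSX : S * ENNReal.ofReal (gam m * r ^ m) ≤ X := iSup_mul_volume_le_lintegral_dil g hr0
    have hdm := measurable_dil g r
    have hgm : Measurable fun x => ∑' n, (D.gate ε δ).indicator (D.pull (n + 1) (dil g r)) x :=
      Measurable.tsum fun n => (H.measurable_pull _ hdm).indicator (H.measurableSet_gate hC)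
    calc ∫⁻ x, dil (D.induced δ g) r x ≤ ∫⁻ x, (Jr * (D.induced δ (dil g r) x + κ * (dil g r x +
        ∑' n, (D.gate ε δ).indicator (D.pull (n + 1) (dil g r)) x)) +
        (Metric.thickening 1 D.M).indicator
        (fun _ => ENNReal.ofReal (r ^ ((m : ℝ) + D.α)) * S) x) := by
          refine lintegral_mono fun x => iSup₂_le fun y hy => ?_
          exact H.induced_le_of_dist hC hD hJ.le hr0 hrr (fun x => le_iSup g x) hy
      _ = Jr * ((∫⁻ x, D.induced δ (dil g r) x) + κ * ∫⁻ x, (dil g r x +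
        ∑' n, (D.gate ε δ).indicator (D.pull (n + 1) (dil g r)) x)) +
          (ENNReal.ofReal (r ^ ((m : ℝ) + D.α)) * S) * V := by
          rw [lintegral_add_right _ (measurable_const.indicator
            Metric.isOpen_thickening.measurableSet), lintegral_const_mul',
            lintegral_add_left (H.measurable_induced hdm δ), lintegral_const_mul',
            lintegral_indicator Metric.isOpen_thickening.measurableSet, setLIntegral_const]
          · exact ENNReal.ofReal_ne_top
          · exact ENNReal.ofReal_ne_top
      _ ≤ Jr * (X + κ * (X + 3 * X)) +
          ENNReal.ofReal (V.toReal / gam m * r ^ D.α) * X := by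
          refine add_le_add (mul_le_mul_right (add_le_add (H.lintegral_induced hC hdm).le
            (mul_le_mul_right ?_ _)) _) ?_
          · rw [lintegral_add_left hdm]
            gcongr
            exact H.lintegral_gate_le hC hdm
          -- The factor `r ^ m` in the tail is the volume of a ball, which converts the supremum `S`
          -- into the integral `X`.
          · calc _ = ENNReal.ofReal (V.toReal / gam m * r ^ D.α) *
                (S * ENNReal.ofReal (gam m * r ^ m)) := by
                  have e : ENNReal.ofReal (r ^ ((m : ℝ) + D.α)) * V =
                    ENNReal.ofReal (V.toReal / gam m * r ^ D.α) * ENNReal.ofReal (gam m * r ^ m) := by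
                    rw [← ENNReal.ofReal_mul (by positivity), ← ENNReal.ofReal_toReal hVt,
                      ← ENNReal.ofReal_mul (by positivity), hrm,
                      ENNReal.toReal_ofReal ENNReal.toReal_nonneg]
                    congr 1
                    field_simp
                  calc _ = (ENNReal.ofReal (r ^ ((m : ℝ) + D.α)) * V) * S := by ring
                    _ = _ := by rw [e]; ring
              _ ≤ _ := mul_le_mul_right hSX _
      _ = ENNReal.ofReal ((1 + J * r ^ D.α) * (1 + 8 * r / δ) + V.toReal / gam m * r ^ D.α) * X := by
          have e : X + κ * (X + 3 * X) = ENNReal.ofReal (1 + 8 * r / δ) * X := by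
            rw [ENNReal.ofReal_add one_pos.le (by positivity), ENNReal.ofReal_one,
              show 8 * r / δ = 4 * (2 * r / δ) by ring, ENNReal.ofReal_mul (by norm_num),
              show ENNReal.ofReal 4 = 4 by simp, hκ]
            ring
          rw [e, ← mul_assoc, hJr, ← ENNReal.ofReal_mul (by positivity), ← add_mul,
            ← ENNReal.ofReal_add (by positivity) (by positivity)]
      _ ≤ _ := by
          refine mul_le_mul_left (ENNReal.ofReal_le_ofReal ?_) _
          have h9 : J * r ^ D.α * (8 * r / δ) ≤ 8 * J / δ * r ^ D.α := by
            calc _ ≤ J * 1 * (8 / δ * r ^ D.α) := by gcongr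
              _ = _ := by ring
          have h11 : 0 ≤ r ^ D.α := hrα0.le
          have h10 : (1 + J * r ^ D.α) * (1 + 8 * r / δ) = 1 + J * r ^ D.α + 8 * r / δ +
            J * r ^ D.α * (8 * r / δ) := by ring
          linarith
  · intro S hg hgS
    have hem := measurable_ero g r
    have hgm : Measurable fun x => ∑' n, (D.gate ε δ).indicator (D.pull (n + 1) (ero g r)) x :=
      Measurable.tsum fun n => (H.measurable_pull _ hem).indicator (H.measurableSet_gate hC)
    have hle : ∫⁻ x, ero g r x ≤ ∫⁻ x, g x := lintegral_mono fun x => ero_le_self g hr0 x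
    rw [← H.lintegral_induced hC hem]
    calc ∫⁻ x, D.induced δ (ero g r) x ≤ ∫⁻ x, (Jr * ero (D.induced δ g) r x +
      (κ * (ero g r x + ∑' n, (D.gate ε δ).indicator (D.pull (n + 1) (ero g r)) x) +
      D.M.indicator (fun _ => ENNReal.ofReal (r ^ ((m : ℝ) + D.α)) * S) x)) := by
          refine lintegral_mono fun x => ?_
          rw [← tsub_le_iff_right]
          have hJ0 : Jr ≠ 0 := (ENNReal.ofReal_pos.2 (by positivity)).ne'
          rw [show ero (D.induced δ g) r x = ⨅ y ∈ Metric.ball x r, D.induced δ g y from rfl,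
            ENNReal.mul_iInf_of_ne hJ0 ENNReal.ofReal_ne_top]
          refine le_iInf fun y => ?_
          rw [ENNReal.mul_iInf_of_ne hJ0 ENNReal.ofReal_ne_top]
          refine le_iInf fun hy => ?_
          rw [tsub_le_iff_right]
          exact H.induced_ero_le_of_dist hC hD hJ.le hr0 hrr hgS hy
      _ = Jr * (∫⁻ x, ero (D.induced δ g) r x) + (κ * (∫⁻ x, (ero g r x +
        ∑' n, (D.gate ε δ).indicator (D.pull (n + 1) (ero g r)) x)) +
          (ENNReal.ofReal (r ^ ((m : ℝ) + D.α)) * S) * volume D.M) := by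
          rw [lintegral_add_left ((measurable_ero _ _).const_mul _), lintegral_const_mul',
            lintegral_add_right _ (measurable_const.indicator H.measurableSet_M),
            lintegral_const_mul',
            lintegral_indicator H.measurableSet_M, setLIntegral_const]
          · exact ENNReal.ofReal_ne_top
          · exact ENNReal.ofReal_ne_top
      _ ≤ Jr * (∫⁻ x, ero (D.induced δ g) r x) + (κ * ((∫⁻ x, g x) + 3 * ∫⁻ x, g x) +
          ENNReal.ofReal (r ^ D.α) * S) := by
          rw [H.std.volume_eq_one, mul_one]
          refine add_le_add_right (add_le_add (mul_le_mul_right ?_ _)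
            (mul_le_mul_left (ENNReal.ofReal_le_ofReal ?_) _)) _
          · rw [lintegral_add_left hem]
            exact add_le_add hle ((H.lintegral_gate_le hC hem).trans (mul_le_mul_right hle _))
          · rw [hrm]
            exact mul_le_of_le_one_left hrα0.le (pow_le_one₀ hr0.le hr1)
      _ ≤ _ := by
          have e : κ * ((∫⁻ x, g x) + 3 * ∫⁻ x, g x) = ENNReal.ofReal (8 * r / δ) * ∫⁻ x, g x := by
            rw [show 8 * r / δ = 4 * (2 * r / δ) by ring, ENNReal.ofReal_mul (by norm_num),
              show ENNReal.ofReal 4 = 4 by simp, hκ]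
            ring
          have h10 : 0 ≤ 8 * J / δ + V.toReal / gam m := by positivity
          have h11 : 0 ≤ 8 / δ := by positivity
          rw [e, mul_add]
          have h12 := mul_nonneg h10 hrα0.le
          have h13 := mul_nonneg h11 hrα0.le
          have h14 := mul_nonneg hJ.le hrα0.le
          have h15 : 0 ≤ V.toReal / gam m * r ^ D.α := by positivity
          have h16 : 0 ≤ 8 * J / δ * r ^ D.α := by positivity
          refine add_le_add (mul_le_mul_left (ENNReal.ofReal_le_ofReal ?_) _)
            (add_le_add (mul_le_mul_left (ENNReal.ofReal_le_ofReal ?_) _)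
              (mul_le_mul_left (ENNReal.ofReal_le_ofReal ?_) _)) <;> linarith

/-! ### The transfer operator and images of measures. -/

theorem measurable_branch (j : Fin (D.K + 1)) {f : Euc m → ℝ≥0∞} (hf : Measurable f) :
    Measurable (D.branch j f) := by
  classical
  have hran := (H.isOpen_TU j).measurableSet
  have hc : ContinuousOn (Function.invFunOn D.T (D.U j)) (D.T '' D.U j) := by
    rintro _ ⟨z, hz, rfl⟩
    obtain ⟨A, -, hA⟩ := H.hasFDerivAt_inv hz
    exact hA.continuousAt.continuousWithinAt
  have h1 : Measurable ((D.T '' D.U j).piecewise (Function.invFunOn D.T (D.U j)) (fun _ => 0)) :=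
    hc.measurable_piecewise continuousOn_const hran
  have hj : Measurable fun x => ENNReal.ofReal |D.detInv j x| := by
    have : Measurable fun x => (fderiv ℝ (Function.invFunOn D.T (D.U j)) x).det :=
      ContinuousLinearMap.continuous_det.measurable.comp (measurable_fderiv ℝ _)
    exact ENNReal.measurable_ofReal.comp (measurable_norm.comp this)
  have : D.branch j f = (D.T '' D.U j).indicator fun x => ENNReal.ofReal |D.detInv j x| *
      f ((D.T '' D.U j).piecewise (Function.invFunOn D.T (D.U j)) (fun _ => 0) x) := by
    refine indicator_congr fun x hx => ?_
    rw [piecewise_eq_of_mem _ _ _ hx]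
  rw [this]
  exact (hj.mul (hf.comp h1)).indicator hran

theorem measurable_transfer {f : Euc m → ℝ≥0∞} (hf : Measurable f) :
    Measurable (D.transfer f) := by
  unfold transfer
  exact Finset.measurable_fun_sum _ fun j _ => H.measurable_branch j hf

theorem setLIntegral_branch (j : Fin (D.K + 1)) (f : Euc m → ℝ≥0∞) {A : Set (Euc m)}
    (hA : MeasurableSet A) :
    ∫⁻ x in A, D.branch j f x = ∫⁻ z in D.U j ∩ D.T ⁻¹' A, f z := by
  have hm := (H.measurableSet_U j).inter (H.std.measurable hA)
  have hd : ∀ z ∈ D.U j ∩ D.T ⁻¹' A,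
      HasFDerivWithinAt D.T (fderiv ℝ D.T z) (D.U j ∩ D.T ⁻¹' A) z := fun z hz =>
    (H.strict_T hz.1).hasFDerivAt.hasFDerivWithinAt
  have h1 : ∫⁻ x in A, D.branch j f x =
      ∫⁻ x in D.T '' (D.U j ∩ D.T ⁻¹' A), D.branch j f x := by
    rw [image_inter_preimage, branch, lintegral_indicator (H.isOpen_TU j).measurableSet,
      lintegral_indicator (H.isOpen_TU j).measurableSet,
      Measure.restrict_restrict (H.isOpen_TU j).measurableSet,
      Measure.restrict_restrict (H.isOpen_TU j).measurableSet, ← inter_assoc, inter_self]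
  rw [h1, lintegral_image_eq_lintegral_abs_det_fderiv_mul volume hm hd
    ((H.smooth.injOn j).mono inter_subset_left)]
  refine setLIntegral_congr_fun hm fun z hz => ?_
  rw [H.branch_apply hz.1, ← mul_assoc, ← ENNReal.ofReal_mul (abs_nonneg _),
    mul_inv_cancel₀ (abs_ne_zero.2 (H.det_ne_zero hz.1)), ENNReal.ofReal_one, one_mul]

/-- The boundary lies in the cuts of all scales, and their volumes in `M` tend to zero. -/
theorem volume_frontier (j : Fin (D.K + 1)) : volume (frontier (D.U j)) = 0 := by
  obtain ⟨r₀, C, hr₀, hC, h⟩ := H.exists_volume_cut_le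
  have hα := H.std.α_pos
  have h1 : ∀ r ∈ Ioc 0 r₀, volume (frontier (D.U j)) ≤ ENNReal.ofReal (C * r ^ D.α) := by
    intro r hr
    refine le_trans ?_ (h r hr)
    refine le_trans (measure_mono (subset_inter (H.frontier_subset_cut j r)
      (frontier_subset_closure.trans (H.closure_U_subset_M j)))) ?_
    exact Finset.single_le_sum (f := fun j => volume (D.cut j r ∩ D.M)) (fun _ _ => zero_le)
      (Finset.mem_univ j)
  have h2 : Tendsto (fun r : ℝ => ENNReal.ofReal (C * r ^ D.α)) (𝓝[>] 0) (𝓝 0) := by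
    have h2 : ContinuousAt (fun r : ℝ => C * r ^ D.α) 0 :=
      continuousAt_const.mul (Real.continuousAt_rpow_const _ _ (Or.inr hα.le))
    have h3 := h2.tendsto
    rw [Real.zero_rpow hα.ne', mul_zero] at h3
    have := (ENNReal.continuous_ofReal.tendsto 0).comp (h3.mono_left (nhdsWithin_le_nhds (s := Ioi 0)))
    rwa [ENNReal.ofReal_zero] at this
  refine le_antisymm (ge_of_tendsto h2 ?_) zero_le
  filter_upwards [Ioc_mem_nhdsGT hr₀] with r hr using h1 r hr

theorem ae_mem_U : ∀ᵐ x ∂(volume.restrict D.M), ∃ j, x ∈ D.U j := by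
  have h0 : volume (⋃ j, frontier (D.U j)) = 0 := measure_iUnion_null fun j => H.volume_frontier j
  have h1 : ∀ᵐ x ∂(volume : Measure (Euc m)), x ∉ ⋃ j, frontier (D.U j) :=
    compl_mem_ae_iff.2 (by simpa using h0)
  rw [ae_restrict_iff' H.measurableSet_M]
  filter_upwards [h1] with x hx hxM
  rw [H.smooth.cover] at hxM
  obtain ⟨j, hj⟩ := mem_iUnion.1 hxM
  refine ⟨j, ?_⟩
  by_contra h
  refine hx (mem_iUnion.2 ⟨j, ?_⟩)
  rw [(H.smooth.isOpen_U j).frontier_eq]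
  exact ⟨hj, h⟩

/-- The transfer operator describes the image of absolutely continuous measures. -/
theorem setLIntegral_transfer {f : Euc m → ℝ≥0∞} (hf : Measurable f)
    (hfM : ∀ x, x ∉ D.M → f x = 0) {A : Set (Euc m)} (hA : MeasurableSet A) :
    ∫⁻ x in A, D.transfer f x = ∫⁻ z in D.T ⁻¹' A, f z := by
  unfold transfer
  rw [lintegral_finsetSum _ fun j _ => H.measurable_branch j hf]
  simp only [H.setLIntegral_branch _ f hA]
  have hTA := H.std.measurable hA
  have hdis : Pairwise (Function.onFun Disjoint fun j => D.U j ∩ D.T ⁻¹' A) := fun i j hij =>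
    (H.smooth.disjoint_U hij).mono inter_subset_left inter_subset_left
  have h1 := lintegral_iUnion (μ := volume)
    (fun j => (H.measurableSet_U j).inter hTA) hdis f
  rw [tsum_fintype] at h1
  rw [← h1, ← iUnion_inter]
  have h2 : ∫⁻ z in D.T ⁻¹' A, f z = ∫⁻ z in D.M ∩ D.T ⁻¹' A, f z := by
    rw [← lintegral_indicator hTA, ← lintegral_indicator (H.measurableSet_M.inter hTA)]
    refine lintegral_congr fun z => ?_
    by_cases hz : z ∈ D.M
    · by_cases hzA : z ∈ D.T ⁻¹' A
      · rw [indicator_of_mem hzA, indicator_of_mem (show z ∈ D.M ∩ D.T ⁻¹' A from ⟨hz, hzA⟩)]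
      · rw [indicator_of_notMem hzA, indicator_of_notMem fun h => hzA h.2]
    · rw [indicator_of_notMem fun h : z ∈ D.M ∩ D.T ⁻¹' A => hz h.1]
      exact indicator_apply_eq_zero.2 fun _ => hfM z hz
  rw [h2]
  refine setLIntegral_congr ?_
  refine ae_eq_set_inter ?_ (ae_eq_refl _)
  have h3 := (ae_restrict_iff' H.measurableSet_M).1 H.ae_mem_U
  filter_upwards [h3] with x hx
  refine propext ⟨fun h => ?_, fun h => mem_iUnion.2 (hx h)⟩
  obtain ⟨j, hj⟩ := mem_iUnion.1 h
  exact H.U_subset_M j hj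

theorem lintegral_transfer {f : Euc m → ℝ≥0∞} (hf : Measurable f)
    (hfM : ∀ x, x ∉ D.M → f x = 0) : ∫⁻ x, D.transfer f x = ∫⁻ z, f z := by
  have := H.setLIntegral_transfer hf hfM MeasurableSet.univ
  simpa using this

theorem map_withDensity {f : Euc m → ℝ≥0∞} (hf : Measurable f)
    (hfM : ∀ x, x ∉ D.M → f x = 0) :
    (volume.withDensity f).map D.T = volume.withDensity (D.transfer f) := by
  ext A hA
  rw [Measure.map_apply H.std.measurable hA, withDensity_apply _ (H.std.measurable hA),
    withDensity_apply _ hA, H.setLIntegral_transfer hf hfM hA]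

theorem one_le_abs_det {j : Fin (D.K + 1)} {x : Euc m} (hx : x ∈ D.U j) :
    1 ≤ |(fderiv ℝ D.T x).det| := by
  obtain ⟨A, hA, hAn⟩ := exists_equiv_of_norm_le (H.norm_le_one_mul hx)
  have h1 := abs_det_le_norm_pow (A.symm : Euc m →L[ℝ] Euc m)
  have h2 : ‖(A.symm : Euc m →L[ℝ] Euc m)‖ ≤ 1 :=
    ContinuousLinearMap.opNorm_le_bound _ zero_le_one hAn
  have h3 : |(A.symm : Euc m →L[ℝ] Euc m).det| ≤ 1 := h1.trans (pow_le_one₀ (norm_nonneg _) h2)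
  have h4 : (A.symm : Euc m →L[ℝ] Euc m).det * (A : Euc m →L[ℝ] Euc m).det = 1 :=
    LinearEquiv.det_symm_mul_det A.toLinearEquiv
  rw [← hA]
  have h5 : |(A.symm : Euc m →L[ℝ] Euc m).det| * |(A : Euc m →L[ℝ] Euc m).det| = 1 := by
    rw [← abs_mul, h4, abs_one]
  nlinarith [abs_nonneg (A : Euc m →L[ℝ] Euc m).det]

theorem transfer_le {f : Euc m → ℝ≥0∞} {S : ℝ≥0∞} (hS : ∀ x, f x ≤ S) (x : Euc m) :
    D.transfer f x ≤ (D.K + 1 : ℕ) * S := by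
  calc D.transfer f x ≤ ∑ j : Fin (D.K + 1), S := by
        refine Finset.sum_le_sum fun j _ => ?_
        by_cases hx : x ∈ D.T '' D.U j
        · obtain ⟨v, hv, rfl⟩ := hx
          rw [H.branch_apply hv]
          refine (mul_le_of_le_one_left zero_le ?_).trans (hS v)
          rw [ENNReal.ofReal_le_one]
          exact inv_le_one_of_one_le₀ (H.one_le_abs_det hv)
        · rw [branch, indicator_of_notMem hx]; exact zero_le
    _ = _ := by simp

theorem transfer_eq_zero {f : Euc m → ℝ≥0∞} {x : Euc m} (hx : x ∉ D.M) :
    D.transfer f x = 0 := by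
  refine Finset.sum_eq_zero fun j _ => ?_
  refine indicator_of_notMem (fun h => hx ?_) _
  obtain ⟨v, hv, rfl⟩ := h
  exact H.std.mapsTo (H.U_subset_M j hv)

end System
end PiecewiseMap

/-! ### Renewal inequalities. -/

/-- Unrolling a triangular recursion. -/
theorem le_of_triangular_recursion {X : ℕ → ℕ → ℝ≥0∞} {a η : ℕ → ℝ≥0∞} {P : ℝ≥0∞}
    (hX : ∀ n k, X (n + 1) k ≤ a k * (X n (k + 1) + η k * X n 0))
    (hP : ∀ n, ∏ i ∈ Finset.range n, a i ≤ P) (n : ℕ) :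
    X n 0 ≤ P * X 0 n + ∑ i ∈ Finset.range n, P * η i * X (n - 1 - i) 0 := by
  -- Each step back in time moves one scale down, or restarts at the top scale with the cost of a
  -- cut.
  have key : ∀ j ≤ n, X n 0 ≤ (∏ i ∈ Finset.range j, a i) * X (n - j) j +
      ∑ i ∈ Finset.range j, P * η i * X (n - 1 - i) 0 := by
    intro j
    induction j with
    | zero => intro _; simp
    | succ j ih =>
      intro hj
      refine (ih (by omega)).trans ?_
      have h1 := hX (n - (j + 1)) j
      rw [show n - (j + 1) + 1 = n - j by omega] at h1
      rw [Finset.sum_range_succ, show n - 1 - j = n - (j + 1) by omega]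
      calc _ ≤ (∏ i ∈ Finset.range j, a i) *
            (a j * (X (n - (j + 1)) (j + 1) + η j * X (n - (j + 1)) 0)) +
            ∑ i ∈ Finset.range j, P * η i * X (n - 1 - i) 0 := by gcongr
        _ = (∏ i ∈ Finset.range (j + 1), a i) * X (n - (j + 1)) (j + 1) +
            (∑ i ∈ Finset.range j, P * η i * X (n - 1 - i) 0 +
              (∏ i ∈ Finset.range (j + 1), a i) * η j * X (n - (j + 1)) 0) := by
          rw [Finset.prod_range_succ]; ring
        _ ≤ _ := by gcongr; exact hP _
  refine (key n le_rfl).trans ?_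
  rw [Nat.sub_self]
  gcongr
  exact hP n

theorem sum_mul_rev_le {θ a : ℕ → ℝ≥0∞} {A : ℝ≥0∞} {n : ℕ} (h : ∀ k < n, a k ≤ A) :
    ∑ i ∈ Finset.range n, θ i * a (n - 1 - i) ≤ (∑' i, θ i) * A := by
  rw [← ENNReal.tsum_mul_right]
  refine le_trans ?_ (ENNReal.sum_le_tsum (Finset.range n))
  refine Finset.sum_le_sum fun i hi => ?_
  gcongr
  exact h _ (by have := Finset.mem_range.1 hi; omega)

/-- `b / (1 - q)` is the fixed point of `x ↦ b + q x`. -/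
theorem le_of_renewal {θ a : ℕ → ℝ≥0∞} {b : ℝ≥0∞} (hθ : ∑' i, θ i < 1)
    (h : ∀ n, a n ≤ b + ∑ i ∈ Finset.range n, θ i * a (n - 1 - i)) (n : ℕ) :
    a n ≤ b / (1 - ∑' i, θ i) := by
  induction n using Nat.strong_induction_on with
  | _ n ih =>
    refine (h n).trans ((add_le_add_right (sum_mul_rev_le ih) _).trans ?_)
    set q := ∑' i, θ i with hq
    have h1 : 1 - q ≠ 0 := (tsub_pos_of_lt hθ).ne'
    have h2 : 1 - q ≠ ∞ := (tsub_le_self.trans_lt ENNReal.one_lt_top).ne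
    have e : b = (1 - q) * (b / (1 - q)) := (ENNReal.mul_div_cancel h1 h2).symm
    calc b + q * (b / (1 - q)) = (1 - q) * (b / (1 - q)) + q * (b / (1 - q)) := by rw [← e]
      _ = b / (1 - q) := by rw [← add_mul, tsub_add_cancel_of_le hθ.le, one_mul]
      _ ≤ _ := le_rfl

/-- Replacing `a` by its tail suprema, which converge to the upper limit, dominated convergence in
the convolution gives `l ≤ b₀ + q l`. -/
theorem limsup_le_of_renewal {θ a b : ℕ → ℝ≥0∞} {b₀ A : ℝ≥0∞} (hθ : ∑' i, θ i < 1)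
    (hA : A ≠ ∞) (haA : ∀ n, a n ≤ A) (hb : Tendsto b atTop (𝓝 b₀))
    (h : ∀ n, a n ≤ b n + ∑ i ∈ Finset.range n, θ i * a (n - 1 - i)) :
    limsup a atTop ≤ b₀ / (1 - ∑' i, θ i) := by
  set q := ∑' i, θ i with hq
  set S : ℕ → ℝ≥0∞ := fun n => ⨆ i ≥ n, a i with hS
  have hSA : ∀ n, S n ≤ A := fun n => iSup₂_le fun i _ => haA i
  have hSanti : Antitone S := fun n k hnk => biSup_mono fun i hi => hnk.trans hi
  set l := limsup a atTop with hl
  have hSl : Tendsto S atTop (𝓝 l) := by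
    rw [hl, limsup_eq_iInf_iSup_of_nat]
    exact tendsto_atTop_iInf hSanti
  have hlA : l ≤ A := limsup_le_of_le (h := Eventually.of_forall haA)
  have hT : Tendsto (fun n => b n + ∑' i, θ i * S (n - 1 - i)) atTop (𝓝 (b₀ + q * l)) := by
    refine hb.add ?_
    rw [hq, ← ENNReal.tsum_mul_right, ← lintegral_count]
    simp_rw [← lintegral_count]
    refine tendsto_lintegral_of_dominated_convergence (fun i => θ i * A) (fun n => by fun_prop)
      (fun n => Eventually.of_forall fun i => by dsimp only; gcongr; exact hSA _) ?_
      (Eventually.of_forall fun i => ?_)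
    · rw [lintegral_count, ENNReal.tsum_mul_right]
      exact ENNReal.mul_ne_top (hθ.trans ENNReal.one_lt_top).ne hA
    · refine ENNReal.Tendsto.const_mul (hSl.comp ?_)
        (Or.inr ((ENNReal.le_tsum i).trans_lt (hθ.trans ENNReal.one_lt_top)).ne)
      exact (tendsto_sub_atTop_nat i).comp (tendsto_sub_atTop_nat 1)
  have hle : l ≤ b₀ + q * l := by
    rw [← hT.limsup_eq]
    refine limsup_le_limsup (Eventually.of_forall fun n => (h n).trans ?_)
    refine add_le_add_right (le_trans ?_ (ENNReal.sum_le_tsum (Finset.range n))) _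
    exact Finset.sum_le_sum fun i _ => mul_le_mul_right
      (le_iSup₂ (f := fun j (_ : j ≥ n - 1 - i) => a j) _ le_rfl) _
  have h1 : 1 - q ≠ 0 := (tsub_pos_of_lt hθ).ne'
  have h2 : 1 - q ≠ ∞ := (tsub_le_self.trans_lt ENNReal.one_lt_top).ne
  have hlt : l ≠ ∞ := (hlA.trans_lt hA.lt_top).ne
  rw [ENNReal.le_div_iff_mul_le (Or.inl h1) (Or.inl h2), mul_comm,
    ENNReal.sub_mul fun _ _ => hlt, one_mul]
  exact tsub_le_iff_right.2 hle

/-- Products `∏ (1 + C (s ^ k ρ) ^ α)` are close to one if `ρ` is small. -/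
theorem prod_one_add_rpow_le {s ρ C α : ℝ} (hs : 0 < s) (hs1 : s < 1) (hρ : 0 < ρ) (hC : 0 ≤ C)
    (hα : 0 < α) (n : ℕ) :
    ∏ k ∈ Finset.range n, ENNReal.ofReal (1 + C * (s ^ k * ρ) ^ α) ≤
      ENNReal.ofReal (Real.exp (C / (1 - s ^ α) * ρ ^ α)) := by
  have hsα : 0 < s ^ α := Real.rpow_pos_of_pos hs _
  have hsα1 : s ^ α < 1 := Real.rpow_lt_one hs.le hs1 hα
  have e : ∀ k : ℕ, (s ^ k * ρ) ^ α = (s ^ α) ^ k * ρ ^ α := fun k => by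
    rw [Real.mul_rpow (by positivity) hρ.le, ← Real.rpow_natCast, ← Real.rpow_mul hs.le,
      mul_comm (k : ℝ), Real.rpow_mul hs.le, Real.rpow_natCast]
  have hρα := Real.rpow_nonneg hρ.le α
  rw [← ENNReal.ofReal_prod_of_nonneg fun k _ => by rw [e]; positivity]
  refine ENNReal.ofReal_le_ofReal ?_
  calc _ ≤ ∏ k ∈ Finset.range n, Real.exp (C * (s ^ k * ρ) ^ α) :=
        Finset.prod_le_prod (fun k _ => by rw [e]; positivity) fun k _ => by
          rw [add_comm]; exact Real.add_one_le_exp _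
    _ = Real.exp (C * ρ ^ α * ∑ k ∈ Finset.range n, (s ^ α) ^ k) := by
        rw [← Real.exp_sum, Finset.mul_sum]
        congr 1
        exact Finset.sum_congr rfl fun k _ => by rw [e]; ring
    _ ≤ Real.exp (C * ρ ^ α * (1 - s ^ α)⁻¹) := by
        gcongr
        rw [← tsum_geometric_of_lt_one hsα.le hsα1]
        exact (summable_geometric_of_lt_one hsα.le hsα1).sum_le_tsum _ fun _ _ => by positivity
    _ = _ := by congr 1; field_simp

/-! ### One step of the induced system. -/

namespace PiecewiseMap
variable {m : ℕ} {D : PiecewiseMap m} {I Cξ : ℝ}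

/-- The transfer operator of the induced system. -/
noncomputable def step (D : PiecewiseMap m) (δ : ℝ) (f : Euc m → ℝ≥0∞) : Euc m → ℝ≥0∞ :=
  D.induced δ (D.transfer f)

/-- Densities live on `M \ R`. -/
def IsDensity (D : PiecewiseMap m) (f : Euc m → ℝ≥0∞) : Prop :=
  Measurable f ∧ (∀ x ∈ D.R, f x = 0) ∧ ∀ x, x ∉ D.M → f x = 0

namespace System
variable (H : D.System I Cξ)
include H

section
variable {ε δ r₀ : ℝ} (hC : D.Collar ε δ r₀)
include hC

/-- Stopping has probability zero on `R`, so a step leaves no mass there; this is what lets the next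
application of `T` expand uniformly. -/
theorem isDensity_step {f : Euc m → ℝ≥0∞} (hf : Measurable f) : D.IsDensity (D.step δ f) := by
  have h0 : ∀ x, D.step δ f x ≠ 0 → x ∉ D.R ∧ x ∈ D.M := by
    intro x hx
    rw [step, H.induced_eq hC] at hx
    constructor
    · intro hR
      have h1 : D.endWeight δ x = 0 := by
        by_contra h; exact (H.endWeight_ne_zero hC h).2 hR
      simp [cutoff_of_mem hR, h1] at hx
    · by_contra hM
      have h1 : D.endWeight δ x = 0 := by
        by_contra h
        obtain ⟨z, hz, rfl⟩ := (H.endWeight_ne_zero hC h).1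
        exact hM (H.std.mapsTo (H.U_subset_M 0 (H.TR_subset_U (hC.nbhdR_subset hz))))
      simp [H.transfer_eq_zero hM, h1] at hx
  refine ⟨H.measurable_induced (H.measurable_transfer hf) δ, fun x hx => ?_, fun x hx => ?_⟩
  · by_contra h; exact (h0 x h).1 hx
  · by_contra h; exact hx (h0 x h).2

theorem isDensity_iterate {f : Euc m → ℝ≥0∞} (hf : D.IsDensity f) (n : ℕ) :
    D.IsDensity ((D.step δ)^[n] f) := by
  cases n with
  | zero => exact hf
  | succ n =>
    have : ∀ n, Measurable ((D.step δ)^[n] f) := by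
      intro n
      induction n with
      | zero => exact hf.1
      | succ n ih => rw [Function.iterate_succ_apply']; exact (H.isDensity_step hC ih).1
    rw [Function.iterate_succ_apply']
    exact H.isDensity_step hC (this n)

theorem lintegral_step {f : Euc m → ℝ≥0∞} (hf : D.IsDensity f) :
    ∫⁻ x, D.step δ f x = ∫⁻ x, f x := by
  rw [step, H.lintegral_induced hC (H.measurable_transfer hf.1), H.lintegral_transfer hf.1 hf.2.2]

theorem lintegral_iterate {f : Euc m → ℝ≥0∞} (hf : D.IsDensity f) (n : ℕ) :
    ∫⁻ x, (D.step δ)^[n] f x = ∫⁻ x, f x := by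
  induction n with
  | zero => rfl
  | succ n ih =>
    rw [Function.iterate_succ_apply', H.lintegral_step hC (H.isDensity_iterate hC hf n), ih]

end

omit H in
theorem _root_.PiecewiseMap.isDensity_indicator (D : PiecewiseMap m) {K : Set (Euc m)} (hK : MeasurableSet K) (hKM : K ⊆ D.M \ D.R) :
    D.IsDensity (K.indicator 1) := by
  refine ⟨measurable_one.indicator hK, fun x hx => ?_, fun x hx => ?_⟩
  · exact indicator_of_notMem (fun h => (hKM h).2 hx) _
  · exact indicator_of_notMem (fun h => hx (hKM h).1) _

/-- The basic estimates for one step of the induced system. -/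
theorem exists_step_estimates : ∃ ε δ r₀, D.Collar ε δ r₀ ∧
    ∃ (s ρ C : ℝ) (P : ℝ≥0∞) (η : ℕ → ℝ≥0∞), 0 < s ∧ s < 1 ∧ 0 < ρ ∧ 0 ≤ C ∧ P ≠ ∞ ∧
      ∑' k, P * η k < 1 ∧
      (∀ n, ∏ k ∈ Finset.range n, ENNReal.ofReal (1 + C * (s ^ k * ρ) ^ D.α) ≤ P) ∧
      (∀ f, D.IsDensity f → ∀ k, ∫⁻ x, dil (D.step δ f) (s ^ k * ρ) x ≤
        ENNReal.ofReal (1 + C * (s ^ k * ρ) ^ D.α) *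
          ((∫⁻ x, dil f (s ^ (k + 1) * ρ) x) + η k * ∫⁻ x, dil f ρ x)) ∧
      (∀ g, ∫⁻ x, dil (D.induced δ g) ρ x ≤
        ENNReal.ofReal (1 + C * ρ ^ D.α) * ∫⁻ x, dil g ρ x) ∧
      ∀ f, D.IsDensity f → ∀ S : ℝ≥0∞, (∀ x, f x ≤ S) → ∀ r ∈ Ioc 0 ρ,
        ∫⁻ x, ero f (s * r) x ≤ ENNReal.ofReal (1 + C * r ^ D.α) *
          ((∫⁻ x, ero (D.step δ f) r x) + ENNReal.ofReal (C * r ^ D.α) * ((∫⁻ x, f x) + S)) := by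
  obtain ⟨hs0, hs1, -, ε₂, lam, hε₂, hlam, hsum, hy, hτ⟩ := H.exists_lam
  have hα := H.std.α_pos
  obtain ⟨s, L, η, hss, hs'1, hL, hη0, hηs, hη1, hcut⟩ := exists_cut_rates H.std.dim_pos hs0 hs1
    hlam hα H.std.α_le_one hy hsum
  have hs'0 := hs0.trans hss
  obtain ⟨ε, δ, r₀, hC, r₁, C₁, hr₁, hC₁, hind⟩ := H.exists_induced_estimates
  obtain ⟨r₂, C₂, hr₂, hC₂, htr⟩ := H.exists_transfer_dil_le hss hs'1
  obtain ⟨r₃, C₃, hr₃, hC₃, her⟩ := H.exists_ero_le_transfer hss hs'1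
  obtain ⟨r₄, C₄, hr₄, hC₄, hvol⟩ := H.exists_volume_cut_le
  -- The products come from multiplying two factors `1 + C r ^ α` with `r ^ α ≤ 1`; the bracket
  -- collects the additive errors, with `D.K + 1` because the transfer operator may multiply the
  -- supremum by the number of branches.
  set C := C₁ + C₂ + C₃ + C₁ * C₂ + C₁ * C₃ + (C₁ * (D.K + 1 : ℕ) + C₁ + C₄) with hCdef
  have hC0 : 0 ≤ C := by positivity
  have hsα1 : s ^ D.α < 1 := Real.rpow_lt_one hs'0.le hs'1 hα
  -- The accumulated distortion tends to one with `ρ`, so a small top scale keeps the total cost of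
  -- the cuts below one.
  have hlim : Tendsto (fun ρ : ℝ => Real.exp (C / (1 - s ^ D.α) * ρ ^ D.α) * ∑' k, η k) (𝓝[>] 0)
      (𝓝 (∑' k, η k)) := by
    have h1 : ContinuousAt (fun ρ : ℝ => Real.exp (C / (1 - s ^ D.α) * ρ ^ D.α) * ∑' k, η k) 0 :=
      ((continuousAt_const.mul (Real.continuousAt_rpow_const _ _ (Or.inr hα.le))).rexp).mul
        continuousAt_const
    have h2 := h1.tendsto
    rw [Real.zero_rpow hα.ne', mul_zero, Real.exp_zero, one_mul] at h2
    exact h2.mono_left nhdsWithin_le_nhds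
  have hev : ∀ᶠ ρ in 𝓝[>] (0 : ℝ), ρ ∈ Ioc 0 (min (min r₁ r₂)
    (min (min r₃ r₄) (min 1 (ε₂ / L)))) := Ioc_mem_nhdsGT (by positivity)
  obtain ⟨ρ, ⟨hρ0, hρ⟩, hρη⟩ := (hev.and (hlim.eventually_lt_const hη1)).exists
  simp only [le_min_iff] at hρ
  obtain ⟨⟨hρ1, hρ2⟩, ⟨hρ3, hρ4⟩, hρ5, hρ6⟩ := hρ
  have hmul : ∀ C' r : ℝ, 0 ≤ C' → C' ≤ C₂ + C₃ → (C₁ * C' ≤ C₁ * C₂ + C₁ * C₃) → r ∈ Ioc 0 ρ →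
      ENNReal.ofReal (1 + C₁ * r ^ D.α) * ENNReal.ofReal (1 + C' * r ^ D.α) ≤
        ENNReal.ofReal (1 + C * r ^ D.α) := by
    intro C' r h0 h1 h2 hr
    have ht : 0 ≤ r ^ D.α := Real.rpow_nonneg hr.1.le _
    have ht1 : r ^ D.α ≤ 1 := Real.rpow_le_one hr.1.le (hr.2.trans hρ5) hα.le
    rw [← ENNReal.ofReal_mul (by positivity)]
    refine ENNReal.ofReal_le_ofReal ?_
    have h3 : C₁ * C' * (r ^ D.α * r ^ D.α) ≤ C₁ * C' * (r ^ D.α * 1) := by gcongr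
    have h4 : (C₁ + C' + C₁ * C') * r ^ D.α ≤ C * r ^ D.α := by
      gcongr
      have : 0 ≤ C₁ * (D.K + 1 : ℕ) + C₁ + C₄ := by positivity
      linarith
    linarith
  refine ⟨ε, δ, r₀, hC, s, ρ, C, ENNReal.ofReal (Real.exp (C / (1 - s ^ D.α) * ρ ^ D.α)),
    fun k => ENNReal.ofReal (η k), hs'0, hs'1, hρ0, hC0, ENNReal.ofReal_ne_top, ?_,
    prod_one_add_rpow_le hs'0 hs'1 hρ0 hC0 hα, fun f hf k => ?_, fun g => ?_,
    fun f hf S hS r hr => ?_⟩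
  · rw [ENNReal.tsum_mul_left, ← ENNReal.ofReal_tsum_of_nonneg hη0 hηs,
      ← ENNReal.ofReal_mul (Real.exp_pos _).le, ← ENNReal.ofReal_one]
    exact (ENNReal.ofReal_lt_ofReal_iff one_pos).2 hρη
  · have hrk : s ^ k * ρ ∈ Ioc 0 ρ :=
      ⟨by positivity, mul_le_of_le_one_left hρ0.le (pow_le_one₀ hs'0.le hs'1.le)⟩
    have h1 := (hind (D.transfer f) _ ⟨hrk.1, hrk.2.trans hρ1⟩).1
    have h2 := htr f hf.2.1 _ ⟨hrk.1, hrk.2.trans hρ2⟩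
    have h3 := hcut D.M D.cutMeasure f ρ ε₂ H.isFiniteMeasure_cutMeasure hρ0
      (by rwa [le_div_iff₀ hL, mul_comm] at hρ6) hf.2.2
      (fun r hr v hv σ h1 h2 => (D.cutMeasure_le r _ measurableSet_closedBall).trans
        (hτ r hr v hv σ h1 h2)) k
    rw [← mul_assoc, ← pow_succ'] at h2
    refine h1.trans ((mul_le_mul_right h2 _).trans ?_)
    rw [← mul_assoc]
    exact mul_le_mul' (hmul C₂ _ hC₂ (by linarith)
      (by have := mul_nonneg hC₁ hC₃; linarith) hrk) (add_le_add_right h3 _)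
  · refine ((hind g ρ ⟨hρ0, hρ1⟩).1).trans (mul_le_mul_left (ENNReal.ofReal_le_ofReal ?_) _)
    have h3 : C₁ * ρ ^ D.α ≤ C * ρ ^ D.α := by
      gcongr
      have : 0 ≤ C₂ + C₃ + C₁ * C₂ + C₁ * C₃ + (C₁ * (D.K + 1 : ℕ) + C₁ + C₄) := by positivity
      linarith
    linarith
  · have h1 := (hind (D.transfer f) _ ⟨hr.1, hr.2.trans hρ1⟩).2 ((D.K + 1 : ℕ) * S)
      (H.measurable_transfer hf.1) (H.transfer_le hS)
    have h2 := her f hf.2.1 hf.2.2 S hS r ⟨hr.1, hr.2.trans hρ3⟩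
    have h3 := hvol r ⟨hr.1, hr.2.trans hρ4⟩
    rw [H.lintegral_transfer hf.1 hf.2.2] at h1
    have ht : 0 ≤ r ^ D.α := Real.rpow_nonneg hr.1.le _
    have hCC := hmul C₃ r hC₃ (by linarith) (by have := mul_nonneg hC₁ hC₂; linarith) hr
    set a := ENNReal.ofReal (1 + C₁ * r ^ D.α)
    set b := ENNReal.ofReal (1 + C₃ * r ^ D.α)
    set Z := ∫⁻ x, ero (D.step δ f) r x
    set F := ∫⁻ x, f x
    have hb : b ≤ ENNReal.ofReal (1 + C * r ^ D.α) := by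
      refine le_trans ?_ hCC
      refine le_mul_of_one_le_left zero_le ?_
      rw [ENNReal.one_le_ofReal]
      have := mul_nonneg hC₁ ht
      linarith
    have h1b : (1 : ℝ≥0∞) ≤ ENNReal.ofReal (1 + C * r ^ D.α) := by
      rw [ENNReal.one_le_ofReal]
      have := mul_nonneg hC0 ht
      linarith
    have hx1 : ENNReal.ofReal (C₁ * r ^ D.α) * (F + (D.K + 1 : ℕ) * S) +
        S * ENNReal.ofReal (C₄ * r ^ D.α) ≤ ENNReal.ofReal (C * r ^ D.α) * (F + S) := by
      have e : ENNReal.ofReal (C * r ^ D.α) =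
          ENNReal.ofReal ((C₂ + C₃ + C₁ * C₂ + C₁ * C₃ + C₁) * r ^ D.α) +
          (ENNReal.ofReal (C₁ * r ^ D.α) * (D.K + 1 : ℕ) + ENNReal.ofReal (C₁ * r ^ D.α) +
            ENNReal.ofReal (C₄ * r ^ D.α)) := by
        rw [← ENNReal.ofReal_natCast, ← ENNReal.ofReal_mul (by positivity),
          ← ENNReal.ofReal_add (by positivity) (by positivity),
          ← ENNReal.ofReal_add (by positivity) (by positivity),
          ← ENNReal.ofReal_add (by positivity) (by positivity)]
        congr 1
        rw [hCdef]; ring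
      rw [e]
      calc _ = ENNReal.ofReal (C₁ * r ^ D.α) * F +
            (ENNReal.ofReal (C₁ * r ^ D.α) * (D.K + 1 : ℕ) + ENNReal.ofReal (C₄ * r ^ D.α)) * S := by
            ring
        _ ≤ (ENNReal.ofReal (C₁ * r ^ D.α) * (D.K + 1 : ℕ) + ENNReal.ofReal (C₁ * r ^ D.α) +
              ENNReal.ofReal (C₄ * r ^ D.α)) * F +
            (ENNReal.ofReal (C₁ * r ^ D.α) * (D.K + 1 : ℕ) + ENNReal.ofReal (C₁ * r ^ D.α) +
              ENNReal.ofReal (C₄ * r ^ D.α)) * S := by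
            refine add_le_add (mul_le_mul_left (le_add_right le_add_self) _)
              (mul_le_mul_left (add_le_add_left le_self_add _) _)
        _ = (ENNReal.ofReal (C₁ * r ^ D.α) * (D.K + 1 : ℕ) + ENNReal.ofReal (C₁ * r ^ D.α) +
              ENNReal.ofReal (C₄ * r ^ D.α)) * (F + S) := by ring
        _ ≤ _ := mul_le_mul_left le_add_self _
    calc _ ≤ b * (∫⁻ x, ero (D.transfer f) r x) + S * ENNReal.ofReal (C₄ * r ^ D.α) :=
          h2.trans (add_le_add_right (mul_le_mul_right h3 _) _)
      _ ≤ b * (a * Z + ENNReal.ofReal (C₁ * r ^ D.α) * (F + (D.K + 1 : ℕ) * S)) +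
          S * ENNReal.ofReal (C₄ * r ^ D.α) :=
        add_le_add_left (mul_le_mul_right h1 _) _
      _ = a * b * Z + (b * (ENNReal.ofReal (C₁ * r ^ D.α) * (F + (D.K + 1 : ℕ) * S)) +
          1 * (S * ENNReal.ofReal (C₄ * r ^ D.α))) := by ring
      _ ≤ ENNReal.ofReal (1 + C * r ^ D.α) * Z + (ENNReal.ofReal (1 + C * r ^ D.α) *
          (ENNReal.ofReal (C₁ * r ^ D.α) * (F + (D.K + 1 : ℕ) * S)) +
          ENNReal.ofReal (1 + C * r ^ D.α) * (S * ENNReal.ofReal (C₄ * r ^ D.α))) := by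
        gcongr
      _ = ENNReal.ofReal (1 + C * r ^ D.α) * (Z + (ENNReal.ofReal (C₁ * r ^ D.α) *
          (F + (D.K + 1 : ℕ) * S) + S * ENNReal.ofReal (C₄ * r ^ D.α))) := by ring
      _ ≤ _ := by gcongr

end System
end PiecewiseMap

/-! ### Uniform bounds for the iterates of a density. -/

theorem dil_indicator_le {m : ℕ} (K : Set (Euc m)) {r : ℝ} {f : Euc m → ℝ≥0∞} {S : ℝ≥0∞}
    (hf : ∀ x, x ∉ K → f x = 0) (hS : ∀ x, f x ≤ S) (x : Euc m) :
    dil f r x ≤ (Metric.cthickening r K).indicator (fun _ => S) x := by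
  refine iSup₂_le fun y hy => ?_
  by_cases hyK : y ∈ K
  · rw [indicator_of_mem (Metric.mem_cthickening_of_dist_le x y r K hyK
      (by rw [dist_comm]; exact (Metric.mem_ball.1 hy).le))]
    exact hS y
  · rw [hf y hyK]; exact zero_le

theorem lintegral_dil_le {m : ℕ} (K : Set (Euc m)) (r : ℝ) {f : Euc m → ℝ≥0∞} {S : ℝ≥0∞}
    (hf : ∀ x, x ∉ K → f x = 0) (hS : ∀ x, f x ≤ S) :
    ∫⁻ x, dil f r x ≤ S * volume (Metric.cthickening r K) := by
  rw [← setLIntegral_const, ← lintegral_indicator Metric.isClosed_cthickening.measurableSet]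
  exact lintegral_mono fun x => dil_indicator_le K hf hS x

namespace PiecewiseMap
variable {m : ℕ} {D : PiecewiseMap m} {I Cξ : ℝ}

/-- What the analysis of the induced system says about the iterates of densities. -/
structure Regular (D : PiecewiseMap m) (ε δ r₀ : ℝ) (B Q : ℝ≥0∞) : Prop where
  collar : D.Collar ε δ r₀
  B_ne_top : B ≠ ∞
  Q_ne_top : Q ≠ ∞
  iterate_le : ∀ K, IsCompact K → K ⊆ D.M \ D.R → ∀ n x, (D.step δ)^[n] (K.indicator 1) x ≤ B
  eventually_le : ∀ K, IsCompact K → K ⊆ D.M \ D.R → ∀ e : ℝ≥0∞, e ≠ 0 → ∃ n, ∀ x,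
    (D.step δ)^[n] (K.indicator 1) x ≤ Q * (volume K + e)
  ero : ∀ y R₁, 0 < R₁ → Metric.closedBall y R₁ ⊆ D.M \ D.R → ∃ r > 0, ∃ c : ℝ≥0∞, c ≠ 0 ∧
    ∀ n, c ≤ ∫⁻ x, ero ((D.step δ)^[n] ((Metric.closedBall y R₁).indicator 1)) r x
  induced_le : ∀ (g : Euc m → ℝ≥0∞) (S : ℝ≥0∞), S ≠ ∞ → (∀ x, g x ≤ S) → (∀ x, x ∉ D.M → g x = 0) →
    ∃ S' : ℝ≥0∞, S' ≠ ∞ ∧ ∀ x, D.induced δ g x ≤ S'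

namespace System
variable (H : D.System I Cξ)
include H

/-- The renewal inequality for the suprema integrals gives the two upper bounds. The lower bound
comes from following infima integrals from scale `s ^ n * r` up to `r`, which loses only a geometric
series of errors. -/
theorem exists_regular : ∃ ε δ r₀ B Q, D.Regular ε δ r₀ B Q := by
  obtain ⟨ε, δ, r₀, hC, s, ρ, C, P, η, hs0, hs1, hρ, hC0, hP, hq, hprod, hU, hI, hL⟩ :=
    H.exists_step_estimates
  have hα := H.std.α_pos
  set q := ∑' k, P * η k with hqdef
  have hq1 : 1 - q ≠ 0 := (tsub_pos_of_lt hq).ne'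
  have hγ := gam_pos m
  set G := ENNReal.ofReal (gam m * ρ ^ m) with hG
  have hG0 : G ≠ 0 := (ENNReal.ofReal_pos.2 (by positivity)).ne'
  have hGt : G ≠ ∞ := ENNReal.ofReal_ne_top
  set V := volume (Metric.cthickening ρ D.M) with hV
  have hVt : V ≠ ∞ := H.std.compact.isBounded.cthickening.measure_lt_top.ne
  have hsup : ∀ (f : Euc m → ℝ≥0∞) x, f x ≤ (∫⁻ x, dil f ρ x) / G := fun f x => by
    rw [ENNReal.le_div_iff_mul_le (Or.inl hG0) (Or.inl hGt)]
    exact (mul_le_mul_left (le_iSup f x) _).trans (iSup_mul_volume_le_lintegral_dil f hρ)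
  have hsk : ∀ k : ℕ, s ^ k * ρ ≤ ρ := fun k =>
    mul_le_of_le_one_left hρ.le (pow_le_one₀ hs0.le hs1.le)
  have hrec : ∀ K, IsCompact K → K ⊆ D.M \ D.R → ∀ n,
      ∫⁻ x, dil ((D.step δ)^[n] (K.indicator 1)) ρ x ≤
        P * (∫⁻ x, dil (K.indicator 1) (s ^ n * ρ) x) + ∑ i ∈ Finset.range n,
          P * η i * ∫⁻ x, dil ((D.step δ)^[n - 1 - i] (K.indicator 1)) ρ x := by
    intro K hK hKM n
    have hd := D.isDensity_indicator hK.measurableSet hKM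
    have := le_of_triangular_recursion (η := η)
      (X := fun n k => ∫⁻ x, dil ((D.step δ)^[n] (K.indicator 1)) (s ^ k * ρ) x)
      (a := fun k => ENNReal.ofReal (1 + C * (s ^ k * ρ) ^ D.α)) (P := P) (fun n k => by
        have := hU _ (H.isDensity_iterate hC hd n) k
        rw [Function.iterate_succ_apply']
        simpa using this) hprod n
    simpa using this
  have hK1 : ∀ (K : Set (Euc m)) (x : Euc m), K.indicator (1 : Euc m → ℝ≥0∞) x ≤ 1 :=
    fun K x => indicator_le_self' (fun _ _ => zero_le) x
  have hX0 : ∀ K : Set (Euc m), ∀ r, ∫⁻ x, dil (K.indicator 1) r x ≤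
      volume (Metric.cthickening r K) := fun K r => by
    simpa using lintegral_dil_le K r (f := K.indicator 1) (fun x hx => indicator_of_notMem hx _)
      (hK1 K)
  have hXV : ∀ K, K ⊆ D.M \ D.R → ∀ n : ℕ, ∫⁻ x, dil (K.indicator 1) (s ^ n * ρ) x ≤ V :=
    fun K hKM n => (hX0 K _).trans (measure_mono ((Metric.cthickening_mono (hsk n) K).trans
      (Metric.cthickening_subset_of_subset ρ (hKM.trans sdiff_subset))))
  have hPV : P * V / (1 - q) ≠ ∞ := ENNReal.div_ne_top (ENNReal.mul_ne_top hP hVt) hq1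
  have hbd : ∀ K, IsCompact K → K ⊆ D.M \ D.R → ∀ n,
      ∫⁻ x, dil ((D.step δ)^[n] (K.indicator 1)) ρ x ≤ P * V / (1 - q) := by
    intro K hK hKM
    refine le_of_renewal hq fun n => (hrec K hK hKM n).trans ?_
    exact add_le_add_left (mul_le_mul_right (hXV K hKM n) _) _
  have hB : P * V / (1 - q) / G ≠ ∞ := ENNReal.div_ne_top hPV hG0
  have hBle : ∀ K, IsCompact K → K ⊆ D.M \ D.R → ∀ n x,
      (D.step δ)^[n] (K.indicator 1) x ≤ P * V / (1 - q) / G := fun K hK hKM n x =>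
    (hsup _ x).trans (ENNReal.div_le_div_right (hbd K hK hKM n) _)
  refine ⟨ε, δ, r₀, P * V / (1 - q) / G, P / (1 - q) / G, hC, hB,
    ENNReal.div_ne_top (ENNReal.div_ne_top hP hq1) hG0, hBle, ?_, ?_, ?_⟩
  · intro K hK hKM e he
    -- The initial term is taken at scale `s ^ n * ρ`, so it tends to `P * volume K`; this makes the
    -- limiting bound proportional to the volume of `K`.
    have ht : Tendsto (fun n : ℕ => P * volume (Metric.cthickening (s ^ n * ρ) K)) atTop
        (𝓝 (P * volume K)) := by
      refine ENNReal.Tendsto.const_mul ?_ (Or.inr hP)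
      have h1 : Tendsto (fun n : ℕ => s ^ n * ρ) atTop (𝓝 0) := by
        simpa using (tendsto_pow_atTop_nhds_zero_of_lt_one hs0.le hs1).mul_const ρ
      exact (tendsto_measure_cthickening_of_isCompact hK).comp h1
    have hl := limsup_le_of_renewal hq hPV (hbd K hK hKM) ht fun n =>
      (hrec K hK hKM n).trans (add_le_add_left (mul_le_mul_right (hX0 K _) _) _)
    -- `P = 0` is impossible, since the empty product is one.
    rcases eq_or_ne P 0 with hP0 | hP0
    · refine ⟨0, fun x => ?_⟩
      have := hprod 0
      simp [hP0] at this
    have h1q : 1 - q ≠ ∞ := (tsub_le_self.trans_lt ENNReal.one_lt_top).ne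
    have hlt : limsup (fun n => ∫⁻ x, dil ((D.step δ)^[n] (K.indicator 1)) ρ x) atTop <
        P * (volume K + e) / (1 - q) := by
      refine hl.trans_lt (ENNReal.div_lt_div_right hq1 h1q ?_)
      exact (ENNReal.mul_lt_mul_iff_right hP0 hP).2 (ENNReal.lt_add_right hK.measure_lt_top.ne he)
    obtain ⟨n, hn⟩ := (eventually_lt_of_limsup_lt hlt).exists
    refine ⟨n, fun x => (hsup _ x).trans ((ENNReal.div_le_div_right hn.le _).trans (le_of_eq ?_))⟩
    simp only [div_eq_mul_inv]; ring
  · intro y R₁ hR₁ hball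
    set K := Metric.closedBall y R₁ with hK
    have hKc : IsCompact K := isCompact_closedBall y R₁
    have hd := D.isDensity_indicator hKc.measurableSet hball
    set f : ℕ → Euc m → ℝ≥0∞ := fun n => (D.step δ)^[n] (K.indicator 1) with hf
    set v := volume (Metric.ball y (R₁ / 2)) with hv
    have hv0 : v ≠ 0 := (Metric.measure_ball_pos volume y (half_pos hR₁)).ne'
    have hvt : v ≠ ∞ := measure_ball_lt_top.ne
    have hv1 : ∀ r ≤ R₁ / 2, v ≤ ∫⁻ x, _root_.ero (f 0) r x := by
      intro r hr
      rw [hv, ← setLIntegral_one]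
      rw [← lintegral_indicator measurableSet_ball]
      refine lintegral_mono (indicator_le fun x hx => le_iInf₂ fun z hz => ?_)
      have hzK : z ∈ K := by
        have h1 := Metric.mem_ball.1 hx
        have h2 := Metric.mem_ball.1 hz
        have := dist_triangle z x y
        exact Metric.mem_closedBall.2 (by linarith)
      simp [hf, indicator_of_mem hzK]
    set S := P * V / (1 - q) / G with hS
    set A : ℝ≥0∞ := 1 + S with hA
    have hAt : A ≠ ∞ := ENNReal.add_ne_top.2 ⟨ENNReal.one_ne_top, hB⟩
    have hmass : ∀ n, ∫⁻ x, f n x ≤ 1 := fun n => by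
      rw [hf]
      dsimp only
      rw [H.lintegral_iterate hC hd, lintegral_indicator_one hKc.measurableSet,
        ← H.std.volume_eq_one]
      exact measure_mono (hball.trans sdiff_subset)
    -- In `n` steps the scale grows from `s ^ n * r` to `r`; the error at scale `s ^ k * r` is a
    -- multiple of its `α`-th power.
    have hiter : ∀ r ∈ Ioc 0 ρ, ∀ n : ℕ, ∫⁻ x, _root_.ero (f 0) (s ^ n * r) x ≤
        P * ((∫⁻ x, _root_.ero (f n) r x) +
          ∑ k ∈ Finset.range n, ENNReal.ofReal (C * (s ^ k * r) ^ D.α) * A) := by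
      intro r hr n
      have key : ∀ j ≤ n, ∫⁻ x, _root_.ero (f 0) (s ^ n * r) x ≤
          (∏ k ∈ Finset.range j, ENNReal.ofReal (1 + C * (s ^ (n - 1 - k) * r) ^ D.α)) *
          ((∫⁻ x, _root_.ero (f j) (s ^ (n - j) * r) x) + ∑ k ∈ Finset.range j,
            ENNReal.ofReal (C * (s ^ (n - 1 - k) * r) ^ D.α) * A) := by
        intro j
        induction j with
        | zero => intro _; simp
        | succ j ih =>
          intro hj
          have hr' : s ^ (n - 1 - j) * r ∈ Ioc 0 ρ := ⟨mul_pos (pow_pos hs0 _) hr.1,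
            (mul_le_of_le_one_left hr.1.le (pow_le_one₀ hs0.le hs1.le)).trans hr.2⟩
          have h1 := hL (f j) (H.isDensity_iterate hC hd j) S (hBle K hKc hball j) _ hr'
          rw [← mul_assoc, ← pow_succ', show n - 1 - j + 1 = n - j by omega] at h1
          have e : D.step δ (f j) = f (j + 1) := (Function.iterate_succ_apply' _ _ _).symm
          rw [e] at h1
          refine (ih (by omega)).trans ?_
          rw [Finset.prod_range_succ, Finset.sum_range_succ, mul_assoc,
            show n - (j + 1) = n - 1 - j by omega]
          refine mul_le_mul_right ?_ _
          set w := ENNReal.ofReal (1 + C * (s ^ (n - 1 - j) * r) ^ D.α) with hw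
          have hw1 : 1 ≤ w := by
            rw [hw, ENNReal.one_le_ofReal]
            have := mul_nonneg hC0 (Real.rpow_nonneg hr'.1.le D.α)
            linarith
          set W := ∑ k ∈ Finset.range j, ENNReal.ofReal (C * (s ^ (n - 1 - k) * r) ^ D.α) * A
          calc _ ≤ w * ((∫⁻ x, _root_.ero (f (j + 1)) (s ^ (n - 1 - j) * r) x) +
                ENNReal.ofReal (C * (s ^ (n - 1 - j) * r) ^ D.α) * A) + 1 * W := by
                rw [one_mul]
                refine add_le_add_left (h1.trans (mul_le_mul_right (add_le_add_right
                  (mul_le_mul_right ?_ _) _) _)) _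
                exact add_le_add_left (hmass j) _
            _ ≤ w * ((∫⁻ x, _root_.ero (f (j + 1)) (s ^ (n - 1 - j) * r) x) +
                ENNReal.ofReal (C * (s ^ (n - 1 - j) * r) ^ D.α) * A) + w * W := by gcongr
            _ = _ := by ring
      have h2 := key n le_rfl
      rw [Nat.sub_self, pow_zero, one_mul] at h2
      refine h2.trans (mul_le_mul' ?_ (add_le_add_right (le_of_eq ?_) _))
      · rw [Finset.prod_range_reflect (fun k => ENNReal.ofReal (1 + C * (s ^ k * r) ^ D.α)) n]
        refine le_trans (Finset.prod_le_prod' fun k _ => ENNReal.ofReal_le_ofReal ?_) (hprod n)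
        have := pow_pos hs0 k
        have h3 := hr.1
        gcongr
        exact hr.2
      · exact Finset.sum_range_reflect (fun k => ENNReal.ofReal (C * (s ^ k * r) ^ D.α) * A) n
    have hsα : 0 < s ^ D.α := Real.rpow_pos_of_pos hs0 _
    have hsα1 : s ^ D.α < 1 := Real.rpow_lt_one hs0.le hs1 hα
    have hsum : ∀ r > 0, ∀ n, ∑ k ∈ Finset.range n, ENNReal.ofReal (C * (s ^ k * r) ^ D.α) * A ≤
        ENNReal.ofReal (C / (1 - s ^ D.α) * r ^ D.α) * A := by
      intro r hr n
      have hrα := Real.rpow_nonneg hr.le D.α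
      rw [← Finset.sum_mul, ← ENNReal.ofReal_sum_of_nonneg fun k _ => by positivity]
      refine mul_le_mul_left (ENNReal.ofReal_le_ofReal ?_) _
      have e : ∀ k : ℕ, C * (s ^ k * r) ^ D.α = C * r ^ D.α * (s ^ D.α) ^ k := fun k => by
        rw [Real.mul_rpow (by positivity) hr.le, ← Real.rpow_natCast, ← Real.rpow_mul hs0.le,
          mul_comm (k : ℝ), Real.rpow_mul hs0.le, Real.rpow_natCast]
        ring
      simp only [e]
      rw [← Finset.mul_sum]
      calc _ ≤ C * r ^ D.α * (1 - s ^ D.α)⁻¹ := by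
            gcongr
            rw [← tsum_geometric_of_lt_one hsα.le hsα1]
            exact (summable_geometric_of_lt_one hsα.le hsα1).sum_le_tsum _
              fun _ _ => by positivity
        _ = _ := by field_simp
    have hlim : Tendsto (fun r : ℝ => P * (ENNReal.ofReal (C / (1 - s ^ D.α) * r ^ D.α) * A))
        (𝓝[>] 0) (𝓝 0) := by
      have h1 : ContinuousAt (fun r : ℝ => C / (1 - s ^ D.α) * r ^ D.α) 0 :=
        continuousAt_const.mul (Real.continuousAt_rpow_const _ _ (Or.inr hα.le))
      have h2 := h1.tendsto
      rw [Real.zero_rpow hα.ne', mul_zero] at h2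
      have h3 := (ENNReal.continuous_ofReal.tendsto 0).comp
        (h2.mono_left (nhdsWithin_le_nhds (s := Ioi 0)))
      rw [ENNReal.ofReal_zero] at h3
      have h4 := ENNReal.Tendsto.const_mul (a := P)
        (ENNReal.Tendsto.mul_const (b := A) h3 (Or.inr hAt)) (Or.inr hP)
      simpa using h4
    have hev : ∀ᶠ r in 𝓝[>] (0 : ℝ), r ∈ Ioc 0 (min ρ (R₁ / 2)) := Ioc_mem_nhdsGT (by positivity)
    -- For small `r` the accumulated error is below half of the initial mass `v`, whatever the
    -- number of steps.
    obtain ⟨r, ⟨hr0, hr⟩, hrv⟩ := (hev.and (hlim.eventually_lt_const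
      (show (0 : ℝ≥0∞) < v / 2 from (ENNReal.half_pos hv0)))).exists
    refine ⟨r, hr0, v / 2 / P, (ENNReal.div_pos (ENNReal.half_pos hv0).ne' hP).ne', fun n => ?_⟩
    refine ENNReal.div_le_of_le_mul' ?_
    have h1 := hiter r ⟨hr0, hr.trans (min_le_left _ _)⟩ n
    have h2 : s ^ n * r ≤ R₁ / 2 :=
      (mul_le_of_le_one_left hr0.le (pow_le_one₀ hs0.le hs1.le)).trans (hr.trans (min_le_right _ _))
    have h3 := (hv1 _ h2).trans h1
    rw [mul_add] at h3
    have h4 := h3.trans (add_le_add_right ((mul_le_mul_right (hsum r hr0 n) _).trans hrv.le) _)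
    have h5 : v / 2 + v / 2 ≤ P * (∫⁻ x, _root_.ero (f n) r x) + v / 2 := by
      rwa [ENNReal.add_halves]
    exact (ENNReal.add_le_add_iff_right (ENNReal.div_ne_top hvt (by norm_num))).1 h5
  · intro g S hS hgS hgM
    refine ⟨ENNReal.ofReal (1 + C * ρ ^ D.α) * (S * V) / G, ENNReal.div_ne_top
      (ENNReal.mul_ne_top ENNReal.ofReal_ne_top (ENNReal.mul_ne_top hS hVt)) hG0, fun x => ?_⟩
    refine (hsup _ x).trans (ENNReal.div_le_div_right ((hI g).trans ?_) _)
    exact mul_le_mul_right (lintegral_dil_le D.M ρ hgM hgS) _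

end System
end PiecewiseMap

/-! ### Setwise limits of measures. -/

theorem tendsto_ultrafilter_lim (U : Ultrafilter ℕ) (g : ℕ → ℝ≥0∞) :
    Tendsto g U (𝓝 (U.map g).lim) := (U.map g).le_nhds_lim

/-- Setwise limits along an ultrafilter of measures dominated by a finite measure. -/
theorem exists_ultrafilter_limit {X : Type*} [MeasurableSpace X] (U : Ultrafilter ℕ)
    (ν : Measure X) [IsFiniteMeasure ν] (μ : ℕ → Measure X) (hμ : ∀ n, μ n ≤ ν) :
    ∃ σ : Measure X, ∀ A, MeasurableSet A → Tendsto (fun n => μ n A) U (𝓝 (σ A)) := by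
  set L : Set X → ℝ≥0∞ := fun A => (U.map fun n => μ n A).lim with hL
  have hlim : ∀ A, Tendsto (fun n => μ n A) U (𝓝 (L A)) := fun A => tendsto_ultrafilter_lim U _
  refine ⟨Measure.ofMeasurable (fun A _ => L A) ?_ ?_, fun A hA => ?_⟩
  · have := hlim ∅
    simp only [measure_empty] at this
    exact tendsto_nhds_unique this tendsto_const_nhds
  · intro f hf hd
    have hsum : ∀ N, Tendsto (fun n => ∑ i ∈ Finset.range N, μ n (f i)) U
        (𝓝 (∑ i ∈ Finset.range N, L (f i))) := fun N => tendsto_finsetSum _ fun i _ => hlim _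
    refine le_antisymm ?_ ?_
    -- Domination by `ν` makes the tails uniformly small, which upgrades finite additivity of the
    -- limit to countable additivity.
    · have h1 : ∀ N, L (⋃ i, f i) ≤ ∑ i ∈ Finset.range N, L (f i) + ∑' i, ν (f (i + N)) := by
        intro N
        refine le_of_tendsto_of_tendsto' (hlim _) ((hsum N).add tendsto_const_nhds) fun n => ?_
        rw [measure_iUnion hd hf, ← ENNReal.summable.sum_add_tsum_nat_add' (k := N)]
        exact add_le_add_right (ENNReal.tsum_le_tsum fun i => hμ n _) _
      have h2 : ∑' i, ν (f i) ≠ ∞ := by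
        rw [← measure_iUnion hd hf]; exact measure_ne_top _ _
      have h3 : Tendsto (fun N => ∑ i ∈ Finset.range N, L (f i) + ∑' i, ν (f (i + N))) atTop
          (𝓝 (∑' i, L (f i) + 0)) :=
        (ENNReal.tendsto_nat_tsum _).add (ENNReal.tendsto_sum_nat_add _ h2)
      rw [add_zero] at h3
      exact ge_of_tendsto' h3 h1
    · rw [ENNReal.tsum_eq_iSup_nat]
      refine iSup_le fun N => le_of_tendsto_of_tendsto' (hsum N) (hlim _) fun n => ?_
      rw [measure_iUnion hd hf]
      exact ENNReal.sum_le_tsum _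
  · rw [Measure.ofMeasurable_apply _ hA]
    exact hlim A

/-- Setwise convergence passes to integrals of simple functions, hence to integrals of measurable
functions with an inequality. -/
theorem lintegral_le_of_ultrafilter_limit {X : Type*} [MeasurableSpace X] {U : Ultrafilter ℕ}
    {μ : ℕ → Measure X} {σ : Measure X}
    (h : ∀ A, MeasurableSet A → Tendsto (fun n => μ n A) U (𝓝 (σ A))) {ψ : X → ℝ≥0∞}
    (hψ : Measurable ψ) {c : ℕ → ℝ≥0∞} {c₀ : ℝ≥0∞} (hc : Tendsto c U (𝓝 c₀))
    (hle : ∀ n, ∫⁻ x, ψ x ∂μ n ≤ c n) : ∫⁻ x, ψ x ∂σ ≤ c₀ := by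
  rw [lintegral_eq_iSup_eapprox_lintegral hψ]
  refine iSup_le fun k => ?_
  have h1 : Tendsto (fun n => (SimpleFunc.eapprox ψ k).lintegral (μ n)) U
      (𝓝 ((SimpleFunc.eapprox ψ k).lintegral σ)) := by
    unfold SimpleFunc.lintegral
    refine tendsto_finsetSum _ fun x hx => ENNReal.Tendsto.const_mul
      (h _ (SimpleFunc.measurableSet_fiber _ _)) (Or.inr ?_)
    obtain ⟨y, rfl⟩ := SimpleFunc.mem_range.1 hx
    exact (SimpleFunc.eapprox_lt_top ψ k y).ne
  refine le_of_tendsto_of_tendsto' h1 hc fun n => le_trans ?_ (hle n)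
  rw [lintegral_eq_iSup_eapprox_lintegral hψ]
  exact le_iSup (fun k => (SimpleFunc.eapprox ψ k).lintegral (μ n)) k

/-! ### The induced system acting on measures; invariant sets are large. -/

namespace PiecewiseMap
variable {m : ℕ} {D : PiecewiseMap m} {I Cξ : ℝ}

/-- The probability that the induced system moves `z` into `A`. -/
noncomputable def hit (D : PiecewiseMap m) (δ : ℝ) (A : Set (Euc m)) (z : Euc m) : ℝ≥0∞ :=
  ∑' n, D.stopWeight δ n (D.T z) * (D.T^[n] ⁻¹' A).indicator 1 (D.T z)

/-- The action of the induced system on measures. -/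
noncomputable def push (D : PiecewiseMap m) (δ : ℝ) (μ : Measure (Euc m)) : Measure (Euc m) :=
  Measure.sum fun n => ((μ.map D.T).withDensity (D.stopWeight δ n)).map D.T^[n]

theorem preimage_iterate_eq {T : Euc m → Euc m} {A : Set (Euc m)} (hA : T ⁻¹' A = A) (n : ℕ) :
    T^[n] ⁻¹' A = A := by
  induction n with
  | zero => rfl
  | succ n ih => rw [Function.iterate_succ, preimage_comp, ih, hA]

/-- The whole motion of one induced step stays in an invariant set or in its complement. Hence
restriction to an invariant set commutes with the induced system. -/
theorem hit_inter {δ : ℝ} {A : Set (Euc m)} (hA : D.T ⁻¹' A = A) (E : Set (Euc m)) :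
    D.hit δ (E ∩ A) = A.indicator (D.hit δ E) := by
  ext z
  have h : ∀ n, D.T^[n] ⁻¹' (E ∩ A) = D.T^[n] ⁻¹' E ∩ A := fun n => by
    rw [preimage_inter, preimage_iterate_eq hA]
  have hz : D.T z ∈ A ↔ z ∈ A := by rw [← mem_preimage, hA]
  unfold hit
  simp only [h]
  by_cases hzA : z ∈ A
  · rw [indicator_of_mem hzA]
    refine tsum_congr fun n => ?_
    rw [inter_comm, ← indicator_indicator, indicator_of_mem (hz.2 hzA)]
  · rw [indicator_of_notMem hzA, ENNReal.tsum_eq_zero]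
    intro n
    rw [indicator_of_notMem fun h : D.T z ∈ _ => hzA (hz.1 h.2), mul_zero]

namespace System
variable (H : D.System I Cξ)
include H

theorem measurable_hit (δ : ℝ) {A : Set (Euc m)} (hA : MeasurableSet A) :
    Measurable (D.hit δ A) :=
  Measurable.tsum fun n => (((H.measurable_stopWeight δ n).mul
    (measurable_one.indicator ((H.std.measurable.iterate n) hA))).comp H.std.measurable)

theorem push_apply (δ : ℝ) (μ : Measure (Euc m)) {A : Set (Euc m)} (hA : MeasurableSet A) :
    D.push δ μ A = ∫⁻ z, D.hit δ A z ∂μ := by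
  have hT := H.std.measurable
  have hm : ∀ n, MeasurableSet (D.T^[n] ⁻¹' A) := fun n => (hT.iterate n) hA
  have hf : ∀ n, Measurable fun z => D.stopWeight δ n z * (D.T^[n] ⁻¹' A).indicator 1 z := fun n =>
    (H.measurable_stopWeight δ n).mul (measurable_one.indicator (hm n))
  unfold push hit
  rw [Measure.sum_apply _ hA, lintegral_tsum fun n => by exact ((hf n).comp hT).aemeasurable]
  refine tsum_congr fun n => ?_
  rw [Measure.map_apply (hT.iterate n) hA, withDensity_apply _ (hm n),
    ← lintegral_indicator (hm n)]
  have := lintegral_map (μ := μ) (hf n) hT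
  rw [← this]
  refine lintegral_congr fun z => ?_
  by_cases hz : z ∈ D.T^[n] ⁻¹' A <;> simp [hz]

theorem push_mono (δ : ℝ) {μ ν : Measure (Euc m)} (h : μ ≤ ν) : D.push δ μ ≤ D.push δ ν :=
  Measure.le_iff.2 fun A hA => by
    rw [H.push_apply δ μ hA, H.push_apply δ ν hA]
    exact lintegral_mono' h le_rfl

theorem push_add (δ : ℝ) (μ ν : Measure (Euc m)) :
    D.push δ (μ + ν) = D.push δ μ + D.push δ ν := by
  ext A hA
  rw [Measure.add_apply, H.push_apply δ _ hA, H.push_apply δ _ hA, H.push_apply δ _ hA,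
    lintegral_add_measure]

theorem push_smul (δ : ℝ) (c : ℝ≥0∞) (μ : Measure (Euc m)) :
    D.push δ (c • μ) = c • D.push δ μ := by
  ext A hA
  rw [Measure.smul_apply, H.push_apply δ _ hA, H.push_apply δ _ hA, lintegral_smul_measure]

theorem push_restrict (δ : ℝ) {A : Set (Euc m)} (hA : MeasurableSet A) (hTA : D.T ⁻¹' A = A)
    (μ : Measure (Euc m)) : D.push δ (μ.restrict A) = (D.push δ μ).restrict A := by
  ext E hE
  rw [Measure.restrict_apply hE, H.push_apply δ _ hE, H.push_apply δ _ (hE.inter hA),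
    hit_inter hTA, lintegral_indicator hA]

theorem push_iterate_add (δ : ℝ) (μ ν : Measure (Euc m)) (n : ℕ) :
    (D.push δ)^[n] (μ + ν) = (D.push δ)^[n] μ + (D.push δ)^[n] ν := by
  induction n generalizing μ ν with
  | zero => rfl
  | succ n ih => simp only [Function.iterate_succ_apply, H.push_add, ih]

theorem push_iterate_smul (δ : ℝ) (c : ℝ≥0∞) (μ : Measure (Euc m)) (n : ℕ) :
    (D.push δ)^[n] (c • μ) = c • (D.push δ)^[n] μ := by
  induction n generalizing μ with
  | zero => rfl
  | succ n ih => simp only [Function.iterate_succ_apply, H.push_smul, ih]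

theorem push_iterate_mono (δ : ℝ) {μ ν : Measure (Euc m)} (h : μ ≤ ν) (n : ℕ) :
    (D.push δ)^[n] μ ≤ (D.push δ)^[n] ν := by
  induction n generalizing μ ν with
  | zero => exact h
  | succ n ih =>
    exact ih (H.push_mono δ h)

theorem withDensity_inter_M {f : Euc m → ℝ≥0∞} (hf : D.IsDensity f) {E : Set (Euc m)}
    (hE : MeasurableSet E) :
    volume.withDensity f E = volume.withDensity f (E ∩ D.M) := by
  rw [withDensity_apply _ hE, withDensity_apply _ (hE.inter H.measurableSet_M),
    ← lintegral_indicator hE, ← lintegral_indicator (hE.inter H.measurableSet_M)]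
  refine lintegral_congr fun x => ?_
  by_cases hxM : x ∈ D.M
  · by_cases hxE : x ∈ E <;> simp [hxE, hxM]
  · rw [indicator_apply_eq_zero.2 fun _ => hf.2.2 x hxM,
      indicator_apply_eq_zero.2 fun _ => hf.2.2 x hxM]

variable {ε δ r₀ : ℝ} {B Q : ℝ≥0∞} (hR : D.Regular ε δ r₀ B Q)

section
variable (hC : D.Collar ε δ r₀)
include hC

theorem push_withDensity {f : Euc m → ℝ≥0∞} (hf : D.IsDensity f) :
    D.push δ (volume.withDensity f) = volume.withDensity (D.step δ f) := by
  have hg := H.measurable_transfer hf.1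
  rw [push, H.map_withDensity hf.1 hf.2.2]
  have h1 : ∀ n, ((volume.withDensity (D.transfer f)).withDensity (D.stopWeight δ n)).map D.T^[n] =
      volume.withDensity (D.pull n fun z => D.stopWeight δ n z * D.transfer f z) := fun n => by
    rw [← withDensity_mul _ hg (H.measurable_stopWeight δ n), mul_comm,
      H.map_iterate_withDensity n fun x hx => by
        rw [Pi.mul_apply, H.stopWeight_eq_zero hC hx, zero_mul]]
    rfl
  simp only [h1]
  rw [← withDensity_tsum fun n => by
    exact H.measurable_pull n ((H.measurable_stopWeight δ n).mul hg)]
  congr 1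
  ext x
  rw [step, induced, tsum_apply (Pi.summable.2 fun _ => ENNReal.summable)]

theorem push_iterate_withDensity {f : Euc m → ℝ≥0∞} (hf : D.IsDensity f) (n : ℕ) :
    (D.push δ)^[n] (volume.withDensity f) = volume.withDensity ((D.step δ)^[n] f) := by
  induction n with
  | zero => rfl
  | succ n ih =>
    rw [Function.iterate_succ_apply', ih, H.push_withDensity hC (H.isDensity_iterate hC hf n),
      Function.iterate_succ_apply']

theorem push_iterate_univ {f : Euc m → ℝ≥0∞} (hf : D.IsDensity f) (n : ℕ) :
    (D.push δ)^[n] (volume.withDensity f) univ = ∫⁻ x, f x := by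
  rw [H.push_iterate_withDensity hC hf, withDensity_apply _ MeasurableSet.univ,
    Measure.restrict_univ, H.lintegral_iterate hC hf]

end

include hR

/-- A fixed measure supported by a small set has a small density. -/
theorem withDensity_le_of_push_eq {F : Euc m → ℝ≥0∞} {b : ℝ≥0∞} (hF : D.IsDensity F) (hb : b ≠ ∞)
    (hFb : volume.withDensity F ≤ b • volume) (hfix : D.push δ (volume.withDensity F) =
      volume.withDensity F) {A : Set (Euc m)} (hA : MeasurableSet A) (hFA : ∀ x, x ∉ A → F x = 0) :
    volume.withDensity F ≤ (Q * volume (A ∩ D.M) * b) • volume := by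
  refine Measure.le_iff.2 fun E hE => ?_
  rw [H.withDensity_inter_M hF hE, Measure.smul_apply, smul_eq_mul]
  have hEt : volume (E ∩ D.M) ≠ ∞ := measure_ne_top_of_subset inter_subset_right
    (by rw [H.std.volume_eq_one]; exact ENNReal.one_ne_top)
  refine le_trans ?_ (mul_le_mul_right (measure_mono (inter_subset_left (t := D.M))) _)
  generalize E ∩ D.M = E at hEt
  have hC := hR.collar
  set κ := volume.withDensity F with hκ
  have hMt : volume D.M ≠ ∞ := by rw [H.std.volume_eq_one]; exact ENNReal.one_ne_top
  set A' := A ∩ (D.M \ D.R) with hA'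
  have hA'm : MeasurableSet A' := hA.inter (H.measurableSet_M.diff H.measurableSet_R)
  have hA't : volume A' ≠ ∞ := measure_ne_top_of_subset (inter_subset_right.trans sdiff_subset) hMt
  have hA'M : volume A' ≤ volume (A ∩ D.M) := measure_mono (inter_subset_inter_right _ sdiff_subset)
  have key : ∀ e : ℝ≥0∞, e ≠ 0 → κ E ≤ Q * (volume (A ∩ D.M) + e) * b * volume E + b * e := by
    intro e he
    obtain ⟨K, hKA, hK, hKe⟩ := hA'm.exists_isCompact_sdiff_lt hA't he
    obtain ⟨n, hn⟩ := hR.eventually_le K hK (hKA.trans inter_subset_right) e he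
    have hKm := hK.measurableSet
    have hd1 := D.isDensity_indicator hKm (hKA.trans inter_subset_right)
    have hd2 : D.IsDensity (Kᶜ.indicator F) := by
      refine ⟨hF.1.indicator hKm.compl, fun x hx => ?_, fun x hx => ?_⟩
      · exact indicator_apply_eq_zero.2 fun _ => hF.2.1 x hx
      · exact indicator_apply_eq_zero.2 fun _ => hF.2.2 x hx
    have h1 : κ.restrict K ≤ b • volume.withDensity (K.indicator 1) := by
      rw [withDensity_indicator_one hKm, ← Measure.restrict_smul]
      exact Measure.restrict_mono le_rfl hFb
    have h2 : κ = κ.restrict K + volume.withDensity (Kᶜ.indicator F) := by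
      rw [withDensity_indicator hKm.compl, ← restrict_withDensity hKm.compl]
      exact (Measure.restrict_add_restrict_compl hKm).symm
    have h3 : κ = (D.push δ)^[n] κ := (Function.iterate_fixed hfix n).symm
    have h4 : κ ≤ b • volume.withDensity ((D.step δ)^[n] (K.indicator 1)) +
        (D.push δ)^[n] (volume.withDensity (Kᶜ.indicator F)) := by
      conv_lhs => rw [h3, h2, H.push_iterate_add]
      refine add_le_add ?_ le_rfl
      rw [← H.push_iterate_withDensity hC hd1, ← H.push_iterate_smul]
      exact H.push_iterate_mono δ h1 n
    refine (h4 E).trans ?_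
    rw [Measure.add_apply, Measure.smul_apply, smul_eq_mul]
    refine add_le_add ?_ ?_
    · have h5 : volume.withDensity ((D.step δ)^[n] (K.indicator 1)) ≤
          (Q * (volume (A ∩ D.M) + e)) • volume := by
        rw [← withDensity_const]
        refine withDensity_mono (Eventually.of_forall fun x => (hn x).trans ?_)
        exact mul_le_mul_right (add_le_add_left ((measure_mono hKA).trans hA'M) _) _
      have h6 := h5 E
      rw [Measure.smul_apply, smul_eq_mul] at h6
      calc _ ≤ b * (Q * (volume (A ∩ D.M) + e) * volume E) := by gcongr
        _ = _ := by ring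
    · refine (measure_mono (subset_univ E)).trans ?_
      rw [H.push_iterate_univ hC hd2, lintegral_indicator hKm.compl, ← withDensity_apply _ hKm.compl]
      have h7 : volume.withDensity F Kᶜ ≤ volume.withDensity F (A' \ K) := by
        have h8 : volume.withDensity F A'ᶜ = 0 := by
          rw [withDensity_apply _ hA'm.compl, setLIntegral_eq_zero_iff hA'm.compl hF.1]
          refine Eventually.of_forall fun x hx => ?_
          by_contra h
          refine hx ⟨?_, ?_, fun hxR => h (hF.2.1 x hxR)⟩
          · by_contra hxA; exact h (hFA x hxA)
          · by_contra hxM; exact h (hF.2.2 x hxM)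
        have h9 : Kᶜ ⊆ (A' \ K) ∪ A'ᶜ := fun x hx => by
          by_cases hxA : x ∈ A'
          · exact Or.inl ⟨hxA, hx⟩
          · exact Or.inr hxA
        refine (measure_mono h9).trans ((measure_union_le _ _).trans ?_)
        rw [h8, add_zero]
      refine h7.trans ((hFb _).trans ?_)
      rw [Measure.smul_apply, smul_eq_mul]
      gcongr
  have ht : Tendsto (fun e : ℝ≥0∞ => Q * (volume (A ∩ D.M) + e) * b * volume E + b * e) (𝓝[≠] 0)
      (𝓝 (Q * (volume (A ∩ D.M) + 0) * b * volume E + b * 0)) := by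
    have h0 : Tendsto (fun e : ℝ≥0∞ => e) (𝓝[≠] 0) (𝓝 0) := tendsto_id.mono_left nhdsWithin_le_nhds
    refine Tendsto.add ?_ (ENNReal.Tendsto.const_mul h0 (Or.inr hb))
    exact ENNReal.Tendsto.mul_const (ENNReal.Tendsto.mul_const (ENNReal.Tendsto.const_mul
      (tendsto_const_nhds.add h0) (Or.inr hR.Q_ne_top)) (Or.inr hb)) (Or.inr hEt)
  rw [add_zero, mul_zero, add_zero] at ht
  exact ge_of_tendsto ht (eventually_nhdsWithin_of_forall key)

/-- Invariant sets of positive measure are large. -/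
theorem one_le_of_push_eq {F : Euc m → ℝ≥0∞} {b : ℝ≥0∞} (hF : D.IsDensity F) (hb : b ≠ ∞)
    (hFb : volume.withDensity F ≤ b • volume) (hfix : D.push δ (volume.withDensity F) =
      volume.withDensity F) {A : Set (Euc m)} (hA : MeasurableSet A) (hFA : ∀ x, x ∉ A → F x = 0)
    (h0 : volume.withDensity F ≠ 0) : 1 ≤ Q * volume (A ∩ D.M) := by
  by_contra! hq
  set q := Q * volume (A ∩ D.M) with hqdef
  have hqt : q ≠ ∞ := (hq.trans ENNReal.one_lt_top).ne
  -- Invariance allows the bound to be fed back into itself, with a gain of a factor `q < 1` each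
  -- time; the measure would vanish.
  have hiter : ∀ n, volume.withDensity F ≤ (q ^ n * b) • volume := by
    intro n
    induction n with
    | zero => simpa using hFb
    | succ n ih =>
      have := H.withDensity_le_of_push_eq hR hF
        (ENNReal.mul_ne_top (ENNReal.pow_ne_top hqt) hb) ih hfix hA hFA
      rwa [← hqdef, ← mul_assoc, ← pow_succ'] at this
  have ht : Tendsto (fun n : ℕ => q ^ n * b) atTop (𝓝 (0 * b)) :=
    ENNReal.Tendsto.mul_const (ENNReal.tendsto_pow_atTop_nhds_zero_of_lt_one hq) (Or.inr hb)
  rw [zero_mul] at ht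
  refine h0 (Measure.measure_univ_eq_zero.1 (le_antisymm (ge_of_tendsto' ht fun n => ?_) zero_le))
  rw [H.withDensity_inter_M hF MeasurableSet.univ, univ_inter]
  have := hiter n D.M
  rwa [Measure.smul_apply, smul_eq_mul, H.std.volume_eq_one, mul_one] at this

end System
end PiecewiseMap

/-! ### An invariant density of the induced system. -/

namespace PiecewiseMap
variable {m : ℕ} {D : PiecewiseMap m} {I Cξ : ℝ}

namespace System
variable (H : D.System I Cξ)
include H

/-- The open set `T R` contains the closure of `R`. Equality would make that closure open as well,
against connectedness and noncompactness of the space. -/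
theorem exists_closedBall_subset : ∃ y R₁, 0 < R₁ ∧ Metric.closedBall y R₁ ⊆ D.M \ D.R := by
  have := H.nontrivial_E
  have hTR := H.isOpen_TR
  have hne : (D.T '' D.R \ closure D.R).Nonempty := by
    by_contra h
    rw [not_nonempty_iff_eq_empty, sdiff_eq_empty] at h
    have h1 : closure D.R = D.T '' D.R := H.rates.closure_R.antisymm h
    have h2 : IsClopen (closure D.R) := ⟨isClosed_closure, h1 ▸ hTR⟩
    rcases isClopen_iff.1 h2 with h3 | h3
    · exact (h3 ▸ subset_closure H.rates.mem_R : D.p ∈ (∅ : Set _))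
    · have h4 := H.isCompact_closure_R
      rw [h3] at h4
      exact noncompact_univ (Euc m) h4
  obtain ⟨y, hy⟩ := hne
  obtain ⟨r, hr, hs⟩ := Metric.isOpen_iff.1 (hTR.sdiff isClosed_closure) y hy
  refine ⟨y, r / 2, half_pos hr, fun x hx => ?_⟩
  have hx' := hs (Metric.closedBall_subset_ball (half_lt_self hr) hx)
  exact ⟨H.U_subset_M 0 (H.TR_subset_U hx'.1), fun h => hx'.2 (subset_closure h)⟩

variable {ε δ r₀ : ℝ} {B Q : ℝ≥0∞} (hR : D.Regular ε δ r₀ B Q)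
include hR

omit hR in
theorem withDensity_le_smul_restrict {f : Euc m → ℝ≥0∞} (hf : D.IsDensity f) {b : ℝ≥0∞}
    (hb : ∀ x, f x ≤ b) : volume.withDensity f ≤ b • volume.restrict (D.M \ D.R) := by
  have hm := H.measurableSet_M.diff H.measurableSet_R
  rw [← Measure.restrict_smul, ← withDensity_const, restrict_withDensity hm,
    ← withDensity_indicator hm]
  refine withDensity_mono (Eventually.of_forall fun x => ?_)
  by_cases hx : x ∈ D.M \ D.R
  · rw [indicator_of_mem hx]; exact hb x
  · have : f x = 0 := by
      by_contra h
      refine hx ⟨?_, fun hxR => h (hf.2.1 x hxR)⟩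
      by_contra hxM; exact h (hf.2.2 x hxM)
    rw [this]; exact zero_le

/-- The induced system has a bounded invariant density, which is bounded below on some ball. -/
theorem exists_fixed_density : ∃ F : Euc m → ℝ≥0∞, D.IsDensity F ∧ (∀ x, F x ≤ B) ∧
    D.push δ (volume.withDensity F) = volume.withDensity F ∧ volume.withDensity F ≠ 0 ∧
    ∃ (y : Euc m) (r : ℝ) (c : ℝ≥0∞), 0 < r ∧ c ≠ 0 ∧ Metric.ball y r ⊆ D.M ∧
      ∀ A, MeasurableSet A → A ⊆ Metric.ball y r → c * volume A ≤ volume.withDensity F A := by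
  have hC := hR.collar
  have hBt := hR.B_ne_top
  obtain ⟨y₀, R₁, hR₁, hball⟩ := H.exists_closedBall_subset
  obtain ⟨r, hr, c, hc, hero⟩ := hR.ero y₀ R₁ hR₁ hball
  set K := Metric.closedBall y₀ R₁ with hKdef
  have hK : IsCompact K := isCompact_closedBall _ _
  have hd := D.isDensity_indicator hK.measurableSet hball
  set f : ℕ → Euc m → ℝ≥0∞ := fun n => (D.step δ)^[n] (K.indicator 1) with hf
  have hfd : ∀ n, D.IsDensity (f n) := H.isDensity_iterate hC hd
  have hfB : ∀ n x, f n x ≤ B := hR.iterate_le K hK hball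
  set v := ∫⁻ x, K.indicator (1 : Euc m → ℝ≥0∞) x with hv
  have hvK : v = volume K := lintegral_indicator_one hK.measurableSet
  have hv0 : v ≠ 0 := by
    rw [hvK]; exact (Metric.measure_closedBall_pos volume y₀ hR₁).ne'
  have hvt : v ≠ ∞ := by rw [hvK]; exact hK.measure_lt_top.ne
  set M' := D.M \ D.R with hM'
  have hM'm : MeasurableSet M' := H.measurableSet_M.diff H.measurableSet_R
  have hMt : volume D.M ≠ ∞ := by rw [H.std.volume_eq_one]; exact ENNReal.one_ne_top
  have hM't : volume M' ≠ ∞ := measure_ne_top_of_subset sdiff_subset hMt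
  set ν : Measure (Euc m) := B • volume.restrict M' with hν
  have hνfin : IsFiniteMeasure ν := ⟨by
    rw [hν, Measure.smul_apply, smul_eq_mul, Measure.restrict_apply_univ]
    exact ENNReal.mul_lt_top hBt.lt_top hM't.lt_top⟩
  set μ : ℕ → Measure (Euc m) := fun n => volume.withDensity (f n) with hμ
  have hμν : ∀ n, μ n ≤ ν := fun n => H.withDensity_le_smul_restrict (hfd n) (hfB n)
  have hμu : ∀ n, μ n univ = v := fun n => by
    rw [hμ]
    dsimp only
    rw [withDensity_apply _ MeasurableSet.univ, Measure.restrict_univ]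
    exact H.lintegral_iterate hC hd n
  have hpush : ∀ n, D.push δ (μ n) = μ (n + 1) := fun n => by
    rw [hμ]
    dsimp only
    rw [H.push_withDensity hC (hfd n), hf]
    dsimp only
    rw [Function.iterate_succ_apply']
  set a : ℕ → ℝ≥0∞ := fun n => ((n + 1 : ℕ) : ℝ≥0∞)⁻¹ with ha
  have ha0 : ∀ n, ((n + 1 : ℕ) : ℝ≥0∞) ≠ 0 := fun n => by simp
  have hat : ∀ n, ((n + 1 : ℕ) : ℝ≥0∞) ≠ ∞ := fun n => ENNReal.natCast_ne_top _
  have hav : ∀ (n : ℕ) (b : ℝ≥0∞), a n * ∑ _k ∈ Finset.range (n + 1), b = b := fun n b => by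
    rw [Finset.sum_const, Finset.card_range, nsmul_eq_mul, ← mul_assoc,
      ENNReal.inv_mul_cancel (ha0 n) (hat n), one_mul]
  -- Cesàro averages of the images of the starting measure, all dominated by `ν`.
  set σ : ℕ → Measure (Euc m) := fun n => a n • ∑ k ∈ Finset.range (n + 1), μ k with hσ
  have hσa : ∀ n A, σ n A = a n * ∑ k ∈ Finset.range (n + 1), μ k A := fun n A => by
    rw [hσ]
    simp [Measure.smul_apply, Measure.coe_finsetSum]
  have hσν : ∀ n, σ n ≤ ν := fun n => Measure.le_iff.2 fun A _ => by
    rw [hσa, ← hav n (ν A)]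
    exact mul_le_mul_right (Finset.sum_le_sum fun k _ => hμν k A) _
  have hσu : ∀ n, σ n univ = v := fun n => by
    rw [hσa]
    simp only [hμu]
    exact hav n v
  set U := hyperfilter ℕ with hU
  obtain ⟨τ, hτ⟩ := exists_ultrafilter_limit U ν σ hσν
  have hτν : τ ≤ ν := Measure.le_iff.2 fun A hA => le_of_tendsto' (hτ A hA) fun n => hσν n A
  have hτu : τ univ = v := by
    have := hτ univ MeasurableSet.univ
    simp only [hσu] at this
    exact tendsto_nhds_unique this tendsto_const_nhds
  have hτfin : IsFiniteMeasure τ := isFiniteMeasure_of_le ν hτν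
  have hatop : Tendsto a U (𝓝 0) :=
    (ENNReal.tendsto_inv_nat_nhds_zero.comp (tendsto_add_atTop_nat 1)).mono_left
      Nat.hyperfilter_le_atTop
  -- Pushing an average forward changes it by at most `a n * v`. The limit gives only an inequality,
  -- which conservation of mass turns into equality.
  have hτpush : D.push δ τ ≤ τ := Measure.le_iff.2 fun A hA => by
    rw [H.push_apply δ τ hA]
    have h1 : Tendsto (fun n => σ n A + a n * v) U (𝓝 (τ A + 0 * v)) :=
      (hτ A hA).add (ENNReal.Tendsto.mul_const hatop (Or.inr hvt))
    rw [zero_mul, add_zero] at h1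
    refine lintegral_le_of_ultrafilter_limit hτ (H.measurable_hit δ hA) h1 fun n => ?_
    have e : σ n = a n • ∑ k ∈ Finset.range (n + 1), μ k := rfl
    rw [e, lintegral_smul_measure, lintegral_finsetSum_measure, hσa, smul_eq_mul, ← mul_add]
    refine mul_le_mul_right ?_ _
    have h2 : ∀ k, ∫⁻ z, D.hit δ A z ∂μ k = μ (k + 1) A := fun k => by
      rw [← H.push_apply δ _ hA, hpush]
    simp only [h2]
    rw [← hμu (n + 1)]
    calc ∑ k ∈ Finset.range (n + 1), μ (k + 1) A ≤ ∑ k ∈ Finset.range (n + 2), μ k A := by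
          rw [Finset.sum_range_succ' (fun k => μ k A) (n + 1)]
          exact le_self_add
      _ = ∑ k ∈ Finset.range (n + 1), μ k A + μ (n + 1) A := Finset.sum_range_succ _ _
      _ ≤ _ := add_le_add_right (measure_mono (subset_univ A)) _
  set F₀ := τ.rnDeriv volume with hF₀
  have hac : τ ≪ volume := (Measure.absolutelyContinuous_of_le hτν).trans
    ((Measure.smul_absolutelyContinuous).trans Measure.restrict_le_self.absolutelyContinuous)
  have hτF₀ : volume.withDensity F₀ = τ := Measure.withDensity_rnDeriv_eq _ _ hac
  have hF₀m : Measurable F₀ := Measure.measurable_rnDeriv _ _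
  have hF₀B : F₀ ≤ᵐ[volume] fun _ => B := by
    refine ae_le_of_forall_setLIntegral_le_of_sigmaFinite hF₀m fun A hA _ => ?_
    rw [← withDensity_apply _ hA, hτF₀, setLIntegral_const]
    refine (hτν A).trans ?_
    rw [hν, Measure.smul_apply, smul_eq_mul]
    exact mul_le_mul_right (Measure.restrict_apply_le _ _) _
  -- The density is adjusted on a null set so that the bound and the vanishing off `D.M \ D.R` hold
  -- everywhere.
  set F : Euc m → ℝ≥0∞ := M'.indicator fun x => min (F₀ x) B with hF
  have hτF : volume.withDensity F = τ := by
    rw [hF, withDensity_indicator hM'm]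
    have h1 : (volume.restrict M').withDensity (fun x => min (F₀ x) B) =
        (volume.restrict M').withDensity F₀ :=
      withDensity_congr_ae (ae_restrict_of_ae (hF₀B.mono fun x hx => min_eq_left hx))
    rw [h1, ← restrict_withDensity hM'm, hτF₀]
    refine Measure.restrict_eq_self_of_ae_mem ?_
    rw [ae_iff]
    refine le_antisymm ((hτν _).trans ?_) zero_le
    rw [hν, Measure.smul_apply, smul_eq_mul]
    have h2 : volume.restrict M' {x | x ∉ M'} = 0 := by
      rw [show {x | x ∉ M'} = M'ᶜ from rfl, Measure.restrict_apply hM'm.compl]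
      exact measure_mono_null (fun x hx => hx.1 hx.2) measure_empty
    rw [h2, mul_zero]
  have hFd : D.IsDensity F := by
    refine ⟨(hF₀m.min measurable_const).indicator hM'm, fun x hx => ?_, fun x hx => ?_⟩
    · exact indicator_of_notMem (fun h => h.2 hx) _
    · exact indicator_of_notMem (fun h => hx h.1) _
  refine ⟨F, hFd, fun x => indicator_le (fun x _ => min_le_right _ _) x, ?_, ?_, ?_⟩
  · rw [hτF]
    have hpfin := isFiniteMeasure_of_le τ hτpush
    refine Measure.eq_of_le_of_measure_univ_eq hτpush ?_
    have h1 := H.push_iterate_univ hC hFd 1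
    rw [Function.iterate_one, hτF, ← Measure.restrict_univ (μ := volume),
      ← withDensity_apply _ MeasurableSet.univ, hτF] at h1
    exact h1
  · rw [hτF]
    intro h
    rw [h] at hτu
    exact hv0 hτu.symm
  · have hr2 : 0 < r / 2 := half_pos hr
    obtain ⟨t, htM, htf, htc⟩ := H.std.compact.finite_cover_balls hr2
    set W := ENNReal.ofReal (gam m * (r / 2) ^ m) with hW
    -- `g y n` bounds the averaged density from below on the ball of radius `r / 2` about `y`. By
    -- the estimate for infima, the limits `l y` over a finite cover cannot all vanish.
    set g : Euc m → ℕ → ℝ≥0∞ := fun y n => a n * ∑ k ∈ Finset.range (n + 1), ero (f k) (r / 2) y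
      with hg
    set l : Euc m → ℝ≥0∞ := fun y => (U.map (g y)).lim with hl
    have hgl : ∀ y, Tendsto (g y) U (𝓝 (l y)) := fun y => tendsto_ultrafilter_lim U _
    have h1 : ∀ k, c ≤ ∑ y ∈ htf.toFinset, W * ero (f k) (r / 2) y := by
      intro k
      refine (hero k).trans ?_
      calc ∫⁻ x, ero (f k) r x ≤ ∫⁻ x, ∑ y ∈ htf.toFinset,
            (Metric.ball y (r / 2)).indicator (fun _ => ero (f k) (r / 2) y) x := by
            refine lintegral_mono fun x => ?_
            by_cases hx : x ∈ D.M
            · obtain ⟨y, hy, hxy⟩ := mem_iUnion₂.1 (htc hx)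
              refine le_trans ?_ (Finset.single_le_sum (f := fun y => (Metric.ball y (r / 2)).indicator
                (fun _ => ero (f k) (r / 2) y) x) (fun _ _ => zero_le) (htf.mem_toFinset.2 hy))
              dsimp only
              rw [indicator_of_mem hxy]
              refine le_iInf₂ fun z hz => ero_le _ ?_
              have h2 := Metric.mem_ball.1 hxy
              have h3 := Metric.mem_ball.1 hz
              have := dist_triangle_right z x y
              linarith
            · refine ((ero_le_self (f k) hr x).trans ?_)
              rw [(hfd k).2.2 x hx]; exact zero_le
        _ = _ := by
            rw [lintegral_finsetSum _ fun y _ => measurable_const.indicator measurableSet_ball]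
            refine Finset.sum_congr rfl fun y _ => ?_
            rw [lintegral_indicator measurableSet_ball, setLIntegral_const, volume_ball_eq y hr2,
              mul_comm]
    have h2 : c ≤ ∑ y ∈ htf.toFinset, W * l y := by
      have h3 : Tendsto (fun n => ∑ y ∈ htf.toFinset, W * g y n) U
          (𝓝 (∑ y ∈ htf.toFinset, W * l y)) := tendsto_finsetSum _ fun y _ =>
        ENNReal.Tendsto.const_mul (hgl y) (Or.inr ENNReal.ofReal_ne_top)
      refine ge_of_tendsto' h3 fun n => ?_
      calc c = a n * ∑ _k ∈ Finset.range (n + 1), c := (hav n c).symm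
        _ ≤ a n * ∑ k ∈ Finset.range (n + 1), ∑ y ∈ htf.toFinset, W * ero (f k) (r / 2) y :=
          mul_le_mul_right (Finset.sum_le_sum fun k _ => h1 k) _
        _ = _ := by
          rw [Finset.sum_comm, Finset.mul_sum]
          refine Finset.sum_congr rfl fun y _ => ?_
          rw [← Finset.mul_sum, hg]
          ring
    obtain ⟨y, hy, hly⟩ : ∃ y ∈ htf.toFinset, l y ≠ 0 := by
      by_contra! h
      refine hc (le_antisymm (h2.trans (le_of_eq ?_)) zero_le)
      exact Finset.sum_eq_zero fun y hy => by rw [h y hy, mul_zero]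
    refine ⟨y, r / 2, l y, hr2, hly, fun x hx => ?_, fun A hA hAs => ?_⟩
    · by_contra hxM
      have h3 : ∀ n, g y n = 0 := fun n => by
        rw [hg]
        dsimp only
        rw [Finset.sum_eq_zero fun k _ => ?_, mul_zero]
        refine le_antisymm ((ero_le (f k) (Metric.mem_ball.1 hx)).trans ?_) zero_le
        rw [(hfd k).2.2 x hxM]
      have h4 := hgl y
      rw [show g y = fun _ => 0 from funext h3] at h4
      exact hly (tendsto_nhds_unique h4 tendsto_const_nhds)
    · rw [hτF]
      have hAt : volume A ≠ ∞ := measure_ne_top_of_subset hAs measure_ball_lt_top.ne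
      refine le_of_tendsto_of_tendsto' (ENNReal.Tendsto.mul_const (hgl y) (Or.inr hAt)) (hτ A hA)
        fun n => ?_
      rw [hσa, hg]
      dsimp only
      rw [mul_assoc, Finset.sum_mul]
      refine mul_le_mul_right (Finset.sum_le_sum fun k _ => ?_) _
      rw [hμ]
      dsimp only
      rw [withDensity_apply _ hA, ← setLIntegral_const]
      exact setLIntegral_mono (hfd k).1 fun x hx => ero_le _ (Metric.mem_ball.1 (hAs hx))

end System
end PiecewiseMap

/-! ### The invariant measure of `T` above the induced one. -/

namespace PiecewiseMap
variable {m : ℕ} {D : PiecewiseMap m} {I Cξ : ℝ}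

/-- The probability that the orbit of `z` is not stopped before time `n`. -/
noncomputable def tower (D : PiecewiseMap m) (δ : ℝ) (n : ℕ) (z : Euc m) : ℝ≥0∞ :=
  ∏ i ∈ Finset.range n, D.cutoff δ (D.T^[i] z)

/-- The invariant measure of `T` above a measure which is invariant for the induced system. -/
noncomputable def lift (D : PiecewiseMap m) (δ : ℝ) (μ : Measure (Euc m)) : Measure (Euc m) :=
  Measure.sum fun n => ((μ.map D.T).withDensity (D.tower δ n)).map D.T^[n]

/-- The density of the invariant measure above a measure with density `F`. -/
noncomputable def liftDensity (D : PiecewiseMap m) (δ : ℝ) (F : Euc m → ℝ≥0∞) (x : Euc m) : ℝ≥0∞ :=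
  ∑' n, D.pull n (fun z => D.tower δ n z * D.transfer F z) x

theorem tower_eq_add (δ : ℝ) (n : ℕ) (z : Euc m) :
    D.tower δ n z = D.tower δ (n + 1) z + D.stopWeight δ n z := by
  rw [tower, tower, stopWeight, Finset.prod_range_succ, ← mul_add,
    add_tsub_cancel_of_le (cutoff_le_one _ _), mul_one]

theorem tower_le_one (δ : ℝ) (n : ℕ) (z : Euc m) : D.tower δ n z ≤ 1 :=
  Finset.prod_le_one' fun _ _ => cutoff_le_one _ _

namespace System
variable (H : D.System I Cξ)
include H

theorem measurable_tower (δ : ℝ) (n : ℕ) : Measurable (D.tower δ n) :=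
  Finset.measurable_fun_prod _ fun k _ =>
    (continuous_cutoff δ).measurable.comp (H.std.measurable.iterate k)

theorem sum_map_iterate_apply {w : ℕ → Euc m → ℝ≥0∞} (μ : Measure (Euc m))
    {A : Set (Euc m)} (hA : MeasurableSet A) :
    Measure.sum (fun n => (μ.withDensity (w n)).map D.T^[n]) A =
      ∑' n, ∫⁻ z in D.T^[n] ⁻¹' A, w n z ∂μ := by
  have hT := H.std.measurable
  rw [Measure.sum_apply _ hA]
  refine tsum_congr fun n => ?_
  rw [Measure.map_apply (hT.iterate n) hA, withDensity_apply _ (hT.iterate n hA)]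

/-- Under `T` the mass at level `n` either rises to level `n + 1` or is stopped. The stopped mass of
all levels adds up to the image of `μ` under the induced system, which is `μ`; its image under `T`
refills level zero. -/
theorem map_lift {δ : ℝ} {μ : Measure (Euc m)} (hμ : D.push δ μ = μ) :
    (D.lift δ μ).map D.T = D.lift δ μ := by
  have hT := H.std.measurable
  ext A hA
  rw [Measure.map_apply hT hA, lift, H.sum_map_iterate_apply _ (hT hA),
    H.sum_map_iterate_apply _ hA]
  conv_rhs => rw [tsum_eq_zero_add' ENNReal.summable]
  have h1 : ∀ n, ∫⁻ z in D.T^[n] ⁻¹' (D.T ⁻¹' A), D.tower δ n z ∂(μ.map D.T) =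
      (∫⁻ z in D.T^[n + 1] ⁻¹' A, D.tower δ (n + 1) z ∂(μ.map D.T)) +
        ∫⁻ z in D.T^[n] ⁻¹' (D.T ⁻¹' A), D.stopWeight δ n z ∂(μ.map D.T) := fun n => by
    rw [← preimage_comp, ← Function.iterate_succ', ← lintegral_add_left (H.measurable_tower δ _)]
    exact lintegral_congr fun z => tower_eq_add δ n z
  have h2 : ∑' n, ∫⁻ z in D.T^[n] ⁻¹' (D.T ⁻¹' A), D.stopWeight δ n z ∂(μ.map D.T) =
      μ (D.T ⁻¹' A) := by
    rw [← H.sum_map_iterate_apply _ (hT hA)]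
    exact congrArg (fun ν : Measure (Euc m) => ν (D.T ⁻¹' A)) hμ
  simp only [h1]
  rw [ENNReal.tsum_add, h2, add_comm]
  congr 1
  simp [tower, Measure.map_apply hT hA]

theorem lift_restrict (δ : ℝ) {A : Set (Euc m)} (hA : MeasurableSet A) (hTA : D.T ⁻¹' A = A)
    (μ : Measure (Euc m)) : D.lift δ (μ.restrict A) = (D.lift δ μ).restrict A := by
  have hT := H.std.measurable
  ext E hE
  rw [Measure.restrict_apply hE, lift, lift, H.sum_map_iterate_apply _ hE,
    H.sum_map_iterate_apply _ (hE.inter hA)]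
  refine tsum_congr fun n => ?_
  have h1 : (μ.restrict A).map D.T = (μ.map D.T).restrict A := by
    rw [Measure.restrict_map hT hA, hTA]
  rw [h1, preimage_inter, preimage_iterate_eq hTA, Measure.restrict_restrict (hT.iterate n hE)]

theorem measurable_liftDensity (δ : ℝ) {F : Euc m → ℝ≥0∞} (hF : Measurable F) :
    Measurable (D.liftDensity δ F) :=
  Measurable.tsum fun n => H.measurable_pull n
    ((H.measurable_tower δ n).mul (H.measurable_transfer hF))

theorem liftDensity_eq_zero {δ : ℝ} {F : Euc m → ℝ≥0∞} {x : Euc m} (hx : x ∉ D.M) :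
    D.liftDensity δ F x = 0 := by
  rw [liftDensity, ENNReal.tsum_eq_zero]
  rintro (_ | n)
  · rw [pull_zero_apply, H.transfer_eq_zero hx, mul_zero]
  · refine pull_eq_zero (fun h => hx ?_) _
    obtain ⟨z, hz, rfl⟩ := h
    rw [Function.iterate_succ_apply']
    exact H.std.mapsTo (H.U_subset_M 0 (mem_dom_succ.1 hz).2)

/-- How the invariant density changes along an orbit near the fixed point. -/
theorem liftDensity_le_apply {δ : ℝ} (F : Euc m → ℝ≥0∞) {x : Euc m} (hx : x ∈ D.U 0) :
    D.cutoff δ x * D.liftDensity δ F x ≤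
      ENNReal.ofReal |(fderiv ℝ D.T x).det| * D.liftDensity δ F (D.T x) := by
  rw [liftDensity, liftDensity, ← ENNReal.tsum_mul_left, ← ENNReal.tsum_mul_left]
  rw [tsum_eq_zero_add' (f := fun n => ENNReal.ofReal |(fderiv ℝ D.T x).det| *
    D.pull n (fun z => D.tower δ n z * D.transfer F z) (D.T x)) ENNReal.summable]
  refine le_trans (ENNReal.tsum_le_tsum fun n => ?_) le_add_self
  by_cases hxn : x ∈ D.ran n
  · obtain ⟨z, hz, rfl⟩ := hxn
    have hz' : z ∈ D.dom (n + 1) := mem_dom_succ.2 ⟨hz, hx⟩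
    obtain ⟨A, hA⟩ := H.strict_iterate hz
    have hdet : (fderiv ℝ D.T^[n + 1] z).det =
        (fderiv ℝ D.T (D.T^[n] z)).det * (fderiv ℝ D.T^[n] z).det := by
      rw [Function.iterate_succ', fderiv_comp z (H.strict_T hx).hasFDerivAt.differentiableAt
        hA.hasFDerivAt.differentiableAt]
      exact LinearMap.det_comp _ _
    have h0 := abs_ne_zero.2 (H.det_ne_zero hx)
    rw [← Function.iterate_succ_apply' D.T n z, H.pull_iterate hz, H.pull_iterate hz', hdet,
      abs_mul, mul_inv, ENNReal.ofReal_mul (by positivity), tower, tower, Finset.prod_range_succ]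
    refine le_of_eq ?_
    have h1 : ENNReal.ofReal |(fderiv ℝ D.T (D.T^[n] z)).det| *
        ENNReal.ofReal |(fderiv ℝ D.T (D.T^[n] z)).det|⁻¹ = 1 := by
      rw [← ENNReal.ofReal_mul (abs_nonneg _), mul_inv_cancel₀ h0, ENNReal.ofReal_one]
    rw [← mul_assoc (ENNReal.ofReal |(fderiv ℝ D.T (D.T^[n] z)).det|), ← mul_assoc
      (ENNReal.ofReal |(fderiv ℝ D.T (D.T^[n] z)).det|), h1]
    ring
  · rw [pull_eq_zero hxn, mul_zero]; exact zero_le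

variable {ε δ r₀ : ℝ} {B Q : ℝ≥0∞}

section
variable (hC : D.Collar ε δ r₀)
include hC

theorem tower_eq_zero {n : ℕ} {z : Euc m} (hz : z ∉ D.dom n) : D.tower δ n z = 0 := by
  have : ∃ k < n, D.T^[k] z ∉ D.U 0 := by
    by_contra! h; exact hz h
  obtain ⟨k, hk, hkU⟩ := this
  refine Finset.prod_eq_zero (Finset.mem_range.2 hk) ?_
  by_contra h
  exact hkU (H.TR_subset_U (hC.nbhdR_subset (H.cutoff_ne_zero hC h)))

theorem lift_withDensity {F : Euc m → ℝ≥0∞} (hF : D.IsDensity F) :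
    D.lift δ (volume.withDensity F) = volume.withDensity (D.liftDensity δ F) := by
  have hg := H.measurable_transfer hF.1
  rw [lift, H.map_withDensity hF.1 hF.2.2]
  have h1 : ∀ n, ((volume.withDensity (D.transfer F)).withDensity (D.tower δ n)).map D.T^[n] =
      volume.withDensity (D.pull n fun z => D.tower δ n z * D.transfer F z) := fun n => by
    rw [← withDensity_mul _ hg (H.measurable_tower δ n), mul_comm,
      H.map_iterate_withDensity n fun x hx => by
        rw [Pi.mul_apply, H.tower_eq_zero hC hx, zero_mul]]
    rfl
  simp only [h1]
  rw [← withDensity_tsum fun n => by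
    exact H.measurable_pull n ((H.measurable_tower δ n).mul hg)]
  congr 1
  ext x
  rw [liftDensity, tsum_apply (Pi.summable.2 fun _ => ENNReal.summable)]

omit hC in
-- The probability of reaching level `n`, times that of stopping there, is the stopping weight. So
-- the density of `lift` is controlled wherever the cutoff stays away from one.
theorem mul_liftDensity (F : Euc m → ℝ≥0∞) (x : Euc m) :
    (1 - D.cutoff δ x) * D.liftDensity δ F x = D.step δ F x := by
  rw [liftDensity, step, induced, ← ENNReal.tsum_mul_left]
  refine tsum_congr fun n => ?_
  by_cases hx : x ∈ D.ran n
  · obtain ⟨z, hz, rfl⟩ := hx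
    rw [H.pull_iterate hz, H.pull_iterate hz, stopWeight, tower]
    ring
  · rw [pull_eq_zero hx, pull_eq_zero hx, mul_zero]

theorem withDensity_le_lift {F : Euc m → ℝ≥0∞} (hF : D.IsDensity F)
    (hfix : D.push δ (volume.withDensity F) = volume.withDensity F) :
    volume.withDensity F ≤ volume.withDensity (D.liftDensity δ F) := by
  rw [← hfix, H.push_withDensity hC hF]
  refine withDensity_mono (Eventually.of_forall fun x => ?_)
  rw [← H.mul_liftDensity F x]
  exact mul_le_of_le_one_left zero_le tsub_le_self

end

variable (hR : D.Regular ε δ r₀ B Q)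
include hR

/-- Where the cutoff is below one half, the density is at most twice a bounded one. Every other
point except `p` reaches such a place in finitely many steps, and along each step the density
changes by a locally bounded factor. -/
theorem liftDensity_bounded_near {F : Euc m → ℝ≥0∞} (hFB : ∀ x, F x ≤ B)
    {x : Euc m} (hx : x ≠ D.p) :
    ∃ S : ℝ≥0∞, S ≠ ∞ ∧ ∀ᶠ y in 𝓝 x, D.liftDensity δ F y ≤ S := by
  have hC := hR.collar
  obtain ⟨S, hS, hSb⟩ := hR.induced_le (D.transfer F) ((D.K + 1 : ℕ) * B)
    (ENNReal.mul_ne_top (ENNReal.natCast_ne_top _) hR.B_ne_top) (H.transfer_le hFB)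
    (fun x hx => H.transfer_eq_zero hx)
  have hh : (1 / 2 : ℝ≥0∞) ≠ 0 := by simp
  have key : ∀ n : ℕ, ∀ x : Euc m, (∀ i < n, 1 / 2 ≤ D.cutoff δ (D.T^[i] x)) →
      D.cutoff δ (D.T^[n] x) < 1 / 2 →
      ∃ S : ℝ≥0∞, S ≠ ∞ ∧ ∀ᶠ y in 𝓝 x, D.liftDensity δ F y ≤ S := by
    intro n
    induction n with
    | zero =>
      intro x _ hx
      refine ⟨S / (1 / 2), ENNReal.div_ne_top hS hh, ?_⟩
      filter_upwards [(continuous_cutoff δ).continuousAt.eventually_lt_const hx] with y hy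
      rw [ENNReal.le_div_iff_mul_le (Or.inl hh) (Or.inl (by simp)), mul_comm]
      refine le_trans ?_ (hSb y)
      rw [← step, ← H.mul_liftDensity]
      gcongr
      calc (1 / 2 : ℝ≥0∞) = 1 - 1 / 2 := by rw [one_div, ENNReal.one_sub_inv_two]
        _ ≤ _ := tsub_le_tsub_left hy.le 1
    | succ n ih =>
      intro x hx hxn
      have h0 := hx 0 (by omega)
      have hxU : x ∈ D.U 0 := by
        refine H.TR_subset_U (hC.nbhdR_subset (H.cutoff_ne_zero hC fun h => ?_))
        rw [Function.iterate_zero_apply, h] at h0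
        simp at h0
      obtain ⟨S', hS', hev⟩ := ih (D.T x) (fun i hi => hx (i + 1) (by omega)) hxn
      have hTc : ContinuousAt D.T x := (H.strict_T hxU).hasFDerivAt.continuousAt
      have hfc : ContinuousAt (fun y => |(fderiv ℝ D.T y).det|) x :=
        (ContinuousLinearMap.continuous_det.continuousAt.comp
          (((H.contDiffAt (H.U_subset_V 0 hxU)).congr_of_eventuallyEq
            (H.T_eventuallyEq hxU).symm).continuousAt_fderiv one_ne_zero)).abs
      set b := |(fderiv ℝ D.T x).det| + 1
      have h4 : (1 / 4 : ℝ≥0∞) ≠ 0 := by simp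
      have h42 : (1 / 4 : ℝ≥0∞) < D.cutoff δ x := by
        refine lt_of_lt_of_le ?_ h0
        rw [one_div, one_div, ENNReal.inv_lt_inv]
        norm_num
      refine ⟨ENNReal.ofReal b * S' / (1 / 4), ENNReal.div_ne_top
        (ENNReal.mul_ne_top ENNReal.ofReal_ne_top hS') h4, ?_⟩
      filter_upwards [hTc.eventually hev, hfc.eventually_le_const (lt_add_one _),
        (continuous_cutoff δ).continuousAt.eventually_const_lt h42,
        (H.smooth.isOpen_U 0).mem_nhds hxU] with y h1 h2 h3 hyU
      rw [ENNReal.le_div_iff_mul_le (Or.inl h4) (Or.inl (by simp)), mul_comm]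
      refine (mul_le_mul_left h3.le _).trans ((H.liftDensity_le_apply F hyU).trans ?_)
      exact mul_le_mul' (ENNReal.ofReal_le_ofReal h2) h1
  have hex : ∃ n, D.cutoff δ (D.T^[n] x) < 1 / 2 := by
    by_contra! h
    refine hx (H.eq_p_of_forall_mem (H.isCompact_nbhdR δ) hC.nbhdR_subset fun n =>
      H.cutoff_ne_zero hC fun h0 => ?_)
    have := h n
    rw [h0] at this
    simp at this
  classical
  exact key (Nat.find hex) x (fun i hi => not_lt.1 (Nat.find_min hex hi)) (Nat.find_spec hex)

theorem liftDensity_bounded_on {F : Euc m → ℝ≥0∞} (hFB : ∀ x, F x ≤ B) {K : Set (Euc m)}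
    (hK : IsCompact K) (hKp : D.p ∉ K) :
    ∃ S : ℝ≥0∞, S ≠ ∞ ∧ ∀ x ∈ K, D.liftDensity δ F x ≤ S := by
  refine hK.induction_on (p := fun s => ∃ S : ℝ≥0∞, S ≠ ∞ ∧ ∀ x ∈ s, D.liftDensity δ F x ≤ S)
    ⟨0, by simp, by simp⟩ ?_ ?_ ?_
  · rintro s t hst ⟨S, hS, h⟩
    exact ⟨S, hS, fun x hx => h x (hst hx)⟩
  · rintro s t ⟨S, hS, h⟩ ⟨S', hS', h'⟩
    refine ⟨max S S', (max_lt hS.lt_top hS'.lt_top).ne, ?_⟩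
    rintro x (hx | hx)
    · exact (h x hx).trans (le_max_left _ _)
    · exact (h' x hx).trans (le_max_right _ _)
  · intro x hx
    obtain ⟨S, hS, h⟩ := H.liftDensity_bounded_near hR hFB (ne_of_mem_of_not_mem hx hKp)
    exact ⟨_, mem_nhdsWithin_of_mem_nhds h, S, hS, fun y hy => hy⟩

/-- Invariant sets which the invariant measure sees are large. -/
theorem one_le_of_lift_ne_zero {F : Euc m → ℝ≥0∞} (hF : D.IsDensity F) (hFB : ∀ x, F x ≤ B)
    (hfix : D.push δ (volume.withDensity F) = volume.withDensity F) {A : Set (Euc m)}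
    (hA : MeasurableSet A) (hTA : D.T ⁻¹' A = A) (h0 : D.lift δ (volume.withDensity F) A ≠ 0) :
    1 ≤ Q * volume (A ∩ D.M) := by
  have hFA : volume.withDensity (A.indicator F) = (volume.withDensity F).restrict A := by
    rw [withDensity_indicator hA, restrict_withDensity hA]
  have hd : D.IsDensity (A.indicator F) := ⟨hF.1.indicator hA,
    fun x hx => indicator_apply_eq_zero.2 fun _ => hF.2.1 x hx,
    fun x hx => indicator_apply_eq_zero.2 fun _ => hF.2.2 x hx⟩
  refine H.one_le_of_push_eq hR hd hR.B_ne_top ?_ ?_ hA (fun x hx => indicator_of_notMem hx F) ?_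
  · rw [← withDensity_const]
    exact withDensity_mono (Eventually.of_forall fun x =>
      (indicator_le_self' (fun _ _ => zero_le) x).trans (hFB x))
  · rw [hFA, H.push_restrict δ hA hTA, hfix]
  · rw [hFA]
    intro h
    have h1 := H.lift_restrict δ hA hTA (volume.withDensity F)
    have h2 : D.lift δ 0 = 0 := by simp [lift]
    rw [h, h2] at h1
    exact h0 (Measure.restrict_eq_zero.1 h1.symm)

/-- The mass at each level is at most a constant times the volume on which the weight of that level
lives. -/
theorem lift_univ_lt_top {F : Euc m → ℝ≥0∞} (hF : D.IsDensity F) (hFB : ∀ x, F x ≤ B)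
    (hsum : ∑' n : ℕ, volume (D.pre (n + 1) D.R) < ∞) :
    D.lift δ (volume.withDensity F) univ < ∞ := by
  have hC := hR.collar
  set S : ℝ≥0∞ := (D.K + 1 : ℕ) * B with hS
  have hSt : S ≠ ∞ := ENNReal.mul_ne_top (ENNReal.natCast_ne_top _) hR.B_ne_top
  have hg : Measurable (D.transfer F) := H.measurable_transfer hF.1
  have hgS : ∀ x, D.transfer F x ≤ D.M.indicator (fun _ => S) x := fun x => by
    by_cases hx : x ∈ D.M
    · rw [indicator_of_mem hx]; exact H.transfer_le hFB x
    · rw [indicator_of_notMem hx, H.transfer_eq_zero hx]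
  have hterm : ∀ n (P : Set (Euc m)), MeasurableSet P → (∀ z, D.tower δ n z ≠ 0 → z ∈ P) →
      ∫⁻ z, D.tower δ n z ∂((volume.withDensity F).map D.T) ≤ S * volume (P ∩ D.M) := by
    intro n P hP h
    rw [H.map_withDensity hF.1 hF.2.2, lintegral_withDensity_eq_lintegral_mul _ hg
      (H.measurable_tower δ n), ← setLIntegral_const,
      ← lintegral_indicator (hP.inter H.measurableSet_M)]
    refine lintegral_mono fun z => ?_
    rw [Pi.mul_apply]
    by_cases hz : z ∈ P ∩ D.M
    · rw [indicator_of_mem hz]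
      have := hgS z
      rw [indicator_of_mem hz.2] at this
      exact mul_le_of_le_of_le_one this (tower_le_one δ n z)
    · refine (le_of_eq (mul_eq_zero.2 ?_)).trans zero_le
      by_contra! h'
      refine hz ⟨h z h'.2, ?_⟩
      by_contra hM
      exact h'.1 (H.transfer_eq_zero hM)
  have hMt : S * volume D.M ≠ ∞ := by rw [H.std.volume_eq_one, mul_one]; exact hSt
  have hall : ∀ n, ∫⁻ z, D.tower δ n z ∂((volume.withDensity F).map D.T) ≤ S * volume D.M :=
    fun n => by
      have := hterm n univ MeasurableSet.univ fun _ _ => trivial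
      rwa [univ_inter] at this
  -- A positive weight at level `n + 3` puts the points up to time `n + 2` in `T R`, hence the point
  -- at time `n + 1` in `R`. The first three levels are bounded separately.
  have hshift : ∀ n, ∫⁻ z, D.tower δ (n + 3) z ∂((volume.withDensity F).map D.T) ≤
      S * volume (D.pre (n + 1) D.R) := by
    intro n
    have hpm : MeasurableSet (D.pre (n + 1) D.R) :=
      (H.isOpen_dom (n + 1)).measurableSet.inter ((H.std.measurable.iterate _) H.measurableSet_R)
    refine (hterm (n + 3) _ hpm fun z hz => ?_).trans
      (mul_le_mul_right (measure_mono inter_subset_left) _)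
    have h1 : ∀ i < n + 3, D.T^[i] z ∈ D.T '' D.R := fun i hi => by
      refine hC.nbhdR_subset (H.cutoff_ne_zero hC fun h => hz ?_)
      exact Finset.prod_eq_zero (Finset.mem_range.2 hi) h
    refine ⟨fun k hk => H.TR_subset_U (h1 k (by omega)), ?_⟩
    have h2 := h1 (n + 2) (by omega)
    rw [Function.iterate_succ_apply'] at h2
    have h3 := H.inv₀_mem h2
    rwa [H.inv₀_T (H.TR_subset_U (h1 (n + 1) (by omega)))] at h3
  rw [lift, H.sum_map_iterate_apply _ MeasurableSet.univ]
  simp only [preimage_univ, Measure.restrict_univ]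
  rw [← ENNReal.summable.sum_add_tsum_nat_add' (k := 3)]
  refine ENNReal.add_lt_top.2 ⟨ENNReal.sum_lt_top.2 fun n _ => (hall n).trans_lt hMt.lt_top, ?_⟩
  refine (ENNReal.tsum_le_tsum hshift).trans_lt ?_
  rw [ENNReal.tsum_mul_left]
  exact ENNReal.mul_lt_top hSt.lt_top hsum

end System
end PiecewiseMap

/-! ### Finitely many ergodic components. -/

/-- If invariant sets of positive measure are large, then there are finitely many of them. -/
theorem exists_finite_ergodic_partition {X : Type*} [MeasurableSpace X] {T : X → X}
    {μ ν : Measure X} [IsFiniteMeasure ν] {Q : ℝ≥0∞} (hQ : Q ≠ ∞)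
    (h : ∀ A, MeasurableSet A → T ⁻¹' A = A → μ A ≠ 0 → 1 ≤ Q * ν A) :
    ∃ (k : ℕ) (A : Fin k → Set X), (∀ i, MeasurableSet (A i) ∧ T ⁻¹' A i = A i ∧ μ (A i) ≠ 0 ∧
      ∀ E, MeasurableSet E → T ⁻¹' E = E → μ (A i ∩ E) = 0 ∨ μ (A i \ E) = 0) ∧
      Pairwise (Function.onFun Disjoint A) ∧ μ (⋃ i, A i)ᶜ = 0 := by
  classical
  set P : Set X → Prop := fun A => MeasurableSet A ∧ T ⁻¹' A = A ∧ μ A ≠ 0 ∧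
      ∀ E, MeasurableSet E → T ⁻¹' E = E → μ (A ∩ E) = 0 ∨ μ (A \ E) = 0 with hP
  -- Induction on an integer bound for `Q * ν A`: splitting a set into two invariant parts of
  -- positive measure leaves at least 1 to each, so both parts fall under the smaller bound.
  have key : ∀ N : ℕ, ∀ A, MeasurableSet A → T ⁻¹' A = A → Q * ν A < N →
      ∃ s : Finset (Set X), (∀ E ∈ s, P E ∧ E ⊆ A) ∧ (s : Set (Set X)).PairwiseDisjoint id ∧
        μ (A \ ⋃₀ s) = 0 := by
    intro N
    induction N with
    | zero => intro A _ _ h0; simp at h0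
    | succ N ih =>
      intro A hA hTA hlt
      by_cases h0 : μ A = 0
      · exact ⟨∅, by simp, by simp, by simpa using h0⟩
      by_cases hat : ∀ E, MeasurableSet E → T ⁻¹' E = E → μ (A ∩ E) = 0 ∨ μ (A \ E) = 0
      · exact ⟨{A}, by simpa using ⟨hA, hTA, h0, hat⟩, by simp, by simp⟩
      push Not at hat
      obtain ⟨E, hE, hTE, h1, h2⟩ := hat
      have hI : T ⁻¹' (A ∩ E) = A ∩ E := by rw [preimage_inter, hTA, hTE]
      have hS : T ⁻¹' (A \ E) = A \ E := by rw [preimage_sdiff, hTA, hTE]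
      have e : Q * ν A = Q * ν (A ∩ E) + Q * ν (A \ E) := by
        rw [← mul_add, measure_inter_add_sdiff A hE]
      rw [e, Nat.cast_succ] at hlt
      have hI1 := h _ (hA.inter hE) hI h1
      have hS1 := h _ (hA.diff hE) hS h2
      obtain ⟨s, hs1, hs2, hs3⟩ := ih _ (hA.inter hE) hI
        (lt_of_add_lt_add_right ((add_le_add_right hS1 _).trans_lt hlt))
      obtain ⟨t, ht1, ht2, ht3⟩ := ih _ (hA.diff hE) hS
        (lt_of_add_lt_add_right ((add_le_add_right hI1 _).trans_lt (by rwa [add_comm] at hlt)))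
      refine ⟨s ∪ t, fun F hF => ?_, ?_, ?_⟩
      · rcases Finset.mem_union.1 hF with hF | hF
        · exact ⟨(hs1 F hF).1, (hs1 F hF).2.trans inter_subset_left⟩
        · exact ⟨(ht1 F hF).1, (ht1 F hF).2.trans sdiff_subset⟩
      · rw [Finset.coe_union, pairwiseDisjoint_union]
        refine ⟨hs2, ht2, fun F hF G hG _ => ?_⟩
        exact (disjoint_sdiff_right.mono_left inter_subset_right).mono (hs1 F hF).2 (ht1 G hG).2
      · refine measure_mono_null (t := ((A ∩ E) \ ⋃₀ s) ∪ ((A \ E) \ ⋃₀ t)) ?_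
          (measure_union_null hs3 ht3)
        rintro x ⟨hxA, hx⟩
        rw [Finset.coe_union, sUnion_union, mem_union, not_or] at hx
        by_cases hxE : x ∈ E
        · exact Or.inl ⟨⟨hxA, hxE⟩, hx.1⟩
        · exact Or.inr ⟨⟨hxA, hxE⟩, hx.2⟩
  obtain ⟨N, hN⟩ := ENNReal.exists_nat_gt (ENNReal.mul_ne_top hQ (measure_ne_top ν univ))
  obtain ⟨s, hs1, hs2, hs3⟩ := key N univ MeasurableSet.univ preimage_univ hN
  set e := s.equivFin.symm
  refine ⟨s.card, fun i => (e i : Set X), fun i => (hs1 _ (e i).2).1, fun i j hij => ?_, ?_⟩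
  · exact hs2 (e i).2 (e j).2 fun h' => hij (e.injective (Subtype.ext h'))
  · refine measure_mono_null (t := univ \ ⋃₀ s) (fun x hx => ⟨trivial, fun h' => hx ?_⟩) hs3
    obtain ⟨E, hE, hxE⟩ := h'
    exact mem_iUnion.2 ⟨e.symm ⟨E, hE⟩, by simpa using hxE⟩

/-! ### The covering condition: lower bounds and infinite measure. -/

namespace PiecewiseMap
variable {m : ℕ} {D : PiecewiseMap m} {I Cξ : ℝ}

namespace System
variable (H : D.System I Cξ)
include H

/-- The bound on the Jacobian handles the pieces, and their boundaries have null images. The summand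
1 keeps `L` from being zero. -/
theorem exists_volume_image_le (hD : D.Covering) : ∃ L : ℝ≥0∞, L ≠ 0 ∧ L ≠ ∞ ∧
    ∀ X, X ⊆ D.M → volume (D.T '' X) ≤ L * volume X := by
  obtain ⟨b, hb⟩ := hD.det_bounded
  refine ⟨(D.K + 1 : ℕ) * ENNReal.ofReal b + 1, by simp, ENNReal.add_ne_top.2
    ⟨ENNReal.mul_ne_top (ENNReal.natCast_ne_top _) ENNReal.ofReal_ne_top, ENNReal.one_ne_top⟩,
    fun X hX => ?_⟩
  set Y := toMeasurable volume X with hY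
  have hYm : MeasurableSet Y := measurableSet_toMeasurable _ _
  have h1 : D.T '' X ⊆ (⋃ j, D.T '' (Y ∩ D.U j)) ∪ ⋃ j, D.T '' frontier (D.U j) := by
    rintro _ ⟨x, hx, rfl⟩
    have hxM := hX hx
    rw [H.smooth.cover] at hxM
    obtain ⟨j, hj⟩ := mem_iUnion.1 hxM
    by_cases hxU : x ∈ D.U j
    · exact Or.inl (mem_iUnion.2 ⟨j, x, ⟨subset_toMeasurable _ _ hx, hxU⟩, rfl⟩)
    · refine Or.inr (mem_iUnion.2 ⟨j, x, ?_, rfl⟩)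
      rw [(H.smooth.isOpen_U j).frontier_eq]
      exact ⟨hj, hxU⟩
  have h2 : ∀ j, volume (D.T '' (Y ∩ D.U j)) ≤ ENNReal.ofReal b * volume X := fun j => by
    have hm := hYm.inter (H.measurableSet_U j)
    refine (addHaar_image_le_lintegral_abs_det_fderiv volume hm (fun x hx =>
      (H.strict_T hx.2).hasFDerivAt.hasFDerivWithinAt)).trans ?_
    calc _ ≤ ∫⁻ x in Y ∩ D.U j, ENNReal.ofReal b :=
          setLIntegral_mono measurable_const fun x hx => ENNReal.ofReal_le_ofReal (hb j x hx.2)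
      _ = ENNReal.ofReal b * volume (Y ∩ D.U j) := setLIntegral_const _ _
      _ ≤ _ := by
          exact mul_le_mul_right
            ((measure_mono inter_subset_left).trans (measure_toMeasurable X).le) _
  have h3 : volume (⋃ j, D.T '' frontier (D.U j)) = 0 := measure_iUnion_null hD.boundary_null
  refine (measure_mono h1).trans ((measure_union_le _ _).trans ?_)
  rw [h3, add_zero]
  refine (measure_iUnion_le _).trans ?_
  rw [tsum_fintype]
  refine (Finset.sum_le_sum fun j _ => h2 j).trans ?_
  rw [Finset.sum_const, Finset.card_univ, Fintype.card_fin, nsmul_eq_mul, ← mul_assoc]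
  gcongr
  exact le_self_add

theorem mapsTo_iterate (n : ℕ) : MapsTo D.T^[n] D.M D.M := H.std.mapsTo.iterate n

theorem volume_image_iterate_le {L : ℝ≥0∞} (hL : ∀ X, X ⊆ D.M → volume (D.T '' X) ≤ L * volume X)
    (n : ℕ) {X : Set (Euc m)} (hX : X ⊆ D.M) : volume (D.T^[n] '' X) ≤ L ^ n * volume X := by
  induction n with
  | zero => simp
  | succ n ih =>
    rw [Function.iterate_succ', image_comp, pow_succ', mul_assoc]
    exact (hL _ ((H.mapsTo_iterate n).mono_left hX).image_subset).trans (mul_le_mul_right ih _)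

/-- Lower bounds on a ball spread to all of `M`. -/
theorem exists_lower_bound (hD : D.Covering) {μ : Measure (Euc m)} (hμ : MeasurePreserving D.T μ μ)
    {y : Euc m} {r : ℝ} {c : ℝ≥0∞} (hr : 0 < r) (hc : c ≠ 0) (hy : Metric.ball y r ⊆ D.M)
    (hle : ∀ A, MeasurableSet A → A ⊆ Metric.ball y r → c * volume A ≤ μ A) :
    ∃ c' : ℝ, 0 < c' ∧ ∀ A, MeasurableSet A → ENNReal.ofReal c' * volume (A ∩ D.M) ≤ μ A := by
  obtain ⟨L, hL0, hLt, hL⟩ := H.exists_volume_image_le hD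
  have hsub : Metric.closedBall y (r / 2) ⊆ Metric.ball y r :=
    Metric.closedBall_subset_ball (half_lt_self hr)
  obtain ⟨N, -, hN⟩ := hD.covers y (r / 2) (half_pos hr) (hsub.trans hy)
  -- The minimum with 1 only keeps the constant finite.
  set c₁ := min 1 (c / L ^ N) with hc₁
  have hc₁t : c₁ ≠ ∞ := ne_top_of_le_ne_top ENNReal.one_ne_top (min_le_left _ _)
  have hc₁0 : c₁ ≠ 0 := (lt_min one_pos (ENNReal.div_pos hc (ENNReal.pow_ne_top hLt))).ne'
  refine ⟨c₁.toReal, ENNReal.toReal_pos hc₁0 hc₁t, fun A hA => ?_⟩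
  rw [ENNReal.ofReal_toReal hc₁t]
  have hTA := (H.std.measurable.iterate N) hA
  set X := Metric.closedBall y (r / 2) ∩ D.T^[N] ⁻¹' A with hX
  have h1 : A ∩ D.M ⊆ D.T^[N] '' X := by
    rintro x ⟨hxA, hxM⟩
    obtain ⟨z, hz, rfl⟩ := hN hxM
    exact ⟨z, ⟨hz, hxA⟩, rfl⟩
  have hXs : X ⊆ Metric.ball y r := inter_subset_left.trans hsub
  calc c₁ * volume (A ∩ D.M) ≤ c / L ^ N * (L ^ N * volume X) :=
        mul_le_mul' (min_le_right _ _) ((measure_mono h1).trans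
          (H.volume_image_iterate_le hL N (hXs.trans hy)))
    _ = c * volume X := by
        rw [← mul_assoc, ENNReal.div_mul_cancel (pow_ne_zero _ hL0) (ENNReal.pow_ne_top hLt)]
    _ ≤ μ X := hle X (measurableSet_closedBall.inter hTA) hXs
    _ ≤ μ (D.T^[N] ⁻¹' A) := measure_mono inter_subset_right
    _ = μ A := (hμ.iterate N).measure_preimage hA.nullMeasurableSet

/-- Points of `R` have preimages outside the piece at the fixed point. -/
theorem exists_full_branch (hD : D.Covering) : ∃ j, j ≠ 0 ∧ closure D.R ⊆ D.T '' D.U j := by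
  obtain ⟨L, -, -, hL⟩ := H.exists_volume_image_le hD
  obtain ⟨y, r, hr, hball⟩ := H.exists_closedBall_subset
  obtain ⟨N, -, hN⟩ := hD.covers y r hr (hball.trans sdiff_subset)
  by_contra! hno
  have hdis : ∀ j, j ≠ 0 → Disjoint (closure D.R) (D.T '' D.U j) := fun j hj =>
    (H.rates.full_or_disjoint j).resolve_left (hno j hj)
  -- Off this null set, a backward orbit meets no boundary of a piece.
  set Z := ⋃ (n : ℕ) (j : Fin (D.K + 1)), D.T^[n] '' (D.T '' frontier (D.U j)) with hZ
  have hZ0 : volume Z = 0 := measure_iUnion_null fun n => measure_iUnion_null fun j => by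
    refine le_antisymm ((H.volume_image_iterate_le hL n ?_).trans ?_) zero_le
    · exact (H.std.mapsTo.mono_left
        (frontier_subset_closure.trans (H.closure_U_subset_M j))).image_subset
    · rw [hD.boundary_null j, mul_zero]
  have hRpos : volume D.R ≠ 0 := (H.rates.isOpen_R.measure_pos volume ⟨_, H.rates.mem_R⟩).ne'
  obtain ⟨x, hxR, hxZ⟩ : (D.R \ Z).Nonempty := by
    by_contra h
    rw [not_nonempty_iff_eq_empty, sdiff_eq_empty] at h
    exact hRpos (measure_mono_null h hZ0)
  obtain ⟨z, hz, rfl⟩ := hN (H.U_subset_M 0 (H.R_subset_U hxR))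
  -- If only the piece at the fixed point covered points of `R`, a backward orbit starting in `R`
  -- would stay in `R`; but one of them starts from a ball outside `R`.
  have hback : ∀ i ≤ N, D.T^[N - i] z ∈ D.R := by
    intro i
    induction i with
    | zero => intro _; exact hxR
    | succ i ih =>
      intro hi
      have h1 := ih (by omega)
      rw [show N - i = (N - (i + 1)) + 1 by omega, Function.iterate_succ_apply'] at h1
      set w := D.T^[N - (i + 1)] z with hw
      have hwM : w ∈ D.M := H.mapsTo_iterate _ (hball hz).1
      rw [H.smooth.cover] at hwM
      obtain ⟨j, hj⟩ := mem_iUnion.1 hwM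
      have hwU : w ∈ D.U j := by
        by_contra hwU
        refine hxZ (mem_iUnion₂.2 ⟨i, j, D.T w, ⟨w, ?_, rfl⟩, ?_⟩)
        · rw [(H.smooth.isOpen_U j).frontier_eq]
          exact ⟨hj, hwU⟩
        · rw [hw, ← Function.iterate_succ_apply' D.T, ← Function.iterate_add_apply]
          congr 1
          omega
      have hj0 : j = 0 := by
        by_contra hj0
        exact Set.disjoint_left.1 (hdis j hj0) (subset_closure h1) ⟨w, hwU, rfl⟩
      subst hj0
      have := H.inv₀_mem (H.R_subset_TR h1)
      rwa [H.inv₀_T hwU] at this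
  have h0 := hback N le_rfl
  rw [Nat.sub_self] at h0
  exact (hball hz).2 h0

theorem pre_subset_R (n : ℕ) : D.pre n D.R ⊆ D.R := by
  induction n with
  | zero => exact fun z hz => hz.2
  | succ n ih =>
    rintro z ⟨hz, hzR⟩
    obtain ⟨h1, h2⟩ := mem_dom_succ'.1 hz
    have h3 := H.inv₀_mem (H.R_subset_TR (ih ⟨h2, hzR⟩))
    rwa [H.inv₀_T h1] at h3

/-- The preimage of `T₁^{-n} R` contains `T₁^{-(n+1)} R` and, in another piece whose image covers
`R`, a disjoint set of measure at least a constant times the volume of `T₁^{-n} R`. By invariance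
these gains add up along `n` to at most the measure of `R`. -/
theorem apply_univ_eq_top (hD : D.Covering) {μ : Measure (Euc m)} (hμ : MeasurePreserving D.T μ μ)
    {c : ℝ} (hc : 0 < c) (hle : ∀ A, MeasurableSet A → ENNReal.ofReal c * volume (A ∩ D.M) ≤ μ A)
    (hsum : ∑' n : ℕ, volume (D.pre (n + 1) D.R) = ∞) : μ univ = ∞ := by
  obtain ⟨L, hL0, hLt, hL⟩ := H.exists_volume_image_le hD
  obtain ⟨j, hj, hjR⟩ := H.exists_full_branch hD
  set a := ENNReal.ofReal c / L with ha
  have ha0 : a ≠ 0 := (ENNReal.div_pos (ENNReal.ofReal_pos.2 hc).ne' hLt).ne'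
  have hpm : ∀ n, MeasurableSet (D.pre n D.R) := fun n =>
    (H.isOpen_dom n).measurableSet.inter ((H.std.measurable.iterate _) H.measurableSet_R)
  have hstep : ∀ n, μ (D.pre (n + 1) D.R) + a * volume (D.pre n D.R) ≤ μ (D.pre n D.R) := by
    intro n
    set P := D.pre n D.R with hP
    set X := D.U j ∩ D.T ⁻¹' P with hX
    have hXm : MeasurableSet X := (H.measurableSet_U j).inter (H.std.measurable (hpm n))
    have h1 : a * volume P ≤ μ X := by
      have h2 : P ⊆ D.T '' X := fun x hx => by
        obtain ⟨u, hu, rfl⟩ := hjR (subset_closure (H.pre_subset_R n hx))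
        exact ⟨u, ⟨hu, hx⟩, rfl⟩
      have hXM : X ⊆ D.M := inter_subset_left.trans (H.U_subset_M j)
      calc a * volume P ≤ a * (L * volume X) :=
            mul_le_mul_right ((measure_mono h2).trans (hL X hXM)) _
        _ = ENNReal.ofReal c * volume (X ∩ D.M) := by
            rw [← mul_assoc, ENNReal.div_mul_cancel hL0 hLt, inter_eq_left.2 hXM]
        _ ≤ _ := hle X hXm
    have hd : Disjoint (D.pre (n + 1) D.R) X := Set.disjoint_left.2 fun z hz hzX =>
      Set.disjoint_left.1 (H.smooth.disjoint_U hj) hzX.1 (mem_dom_succ'.1 hz.1).1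
    calc _ ≤ μ (D.pre (n + 1) D.R) + μ X := add_le_add_right h1 _
      _ = μ (D.pre (n + 1) D.R ∪ X) := (measure_union hd hXm).symm
      _ ≤ μ (D.T ⁻¹' P) := by
          refine measure_mono (union_subset (fun z hz => ?_) inter_subset_right)
          exact ⟨(mem_dom_succ'.1 hz.1).2, hz.2⟩
      _ = μ P := hμ.measure_preimage (hpm n).nullMeasurableSet
  have hN : ∀ N, μ (D.pre N D.R) + ∑ n ∈ Finset.range N, a * volume (D.pre n D.R) ≤
      μ (D.pre 0 D.R) := by
    intro N
    induction N with
    | zero => simp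
    | succ N ih =>
      refine le_trans ?_ ih
      rw [Finset.sum_range_succ, add_comm (∑ n ∈ Finset.range N, _), ← add_assoc]
      exact add_le_add_left (hstep N) _
  -- The sum here starts at `n = 0`, one term earlier than in the hypothesis.
  have htop : ∑' n, a * volume (D.pre n D.R) = ∞ := by
    rw [tsum_eq_zero_add' ENNReal.summable, ENNReal.tsum_mul_left, hsum, ENNReal.mul_top ha0,
      add_top]
  refine top_unique (htop.symm.le.trans ?_)
  rw [ENNReal.tsum_eq_iSup_nat]
  exact iSup_le fun N => (le_add_self.trans (hN N)).trans (measure_mono (subset_univ _))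

end System
end PiecewiseMap

/-! ### The theorem. -/

theorem theoremA {m : ℕ} (D : PiecewiseMap m) (I Cξ : ℝ)
    (h₀ : D.Standing) (h₁ : D.PiecewiseSmooth) (h₂ : D.FixedPoint)
    (h₃ : D.ExpandingRates I Cξ) (h₄ : D.Distortion I Cξ) :
    ∃ (μ : Measure (Euc m)) (k : ℕ) (h : Fin k → Euc m → ℝ≥0∞),
      -- `μ` is a nonzero absolutely continuous invariant measure
      μ ≠ 0 ∧ μ ≪ volume.restrict D.M ∧ MeasurePreserving D.T μ μ ∧ SigmaFinite μ ∧
      -- its ergodic components are the measures with densities `h i`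
      (∀ i, Measurable (h i)) ∧
      μ = ∑ i, (volume.restrict D.M).withDensity (h i) ∧
      (Pairwise fun i j => (volume.restrict D.M).withDensity (h i) ⟂ₘ
        (volume.restrict D.M).withDensity (h j)) ∧
      (∀ i, (volume.restrict D.M).withDensity (h i) ≠ 0 ∧
        Ergodic D.T ((volume.restrict D.M).withDensity (h i)) ∧
        SigmaFinite ((volume.restrict D.M).withDensity (h i)) ∧
        ∀ Q : Set (Euc m), IsCompact Q → Q ⊆ D.M \ {D.p} →
          ∃ C : ℝ, ∀ᵐ x ∂(volume.restrict Q), h i x ≤ ENNReal.ofReal C) ∧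
      -- finiteness
      (∑' n : ℕ, volume (D.pre (n + 1) D.R) < ∞ → IsFiniteMeasure μ) ∧
      -- lower bound, and infinite measure
      (D.Covering →
        (∃ c : ℝ, 0 < c ∧ ∀ᵐ x ∂(volume.restrict D.M), ENNReal.ofReal c ≤ ∑ i, h i x) ∧
        (∑' n : ℕ, volume (D.pre (n + 1) D.R) = ∞ → μ univ = ∞)) := by
  have H : D.System I Cξ := ⟨h₀, h₁, h₂, h₃, h₄⟩
  obtain ⟨ε, δ, r₀, B, Q, hR⟩ := H.exists_regular
  obtain ⟨F, hF, hFB, hfix, hF0, y, r, c, hr, hc, hy, hle⟩ := H.exists_fixed_density hR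
  have hC := hR.collar
  have := H.nontrivial_E
  set h := D.liftDensity δ F with hh
  have hm : Measurable h := H.measurable_liftDensity δ hF.1
  set μ := D.lift δ (volume.withDensity F) with hμ
  have hMm := H.measurableSet_M
  have hμh : μ = volume.withDensity h := H.lift_withDensity hC hF
  have hMh : D.M.indicator h = h := by
    ext x
    by_cases hx : x ∈ D.M
    · rw [indicator_of_mem hx]
    · rw [indicator_of_notMem hx, hh, H.liftDensity_eq_zero hx]
  have hμM : μ = (volume.restrict D.M).withDensity h := by
    rw [hμh, ← withDensity_indicator hMm, hMh]
  have hpres : MeasurePreserving D.T μ μ := ⟨h₀.measurable, H.map_lift hfix⟩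
  have hFμ : volume.withDensity F ≤ μ := hμh ▸ H.withDensity_le_lift hC hF hfix
  have hMfin : IsFiniteMeasure (volume.restrict D.M) := ⟨by
    rw [Measure.restrict_apply_univ, h₀.volume_eq_one]; exact ENNReal.one_lt_top⟩
  have hbd : ∀ K, IsCompact K → K ⊆ D.M \ {D.p} → ∃ S : ℝ≥0∞, S ≠ ∞ ∧ ∀ x ∈ K, h x ≤ S :=
    fun K hK hKp => H.liftDensity_bounded_on hR hFB hK fun hp => (hKp hp).2 rfl
  -- The density may be infinite at `p`, a null set.
  have hfin : ∀ᵐ x ∂(volume.restrict D.M), h x ≠ ∞ := by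
    have h1 : volume ({D.p} : Set (Euc m)) = 0 := measure_singleton _
    refine ae_restrict_of_ae ?_
    filter_upwards [compl_mem_ae_iff.2 h1] with x hx
    obtain ⟨S, hS, hSx⟩ := H.liftDensity_bounded_near hR hFB hx
    exact ne_top_of_le_ne_top hS hSx.self_of_nhds
  -- The components are the restrictions of `μ` to finitely many disjoint invariant sets, so their
  -- mutual singularity is immediate.
  obtain ⟨k, A, hA, hAd, hAc⟩ := exists_finite_ergodic_partition (T := D.T) (μ := μ)
    (ν := volume.restrict D.M) hR.Q_ne_top fun A hA hTA h0 => by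
      rw [Measure.restrict_apply hA]
      exact H.one_le_of_lift_ne_zero hR hF hFB hfix hA hTA h0
  have hAi : ∀ i, (volume.restrict D.M).withDensity ((A i).indicator h) = μ.restrict (A i) :=
    fun i => by rw [hμM, withDensity_indicator (hA i).1, restrict_withDensity (hA i).1]
  have hsum : μ = ∑ i, (volume.restrict D.M).withDensity ((A i).indicator h) := by
    simp only [hAi]
    rw [← Measure.sum_fintype, ← Measure.restrict_iUnion hAd fun i => (hA i).1,
      Measure.restrict_eq_self_of_ae_mem]
    exact hAc
  refine ⟨μ, k, fun i => (A i).indicator h, fun h0 => hF0 ?_, ?_, hpres, ?_,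
    fun i => hm.indicator (hA i).1, hsum, fun i j hij => ?_, fun i => ⟨?_, ?_, ?_, ?_⟩,
    fun hs => ⟨H.lift_univ_lt_top hR hF hFB hs⟩, fun hD => ?_⟩
  · exact le_antisymm (h0 ▸ hFμ) (Measure.zero_le _)
  · rw [hμM]; exact withDensity_absolutelyContinuous _ _
  · rw [hμM]; exact SigmaFinite.withDensity_of_ne_top hfin
  · simp only [hAi]
    refine ⟨(A i)ᶜ, (hA i).1.compl, ?_, ?_⟩
    · rw [Measure.restrict_apply (hA i).1.compl, compl_inter_self, measure_empty]
    · rw [compl_compl, Measure.restrict_apply (hA i).1, (hAd hij).inter_eq, measure_empty]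
  · rw [hAi]
    exact fun h0 => (hA i).2.2.1 (Measure.restrict_eq_zero.1 h0)
  · rw [hAi]
    have h1 := hpres.restrict_preimage (hA i).1
    rw [(hA i).2.1] at h1
    refine ⟨h1, ⟨fun E hE hTE => ?_⟩⟩
    rw [eventuallyConst_set]
    rcases (hA i).2.2.2 E hE hTE with h2 | h2
    · right
      rw [ae_iff]
      simpa [Measure.restrict_apply hE, inter_comm] using h2
    · left
      change μ.restrict (A i) Eᶜ = 0
      rwa [Measure.restrict_apply hE.compl, inter_comm, ← sdiff_eq]
  · refine SigmaFinite.withDensity_of_ne_top (hfin.mono fun x hx => ?_)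
    exact ne_top_of_le_ne_top hx (indicator_le_self' (fun _ _ => zero_le) x)
  · intro K hK hKp
    obtain ⟨S, hS, hSx⟩ := hbd K hK hKp
    refine ⟨S.toReal, ?_⟩
    rw [ENNReal.ofReal_toReal hS]
    filter_upwards [ae_restrict_mem hK.measurableSet] with x hx
    exact (indicator_le_self' (fun _ _ => zero_le) x).trans (hSx x hx)
  -- `μ` dominates the induced invariant measure, so it inherits the lower bound on a ball that the
  -- covering condition spreads over `M`.
  · obtain ⟨c', hc', hlow⟩ := H.exists_lower_bound hD hpres hr hc hy fun E hE hEs =>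
      (hle E hE hEs).trans (hFμ E)
    refine ⟨⟨c', hc', ?_⟩, H.apply_univ_eq_top hD hpres hc' hlow⟩
    refine ae_le_of_forall_setLIntegral_le_of_sigmaFinite measurable_const fun E hE _ => ?_
    rw [setLIntegral_const, Measure.restrict_apply hE]
    refine (hlow E hE).trans (le_of_eq ?_)
    rw [hsum, Measure.coe_finsetSum, Finset.sum_apply,
      lintegral_finsetSum _ fun i _ => hm.indicator (hA i).1]
    exact Finset.sum_congr rfl fun i _ => withDensity_apply _ hE
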